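/- Conventions. All manifolds below are compact, Hausdorff, without boundary; currents are real currents, possibly of mixed degree, i.e. continuous linear functionals on the real $C^\infty$ forms. Complex manifolds are oriented canonically, and a smooth form $\alpha$ on $M$ is identified with the current $\varphi\mapsto\int_M\alpha\wedge\varphi$. A homogeneous current $T$ of dimension $k$ on an $m$-dimensional manifold $M$ is *Lebesgue* if every point $q$ has a coordinate system $U\to\mathbb R^m$ and a neighbourhood $B\subset U$ such that for every $\xi\in C^\infty_c(B)$ and every projection $\pi$ of $U$ to a $k$-dimensional coordinate plane, $\pi_*(\xi T)$ is given by a compactly supported, bounded, Riemann integrable density $L$, such that for all $a$ the limit $\psi_a(x)=\lim_{\lambda\to0+}L(\lambda x+a)$ exists for almost all $x$ and $(a,x)\mapsto\psi_a(x)$ is bounded and Riemann integrable on compact sets. A current is Lebesgue if its homogeneous parts are. A *de Rham datum* on $M$ consists of finitely many ordered charts $h_i:U_i\cong\mathbb R^m$ whose balls $B_i=h_i^{-1}(\{|x|<1\})$ cover $M$, diffeomorphisms $B_i\cong\mathbb R^m$ such that the transported translations, extended by the identity outside $B_i$, form a smooth family of maps $s^i_x:M\to M$ $(x\in\mathbb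 R^m)$, and even $C^\infty$ functions $f_i\ge0$ supported in the unit ball with $\int f_i=1$. It defines the smoothing operators $R_\epsilon=R^1_\epsilon\cdots R^h_\epsilon$ on currents, where $(R^i_\epsilon T)(\varphi)=T\bigl(\int (s^i_x)^*\varphi\;\epsilon^{-m}f_i(x/\epsilon)\,dx\bigr)$; $R_\epsilon T$ is $C^\infty$. On a product $\mathcal X\times\mathcal Y$ the product of two de Rham data defines the smoothing operator $R_\epsilon^{\mathcal X}\otimes R_\epsilon^{\mathcal Y}$ acting by the smoothing operators of the factors in the two groups of variables. The intersection of currents is $[T_1\wedge T_2](\varphi)=\lim_{\epsilon\to0+}T_1(R_\epsilon T_2\wedge\varphi)$ (when the limits exist and form a current). For a closed Lebesgue current $F$ on $\mathcal X\times\mathcal Y$, with projections $P_{\mathcal X},P_{\mathcal Y}$ and product de Rham data, put $$F_*(T)=(P_{\mathcal Y})_*[F\wedge(T\times[\mathcal Y])],\qquad F^*(T)=(P_{\mathcal X})_*[F\wedge([\mathcal X]\times T)]$$ for Lebesgue currents $T$ on $\mathcal X$, respectively on $\mathcal Y$. **Proposition 4.3.** Let $\mathcal X,\mathcal Y$ be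 compact complex manifolds with de Rham data, let $\mathcal X\times\mathcal Y$ carry the product de Rham data, and let $f:\mathcal X\to\mathcal Y$ be a holomorphic map. Then integration over the graph of $f$ is a closed Lebesgue current $F$ on $\mathcal X\times\mathcal Y$, and $F_*$, $F^*$ extend Gillet and Soulé's operations: 1. For every Lebesgue current $T$ on $\mathcal X$, the current $F_*(T)$ is well defined and $F_*(T)=f_*(T)$, where $f_*(T)(\varphi)=T(f^*\varphi)$ is the push-forward along the proper map $f$. 2. If $f$ is smooth (a holomorphic submersion), then for every Lebesgue current $T$ on $\mathcal Y$ the current $F^*(T)$ is well defined and $F^*(T)=f^*(T)$, where $f^*(T)(\varphi)=T(f_*\varphi)$ is the smooth pull-back and $f_*\varphi$ is the integral of $\varphi$ over the fibres of $f$, i.e. the $C^\infty$ form with $\int_{\mathcal Y}\eta\wedge f_*\varphi=\int_{\mathcal X}f^*\eta\wedge\varphi$ for all $C^\infty$ forms $\eta$ on $\mathcal Y$. -/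

import Mathlib

open Set Filter MeasureTheory Module
open scoped Manifold ContDiff Topology

namespace Currents

noncomputable section

section Wedge

variable {E : Type*} [NormedAddCommGroup E] [NormedSpace ℝ E]

/-- Auxiliary: the exterior product as an alternating map. -/
def wedgeAux {i j k : ℕ} (h : i + j = k) (a : E [⋀^Fin i]→L[ℝ] ℝ) (b : E [⋀^Fin j]→L[ℝ] ℝ) :
    E [⋀^Fin k]→ₗ[ℝ] ℝ :=
  ((LinearMap.mul' ℝ ℝ).compAlternatingMap
    (a.toAlternatingMap.domCoprod b.toAlternatingMap)).domDomCongr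
      (finSumFinEquiv.trans (finCongr h))

theorem wedgeAux_apply {i j k : ℕ} (h : i + j = k) (a : E [⋀^Fin i]→L[ℝ] ℝ)
    (b : E [⋀^Fin j]→L[ℝ] ℝ) (v : Fin k → E) :
    wedgeAux h a b v = ∑ σ : Equiv.Perm.ModSumCongr (Fin i) (Fin j),
      ((Equiv.Perm.sign σ.out : ℤ) : ℝ) *
        (a (fun l => v (Fin.cast h (finSumFinEquiv (σ.out (Sum.inl l))))) *
          b (fun l => v (Fin.cast h (finSumFinEquiv (σ.out (Sum.inr l)))))) := by
  simp only [wedgeAux, AlternatingMap.domDomCongr_apply, LinearMap.compAlternatingMap_apply,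
    AlternatingMap.domCoprod_apply, sum_apply, map_sum]
  refine Finset.sum_congr rfl fun σ _ => ?_
  conv_lhs => rw [← Quotient.out_eq' σ]
  rw [AlternatingMap.domCoprod.summand_mk'', smul_apply, MultilinearMap.domDomCongr_apply,
    MultilinearMap.domCoprod_apply, Units.smul_def, map_zsmul, LinearMap.mul'_apply,
    zsmul_eq_mul]
  rfl

/-- The exterior product of two alternating forms, with the normalisation
`(a ∧ b)(v₁, …, v_k) = ∑ sign(σ) a(v_σ(1), …, v_σ(i)) b(v_σ(i+1), …, v_σ(k))`, the sum being over
the `(i, j)`-shuffles `σ`; here `k = i + j`. -/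
def wedgeAlt {i j k : ℕ} (h : i + j = k) (a : E [⋀^Fin i]→L[ℝ] ℝ) (b : E [⋀^Fin j]→L[ℝ] ℝ) :
    E [⋀^Fin k]→L[ℝ] ℝ where
  toMultilinearMap := (wedgeAux h a b).toMultilinearMap
  map_eq_zero_of_eq' := (wedgeAux h a b).map_eq_zero_of_eq'
  cont := by
    change Continuous fun v => wedgeAux h a b v
    simp only [wedgeAux_apply]
    fun_prop

theorem wedgeAlt_apply {i j k : ℕ} (h : i + j = k) (a : E [⋀^Fin i]→L[ℝ] ℝ)
    (b : E [⋀^Fin j]→L[ℝ] ℝ) (v : Fin k → E) :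
    wedgeAlt h a b v = ∑ σ : Equiv.Perm.ModSumCongr (Fin i) (Fin j),
      ((Equiv.Perm.sign σ.out : ℤ) : ℝ) *
        (a (fun l => v (Fin.cast h (finSumFinEquiv (σ.out (Sum.inl l))))) *
          b (fun l => v (Fin.cast h (finSumFinEquiv (σ.out (Sum.inr l)))))) :=
  wedgeAux_apply h a b v

end Wedge

section Forms

variable {E : Type*} [NormedAddCommGroup E] [NormedSpace ℝ E]
  {H : Type*} [TopologicalSpace H] (I : ModelWithCorners ℝ E H)
  {M : Type*} [TopologicalSpace M] [ChartedSpace H M]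
  {E' : Type*} [NormedAddCommGroup E'] [NormedSpace ℝ E']
  {H' : Type*} [TopologicalSpace H'] (I' : ModelWithCorners ℝ E' H')
  {M' : Type*} [TopologicalSpace M'] [ChartedSpace H' M']

/-- A (not necessarily continuous) real differential form of mixed degree on `M`: at each point `p`
and for each degree `k`, an alternating `k`-linear form on the tangent space at `p`
(Mathlib's `TangentSpace I p`, whose underlying vector space is the model space `E`). -/
abbrev RawForm (E M : Type*) [NormedAddCommGroup E] [NormedSpace ℝ E] : Type _ :=
  M → ∀ k : ℕ, E [⋀^Fin k]→L[ℝ] ℝ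

/-- The differential of `s : M → M'` at `p` (Mathlib's `mfderiv`), as a map of model spaces. -/
def diffAt (s : M → M') (p : M) : E →L[ℝ] E' := mfderiv I I' s p

/-- The pointwise pull-back `s^* α` along a map `s`. -/
def rawPullback (s : M → M') (α : RawForm E' M') : RawForm E M := fun p k =>
  (α (s p) k).compContinuousLinearMap (diffAt I I' s p)

/-- The pointwise exterior product of forms of mixed degree. -/
def rawWedge (α β : RawForm E M) : RawForm E M := fun p k =>
  ∑ i : Fin (k + 1), wedgeAlt (Nat.add_sub_of_le (Nat.lt_succ_iff.1 i.2)) (α p i) (β p (k - i))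

/-- The expression of the degree `k` part of a form in the chart at `x`, as a form on the model
vector space: its pull-back by the inverse of that chart. -/
def coordForm (x : M) (α : RawForm E M) (k : ℕ) (y : E) : E [⋀^Fin k]→L[ℝ] ℝ :=
  (α ((extChartAt I x).symm y) k).compContinuousLinearMap
    (diffAt 𝓘(ℝ, E) I (extChartAt I x).symm y)

/-- A form is smooth if all its coefficients in all charts are smooth. -/
def IsSmoothForm (α : RawForm E M) : Prop :=
  ∀ (x : M) (k : ℕ) (v : Fin k → E),
    ContDiffOn ℝ ∞ (fun y => coordForm I x α k y v) (extChartAt I x).target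

variable (M) in
/-- The real vector space of smooth real differential forms of mixed degree on `M`. -/
def Form : Submodule ℝ (RawForm E M) where
  carrier := {α | IsSmoothForm I α}
  zero_mem' := fun _ _ _ => contDiffOn_const (c := (0 : ℝ))
  add_mem' := fun ha hb x k v => (ha x k v).add (hb x k v)
  smul_mem' := fun _ _ ha x k v => contDiffOn_const.mul (ha x k v)

theorem isSmoothForm_rawWedge {α β : RawForm E M} (hα : IsSmoothForm I α)
    (hβ : IsSmoothForm I β) : IsSmoothForm I (rawWedge α β) := by
  intro x k v
  have : ∀ y, coordForm I x (rawWedge α β) k y v = ∑ i : Fin (k + 1),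
      wedgeAlt (Nat.add_sub_of_le (Nat.lt_succ_iff.1 i.2)) (coordForm I x α i y)
        (coordForm I x β (k - i) y) v := by
    intro y
    rw [coordForm, rawWedge, ContinuousAlternatingMap.compContinuousLinearMap_apply,
      ContinuousAlternatingMap.sum_apply]
    simp only [wedgeAlt_apply]
    rfl
  simp only [this, wedgeAlt_apply]
  exact ContDiffOn.sum fun q _ => ContDiffOn.sum fun σ _ =>
    contDiffOn_const.mul ((hα x _ _).mul (hβ x _ _))

/-- The exterior product of smooth forms. -/
def wedge (α β : Form I M) : Form I M :=
  ⟨rawWedge α.1 β.1, isSmoothForm_rawWedge I α.2 β.2⟩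

theorem isSmoothForm_rawPullback [I.Boundaryless] [I'.Boundaryless] [IsManifold I ∞ M]
    [IsManifold I' ∞ M'] [FiniteDimensional ℝ E']
    {s : M → M'} (hs : ContMDiff I I' ∞ s) {α : RawForm E' M'}
    (hα : IsSmoothForm I' α) : IsSmoothForm I (rawPullback I I' s α) := by
  intro x k v y₀ hy₀
  set e := extChartAt I x with he
  set e' := extChartAt I' (s (e.symm y₀)) with he'
  set g : E → E' := fun y => e' (s (e.symm y)) with hg
  have hopen : IsOpen e.target := isOpen_extChartAt_target x
  have hopen' : IsOpen e'.target := isOpen_extChartAt_target _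
  have hsymm : ContMDiffOn 𝓘(ℝ, E) I ∞ e.symm e.target := contMDiffOn_extChartAt_symm x
  have hsymm' : ContMDiffOn 𝓘(ℝ, E') I' ∞ e'.symm e'.target := contMDiffOn_extChartAt_symm _
  have hcomp : ContMDiffOn 𝓘(ℝ, E) I' ∞ (fun y => s (e.symm y)) e.target :=
    hs.comp_contMDiffOn hsymm
  have hU : ∀ᶠ y in 𝓝 y₀, y ∈ e.target ∧ s (e.symm y) ∈ e'.source := by
    refine Filter.Eventually.and (hopen.mem_nhds hy₀) ?_
    exact (hcomp.continuousOn.continuousAt (hopen.mem_nhds hy₀)).preimage_mem_nhds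
      ((isOpen_extChartAt_source _).mem_nhds (mem_extChartAt_source _))
  have hgsm : ∀ y, y ∈ e.target → s (e.symm y) ∈ e'.source → ContDiffAt ℝ ∞ g y := by
    intro y hy hy'
    rw [← contMDiffAt_iff_contDiffAt]
    exact ((contMDiffOn_extChartAt (I := I') (n := ∞) (x := s (e.symm y₀))).contMDiffAt
      ((chartAt H' (s (e.symm y₀))).open_source.mem_nhds (by rwa [he', extChartAt_source] at hy'))).comp y (hcomp.contMDiffAt (hopen.mem_nhds hy))
  have key : ∀ᶠ y in 𝓝 y₀, coordForm I x (rawPullback I I' s α) k y v =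
      coordForm I' (s (e.symm y₀)) α k (g y) (fun i => fderiv ℝ g y (v i)) := by
    filter_upwards [hU.eventually_nhds] with y hy
    obtain ⟨hy1, hy2⟩ := hy.self_of_nhds
    have hleft : e'.symm (g y) = s (e.symm y) := e'.left_inv hy2
    have h1 : mfderiv 𝓘(ℝ, E) I' (fun z => s (e.symm z)) y =
        (mfderiv I I' s (e.symm y)).comp (mfderiv 𝓘(ℝ, E) I e.symm y) :=
      mfderiv_comp y (hs.mdifferentiableAt (by simp))
        ((hsymm.contMDiffAt (hopen.mem_nhds hy1)).mdifferentiableAt (by simp))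
    have h2 : mfderiv 𝓘(ℝ, E) I' (fun z => e'.symm (g z)) y =
        (mfderiv 𝓘(ℝ, E') I' e'.symm (g y)).comp (mfderiv 𝓘(ℝ, E) 𝓘(ℝ, E') g y) :=
      mfderiv_comp y
        ((hsymm'.contMDiffAt (hopen'.mem_nhds (e'.map_source hy2))).mdifferentiableAt (by simp))
        (((hgsm y hy1 hy2).differentiableAt (by simp)).mdifferentiableAt)
    have h3 : (fun z => e'.symm (g z)) =ᶠ[𝓝 y] fun z => s (e.symm z) := by
      filter_upwards [hy] with z hz using e'.left_inv hz.2
    have h1' : diffAt 𝓘(ℝ, E) I' (fun z => s (e.symm z)) y =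
        (diffAt I I' s (e.symm y)).comp (diffAt 𝓘(ℝ, E) I e.symm y) := h1
    have h2' : diffAt 𝓘(ℝ, E) I' (fun z => e'.symm (g z)) y =
        (diffAt 𝓘(ℝ, E') I' e'.symm (g y)).comp (fderiv ℝ g y) := by
      rw [← mfderiv_eq_fderiv]; exact h2
    have h5 : diffAt 𝓘(ℝ, E) I' (fun z => e'.symm (g z)) y =
        diffAt 𝓘(ℝ, E) I' (fun z => s (e.symm z)) y := h3.mfderiv_eq
    have h6 := (h1'.symm.trans (h5.symm.trans h2'))
    change α (s (e.symm y)) k (fun i =>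
        ((diffAt I I' s (e.symm y)).comp (diffAt 𝓘(ℝ, E) I e.symm y)) (v i)) =
      α (e'.symm (g y)) k (fun i =>
        ((diffAt 𝓘(ℝ, E') I' e'.symm (g y)).comp (fderiv ℝ g y)) (v i))
    rw [hleft, h6]
  refine ContDiffAt.contDiffWithinAt (ContDiffAt.congr_of_eventuallyEq ?_ key)
  obtain ⟨hy1, hy2⟩ := hU.self_of_nhds
  have hg0 := hgsm y₀ hy1 hy2
  let b := Module.finBasis ℝ E'
  have expand : ∀ y, coordForm I' (s (e.symm y₀)) α k (g y) (fun i => fderiv ℝ g y (v i)) =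
      ∑ r : Fin k → Fin (Module.finrank ℝ E'), (∏ i, b.repr (fderiv ℝ g y (v i)) (r i)) *
        coordForm I' (s (e.symm y₀)) α k (g y) (fun i => b (r i)) := by
    intro y
    have : (fun i => fderiv ℝ g y (v i)) =
        fun i => ∑ j, b.repr (fderiv ℝ g y (v i)) j • b j := by
      funext i; exact (b.sum_repr _).symm
    rw [this]
    change (coordForm I' (s (e.symm y₀)) α k (g y)).toMultilinearMap _ = _
    rw [MultilinearMap.map_sum]
    refine Finset.sum_congr rfl fun r _ => ?_
    rw [MultilinearMap.map_smul_univ]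
    rfl
  simp only [expand]
  refine ContDiffAt.sum fun r _ => ContDiffAt.mul (contDiffAt_prod fun i _ => ?_) ?_
  · have hd : ContDiffAt ℝ ∞ (fun y => fderiv ℝ g y (v i)) y₀ :=
      (hg0.fderiv_right (m := ∞) (by simp)).clm_apply contDiffAt_const
    exact ((b.coord (r i)).toContinuousLinearMap.contDiff).contDiffAt.comp y₀ hd
  · have := (hα (s (e.symm y₀)) k (fun i => b (r i))).contDiffAt
      (hopen'.mem_nhds (e'.map_source hy2))
    exact this.comp y₀ hg0

/-- The pull-back `s^* β` of a smooth form along a smooth map. -/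
def pullback [I.Boundaryless] [I'.Boundaryless] [IsManifold I ∞ M] [IsManifold I' ∞ M']
    [FiniteDimensional ℝ E'] (s : C^∞⟮I, M; I', M'⟯) (β : Form I' M') : Form I M :=
  ⟨rawPullback I I' s β.1, isSmoothForm_rawPullback I I' s.contMDiff β.2⟩

/-- `β` is the exterior derivative of `α`: in every chart, the degree `k + 1` part of `β` is the
exterior derivative of the degree `k` part of `α`, and `β` has no part of degree `0`. -/
def IsExteriorDerivative (α β : Form I M) : Prop :=
  ∀ (x : M), ∀ y ∈ (extChartAt I x).target, coordForm I x β.1 0 y = 0 ∧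
    ∀ k : ℕ, coordForm I x β.1 (k + 1) y = extDeriv (coordForm I x α.1 k) y

/-- Convergence to zero of a sequence of smooth forms on a compact manifold: all derivatives of all
coefficients in all charts tend to zero uniformly on compact sets. -/
def TendstoZero (φ : ℕ → Form I M) : Prop :=
  ∀ (x : M) (k : ℕ) (v : Fin k → E) (j : ℕ) (K : Set E), IsCompact K → K ⊆ (extChartAt I x).target →
    TendstoUniformlyOn
      (fun n y => iteratedFDeriv ℝ j (fun z => coordForm I x (φ n).1 k z v) y) 0 atTop K

end Forms

section Integration

variable (E : Type*) [NormedAddCommGroup E] [NormedSpace ℝ E] [NormedSpace ℂ E]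
  [IsScalarTower ℝ ℂ E] [FiniteDimensional ℂ E]

/-- The real basis `b₁, i b₁, …, bₙ, i bₙ` of a complex vector space with complex basis
`b₁, …, bₙ`; it is positively oriented for the canonical orientation. -/
def complexFrame : Basis (Fin (finrank ℂ E * 2)) ℝ E :=
  (Complex.basisOneI.smulTower (Module.finBasis ℂ E)).reindex
    ((Equiv.prodComm _ _).trans finProdFinEquiv)

variable {E} [FiniteDimensional ℝ E] {H : Type*} [TopologicalSpace H]
  (I : ModelWithCorners ℝ E H)
  {M : Type*} [TopologicalSpace M] [ChartedSpace H M] [T2Space M] [CompactSpace M]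
  [IsManifold I ∞ M]

variable (M) in
/-- A smooth partition of unity subordinate to the domains of the charts. -/
def chartPartition : SmoothPartitionOfUnity M I M univ :=
  Classical.choose (SmoothPartitionOfUnity.exists_isSubordinate_chartAt_source I M)

/-- The integral `∫_M α` of (the top degree part of) a smooth form over a compact complex manifold
with its canonical orientation: by a partition of unity it is reduced to integrals in charts, and
there it is the Lebesgue integral of the coefficient in the real coordinates `x₁, y₁, …, xₙ, yₙ`
with respect to a complex basis. -/
def integral (α : Form I M) : ℝ :=
  ∑ᶠ x : M, ∫ t in (complexFrame E).equivFun.symm ⁻¹' (extChartAt I x).target,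
    chartPartition I M x ((extChartAt I x).symm ((complexFrame E).equivFun.symm t)) *
      coordForm I x α.1 (finrank ℂ E * 2) ((complexFrame E).equivFun.symm t) (complexFrame E)

end Integration

section CurrentDefs

variable {E : Type*} [NormedAddCommGroup E] [NormedSpace ℝ E]
  {H : Type*} [TopologicalSpace H] (I : ModelWithCorners ℝ E H)
  (M : Type*) [TopologicalSpace M] [ChartedSpace H M]

/-- A real current on a compact manifold: a linear functional on the smooth forms that is continuous
for the convergence of forms with all derivatives. No homogeneity is required. -/
structure Current where
  toLinearMap : Form I M →ₗ[ℝ] ℝ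
  tendsto_zero : ∀ φ : ℕ → Form I M, TendstoZero I φ →
    Tendsto (fun n => toLinearMap (φ n)) atTop (𝓝 0)

instance : CoeFun (Current I M) (fun _ => Form I M → ℝ) := ⟨fun T => T.toLinearMap⟩

variable {I M}

/-- A current is closed if it vanishes on exact forms. -/
def Current.IsClosed (T : Current I M) : Prop :=
  ∀ α β : Form I M, IsExteriorDerivative I α β → T β = 0

/-- A function on `ℝ^ι` is Riemann integrable on compact sets. -/
def LocallyRiemannIntegrable {ι : Type*} [Fintype ι] (g : (ι → ℝ) → ℝ) : Prop :=
  ∀ J : BoxIntegral.Box ι, BoxIntegral.Integrable J BoxIntegral.IntegrationParams.Riemann g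
    BoxIntegral.BoxAdditiveMap.volume

/-- `η` is the form `ξ · π^*(g da₁ ∧ ⋯ ∧ da_k)`, extended by zero, where `π` is the projection of
the domain of the coordinate system `e` to the coordinate plane of the coordinates
`e_{s(1)}, …, e_{s(k)}`. -/
def IsCutoffPlaneForm {m k : ℕ} (e : OpenPartialHomeomorph M (Fin m → ℝ)) (s : Fin k ↪o Fin m)
    (ξ : M → ℝ) (g : (Fin k → ℝ) → ℝ) (η : Form I M) : Prop :=
  (∀ p, ∀ j ≠ k, η.1 p j = 0) ∧ (∀ p ∉ e.source, η.1 p k = 0) ∧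
    ∀ p ∈ e.source, ∀ v : Fin k → E, η.1 p k v = ξ p * g (fun i => e p (s i)) *
      (Matrix.of fun i j => diffAt I 𝓘(ℝ, Fin m → ℝ) e p (v j) (s i)).det

/-- The point `q` is of Lebesgue type for the part of dimension `k` of the current `T`: in some
coordinate system at `q`, for cut-off functions `ξ` supported near `q` the projection of `ξ T` to
every `k`-dimensional coordinate plane is given by a bounded, compactly supported, Riemann integrable
density `L`, and `L` has at every point `a` of the plane a polar function
`ψ a x = lim_{t → 0+} L (t x + a)`, defined for almost every `x`, which is bounded and
Riemann integrable on compact sets as a function of `(a, x)`. -/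
def Current.IsLebesgueTypeAt (T : Current I M) (k : ℕ) (q : M) : Prop :=
  ∃ e : OpenPartialHomeomorph M (Fin (finrank ℝ E) → ℝ), q ∈ e.source ∧
    ContMDiffOn I 𝓘(ℝ, Fin (finrank ℝ E) → ℝ) ∞ e e.source ∧
    ContMDiffOn 𝓘(ℝ, Fin (finrank ℝ E) → ℝ) I ∞ e.symm e.target ∧
    ∃ B : Set M, IsOpen B ∧ q ∈ B ∧ B ⊆ e.source ∧
      ∀ ξ : M → ℝ, ContMDiff I 𝓘(ℝ) ∞ ξ → HasCompactSupport ξ → tsupport ξ ⊆ B →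
      ∀ s : Fin k ↪o Fin (finrank ℝ E), ∃ L : (Fin k → ℝ) → ℝ,
        HasCompactSupport L ∧ (∃ C, ∀ a, |L a| ≤ C) ∧ LocallyRiemannIntegrable L ∧
        (∀ g : (Fin k → ℝ) → ℝ, ContDiff ℝ ∞ g → HasCompactSupport g →
          ∀ η : Form I M, IsCutoffPlaneForm e s ξ g η → T η = ∫ a, g a * L a) ∧
        ∃ ψ : (Fin k → ℝ) → (Fin k → ℝ) → ℝ,
          (∀ a, ∀ᵐ x, Tendsto (fun t : ℝ => L (t • x + a)) (𝓝[>] 0) (𝓝 (ψ a x))) ∧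
          (∃ C, ∀ a x, |ψ a x| ≤ C) ∧
          LocallyRiemannIntegrable fun z : Fin k ⊕ Fin k → ℝ =>
            ψ (fun i => z (Sum.inl i)) (fun i => z (Sum.inr i))

/-- A Lebesgue current: all points are of Lebesgue type for all its homogeneous parts. -/
def Current.IsLebesgue (T : Current I M) : Prop :=
  ∀ (k : ℕ) (q : M), T.IsLebesgueTypeAt k q

end CurrentDefs

section DeRham

/-- The translation by `x` in the coordinates `h : B ≃ ℝ^d`, extended by the identity outside
of `B`. -/
def translate {M : Type*} [TopologicalSpace M] {d : ℕ}
    (h : OpenPartialHomeomorph M (EuclideanSpace ℝ (Fin d)))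
    (x : EuclideanSpace ℝ (Fin d)) (p : M) : M :=
  open Classical in if p ∈ h.source then h.symm (h p + x) else p

variable {E : Type*} [NormedAddCommGroup E] [NormedSpace ℝ E]
  {H : Type*} [TopologicalSpace H] (I : ModelWithCorners ℝ E H)
  (M : Type*) [TopologicalSpace M] [ChartedSpace H M]
  {E' : Type*} [NormedAddCommGroup E'] [NormedSpace ℝ E']
  {H' : Type*} [TopologicalSpace H'] (I' : ModelWithCorners ℝ E' H')
  (M' : Type*) [TopologicalSpace M'] [ChartedSpace H' M']

/-- One member of a de Rham datum: an open set `U` with a diffeomorphism `chart : U ≃ ℝ^m`, the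
preimage `B ⊆ U` of the open unit ball with another diffeomorphism `ball : B ≃ ℝ^m` for which
the translations of `ℝ^m`, transported to `B` and extended by the identity, form a smooth family
of maps `M → M`; and a bump function on `ℝ^m` supported in the unit ball. -/
structure SmoothingChart where
  chart : OpenPartialHomeomorph M (EuclideanSpace ℝ (Fin (finrank ℝ E)))
  chart_target : chart.target = univ
  chart_smooth : ContMDiffOn I 𝓘(ℝ, EuclideanSpace ℝ (Fin (finrank ℝ E))) ∞ chart chart.source
  chart_symm_smooth : ContMDiff 𝓘(ℝ, EuclideanSpace ℝ (Fin (finrank ℝ E))) I ∞ chart.symm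
  ball : OpenPartialHomeomorph M (EuclideanSpace ℝ (Fin (finrank ℝ E)))
  ball_source : ball.source = chart.source ∩ chart ⁻¹' Metric.ball 0 1
  ball_target : ball.target = univ
  ball_smooth : ContMDiffOn I 𝓘(ℝ, EuclideanSpace ℝ (Fin (finrank ℝ E))) ∞ ball ball.source
  ball_symm_smooth : ContMDiff 𝓘(ℝ, EuclideanSpace ℝ (Fin (finrank ℝ E))) I ∞ ball.symm
  translate_smooth : ContMDiff (𝓘(ℝ, EuclideanSpace ℝ (Fin (finrank ℝ E))).prod I) I ∞
    fun z : EuclideanSpace ℝ (Fin (finrank ℝ E)) × M => translate ball z.1 z.2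
  bump : EuclideanSpace ℝ (Fin (finrank ℝ E)) → ℝ
  bump_smooth : ContDiff ℝ ∞ bump
  bump_nonneg : ∀ x, 0 ≤ bump x
  bump_support : ∀ x, 1 ≤ ‖x‖ → bump x = 0
  bump_even : ∀ x, bump (-x) = bump x
  bump_integral : ∫ x, bump x = 1

/-- De Rham data on a compact manifold: finitely many smoothing charts, in a given order, whose
balls cover the manifold. -/
structure DeRhamData where
  charts : List (SmoothingChart I M)
  cover : ∀ p : M, ∃ c ∈ charts, p ∈ c.ball.source

variable {I M I' M'}

open Classical in
/-- The average `∫ (s_x)^* φ · ε^{-d} f(x / ε) dx` of the pull-backs of `φ` along a smooth family of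
maps `s_x`, `x ∈ ℝ^d`. (It is a smooth form if `s` is a smooth family and `f` is a bump function;
otherwise the value is `0` by convention.) -/
def smear {d : ℕ} (s : EuclideanSpace ℝ (Fin d) → M → M) (f : EuclideanSpace ℝ (Fin d) → ℝ)
    (ε : ℝ) (φ : Form I M) : Form I M :=
  let α : RawForm E M := fun p k =>
    ∫ x, ((ε ^ d)⁻¹ * f (ε⁻¹ • x)) • rawPullback I I (s x) φ.1 p k
  if h : IsSmoothForm I α then ⟨α, h⟩ else 0

/-- The transpose of de Rham's smoothing operator `R_ε = R^1_ε ⋯ R^h_ε`: one has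
`(R_ε T)(φ) = T (𝒰.smooth ε φ)`. The factor `R^i_ε` acts on forms by averaging the pull-backs along
the extended translations in the `i`-th ball. -/
def DeRhamData.smooth (𝒰 : DeRhamData I M) (ε : ℝ) (φ : Form I M) : Form I M :=
  𝒰.charts.foldl (fun φ c => smear (translate c.ball) c.bump ε φ) φ

/-- The transpose of the smoothing operator of the product de Rham data on `M × M'`: in the
products `B_i × B'_j` of the balls one averages over the product translations (each factor extended
by the identity) with the product bump functions `f_i(x) f'_j(x')`. As an operator this is
`R_ε ⊗ R'_ε`: the smoothing operators of the two factors act in the two groups of variables, and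
these actions commute. Composing the operators `R^i_ε ⊗ R'^j_ε` over any ordering of the pairs
`(i, j)` gives an operator of the same kind, for the lists of charts of `M` and of `M'` in which a
chart is repeated as often as it occurs in a pair. -/
def DeRhamData.prodSmooth (𝒰 : DeRhamData I M) (𝒱 : DeRhamData I' M') (ε : ℝ)
    (Φ : Form (I.prod I') (M × M')) : Form (I.prod I') (M × M') :=
  𝒱.charts.foldl (fun Φ c => smear (fun x z => (z.1, translate c.ball x z.2)) c.bump ε Φ)
    (𝒰.charts.foldl (fun Φ c => smear (fun x z => (translate c.ball x z.1, z.2)) c.bump ε Φ) Φ)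

end DeRham

section Operations

variable {E : Type*} [NormedAddCommGroup E] [NormedSpace ℝ E] [NormedSpace ℂ E]
  [IsScalarTower ℝ ℂ E] [FiniteDimensional ℂ E] [FiniteDimensional ℝ E]
  {H : Type*} [TopologicalSpace H] {I : ModelWithCorners ℝ E H} [I.Boundaryless]
  {M : Type*} [TopologicalSpace M] [ChartedSpace H M] [T2Space M] [CompactSpace M]
  [IsManifold I ∞ M]
  {E' : Type*} [NormedAddCommGroup E'] [NormedSpace ℝ E'] [NormedSpace ℂ E']
  [IsScalarTower ℝ ℂ E'] [FiniteDimensional ℂ E'] [FiniteDimensional ℝ E']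
  {H' : Type*} [TopologicalSpace H'] {I' : ModelWithCorners ℝ E' H'} [I'.Boundaryless]
  {M' : Type*} [TopologicalSpace M'] [ChartedSpace H' M'] [T2Space M'] [CompactSpace M']
  [IsManifold I' ∞ M']

/-- The smooth form `α` represents the current `T` regularised by the operator whose transpose on
forms is `R`: `∫_M α ∧ φ = T (R φ)` for all `φ`. -/
def Represents (α : Form I M) (T : Current I M) (R : Form I M → Form I M) : Prop :=
  ∀ φ : Form I M, integral I (wedge I α φ) = T (R φ)

/-- `W` is the intersection `[T₁ ∧ T₂]` with respect to the regularisation `R`: for small `ε > 0`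
the current `R_ε T₂` is a smooth form, and `W(φ) = lim_{ε → 0} T₁ (R_ε T₂ ∧ φ)` for all `φ`. -/
def IsIntersection (R : ℝ → Form I M → Form I M) (T₁ T₂ W : Current I M) : Prop :=
  ∃ α : ℝ → Form I M, (∀ᶠ ε in 𝓝[>] (0 : ℝ), Represents (α ε) T₂ (R ε)) ∧
    ∀ φ : Form I M, Tendsto (fun ε => T₁ (wedge I (α ε) φ)) (𝓝[>] (0 : ℝ)) (𝓝 (W φ))

/-- `S = s_* T`: the push-forward of currents along a (proper) smooth map is the transpose of the
pull-back of forms. -/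
def IsPushforward (s : C^∞⟮I, M; I', M'⟯) (T : Current I M) (S : Current I' M') : Prop :=
  ∀ φ : Form I' M', S φ = T (pullback I I' s φ)

/-- `ψ = s_* φ` is the integral of the form `φ` over the fibres of `s`: the smooth form on the target
with `∫_{M'} η ∧ s_* φ = ∫_M s^* η ∧ φ` for all `η`. -/
def IsFibreIntegral (s : C^∞⟮I, M; I', M'⟯) (φ : Form I M) (ψ : Form I' M') : Prop :=
  ∀ η : Form I' M', integral I' (wedge I' η ψ) = integral I (wedge I (pullback I I' s η) φ)

/-- `S = s^* T`: the pull-back of currents along a submersion is the transpose of the integration of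
forms over the fibres, `S(φ) = T(s_* φ)`. -/
def IsSmoothPullback (s : C^∞⟮I, M; I', M'⟯) (T : Current I' M') (S : Current I M) : Prop :=
  ∀ φ : Form I M, ∃ ψ : Form I' M', IsFibreIntegral s φ ψ ∧ S φ = T ψ

/-- `U = T × [M']`, i.e. `U(Φ)` is `T` applied to the integral of `Φ` over the factor `M'`. -/
def IsTimesRight (T : Current I M) (U : Current (I.prod I') (M × M')) : Prop :=
  IsSmoothPullback (ContMDiffMap.fst : C^∞⟮I.prod I', M × M'; I, M⟯) T U

/-- `U = [M] × T`, i.e. `U(Φ)` is `T` applied to the integral of `Φ` over the factor `M`. -/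
def IsTimesLeft (T : Current I' M') (U : Current (I.prod I') (M × M')) : Prop :=
  IsSmoothPullback (ContMDiffMap.snd : C^∞⟮I.prod I', M × M'; I', M'⟯) T U

/-- `S = F_* T = (P_{M'})_* [F ∧ (T × [M'])]`, the push-forward through the current `F` on
`M × M'`, the intersection being taken with respect to the product de Rham data. -/
def IsPushforwardThrough (𝒰 : DeRhamData I M) (𝒱 : DeRhamData I' M')
    (F : Current (I.prod I') (M × M')) (T : Current I M) (S : Current I' M') : Prop :=
  ∃ U W : Current (I.prod I') (M × M'), IsTimesRight T U ∧
    IsIntersection (𝒰.prodSmooth 𝒱) F U W ∧ IsPushforward ContMDiffMap.snd W S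

/-- `S = F^* T = (P_M)_* [F ∧ ([M] × T)]`, the pull-back through the current `F` on `M × M'`, the
intersection being taken with respect to the product de Rham data. -/
def IsPullbackThrough (𝒰 : DeRhamData I M) (𝒱 : DeRhamData I' M')
    (F : Current (I.prod I') (M × M')) (T : Current I' M') (S : Current I M) : Prop :=
  ∃ U W : Current (I.prod I') (M × M'), IsTimesLeft T U ∧
    IsIntersection (𝒰.prodSmooth 𝒱) F U W ∧ IsPushforward ContMDiffMap.fst W S

/-- `F` is the current of integration over the graph of `s`: `F(Φ) = ∫_M (id, s)^* Φ`. -/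
def IsGraphCurrent (s : C^∞⟮I, M; I', M'⟯) (F : Current (I.prod I') (M × M')) : Prop :=
  ∀ Φ : Form (I.prod I') (M × M'),
    F Φ = integral I (pullback I (I.prod I') (ContMDiffMap.id.prodMk s) Φ)

end Operations

section Complex

variable {E : Type*} [NormedAddCommGroup E] [NormedSpace ℂ E]
  {X : Type*} [TopologicalSpace X] [ChartedSpace E X] [IsManifold 𝓘(ℂ, E) ω X]
  {E' : Type*} [NormedAddCommGroup E'] [NormedSpace ℂ E']
  {Y : Type*} [TopologicalSpace Y] [ChartedSpace E' Y] [IsManifold 𝓘(ℂ, E') ω Y]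

/-- A complex manifold is a smooth real manifold. -/
instance isManifold_real : IsManifold 𝓘(ℝ, E) ∞ X := by
  refine isManifold_of_contDiffOn _ _ _ fun e e' he he' => ?_
  have h := (contDiffGroupoid ω 𝓘(ℂ, E)).compatible he he'
  rw [contDiffGroupoid, mem_groupoid_of_pregroupoid, contDiffPregroupoid] at h
  exact (h.1.restrict_scalars ℝ).of_le le_top

/-- A holomorphic map, as a smooth map of the underlying real manifolds. -/
def realMap (f : X → Y) (hf : ContMDiff 𝓘(ℂ, E) 𝓘(ℂ, E') ω f) :
    C^∞⟮𝓘(ℝ, E), X; 𝓘(ℝ, E'), Y⟯ :=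
  ⟨f, by
    rw [contMDiff_iff] at hf ⊢
    exact ⟨hf.1, fun x y => ((hf.2 x y).restrict_scalars ℝ).of_le le_top⟩⟩

end Complex

end

end Currents

set_option linter.unusedSectionVars false
set_option linter.style.haveILetI false

open Set Filter MeasureTheory Module
open scoped Manifold ContDiff Topology

namespace Currents

noncomputable section

section AlternatingAlgebra

variable {V : Type*} [NormedAddCommGroup V] [NormedSpace ℝ V]

theorem alternating_apply_eq_sum {ι : Type*} [Fintype ι] (b : Basis ι ℝ V) {k : ℕ}
    (a : V [⋀^Fin k]→ₗ[ℝ] ℝ) (w : Fin k → V) :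
    a w = ∑ r : Fin k → ι, (∏ i, b.repr (w i) (r i)) * a (fun i => b (r i)) := by
  classical
  have : w = fun i => ∑ j, b.repr (w i) j • b j := by
    funext i; exact (b.sum_repr _).symm
  conv_lhs => rw [this]
  change a.toMultilinearMap _ = _
  rw [MultilinearMap.map_sum]
  refine Finset.sum_congr rfl fun r _ => ?_
  rw [MultilinearMap.map_smul_univ]
  rfl

theorem continuousAlternating_apply_eq_sum {ι : Type*} [Fintype ι] (b : Basis ι ℝ V) {k : ℕ}
    (a : V [⋀^Fin k]→L[ℝ] ℝ) (w : Fin k → V) :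
    a w = ∑ r : Fin k → ι, (∏ i, b.repr (w i) (r i)) * a (fun i => b (r i)) :=
  alternating_apply_eq_sum b a.toAlternatingMap w

section WedgeBilinear

variable {i j n : ℕ} (h : i + j = n)

theorem wedgeAlt_add_left (a a' : V [⋀^Fin i]→L[ℝ] ℝ) (b : V [⋀^Fin j]→L[ℝ] ℝ) :
    wedgeAlt h (a + a') b = wedgeAlt h a b + wedgeAlt h a' b := by
  ext v
  simp only [wedgeAlt_apply, ContinuousAlternatingMap.add_apply, add_mul, mul_add,
    Finset.sum_add_distrib]

theorem wedgeAlt_add_right (a : V [⋀^Fin i]→L[ℝ] ℝ) (b b' : V [⋀^Fin j]→L[ℝ] ℝ) :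
    wedgeAlt h a (b + b') = wedgeAlt h a b + wedgeAlt h a b' := by
  ext v
  simp only [wedgeAlt_apply, ContinuousAlternatingMap.add_apply, mul_add,
    Finset.sum_add_distrib]

theorem wedgeAlt_smul_left (t : ℝ) (a : V [⋀^Fin i]→L[ℝ] ℝ) (b : V [⋀^Fin j]→L[ℝ] ℝ) :
    wedgeAlt h (t • a) b = t • wedgeAlt h a b := by
  ext v
  simp only [wedgeAlt_apply, ContinuousAlternatingMap.smul_apply, smul_eq_mul, Finset.mul_sum]
  exact Finset.sum_congr rfl fun _ _ => by ring

theorem wedgeAlt_smul_right (t : ℝ) (a : V [⋀^Fin i]→L[ℝ] ℝ) (b : V [⋀^Fin j]→L[ℝ] ℝ) :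
    wedgeAlt h a (t • b) = t • wedgeAlt h a b := by
  ext v
  simp only [wedgeAlt_apply, ContinuousAlternatingMap.smul_apply, smul_eq_mul, Finset.mul_sum]
  exact Finset.sum_congr rfl fun _ _ => by ring

/-- The exterior product as a bilinear pairing with values on a given frame. -/
def wedgePairing (v : Fin n → V) :
    (V [⋀^Fin i]→L[ℝ] ℝ) →ₗ[ℝ] (V [⋀^Fin j]→L[ℝ] ℝ) →ₗ[ℝ] ℝ :=
  LinearMap.mk₂ ℝ (fun a b => wedgeAlt h a b v)
    (fun a a' b => by rw [wedgeAlt_add_left]; rfl)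
    (fun t a b => by rw [wedgeAlt_smul_left]; rfl)
    (fun a b b' => by rw [wedgeAlt_add_right]; rfl)
    (fun t a b => by rw [wedgeAlt_smul_right]; rfl)

@[simp] theorem wedgePairing_apply (v : Fin n → V) (a : V [⋀^Fin i]→L[ℝ] ℝ)
    (b : V [⋀^Fin j]→L[ℝ] ℝ) : wedgePairing h v a b = wedgeAlt h a b v := rfl

/-- If all proper shuffles contribute zero, the exterior product is a plain product. -/
theorem wedgeAlt_eq_mul (a : V [⋀^Fin i]→L[ℝ] ℝ) (b : V [⋀^Fin j]→L[ℝ] ℝ) (w : Fin i ⊕ Fin j → V)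
    (hz : ∀ σ : Equiv.Perm (Fin i ⊕ Fin j),
      (∃ l l', σ (Sum.inl l) = Sum.inr l') → (∃ l l', σ (Sum.inr l) = Sum.inl l') →
        a (fun l => w (σ (Sum.inl l))) * b (fun l => w (σ (Sum.inr l))) = 0) :
    wedgeAlt h a b (fun l => w ((finSumFinEquiv.trans (finCongr h)).symm l)) =
      a (fun l => w (Sum.inl l)) * b (fun l => w (Sum.inr l)) := by
  change wedgeAux h a b _ = _
  rw [wedgeAux, AlternatingMap.domDomCongr_apply, LinearMap.compAlternatingMap_apply,
    AlternatingMap.domCoprod_apply]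
  have hw' : (fun x => w ((finSumFinEquiv.trans (finCongr h)).symm
      ((finSumFinEquiv.trans (finCongr h)) x))) = w := by
    funext l; simp
  have hw'' : ((fun l => w ((finSumFinEquiv.trans (finCongr h)).symm l)) ∘
      (finSumFinEquiv.trans (finCongr h))) = w := hw'
  rw [hw'']
  simp only [sum_apply, map_sum]
  have hs : ∀ σ : Equiv.Perm (Fin i ⊕ Fin j),
      LinearMap.mul' ℝ ℝ (AlternatingMap.domCoprod.summand a.toAlternatingMap b.toAlternatingMap
        (Quotient.mk'' σ) w) = ((Equiv.Perm.sign σ : ℤ) : ℝ) *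
        (a (fun l => w (σ (Sum.inl l))) * b (fun l => w (σ (Sum.inr l)))) := by
    intro σ
    rw [AlternatingMap.domCoprod.summand_mk'', smul_apply, MultilinearMap.domDomCongr_apply,
      MultilinearMap.domCoprod_apply, Units.smul_def, map_zsmul, LinearMap.mul'_apply,
      zsmul_eq_mul]
    rfl
  refine (Finset.sum_eq_single (Quotient.mk'' (1 : Equiv.Perm (Fin i ⊕ Fin j))) ?_ ?_).trans ?_
  rotate_right
  · rw [hs]; simp
  · intro σ _ hσ
    induction σ using Quotient.inductionOn' with
    | h σ =>
      rw [hs]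
      have hnot : σ ∉ (Equiv.Perm.sumCongrHom (Fin i) (Fin j)).range := by
        intro hm
        refine hσ (Quotient.sound' ?_)
        rw [QuotientGroup.leftRel_apply]
        simpa using hm
      have h1 : ∃ l l', σ (Sum.inl l) = Sum.inr l' := by
        by_contra hcon
        push Not at hcon
        refine hnot (Equiv.Perm.mem_sumCongrHom_range_of_perm_mapsTo_inl ?_)
        rintro _ ⟨l, rfl⟩
        rcases hl : σ (Sum.inl l) with m | m
        · exact ⟨m, rfl⟩
        · exact absurd hl (hcon l m)
      have h2 : ∃ l l', σ (Sum.inr l) = Sum.inl l' := by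
        by_contra hcon
        push Not at hcon
        refine hnot (Equiv.Perm.mem_sumCongrHom_range_of_perm_mapsTo_inl
          ((Equiv.Perm.perm_mapsTo_inl_iff_mapsTo_inr σ).2 ?_))
        rintro _ ⟨l, rfl⟩
        rcases hl : σ (Sum.inr l) with m | m
        · exact absurd hl (hcon l m)
        · exact ⟨m, rfl⟩
      rw [hz σ h1 h2, mul_zero]
  · intro hn; exact absurd (Finset.mem_univ _) hn

end WedgeBilinear

variable [FiniteDimensional ℝ V]

/-- On a finite-dimensional space every alternating map is continuous. -/
def toContinuousAlternating {k : ℕ} (a : V [⋀^Fin k]→ₗ[ℝ] ℝ) : V [⋀^Fin k]→L[ℝ] ℝ where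
  toMultilinearMap := a.toMultilinearMap
  map_eq_zero_of_eq' := a.map_eq_zero_of_eq'
  cont := by
    have : (fun w => a w) = fun w => ∑ r : Fin k → Fin (finrank ℝ V),
        (∏ i, (Module.finBasis ℝ V).repr (w i) (r i)) * a (fun i => Module.finBasis ℝ V (r i)) :=
      funext fun w => alternating_apply_eq_sum _ _ _
    change Continuous fun w => a w
    rw [this]
    refine continuous_finsetSum _ fun r _ => Continuous.mul
      (continuous_finsetProd _ fun i _ => ?_) continuous_const
    exact (LinearMap.continuous_of_finiteDimensional ((Module.finBasis ℝ V).coord (r i))).comp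
      (continuous_apply i)

theorem exists_alternating_expansion {ι : Type*} [Fintype ι] (b : Basis ι ℝ V) (k : ℕ) :
    ∃ c : (Fin k → ι) → V [⋀^Fin k]→L[ℝ] ℝ,
      ∀ a : V [⋀^Fin k]→L[ℝ] ℝ, a = ∑ r, a (fun i => b (r i)) • c r := by
  classical
  let ev : (V [⋀^Fin k]→L[ℝ] ℝ) →ₗ[ℝ] ((Fin k → ι) → ℝ) :=
    { toFun := fun a r => a (fun i => b (r i))
      map_add' := fun _ _ => rfl
      map_smul' := fun _ _ => rfl }
  have hev : LinearMap.ker ev = ⊥ := by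
    rw [LinearMap.ker_eq_bot']
    intro a ha
    ext w
    rw [continuousAlternating_apply_eq_sum b]
    refine Finset.sum_eq_zero fun r _ => ?_
    have : a (fun i => b (r i)) = 0 := congrFun ha r
    rw [this, mul_zero]
  obtain ⟨g, hg⟩ := ev.exists_leftInverse_of_injective hev
  refine ⟨fun r => g (Pi.single r 1), fun a => ?_⟩
  have h1 : g (ev a) = a := LinearMap.congr_fun hg a
  conv_lhs => rw [← h1, pi_eq_sum_univ' (ev a), map_sum]
  refine Finset.sum_congr rfl fun r _ => ?_
  rw [map_smul]
  rfl

instance finiteDimensional_alternating (k : ℕ) : FiniteDimensional ℝ (V [⋀^Fin k]→L[ℝ] ℝ) := by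
  obtain ⟨c, hc⟩ := exists_alternating_expansion (Module.finBasis ℝ V) k
  refine Module.Finite.of_surjective (Fintype.linearCombination ℝ c) fun a => ?_
  exact ⟨fun r => a (fun i => Module.finBasis ℝ V (r i)), (hc a).symm⟩

section Regularity

variable {Z : Type*} [NormedAddCommGroup Z] [NormedSpace ℝ Z] {k : ℕ} {n : ℕ∞ω}

theorem contDiffWithinAt_alternating {A : Z → V [⋀^Fin k]→L[ℝ] ℝ} {s : Set Z} {z : Z}
    (h : ∀ v, ContDiffWithinAt ℝ n (fun z => A z v) s z) : ContDiffWithinAt ℝ n A s z := by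
  obtain ⟨c, hc⟩ := exists_alternating_expansion (Module.finBasis ℝ V) k
  have : A = fun z => ∑ r, A z (fun i => Module.finBasis ℝ V (r i)) • c r := by
    funext z; exact hc (A z)
  rw [this]
  exact ContDiffWithinAt.sum fun r _ => (h _).smul contDiffWithinAt_const

theorem contDiffAt_alternating {A : Z → V [⋀^Fin k]→L[ℝ] ℝ} {z : Z}
    (h : ∀ v, ContDiffAt ℝ n (fun z => A z v) z) : ContDiffAt ℝ n A z :=
  contDiffWithinAt_univ.1 (contDiffWithinAt_alternating fun v => contDiffWithinAt_univ.2 (h v))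

theorem ContDiffAt.alternating_eval {A : Z → V [⋀^Fin k]→L[ℝ] ℝ} {z : Z}
    (h : ContDiffAt ℝ n A z) (v : Fin k → V) : ContDiffAt ℝ n (fun z => A z v) z :=
  (ContinuousAlternatingMap.apply ℝ V ℝ v).contDiff.contDiffAt.comp z h

/-- Evaluating a smooth family of alternating forms on smooth vectors gives a smooth function. -/
theorem contDiffAt_alternating_apply {A : Z → V [⋀^Fin k]→L[ℝ] ℝ} {w : Z → Fin k → V} {z : Z}
    (hA : ∀ v, ContDiffAt ℝ n (fun z => A z v) z) (hw : ∀ i, ContDiffAt ℝ n (fun z => w z i) z) :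
    ContDiffAt ℝ n (fun z => A z (w z)) z := by
  have : (fun z => A z (w z)) = fun z => ∑ r : Fin k → Fin (finrank ℝ V),
      (∏ i, (Module.finBasis ℝ V).repr (w z i) (r i)) *
        A z (fun i => Module.finBasis ℝ V (r i)) := by
    funext z; exact continuousAlternating_apply_eq_sum _ _ _
  rw [this]
  refine ContDiffAt.sum fun r _ => ContDiffAt.mul (contDiffAt_prod fun i _ => ?_) (hA _)
  exact (((Module.finBasis ℝ V).coord (r i)).toContinuousLinearMap.contDiff).contDiffAt.comp z
    (hw i)

end Regularity

section WedgePairing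

variable {i j n : ℕ} (h : i + j = n)

/-- Partial evaluation of an alternating form indexed by a sum type. -/
def partialEvalLeft (D : V [⋀^Fin i ⊕ Fin j]→ₗ[ℝ] ℝ) (v : Fin i → V) : V [⋀^Fin j]→L[ℝ] ℝ :=
  toContinuousAlternating
    { toMultilinearMap := D.toMultilinearMap.currySum v
      map_eq_zero_of_eq' := fun u l l' hu hl => by
        change D.toMultilinearMap.currySum v u = 0
        rw [MultilinearMap.currySum_apply']
        exact D.map_eq_zero_of_eq _ (i := Sum.inr l) (j := Sum.inr l') (by simpa using hu)
          (by simpa using hl) }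

theorem partialEvalLeft_apply (D : V [⋀^Fin i ⊕ Fin j]→ₗ[ℝ] ℝ) (v : Fin i → V) (u : Fin j → V) :
    partialEvalLeft D v u = D (Sum.elim v u) := by
  change D.toMultilinearMap.currySum v u = _
  rw [MultilinearMap.currySum_apply']
  rfl

theorem sum_elim_linearIndependent_basis (B : Basis (Fin n) ℝ V) {k l : ℕ} (hkl : k + l = n)
    {v : Fin k → V} (hv : LinearIndependent ℝ v) :
    ∃ (u : Fin l → V) (B' : Basis (Fin k ⊕ Fin l) ℝ V), ⇑B' = Sum.elim v u := by
  classical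
  let S := Basis.sumExtend hv
  haveI : Finite (Fin k ⊕ Module.Basis.sumExtendIndex hv) := Module.Finite.finite_basis S
  haveI : Finite (Module.Basis.sumExtendIndex hv) :=
    Finite.of_injective (Sum.inr : _ → Fin k ⊕ Module.Basis.sumExtendIndex hv) Sum.inr_injective
  have hc : Nat.card (Fin k ⊕ Module.Basis.sumExtendIndex hv) = n := by
    rw [← Module.finrank_eq_nat_card_basis S, Module.finrank_eq_nat_card_basis B, Nat.card_fin]
  have hc' : Nat.card (Module.Basis.sumExtendIndex hv) = Nat.card (Fin l) := by
    rw [Nat.card_sum, Nat.card_fin] at hc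
    rw [Nat.card_fin]; omega
  obtain ⟨eq⟩ := Finite.card_eq.1 hc'
  refine ⟨fun m => S (Sum.inr (eq.symm m)), S.reindex (Equiv.sumCongr (Equiv.refl _) eq), ?_⟩
  funext x
  rcases x with x | x
  · simp [S, Basis.sumExtend]
    rfl
  · simp

theorem wedge_ne_zero_aux (B : Basis (Fin n) ℝ V) (c : V [⋀^Fin n]→L[ℝ] ℝ) (hc : c B = 0) :
    c = 0 := by
  ext v
  have := (AlternatingMap.map_basis_eq_zero_iff B c.toAlternatingMap).1 hc
  exact DFunLike.congr_fun this v

theorem exists_wedge_right_ne_zero (B : Basis (Fin n) ℝ V) {a : V [⋀^Fin i]→L[ℝ] ℝ} (ha : a ≠ 0) :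
    ∃ b : V [⋀^Fin j]→L[ℝ] ℝ, wedgeAlt h a b B ≠ 0 := by
  classical
  obtain ⟨v, hv⟩ : ∃ v, a v ≠ 0 := by
    by_contra hcon; push Not at hcon; exact ha (ContinuousAlternatingMap.ext hcon)
  have hli : LinearIndependent ℝ v := by
    by_contra hcon
    exact hv (a.toAlternatingMap.map_linearDependent v hcon)
  obtain ⟨u, B', hB'⟩ := sum_elim_linearIndependent_basis B h hli
  refine ⟨partialEvalLeft B'.det v, fun hzero => ?_⟩
  have h0 := wedge_ne_zero_aux B _ hzero
  have h1 := wedgeAlt_eq_mul h a (partialEvalLeft B'.det v) (Sum.elim v u) (by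
    rintro σ - ⟨l, l', hl⟩
    refine mul_eq_zero_of_right _ ?_
    rw [partialEvalLeft_apply]
    exact AlternatingMap.map_eq_zero_of_eq _ _ (i := Sum.inr l) (j := Sum.inl l')
      (by simp [hl]) (by simp))
  rw [h0] at h1
  have h2 : partialEvalLeft B'.det v (fun l => Sum.elim v u (Sum.inr l)) = 1 := by
    rw [partialEvalLeft_apply]
    change B'.det (Sum.elim v u) = 1
    rw [← hB', Basis.det_self]
  rw [h2, mul_one] at h1
  exact hv h1.symm

theorem exists_wedge_left_ne_zero (B : Basis (Fin n) ℝ V) {b : V [⋀^Fin j]→L[ℝ] ℝ} (hb : b ≠ 0) :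
    ∃ a : V [⋀^Fin i]→L[ℝ] ℝ, wedgeAlt h a b B ≠ 0 := by
  classical
  obtain ⟨v, hv⟩ : ∃ v, b v ≠ 0 := by
    by_contra hcon; push Not at hcon; exact hb (ContinuousAlternatingMap.ext hcon)
  have hli : LinearIndependent ℝ v := by
    by_contra hcon
    exact hv (b.toAlternatingMap.map_linearDependent v hcon)
  obtain ⟨u, B', hB'⟩ := sum_elim_linearIndependent_basis B ((add_comm j i).trans h) hli
  refine ⟨partialEvalLeft B'.det v, fun hzero => ?_⟩
  have h0 := wedge_ne_zero_aux B _ hzero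
  have h1 := wedgeAlt_eq_mul h (partialEvalLeft B'.det v) b (Sum.elim u v) (by
    rintro σ ⟨l, l', hl⟩ -
    refine mul_eq_zero_of_left ?_ _
    rw [partialEvalLeft_apply]
    exact AlternatingMap.map_eq_zero_of_eq _ _ (i := Sum.inr l) (j := Sum.inl l')
      (by simp [hl]) (by simp))
  rw [h0] at h1
  have h2 : partialEvalLeft B'.det v (fun l => Sum.elim u v (Sum.inl l)) = 1 := by
    rw [partialEvalLeft_apply]
    change B'.det (Sum.elim v u) = 1
    rw [← hB', Basis.det_self]
  rw [h2, one_mul] at h1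
  exact hv h1.symm

theorem wedgePairing_isPerfPair (B : Basis (Fin n) ℝ V) :
    (wedgePairing h (i := i) (j := j) B).IsPerfPair := by
  refine LinearMap.IsPerfPair.of_injective ?_ ?_
  · refine (injective_iff_map_eq_zero _).2 fun a ha => ?_
    by_contra hne
    obtain ⟨b, hb⟩ := exists_wedge_right_ne_zero h B hne
    exact hb (LinearMap.congr_fun ha b)
  · refine (injective_iff_map_eq_zero _).2 fun b hb' => ?_
    by_contra hne
    obtain ⟨a, ha⟩ := exists_wedge_left_ne_zero h B hne
    exact ha (LinearMap.congr_fun hb' a)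

/-- Every linear functional on `j`-forms is the exterior product with an `i`-form on the left. -/
theorem exists_wedge_left_eq (B : Basis (Fin n) ℝ V) (l : (V [⋀^Fin j]→L[ℝ] ℝ) →ₗ[ℝ] ℝ) :
    ∃ a : V [⋀^Fin i]→L[ℝ] ℝ, ∀ b, wedgeAlt h a b B = l b := by
  haveI : (wedgePairing h (i := i) (j := j) B).IsPerfPair :=
    wedgePairing_isPerfPair h B
  obtain ⟨a, ha⟩ := (LinearMap.IsPerfPair.bijective_left
    (wedgePairing h (i := i) (j := j) B)).2 l
  exact ⟨a, fun b => LinearMap.congr_fun ha b⟩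

/-- Every linear functional on `i`-forms is the exterior product with a `j`-form on the right. -/
theorem exists_wedge_right_eq (B : Basis (Fin n) ℝ V) (l : (V [⋀^Fin i]→L[ℝ] ℝ) →ₗ[ℝ] ℝ) :
    ∃ b : V [⋀^Fin j]→L[ℝ] ℝ, ∀ a, wedgeAlt h a b B = l a := by
  haveI : (wedgePairing h (i := i) (j := j) B).IsPerfPair :=
    wedgePairing_isPerfPair h B
  obtain ⟨b, hb⟩ := (LinearMap.IsPerfPair.bijective_right
    (wedgePairing h (i := i) (j := j) B)).2 l
  exact ⟨b, fun a => LinearMap.congr_fun hb a⟩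

end WedgePairing

theorem continuousAlternating_comp_basis {n : ℕ} (B : Basis (Fin n) ℝ V)
    (c : V [⋀^Fin n]→L[ℝ] ℝ) (L : V →L[ℝ] V) :
    c.compContinuousLinearMap L B = L.det * c B := by
  have := AlternatingMap.eq_smul_basis_det B c.toAlternatingMap
  have h1 : c (fun i => L (B i)) = (c B • B.det) (fun i => L (B i)) := DFunLike.congr_fun this _
  change c (fun i => L (B i)) = _
  rw [h1]
  change c B * B.det (fun i => L (B i)) = _
  have h2 := Basis.det_comp B (L : V →ₗ[ℝ] V) B
  rw [Basis.det_self, mul_one] at h2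
  have h3 : B.det (fun i => L (B i)) = LinearMap.det (L : V →ₗ[ℝ] V) := h2
  rw [h3, mul_comm]

theorem alternating_eq_zero_of_finrank_lt {k : ℕ} (hk : finrank ℝ V < k)
    (a : V [⋀^Fin k]→L[ℝ] ℝ) : a = 0 := by
  ext v
  refine a.toAlternatingMap.map_linearDependent v fun hv => ?_
  have := hv.fintype_card_le_finrank
  rw [Fintype.card_fin] at this
  omega

end AlternatingAlgebra

section Charts

variable {E : Type*} [NormedAddCommGroup E] [NormedSpace ℝ E]
  {H : Type*} [TopologicalSpace H] (I : ModelWithCorners ℝ E H)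
  {M : Type*} [TopologicalSpace M] [ChartedSpace H M]
  {E' : Type*} [NormedAddCommGroup E'] [NormedSpace ℝ E']
  {H' : Type*} [TopologicalSpace H'] (I' : ModelWithCorners ℝ E' H')
  {M' : Type*} [TopologicalSpace M'] [ChartedSpace H' M']
  {V : Type*} [NormedAddCommGroup V] [NormedSpace ℝ V]
  {V' : Type*} [NormedAddCommGroup V'] [NormedSpace ℝ V']

/-- A smooth coordinate system with values in a vector space. -/
structure IsChart (e : PartialEquiv M V) : Prop where
  open_source : IsOpen e.source
  open_target : IsOpen e.target
  smooth : ContMDiffOn I 𝓘(ℝ, V) ∞ e e.source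
  smooth_symm : ContMDiffOn 𝓘(ℝ, V) I ∞ e.symm e.target

theorem isChart_extChartAt [I.Boundaryless] [IsManifold I ∞ M] (x : M) :
    IsChart I (extChartAt I x) where
  open_source := isOpen_extChartAt_source x
  open_target := isOpen_extChartAt_target x
  smooth := by rw [extChartAt_source]; exact contMDiffOn_extChartAt
  smooth_symm := contMDiffOn_extChartAt_symm x

variable {I} in
theorem IsChart.contMDiffAt {e : PartialEquiv M V} (he : IsChart I e) {p : M} (hp : p ∈ e.source) :
    ContMDiffAt I 𝓘(ℝ, V) ∞ e p :=
  he.smooth.contMDiffAt (he.open_source.mem_nhds hp)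

variable {I} in
theorem IsChart.contMDiffAt_symm {e : PartialEquiv M V} (he : IsChart I e) {z : V}
    (hz : z ∈ e.target) : ContMDiffAt 𝓘(ℝ, V) I ∞ e.symm z :=
  he.smooth_symm.contMDiffAt (he.open_target.mem_nhds hz)

/-- The expression of a form in a coordinate system. -/
def formIn (e : PartialEquiv M V) (α : RawForm E M) (k : ℕ) (z : V) : V [⋀^Fin k]→L[ℝ] ℝ :=
  (α (e.symm z) k).compContinuousLinearMap (diffAt 𝓘(ℝ, V) I e.symm z)

theorem coordForm_eq_formIn (x : M) (α : RawForm E M) (k : ℕ) (z : E) :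
    coordForm I x α k z = formIn I (extChartAt I x) α k z := rfl

theorem formIn_apply (e : PartialEquiv M V) (α : RawForm E M) (k : ℕ) (z : V) (v : Fin k → V) :
    formIn I e α k z v = α (e.symm z) k (fun i => diffAt 𝓘(ℝ, V) I e.symm z (v i)) := rfl

theorem formIn_eq_zero (e : PartialEquiv M V) {α : RawForm E M} {k : ℕ} {z : V}
    (h : α (e.symm z) k = 0) : formIn I e α k z = 0 := by
  rw [formIn, h]; rfl

theorem formIn_rawWedge (e : PartialEquiv M V) (α β : RawForm E M) (k : ℕ) (z : V) :
    formIn I e (rawWedge α β) k z = ∑ i : Fin (k + 1),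
      wedgeAlt (Nat.add_sub_of_le (Nat.lt_succ_iff.1 i.2)) (formIn I e α i z)
        (formIn I e β (k - i) z) := by
  ext v
  rw [formIn_apply, rawWedge, ContinuousAlternatingMap.sum_apply,
    ContinuousAlternatingMap.sum_apply]
  simp only [wedgeAlt_apply]
  rfl

theorem rawPullback_id (α : RawForm E M) : rawPullback I I (fun p : M => p) α = α := by
  funext p k
  have : diffAt I I (fun p : M => p) p = ContinuousLinearMap.id ℝ E := mfderiv_id
  ext v
  change α p k (fun i => diffAt I I (fun p : M => p) p (v i)) = α p k v
  rw [this]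
  rfl

variable {I I'} in
theorem formIn_rawPullback {s : M → M'} {e : PartialEquiv M V} {e' : PartialEquiv M' V'}
    (he : IsChart I e) (he' : IsChart I' e') {z : V} (hz : z ∈ e.target)
    (hs : ContMDiffAt I I' ∞ s (e.symm z)) (hz' : s (e.symm z) ∈ e'.source)
    (α : RawForm E' M') (k : ℕ) :
    formIn I e (rawPullback I I' s α) k z =
      (formIn I' e' α k (e' (s (e.symm z)))).compContinuousLinearMap
        (fderiv ℝ (fun y => e' (s (e.symm y))) z) := by
  set g : V → V' := fun y => e' (s (e.symm y)) with hg
  have hcomp : ContMDiffAt 𝓘(ℝ, V) I' ∞ (fun y => s (e.symm y)) z :=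
    hs.comp z (he.contMDiffAt_symm hz)
  have hgsm : ContMDiffAt 𝓘(ℝ, V) 𝓘(ℝ, V') ∞ g z :=
    (he'.contMDiffAt hz').comp z hcomp
  have h1 : mfderiv 𝓘(ℝ, V) I' (fun y => s (e.symm y)) z =
      (mfderiv I I' s (e.symm z)).comp (mfderiv 𝓘(ℝ, V) I e.symm z) :=
    mfderiv_comp z (hs.mdifferentiableAt (by simp))
      ((he.contMDiffAt_symm hz).mdifferentiableAt (by simp))
  have h2 : mfderiv 𝓘(ℝ, V) I' (fun y => e'.symm (g y)) z =
      (mfderiv 𝓘(ℝ, V') I' e'.symm (g z)).comp (mfderiv 𝓘(ℝ, V) 𝓘(ℝ, V') g z) :=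
    mfderiv_comp z
      ((he'.contMDiffAt_symm (e'.map_source hz')).mdifferentiableAt (by simp))
      (hgsm.mdifferentiableAt (by simp))
  have h3 : (fun y => e'.symm (g y)) =ᶠ[𝓝 z] fun y => s (e.symm y) := by
    filter_upwards [hcomp.continuousAt.preimage_mem_nhds (he'.open_source.mem_nhds hz')] with y hy
    exact e'.left_inv hy
  have h1' : diffAt 𝓘(ℝ, V) I' (fun y => s (e.symm y)) z =
      (diffAt I I' s (e.symm z)).comp (diffAt 𝓘(ℝ, V) I e.symm z) := h1
  have h2' : diffAt 𝓘(ℝ, V) I' (fun y => e'.symm (g y)) z =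
      (diffAt 𝓘(ℝ, V') I' e'.symm (g z)).comp (fderiv ℝ g z) := by
    rw [← mfderiv_eq_fderiv]; exact h2
  have h5 : diffAt 𝓘(ℝ, V) I' (fun y => e'.symm (g y)) z =
      diffAt 𝓘(ℝ, V) I' (fun y => s (e.symm y)) z := h3.mfderiv_eq
  have h6 := (h1'.symm.trans (h5.symm.trans h2'))
  have hleft : e'.symm (g z) = s (e.symm z) := e'.left_inv hz'
  ext v
  change α (s (e.symm z)) k (fun i =>
      ((diffAt I I' s (e.symm z)).comp (diffAt 𝓘(ℝ, V) I e.symm z)) (v i)) =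
    α (e'.symm (g z)) k (fun i =>
      ((diffAt 𝓘(ℝ, V') I' e'.symm (g z)).comp (fderiv ℝ g z)) (v i))
  rw [hleft, h6]

variable {I} in
theorem formIn_change {e : PartialEquiv M V} {e' : PartialEquiv M V'}
    (he : IsChart I e) (he' : IsChart I e') {z : V} (hz : z ∈ e.target)
    (hz' : e.symm z ∈ e'.source) (α : RawForm E M) (k : ℕ) :
    formIn I e α k z = (formIn I e' α k (e' (e.symm z))).compContinuousLinearMap
        (fderiv ℝ (fun y => e' (e.symm y)) z) := by
  have := formIn_rawPullback (s := fun p : M => p) he he' hz contMDiffAt_id hz' α k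
  rwa [rawPullback_id] at this

variable {I} in
theorem IsChart.diffAt_symm_comp {e : PartialEquiv M V} (he : IsChart I e) {p : M}
    (hp : p ∈ e.source) :
    (diffAt 𝓘(ℝ, V) I e.symm (e p)).comp (diffAt I 𝓘(ℝ, V) e p) = ContinuousLinearMap.id ℝ E := by
  have h1 : mfderiv I I (fun q => e.symm (e q)) p =
      (mfderiv 𝓘(ℝ, V) I e.symm (e p)).comp (mfderiv I 𝓘(ℝ, V) e p) :=
    mfderiv_comp p ((he.contMDiffAt_symm (e.map_source hp)).mdifferentiableAt (by simp))
      ((he.contMDiffAt hp).mdifferentiableAt (by simp))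
  have h2 : mfderiv I I (fun q => e.symm (e q)) p = mfderiv I I (fun q : M => q) p := by
    refine Filter.EventuallyEq.mfderiv_eq ?_
    filter_upwards [he.open_source.mem_nhds hp] with q hq using e.left_inv hq
  have h3 : mfderiv I I (fun q : M => q) p = ContinuousLinearMap.id ℝ E := mfderiv_id
  have h4 : (diffAt 𝓘(ℝ, V) I e.symm (e p)).comp (diffAt I 𝓘(ℝ, V) e p) =
    diffAt I I (fun q => e.symm (e q)) p := h1.symm
  have h5 : diffAt I I (fun q => e.symm (e q)) p = ContinuousLinearMap.id ℝ E := h2.trans h3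
  rw [h4, h5]

variable {I} in
theorem IsChart.diffAt_comp_symm {e : PartialEquiv M V} (he : IsChart I e) {z : V}
    (hz : z ∈ e.target) :
    (diffAt I 𝓘(ℝ, V) e (e.symm z)).comp (diffAt 𝓘(ℝ, V) I e.symm z) =
      ContinuousLinearMap.id ℝ V := by
  have h1 : mfderiv 𝓘(ℝ, V) 𝓘(ℝ, V) (fun q => e (e.symm q)) z =
      (mfderiv I 𝓘(ℝ, V) e (e.symm z)).comp (mfderiv 𝓘(ℝ, V) I e.symm z) :=
    mfderiv_comp z ((he.contMDiffAt (e.map_target hz)).mdifferentiableAt (by simp))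
      ((he.contMDiffAt_symm hz).mdifferentiableAt (by simp))
  have h2 : mfderiv 𝓘(ℝ, V) 𝓘(ℝ, V) (fun q => e (e.symm q)) z =
      mfderiv 𝓘(ℝ, V) 𝓘(ℝ, V) (fun q : V => q) z := by
    refine Filter.EventuallyEq.mfderiv_eq ?_
    filter_upwards [he.open_target.mem_nhds hz] with q hq using e.right_inv hq
  have h3 : mfderiv 𝓘(ℝ, V) 𝓘(ℝ, V) (fun q : V => q) z = ContinuousLinearMap.id ℝ V := mfderiv_id
  have h4 : (diffAt I 𝓘(ℝ, V) e (e.symm z)).comp (diffAt 𝓘(ℝ, V) I e.symm z) =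
    diffAt 𝓘(ℝ, V) 𝓘(ℝ, V) (fun q => e (e.symm q)) z := h1.symm
  have h5 : diffAt 𝓘(ℝ, V) 𝓘(ℝ, V) (fun q => e (e.symm q)) z = ContinuousLinearMap.id ℝ V :=
    h2.trans h3
  rw [h4, h5]

variable {I} in
/-- A form is determined by its expression in coordinates. -/
theorem form_eq_of_formIn {e : PartialEquiv M V} (he : IsChart I e) {p : M} (hp : p ∈ e.source)
    (α : RawForm E M) (k : ℕ) :
    α p k = (formIn I e α k (e p)).compContinuousLinearMap (diffAt I 𝓘(ℝ, V) e p) := by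
  ext v
  change α p k v = α (e.symm (e p)) k (fun i =>
    ((diffAt 𝓘(ℝ, V) I e.symm (e p)).comp (diffAt I 𝓘(ℝ, V) e p)) (v i))
  rw [he.diffAt_symm_comp hp, e.left_inv hp]
  rfl

/-- The pull-back of a form by a coordinate system, extended by zero. -/
def extendForm (e : PartialEquiv M V) (A : RawForm V V) : RawForm E M := fun p k =>
  open Classical in
  if p ∈ e.source then (A (e p) k).compContinuousLinearMap (diffAt I 𝓘(ℝ, V) e p) else 0

variable {I} in
theorem formIn_extendForm {e : PartialEquiv M V} (he : IsChart I e) (A : RawForm V V) (k : ℕ)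
    {z : V} (hz : z ∈ e.target) : formIn I e (extendForm I e A) k z = A z k := by
  ext v
  rw [formIn_apply, extendForm, if_pos (e.map_target hz), e.right_inv hz]
  change A z k (fun i => ((diffAt I 𝓘(ℝ, V) e (e.symm z)).comp
    (diffAt 𝓘(ℝ, V) I e.symm z)) (v i)) = _
  rw [he.diffAt_comp_symm hz]
  rfl

theorem extendForm_of_notMem (e : PartialEquiv M V) (A : RawForm V V) {p : M}
    (hp : p ∉ e.source) : extendForm I e A p = 0 := by
  funext k; rw [extendForm, if_neg hp]; rfl

theorem extendForm_eq_zero (e : PartialEquiv M V) {A : RawForm V V} {p : M}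
    (hp : A (e p) = 0) : extendForm I e A p = 0 := by
  funext k
  rw [extendForm]
  split_ifs
  · rw [hp]; rfl
  · rfl

end Charts

section Families

variable {E : Type*} [NormedAddCommGroup E] [NormedSpace ℝ E]
  {H : Type*} [TopologicalSpace H] (I : ModelWithCorners ℝ E H)
  {M : Type*} [TopologicalSpace M] [ChartedSpace H M]
  {E' : Type*} [NormedAddCommGroup E'] [NormedSpace ℝ E']
  {H' : Type*} [TopologicalSpace H'] (I' : ModelWithCorners ℝ E' H')
  {M' : Type*} [TopologicalSpace M'] [ChartedSpace H' M']
  {V : Type*} [NormedAddCommGroup V] [NormedSpace ℝ V]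
  {V' : Type*} [NormedAddCommGroup V'] [NormedSpace ℝ V']
  {P : Type*} [NormedAddCommGroup P] [NormedSpace ℝ P]
  {P' : Type*} [NormedAddCommGroup P'] [NormedSpace ℝ P']

/-- A family of forms is smooth in the parameter and the coordinates near a given point. -/
def FamilyAt (e : PartialEquiv M V) (Φ : P → RawForm E M) (p : P) (z : V) : Prop :=
  ∀ (k : ℕ) (v : Fin k → V),
    ContDiffAt ℝ ∞ (fun q : P × V => formIn I e (Φ q.1) k q.2 v) (p, z)

/-- A smooth family of forms, with parameters in a vector space. -/
def SmoothFamily (Φ : P → RawForm E M) : Prop :=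
  ∀ (x : M) (p : P), ∀ z ∈ (extChartAt I x).target, FamilyAt I (extChartAt I x) Φ p z

variable {I I'}

theorem FamilyAt.congr {e : PartialEquiv M V} {Φ Ψ : P → RawForm E M} {p : P} {z : V}
    (h : FamilyAt I e Φ p z) (hΦ : ∀ᶠ q : P × V in 𝓝 (p, z), Ψ q.1 (e.symm q.2) = Φ q.1 (e.symm q.2)) :
    FamilyAt I e Ψ p z := by
  intro k v
  refine (h k v).congr_of_eventuallyEq ?_
  filter_upwards [hΦ] with q hq
  rw [formIn_apply, formIn_apply, hq]

theorem FamilyAt.pullback [FiniteDimensional ℝ V'] {s : P → M → M'}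
    (hs : ContMDiff (𝓘(ℝ, P).prod I) I' ∞ (fun q : P × M => s q.1 q.2))
    {e : PartialEquiv M V} {e' : PartialEquiv M' V'} (he : IsChart I e) (he' : IsChart I' e')
    {Φ : P → RawForm E' M'} {p : P} {z : V} (hz : z ∈ e.target)
    (hz' : s p (e.symm z) ∈ e'.source) (hΦ : FamilyAt I' e' Φ p (e' (s p (e.symm z)))) :
    FamilyAt I e (fun p => rawPullback I I' (s p) (Φ p)) p z := by
  intro k v
  set g : P × V → V' := fun q => e' (s q.1 (e.symm q.2)) with hg
  have hcomp : ∀ q : P × V, q.2 ∈ e.target →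
      ContMDiffAt 𝓘(ℝ, P × V) I' ∞ (fun q : P × V => s q.1 (e.symm q.2)) q := by
    intro q hq
    have h1 : ContMDiffAt 𝓘(ℝ, P × V) 𝓘(ℝ, P) ∞ (Prod.fst : P × V → P) q :=
      contDiff_fst.contMDiff.contMDiffAt
    have h2 : ContMDiffAt 𝓘(ℝ, P × V) 𝓘(ℝ, V) ∞ (Prod.snd : P × V → V) q :=
      contDiff_snd.contMDiff.contMDiffAt
    have h3 : ContMDiffAt 𝓘(ℝ, P × V) I ∞ (fun q : P × V => e.symm q.2) q :=
      (he.contMDiffAt_symm hq).comp q h2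
    exact (hs.contMDiffAt (x := (q.1, e.symm q.2))).comp q (h1.prodMk h3)
  have hs' : ∀ p, ContMDiff I I' ∞ (s p) := fun p =>
    hs.comp (contMDiff_const.prodMk contMDiff_id)
  have hU : ∀ᶠ q : P × V in 𝓝 (p, z), q.2 ∈ e.target ∧ s q.1 (e.symm q.2) ∈ e'.source := by
    refine Filter.Eventually.and ?_ ?_
    · exact continuousAt_snd.preimage_mem_nhds (he.open_target.mem_nhds hz)
    · exact (hcomp (p, z) hz).continuousAt.preimage_mem_nhds (he'.open_source.mem_nhds hz')
  have hgsm : ∀ q : P × V, q.2 ∈ e.target → s q.1 (e.symm q.2) ∈ e'.source →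
      ContDiffAt ℝ ∞ g q := by
    intro q hq hq'
    rw [← contMDiffAt_iff_contDiffAt]
    exact (he'.contMDiffAt hq').comp q (hcomp q hq)
  have hg0 := hgsm (p, z) hz hz'
  have key : ∀ᶠ q : P × V in 𝓝 (p, z),
      formIn I e (rawPullback I I' (s q.1) (Φ q.1)) k q.2 v =
        formIn I' e' (Φ q.1) k (g q) (fun i => fderiv ℝ g q (0, v i)) := by
    filter_upwards [hU] with q hq
    rw [formIn_rawPullback he he' hq.1 (hs' q.1).contMDiffAt hq.2]
    change formIn I' e' (Φ q.1) k (g q) (fun i => fderiv ℝ (fun y => g (q.1, y)) q.2 (v i)) = _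
    have h1 : HasFDerivAt g (fderiv ℝ g q) (q.1, q.2) :=
      ((hgsm q hq.1 hq.2).differentiableAt (by simp)).hasFDerivAt
    have h2 := h1.comp q.2 (hasFDerivAt_prodMk_right q.1 q.2)
    have h3 : fderiv ℝ (fun y => g (q.1, y)) q.2 =
        (fderiv ℝ g q).comp (ContinuousLinearMap.inr ℝ P V) := h2.fderiv
    rw [h3]
    rfl
  refine ContDiffAt.congr_of_eventuallyEq ?_ key
  refine contDiffAt_alternating_apply (A := fun q : P × V => formIn I' e' (Φ q.1) k (g q))
    (w := fun q i => fderiv ℝ g q (0, v i)) (fun w => ?_) (fun i => ?_)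
  · have h1 : ContDiffAt ℝ ∞ (fun q : P × V => (q.1, g q)) (p, z) := contDiffAt_fst.prodMk hg0
    exact ContDiffAt.comp (p, z)
      (g := fun q : P × V' => formIn I' e' (Φ q.1) k q.2 w) (f := fun q : P × V => (q.1, g q))
      (hΦ k w) h1
  · exact (hg0.fderiv_right (m := ∞) (by simp)).clm_apply contDiffAt_const

theorem FamilyAt.change [FiniteDimensional ℝ V'] {e : PartialEquiv M V} {e' : PartialEquiv M V'}
    (he : IsChart I e) (he' : IsChart I e') {Φ : P → RawForm E M} {p : P} {z : V}
    (hz : z ∈ e.target) (hz' : e.symm z ∈ e'.source)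
    (hΦ : FamilyAt I e' Φ p (e' (e.symm z))) : FamilyAt I e Φ p z := by
  have := FamilyAt.pullback (s := fun _ (q : M) => q) (P := P) contMDiff_snd he he' hz hz' hΦ
  simpa only [rawPullback_id] using this

theorem FamilyAt.comp {e : PartialEquiv M V} {Φ : P → RawForm E M} {g : P' → P} {p : P'} {z : V}
    (h : FamilyAt I e Φ (g p) z) (hg : ContDiffAt ℝ ∞ g p) :
    FamilyAt I e (fun p => Φ (g p)) p z := by
  intro k v
  have h1 : ContDiffAt ℝ ∞ (fun q : P' × V => (g q.1, q.2)) (p, z) :=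
    (hg.comp (p, z) contDiffAt_fst).prodMk contDiffAt_snd
  exact ContDiffAt.comp (p, z)
    (g := fun q : P × V => formIn I e (Φ q.1) k q.2 v) (f := fun q : P' × V => (g q.1, q.2))
    (h k v) h1

theorem SmoothFamily.comp {Φ : P → RawForm E M} (h : SmoothFamily I Φ) {g : P' → P}
    (hg : ContDiff ℝ ∞ g) : SmoothFamily I (fun p => Φ (g p)) := fun x p z hz =>
  (h x (g p) z hz).comp hg.contDiffAt

theorem SmoothFamily.add {Φ Ψ : P → RawForm E M} (h : SmoothFamily I Φ) (h' : SmoothFamily I Ψ) :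
    SmoothFamily I (fun p => Φ p + Ψ p) := fun x p z hz k v =>
  (h x p z hz k v).add (h' x p z hz k v)

theorem SmoothFamily.smul {Φ : P → RawForm E M} (h : SmoothFamily I Φ) {c : P → ℝ}
    (hc : ContDiff ℝ ∞ c) : SmoothFamily I (fun p => c p • Φ p) := fun x p z hz k v =>
  ((hc.contDiffAt.comp (p, z) contDiffAt_fst).mul (h x p z hz k v) :)

theorem SmoothFamily.wedge {Φ Ψ : P → RawForm E M} (h : SmoothFamily I Φ)
    (h' : SmoothFamily I Ψ) : SmoothFamily I (fun p => rawWedge (Φ p) (Ψ p)) := by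
  intro x p z hz k v
  simp only [formIn_rawWedge, ContinuousAlternatingMap.sum_apply, wedgeAlt_apply]
  exact ContDiffAt.sum fun q _ => ContDiffAt.sum fun σ _ =>
    contDiffAt_const.mul ((h x p z hz _ _).mul (h' x p z hz _ _))

variable [I.Boundaryless] [IsManifold I ∞ M] [I'.Boundaryless] [IsManifold I' ∞ M']

theorem FamilyAt.of_isSmoothForm {α : RawForm E M} (hα : IsSmoothForm I α) (x : M) (p : P) {z : E}
    (hz : z ∈ (extChartAt I x).target) : FamilyAt I (extChartAt I x) (fun _ : P => α) p z := by
  intro k v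
  have h1 := (hα x k v).contDiffAt ((isOpen_extChartAt_target x).mem_nhds hz)
  exact h1.comp (p, z) contDiffAt_snd

theorem SmoothFamily.const {α : RawForm E M} (hα : IsSmoothForm I α) :
    SmoothFamily I (fun _ : P => α) := fun x p _ hz => FamilyAt.of_isSmoothForm hα x p hz

theorem SmoothFamily.isSmoothForm {Φ : P → RawForm E M} (h : SmoothFamily I Φ) (p : P) :
    IsSmoothForm I (Φ p) := by
  intro x k v z hz
  have h1 : ContDiffAt ℝ ∞ (fun z : E => (p, z)) z := contDiffAt_const.prodMk contDiffAt_id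
  exact (ContDiffAt.comp z (g := fun q : P × E => formIn I (extChartAt I x) (Φ q.1) k q.2 v)
    (f := fun z : E => (p, z)) (h x p z hz k v) h1).contDiffWithinAt

theorem SmoothFamily.familyAt [FiniteDimensional ℝ E] {Φ : P → RawForm E M}
    (h : SmoothFamily I Φ) {e : PartialEquiv M V} (he : IsChart I e) (p : P) {z : V}
    (hz : z ∈ e.target) : FamilyAt I e Φ p z :=
  FamilyAt.change he (isChart_extChartAt I (e.symm z)) hz (mem_extChartAt_source _)
    (h _ _ _ ((extChartAt I (e.symm z)).map_source (mem_extChartAt_source _)))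

theorem SmoothFamily.pullback [FiniteDimensional ℝ E'] {s : P → M → M'}
    (hs : ContMDiff (𝓘(ℝ, P).prod I) I' ∞ (fun q : P × M => s q.1 q.2))
    {Φ : P → RawForm E' M'} (hΦ : SmoothFamily I' Φ) :
    SmoothFamily I (fun p => rawPullback I I' (s p) (Φ p)) := fun x _ z hz =>
  FamilyAt.pullback hs (isChart_extChartAt I x) (isChart_extChartAt I'
    (s _ ((extChartAt I x).symm z))) hz (mem_extChartAt_source _)
    (hΦ _ _ _ (mem_extChartAt_target _))

theorem SmoothFamily.mul {Φ : P → RawForm E M} (h : SmoothFamily I Φ) {χ : M → ℝ}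
    (hχ : ContMDiff I 𝓘(ℝ) ∞ χ) : SmoothFamily I (fun p q => χ q • Φ p q) := by
  intro x p z hz k v
  have h1 : ContDiffAt ℝ ∞ (fun y => χ ((extChartAt I x).symm y)) z := by
    rw [← contMDiffAt_iff_contDiffAt]
    exact hχ.contMDiffAt.comp z ((isChart_extChartAt I x).contMDiffAt_symm hz)
  exact ((h1.comp (p, z) contDiffAt_snd).mul (h x p z hz k v) :)

theorem IsSmoothForm.mul {α : RawForm E M} (hα : IsSmoothForm I α) {χ : M → ℝ}
    (hχ : ContMDiff I 𝓘(ℝ) ∞ χ) : IsSmoothForm I (fun q => χ q • α q) :=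
  (SmoothFamily.mul (SmoothFamily.const (P := ℝ) hα) hχ).isSmoothForm 0

/-- Smoothness of a family of forms that are extended by zero from a coordinate system. -/
theorem SmoothFamily.extendForm [T2Space M] [FiniteDimensional ℝ V] {e : PartialEquiv M V}
    (he : IsChart I e) {A : P → RawForm V V}
    (hA : ∀ p, ∀ z ∈ e.target, ∀ k v, ContDiffAt ℝ ∞ (fun q : P × V => A q.1 q.2 k v) (p, z))
    (hK : ∀ p, ∃ K ⊆ e.target, IsCompact K ∧ ∀ᶠ p' in 𝓝 p, ∀ z ∉ K, A p' z = 0) :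
    SmoothFamily I (fun p => extendForm I e (A p)) := by
  intro x p z hz
  by_cases hx : (extChartAt I x).symm z ∈ e.source
  · refine FamilyAt.change (isChart_extChartAt I x) he hz hx fun k v => ?_
    refine (hA p _ (e.map_source hx) k v).congr_of_eventuallyEq ?_
    filter_upwards [continuousAt_snd.preimage_mem_nhds
      (he.open_target.mem_nhds (e.map_source hx))] with q hq
    rw [formIn_extendForm he _ _ hq]
  · obtain ⟨K, hKt, hKc, hK⟩ := hK p
    have hcl : IsClosed (e.symm '' K) :=
      (hKc.image_of_continuousOn (he.smooth_symm.continuousOn.mono hKt)).isClosed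
    have hnot : (extChartAt I x).symm z ∉ e.symm '' K := by
      rintro ⟨y, hy, hy'⟩
      exact hx (hy' ▸ e.map_target (hKt hy))
    have hzero : FamilyAt I (extChartAt I x) (fun _ : P => (0 : RawForm E M)) p z := fun k v => by
      have : (fun q : P × E => formIn I (extChartAt I x) (0 : RawForm E M) k q.2 v) =
        fun _ => 0 := by
        funext q; rw [formIn_apply]; rfl
      simp only [this]; exact contDiffAt_const
    refine hzero.congr ?_
    have h1 : ∀ᶠ q : P × E in 𝓝 (p, z), ∀ z ∉ K, A q.1 z = 0 :=
      (continuous_fst.tendsto (p, z)).eventually hK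
    have h2 : ∀ᶠ q : P × E in 𝓝 (p, z), (extChartAt I x).symm q.2 ∈ (e.symm '' K)ᶜ := by
      refine ContinuousAt.preimage_mem_nhds (f := fun q : P × E => (extChartAt I x).symm q.2) ?_
        (hcl.isOpen_compl.mem_nhds hnot)
      exact ContinuousAt.comp (g := (extChartAt I x).symm)
        ((isChart_extChartAt I x).contMDiffAt_symm hz).continuousAt continuousAt_snd
    filter_upwards [h1, h2] with q hq1 hq2
    by_cases hs : (extChartAt I x).symm q.2 ∈ e.source
    · refine extendForm_eq_zero I e (hq1 _ fun hmem => hq2 ⟨_, hmem, e.left_inv hs⟩)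
    · exact extendForm_of_notMem I e _ hs

end Families

section Integral

variable {E : Type*} [NormedAddCommGroup E] [NormedSpace ℝ E] [NormedSpace ℂ E]
  [IsScalarTower ℝ ℂ E] [FiniteDimensional ℂ E] [FiniteDimensional ℝ E]
  {H : Type*} [TopologicalSpace H] {I : ModelWithCorners ℝ E H}
  {M : Type*} [TopologicalSpace M] [ChartedSpace H M] [T2Space M] [CompactSpace M]
  [IsManifold I ∞ M]

variable (E) in
/-- The Lebesgue measure in the real coordinates with respect to the complex frame. -/
def frameMeasure [MeasurableSpace E] [BorelSpace E] : Measure E :=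
  Measure.map (complexFrame E).equivFunL.symm volume

instance [MeasurableSpace E] [BorelSpace E] : (frameMeasure E).IsAddHaarMeasure :=
  ContinuousLinearEquiv.isAddHaarMeasure_map _ _

theorem setIntegral_frameMeasure [MeasurableSpace E] [BorelSpace E] (g : E → ℝ) (s : Set E) :
    ∫ z in s, g z ∂frameMeasure E = ∫ t in (complexFrame E).equivFun.symm ⁻¹' s,
      g ((complexFrame E).equivFun.symm t) := by
  have hme : MeasurableEmbedding (complexFrame E).equivFunL.symm :=
    (complexFrame E).equivFunL.symm.toHomeomorph.measurableEmbedding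
  rw [frameMeasure, hme.setIntegral_map]
  rfl

variable (I M) in
theorem finite_chartPartition_support :
    {x : M | (Function.support (chartPartition I M x)).Nonempty}.Finite :=
  (chartPartition I M).locallyFinite.finite_nonempty_of_compact

variable (I M) in
/-- The finitely many points whose chart carries a piece of the partition of unity. -/
def chartPoints : Finset M := (finite_chartPartition_support I M).toFinset

theorem chartPartition_eq_zero {x : M} (hx : x ∉ chartPoints I M) (p : M) :
    chartPartition I M x p = 0 := by
  by_contra hne
  exact hx ((finite_chartPartition_support I M).mem_toFinset.2 ⟨p, hne⟩)

variable (I) in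
theorem sum_chartPartition (p : M) : ∑ x ∈ chartPoints I M, chartPartition I M x p = 1 := by
  rw [← (chartPartition I M).sum_eq_one (mem_univ p)]
  symm
  refine finsum_eq_sum_of_support_subset _ fun x hx => ?_
  by_contra hne
  exact hx (chartPartition_eq_zero hne p)

theorem tsupport_chartPartition (x : M) :
    tsupport (chartPartition I M x) ⊆ (extChartAt I x).source := by
  rw [extChartAt_source]
  exact Classical.choose_spec (SmoothPartitionOfUnity.exists_isSubordinate_chartAt_source I M) x

theorem chartPartition_contMDiff (x : M) : ContMDiff I 𝓘(ℝ) ∞ (chartPartition I M x) :=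
  (chartPartition I M x).contMDiff

theorem integrableOn_of_compact_support {V : Type*} [NormedAddCommGroup V]
    [MeasurableSpace V] [BorelSpace V] (μ : Measure V) [IsFiniteMeasureOnCompacts μ]
    {F : Type*} [NormedAddCommGroup F]
    {O K : Set V} {g : V → F} (hO : MeasurableSet O) (hK : IsCompact K) (hKO : K ⊆ O)
    (hg : ContinuousOn g O) (h0 : ∀ z ∈ O, z ∉ K → g z = 0) : IntegrableOn g O μ := by
  refine IntegrableOn.of_forall_sdiff_eq_zero
    (s := K) ((hg.mono hKO).integrableOn_compact hK) hO fun z hz => h0 z hz.1 hz.2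

/-- The compact subset of the chart domain outside of which the partition function vanishes. -/
theorem exists_compact_chartPartition (x : M) : ∃ K ⊆ (extChartAt I x).target, IsCompact K ∧
    ∀ p ∉ (extChartAt I x).symm '' K, chartPartition I M x p = 0 := by
  refine ⟨extChartAt I x '' tsupport (chartPartition I M x), ?_, ?_, ?_⟩
  · rintro _ ⟨p, hp, rfl⟩
    exact (extChartAt I x).map_source (tsupport_chartPartition x hp)
  · exact (isClosed_tsupport _).isCompact.image_of_continuousOn
      ((continuousOn_extChartAt x).mono (tsupport_chartPartition x))
  · intro p hp
    by_contra hne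
    have hpt : p ∈ tsupport (chartPartition I M x) := subset_tsupport _ hne
    exact hp ⟨_, ⟨p, hpt, rfl⟩, (extChartAt I x).left_inv (tsupport_chartPartition x hpt)⟩

theorem isSmoothForm_formIn_continuousOn [I.Boundaryless] {V : Type*} [NormedAddCommGroup V]
    [NormedSpace ℝ V] {α : RawForm E M} (hα : IsSmoothForm I α) {e : PartialEquiv M V}
    (he : IsChart I e) (k : ℕ) (v : Fin k → V) :
    ContDiffOn ℝ ∞ (fun z => formIn I e α k z v) e.target := by
  intro z hz
  have h1 : ContDiffAt ℝ ∞ (fun z : V => ((0 : ℝ), z)) z := contDiffAt_const.prodMk contDiffAt_id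
  exact (ContDiffAt.comp z (g := fun q : ℝ × V => formIn I e α k q.2 v)
    (f := fun z : V => ((0 : ℝ), z))
    ((SmoothFamily.const (P := ℝ) hα).familyAt he 0 hz k v) h1).contDiffWithinAt

variable [I.Boundaryless]

theorem integrableOn_chartPartition_mul [MeasurableSpace E] [BorelSpace E] (x : M)
    {α : RawForm E M} (hα : IsSmoothForm I α) :
    IntegrableOn (fun z => chartPartition I M x ((extChartAt I x).symm z) *
      coordForm I x α (finrank ℂ E * 2) z (complexFrame E)) (extChartAt I x).target
      (frameMeasure E) := by
  obtain ⟨K, hKt, hKc, hK⟩ := exists_compact_chartPartition (I := I) x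
  refine integrableOn_of_compact_support _ (isOpen_extChartAt_target x).measurableSet hKc hKt ?_ ?_
  · refine ContinuousOn.mul ?_ (hα x _ _).continuousOn
    exact (chartPartition I M x).contMDiff.continuous.comp_continuousOn
      (isChart_extChartAt I x).smooth_symm.continuousOn
  · intro z hz hzK
    rw [hK, zero_mul]
    rintro ⟨y, hy, hyz⟩
    exact hzK ((extChartAt I x).symm.injOn (hKt hy) hz hyz ▸ hy)

/-- The integral as a finite sum of integrals in charts. -/
theorem integral_eq_sum [MeasurableSpace E] [BorelSpace E] (α : Form I M) :
    integral I α = ∑ x ∈ chartPoints I M, ∫ z in (extChartAt I x).target,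
      chartPartition I M x ((extChartAt I x).symm z) *
        coordForm I x α.1 (finrank ℂ E * 2) z (complexFrame E) ∂frameMeasure E := by
  rw [integral]
  have : ∀ x : M, (∫ t in (complexFrame E).equivFun.symm ⁻¹' (extChartAt I x).target,
      chartPartition I M x ((extChartAt I x).symm ((complexFrame E).equivFun.symm t)) *
        coordForm I x α.1 (finrank ℂ E * 2) ((complexFrame E).equivFun.symm t) (complexFrame E)) =
      ∫ z in (extChartAt I x).target, chartPartition I M x ((extChartAt I x).symm z) *
        coordForm I x α.1 (finrank ℂ E * 2) z (complexFrame E) ∂frameMeasure E := fun x =>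
    (setIntegral_frameMeasure (fun z => chartPartition I M x ((extChartAt I x).symm z) *
        coordForm I x α.1 (finrank ℂ E * 2) z (complexFrame E)) _).symm
  simp only [this]
  refine finsum_eq_sum_of_support_subset _ fun x hx => ?_
  by_contra hne
  refine hx ?_
  simp only [chartPartition_eq_zero hne, zero_mul, integral_zero]

variable (I) in
theorem integral_add (α β : Form I M) : integral I (α + β) = integral I α + integral I β := by
  letI : MeasurableSpace E := borel E
  haveI : BorelSpace E := ⟨rfl⟩
  rw [integral_eq_sum, integral_eq_sum, integral_eq_sum, ← Finset.sum_add_distrib]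
  refine Finset.sum_congr rfl fun x _ => ?_
  rw [← MeasureTheory.integral_add (integrableOn_chartPartition_mul x α.2)
    (integrableOn_chartPartition_mul x β.2)]
  refine integral_congr_ae (Eventually.of_forall fun z => ?_)
  change _ * (coordForm I x α.1 _ z _ + coordForm I x β.1 _ z _) = _
  rw [mul_add]

variable (I) in
theorem integral_smul (t : ℝ) (α : Form I M) : integral I (t • α) = t * integral I α := by
  letI : MeasurableSpace E := borel E
  haveI : BorelSpace E := ⟨rfl⟩
  rw [integral_eq_sum, integral_eq_sum, Finset.mul_sum]
  refine Finset.sum_congr rfl fun x _ => ?_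
  rw [← MeasureTheory.integral_const_mul]
  refine integral_congr_ae (Eventually.of_forall fun z => ?_)
  change _ * (t * coordForm I x α.1 _ z _) = _
  ring

variable (I M) in
/-- The integral as a linear functional. -/
def integralLM : Form I M →ₗ[ℝ] ℝ where
  toFun := integral I
  map_add' := integral_add I
  map_smul' := integral_smul I

theorem integral_tendsto_zero {φ : ℕ → Form I M}
    (hφ : ∀ (x : M) (K : Set E), IsCompact K → K ⊆ (extChartAt I x).target →
      TendstoUniformlyOn (fun n y => coordForm I x (φ n).1 (finrank ℂ E * 2) y (complexFrame E))
        0 atTop K) : Tendsto (fun n => integral I (φ n)) atTop (𝓝 0) := by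
  letI : MeasurableSpace E := borel E
  haveI : BorelSpace E := ⟨rfl⟩
  simp only [integral_eq_sum]
  rw [← Finset.sum_const_zero (s := chartPoints I M)]
  refine tendsto_finsetSum _ fun x _ => ?_
  obtain ⟨K, hKt, hKc, hK⟩ := exists_compact_chartPartition (I := I) x
  have hfin : frameMeasure E K < ⊤ := hKc.measure_lt_top
  have hset : ∀ n, (∫ z in (extChartAt I x).target,
      chartPartition I M x ((extChartAt I x).symm z) *
        coordForm I x (φ n).1 (finrank ℂ E * 2) z (complexFrame E) ∂frameMeasure E) =
      ∫ z in K, chartPartition I M x ((extChartAt I x).symm z) *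
        coordForm I x (φ n).1 (finrank ℂ E * 2) z (complexFrame E) ∂frameMeasure E := by
    intro n
    refine setIntegral_eq_of_subset_of_forall_sdiff_eq_zero
      (isOpen_extChartAt_target x).measurableSet hKt fun z hz => ?_
    rw [hK, zero_mul]
    rintro ⟨y, hy, hyz⟩
    exact hz.2 ((extChartAt I x).symm.injOn (hKt hy) hz.1 hyz ▸ hy)
  simp only [hset]
  rw [Metric.tendsto_atTop]
  intro ε hε
  set m := (frameMeasure E).real K with hm
  have hm0 : 0 ≤ m := measureReal_nonneg
  have hδ : 0 < ε / (m + 1) := div_pos hε (by linarith)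
  obtain ⟨n₀, hn₀⟩ := eventually_atTop.1 ((Metric.tendstoUniformlyOn_iff.1 (hφ x K hKc hKt)) _ hδ)
  refine ⟨n₀, fun n hn => ?_⟩
  rw [dist_zero_right]
  calc ‖∫ z in K, chartPartition I M x ((extChartAt I x).symm z) *
        coordForm I x (φ n).1 (finrank ℂ E * 2) z (complexFrame E) ∂frameMeasure E‖
      ≤ ε / (m + 1) * m := by
        refine norm_setIntegral_le_of_norm_le_const hfin fun z hz => ?_
        have h1 := hn₀ n hn z hz
        rw [Pi.zero_apply, dist_zero_left] at h1
        rw [norm_mul]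
        have h2 : ‖chartPartition I M x ((extChartAt I x).symm z)‖ ≤ 1 := by
          rw [Real.norm_of_nonneg ((chartPartition I M).nonneg x _)]
          exact (chartPartition I M).le_one x _
        nlinarith [norm_nonneg (coordForm I x (φ n).1 (finrank ℂ E * 2) z (complexFrame E))]
    _ < ε := by
        rw [div_mul_eq_mul_div, div_lt_iff₀ (by linarith)]
        nlinarith

end Integral

section LocalFormula

variable {E : Type*} [NormedAddCommGroup E] [NormedSpace ℝ E]
  {H : Type*} [TopologicalSpace H] (I : ModelWithCorners ℝ E H)
  (M : Type*) [TopologicalSpace M] [ChartedSpace H M]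

/-- All coordinate changes between the preferred charts preserve the orientation. -/
class PositiveAtlas : Prop where
  det_pos : ∀ x x' : M, ∀ z ∈ (extChartAt I x).target, (extChartAt I x).symm z ∈
    (extChartAt I x').source →
      0 < (fderiv ℝ (fun y => extChartAt I x' ((extChartAt I x).symm y)) z).det

variable {M}

/-- The coordinate system `e` has orientation sign `σ` with respect to the preferred charts. -/
def HasSign (e : PartialEquiv M E) (σ : ℝ) : Prop :=
  (σ = 1 ∨ σ = -1) ∧ ∀ z ∈ e.target, ∀ x : M, e.symm z ∈ (extChartAt I x).source →
    0 < σ * (fderiv ℝ (fun y => extChartAt I x (e.symm y)) z).det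

theorem hasSign_extChartAt [PositiveAtlas I M] (x : M) : HasSign I (extChartAt I x) 1 :=
  ⟨Or.inl rfl, fun z hz x' hx' => by
    rw [one_mul]; exact PositiveAtlas.det_pos x x' z hz hx'⟩

variable {I}
variable [NormedSpace ℂ E]
  [IsScalarTower ℝ ℂ E] [FiniteDimensional ℂ E] [FiniteDimensional ℝ E]
  [T2Space M] [CompactSpace M] [IsManifold I ∞ M] [I.Boundaryless]

theorem contDiffAt_chart_change {V V' : Type*} [NormedAddCommGroup V] [NormedSpace ℝ V]
    [NormedAddCommGroup V'] [NormedSpace ℝ V'] {e : PartialEquiv M V} {e' : PartialEquiv M V'}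
    (he : IsChart I e) (he' : IsChart I e') {z : V} (hz : z ∈ e.target)
    (hz' : e.symm z ∈ e'.source) : ContDiffAt ℝ ∞ (fun y => e' (e.symm y)) z := by
  rw [← contMDiffAt_iff_contDiffAt]
  exact (he'.contMDiffAt hz').comp z (he.contMDiffAt_symm hz)

theorem HasSign.abs_det {e : PartialEquiv M E} {σ : ℝ} (h : HasSign I e σ) {z : E}
    (hz : z ∈ e.target) {x : M} (hx : e.symm z ∈ (extChartAt I x).source) :
    |(fderiv ℝ (fun y => extChartAt I x (e.symm y)) z).det| =
      σ * (fderiv ℝ (fun y => extChartAt I x (e.symm y)) z).det := by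
  have := h.2 z hz x hx
  rcases h.1 with rfl | rfl
  · rw [one_mul] at this ⊢; exact abs_of_pos this
  · rw [neg_one_mul] at this ⊢; exact abs_of_neg (by linarith)

theorem setIntegral_chart_change [MeasurableSpace E] [BorelSpace E]
    {e : PartialEquiv M E} (he : IsChart I e) {σ : ℝ}
    (hσ : HasSign I e σ) {α : RawForm E M} {K : Set E} (hKt : K ⊆ e.target)
    (hα : ∀ p ∉ e.symm '' K, α p (finrank ℂ E * 2) = 0) (x : M) :
    ∫ z in (extChartAt I x).target, chartPartition I M x ((extChartAt I x).symm z) *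
        coordForm I x α (finrank ℂ E * 2) z (complexFrame E) ∂frameMeasure E =
      σ * ∫ z in e.target, chartPartition I M x (e.symm z) *
        formIn I e α (finrank ℂ E * 2) z (complexFrame E) ∂frameMeasure E := by
  set c := extChartAt I x with hc
  have hcc : IsChart I c := isChart_extChartAt I x
  set S : Set E := e.target ∩ e.symm ⁻¹' c.source with hS
  set τ : E → E := fun y => c (e.symm y) with hτ
  have hSo : IsOpen S := he.smooth_symm.continuousOn.isOpen_inter_preimage he.open_target
    hcc.open_source
  have hinj : InjOn τ S := by
    intro y hy y' hy' hyy
    exact e.symm.injOn hy.1 hy'.1 (c.injOn hy.2 hy'.2 hyy)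
  have himg : τ '' S = c.target ∩ c.symm ⁻¹' e.source := by
    ext y
    constructor
    · rintro ⟨z, hz, rfl⟩
      refine ⟨c.map_source hz.2, ?_⟩
      change c.symm (c (e.symm z)) ∈ e.source
      rw [c.left_inv hz.2]
      exact e.map_target hz.1
    · rintro ⟨hy, hy'⟩
      refine ⟨e (c.symm y), ⟨e.map_source hy', ?_⟩, ?_⟩
      · change e.symm (e (c.symm y)) ∈ c.source
        rw [e.left_inv hy']; exact c.map_target hy
      · change c (e.symm (e (c.symm y))) = y
        rw [e.left_inv hy', c.right_inv hy]
  have hL : ∫ z in c.target, chartPartition I M x (c.symm z) *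
        coordForm I x α (finrank ℂ E * 2) z (complexFrame E) ∂frameMeasure E =
      ∫ z in τ '' S, chartPartition I M x (c.symm z) *
        coordForm I x α (finrank ℂ E * 2) z (complexFrame E) ∂frameMeasure E := by
    rw [himg]
    refine setIntegral_eq_of_subset_of_forall_sdiff_eq_zero hcc.open_target.measurableSet
      inter_subset_left fun z hz => ?_
    have : α (c.symm z) (finrank ℂ E * 2) = 0 := by
      refine hα _ ?_
      rintro ⟨y, hy, hyz⟩
      exact hz.2 ⟨hz.1, show c.symm z ∈ e.source from hyz ▸ e.map_target (hKt hy)⟩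
    rw [coordForm_eq_formIn, formIn_eq_zero I _ this]
    exact mul_zero _
  have hR : ∫ z in e.target, chartPartition I M x (e.symm z) *
        formIn I e α (finrank ℂ E * 2) z (complexFrame E) ∂frameMeasure E =
      ∫ z in S, chartPartition I M x (e.symm z) *
        formIn I e α (finrank ℂ E * 2) z (complexFrame E) ∂frameMeasure E := by
    refine setIntegral_eq_of_subset_of_forall_sdiff_eq_zero he.open_target.measurableSet
      inter_subset_left fun z hz => ?_
    have : chartPartition I M x (e.symm z) = 0 := by
      by_contra hne
      exact hz.2 ⟨hz.1, tsupport_chartPartition x (subset_tsupport _ hne)⟩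
    rw [this, zero_mul]
  rw [hL, hR, integral_image_eq_integral_abs_det_fderiv_smul (frameMeasure E) hSo.measurableSet
    (f' := fun z => fderiv ℝ τ z) (fun z hz =>
      ((contDiffAt_chart_change he hcc hz.1 hz.2).differentiableAt
        (by simp)).hasFDerivAt.hasFDerivWithinAt) hinj, ← MeasureTheory.integral_const_mul]
  refine setIntegral_congr_fun hSo.measurableSet fun z hz => ?_
  have h1 : |(fderiv ℝ τ z).det| = σ * (fderiv ℝ τ z).det := hσ.abs_det hz.1 hz.2
  have h2 : formIn I e α (finrank ℂ E * 2) z (complexFrame E) =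
      (fderiv ℝ τ z).det * formIn I c α (finrank ℂ E * 2) (τ z) (complexFrame E) := by
    rw [formIn_change he hcc hz.1 hz.2, continuousAlternating_comp_basis]
  change |(fderiv ℝ τ z).det| • (chartPartition I M x (c.symm (τ z)) *
    formIn I c α (finrank ℂ E * 2) (τ z) (complexFrame E)) = σ * (chartPartition I M x (e.symm z) *
      formIn I e α (finrank ℂ E * 2) z (complexFrame E))
  have h3 : c.symm (τ z) = e.symm z := c.left_inv hz.2
  rw [h1, h2, h3, smul_eq_mul]
  ring

/-- The integral of a form supported in the domain of a coordinate system. -/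
theorem integral_eq_of_chart [MeasurableSpace E] [BorelSpace E]
    {e : PartialEquiv M E} (he : IsChart I e) {σ : ℝ}
    (hσ : HasSign I e σ) (α : Form I M) {K : Set E} (hKc : IsCompact K) (hKt : K ⊆ e.target)
    (hα : ∀ p ∉ e.symm '' K, α.1 p (finrank ℂ E * 2) = 0) :
    integral I α = σ * ∫ z in e.target,
      formIn I e α.1 (finrank ℂ E * 2) z (complexFrame E) ∂frameMeasure E := by
  rw [integral_eq_sum]
  simp only [setIntegral_chart_change he hσ hKt hα]
  rw [← Finset.mul_sum, ← integral_finsetSum]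
  · congr 1
    refine integral_congr_ae (Eventually.of_forall fun z => ?_)
    change ∑ x ∈ chartPoints I M, _ * _ = _
    rw [← Finset.sum_mul, sum_chartPartition, one_mul]
  · intro x _
    refine integrableOn_of_compact_support _ he.open_target.measurableSet hKc hKt ?_ ?_
    · exact ((chartPartition_contMDiff (I := I) x).continuous.comp_continuousOn
        he.smooth_symm.continuousOn).mul
        (isSmoothForm_formIn_continuousOn α.2 he _ _).continuousOn
    · intro z hz hzK
      rw [formIn_eq_zero I]
      · exact mul_zero _
      · refine hα _ ?_
        rintro ⟨y, hy, hyz⟩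
        exact hzK (e.symm.injOn (hKt hy) hz hyz ▸ hy)

end LocalFormula

section FormOperations

variable {E : Type*} [NormedAddCommGroup E] [NormedSpace ℝ E]
  {H : Type*} [TopologicalSpace H] {I : ModelWithCorners ℝ E H}
  {M : Type*} [TopologicalSpace M] [ChartedSpace H M]
  {V : Type*} [NormedAddCommGroup V] [NormedSpace ℝ V]

theorem wedgeAlt_zero_left {i j n : ℕ} (h : i + j = n) (b : V [⋀^Fin j]→L[ℝ] ℝ) :
    wedgeAlt h (0 : V [⋀^Fin i]→L[ℝ] ℝ) b = 0 := by
  have := wedgeAlt_smul_left h (0 : ℝ) (0 : V [⋀^Fin i]→L[ℝ] ℝ) b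
  rwa [zero_smul, zero_smul] at this

theorem wedgeAlt_zero_right {i j n : ℕ} (h : i + j = n) (a : V [⋀^Fin i]→L[ℝ] ℝ) :
    wedgeAlt h a (0 : V [⋀^Fin j]→L[ℝ] ℝ) = 0 := by
  have := wedgeAlt_smul_right h (0 : ℝ) a (0 : V [⋀^Fin j]→L[ℝ] ℝ)
  rwa [zero_smul, zero_smul] at this

theorem rawWedge_add_left (α α' β : RawForm E M) :
    rawWedge (α + α') β = rawWedge α β + rawWedge α' β := by
  funext p k
  simp only [rawWedge, Pi.add_apply, wedgeAlt_add_left, Finset.sum_add_distrib]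

theorem rawWedge_add_right (α β β' : RawForm E M) :
    rawWedge α (β + β') = rawWedge α β + rawWedge α β' := by
  funext p k
  simp only [rawWedge, Pi.add_apply, wedgeAlt_add_right, Finset.sum_add_distrib]

theorem rawWedge_smul_left (t : ℝ) (α β : RawForm E M) :
    rawWedge (t • α) β = t • rawWedge α β := by
  funext p k
  simp only [rawWedge, Pi.smul_apply, wedgeAlt_smul_left, Finset.smul_sum]

theorem rawWedge_smul_right (t : ℝ) (α β : RawForm E M) :
    rawWedge α (t • β) = t • rawWedge α β := by
  funext p k
  simp only [rawWedge, Pi.smul_apply, wedgeAlt_smul_right, Finset.smul_sum]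

theorem rawWedge_eq_zero_right (α : RawForm E M) {β : RawForm E M} {p : M} (h : β p = 0) (k : ℕ) :
    rawWedge α β p k = 0 := by
  rw [rawWedge, h]
  exact Finset.sum_eq_zero fun i _ => wedgeAlt_zero_right _ _

theorem rawWedge_eq_zero_left {α : RawForm E M} (β : RawForm E M) {p : M} (h : α p = 0) (k : ℕ) :
    rawWedge α β p k = 0 := by
  rw [rawWedge, h]
  exact Finset.sum_eq_zero fun i _ => wedgeAlt_zero_left _ _

variable {E' : Type*} [NormedAddCommGroup E'] [NormedSpace ℝ E']
  {H' : Type*} [TopologicalSpace H'] {I' : ModelWithCorners ℝ E' H'}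
  {M' : Type*} [TopologicalSpace M'] [ChartedSpace H' M']

theorem rawPullback_rawWedge (s : M → M') (α β : RawForm E' M') :
    rawPullback I I' s (rawWedge α β) = rawWedge (rawPullback I I' s α) (rawPullback I I' s β) := by
  funext p k
  ext v
  simp only [rawWedge, rawPullback, ContinuousAlternatingMap.compContinuousLinearMap_apply,
    ContinuousAlternatingMap.sum_apply, wedgeAlt_apply]
  rfl

variable (I) in
/-- The exterior product of smooth forms as a bilinear map. -/
def wedgeLM : Form I M →ₗ[ℝ] Form I M →ₗ[ℝ] Form I M :=
  LinearMap.mk₂ ℝ (wedge I)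
    (fun _ _ _ => Subtype.ext (rawWedge_add_left _ _ _))
    (fun _ _ _ => Subtype.ext (rawWedge_smul_left _ _ _))
    (fun _ _ _ => Subtype.ext (rawWedge_add_right _ _ _))
    (fun _ _ _ => Subtype.ext (rawWedge_smul_right _ _ _))

variable [I.Boundaryless] [IsManifold I ∞ M] [I'.Boundaryless] [IsManifold I' ∞ M']
  [FiniteDimensional ℝ E']

/-- The pull-back of forms as a linear map. -/
def pullbackLM (s : C^∞⟮I, M; I', M'⟯) : Form I' M' →ₗ[ℝ] Form I M where
  toFun := pullback I I' s
  map_add' _ _ := rfl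
  map_smul' _ _ := rfl

theorem pullback_wedge (s : C^∞⟮I, M; I', M'⟯) (α β : Form I' M') :
    pullback I I' s (wedge I' α β) = wedge I (pullback I I' s α) (pullback I I' s β) :=
  Subtype.ext (rawPullback_rawWedge s α.1 β.1)

theorem rawPullback_comp {E'' : Type*} [NormedAddCommGroup E''] [NormedSpace ℝ E'']
    {H'' : Type*} [TopologicalSpace H''] {I'' : ModelWithCorners ℝ E'' H''}
    {M'' : Type*} [TopologicalSpace M''] [ChartedSpace H'' M'']
    {s : M → M'} {t : M' → M''} (hs : ContMDiff I I' ∞ s) (ht : ContMDiff I' I'' ∞ t)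
    (α : RawForm E'' M'') :
    rawPullback I I' s (rawPullback I' I'' t α) = rawPullback I I'' (fun p => t (s p)) α := by
  funext p k
  have h1 : mfderiv I I'' (fun p => t (s p)) p = (mfderiv I' I'' t (s p)).comp (mfderiv I I' s p) :=
    mfderiv_comp p (ht.mdifferentiableAt (by simp)) (hs.mdifferentiableAt (by simp))
  have h2 : diffAt I I'' (fun p => t (s p)) p = (diffAt I' I'' t (s p)).comp (diffAt I I' s p) := h1
  ext v
  change α (t (s p)) k (fun i => ((diffAt I' I'' t (s p)).comp (diffAt I I' s p)) (v i)) = _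
  rw [← h2]
  rfl

/-- Multiplication of a form by a smooth function. -/
def mulForm (χ : C^∞⟮I, M; 𝓘(ℝ), ℝ⟯) (α : Form I M) : Form I M :=
  ⟨fun p => χ p • α.1 p, IsSmoothForm.mul α.2 χ.contMDiff⟩

@[simp] theorem mulForm_apply (χ : C^∞⟮I, M; 𝓘(ℝ), ℝ⟯) (α : Form I M) (p : M) :
    (mulForm χ α).1 p = χ p • α.1 p := rfl

theorem wedge_mulForm (χ : C^∞⟮I, M; 𝓘(ℝ), ℝ⟯) (α β : Form I M) :
    wedge I (mulForm χ α) β = wedge I α (mulForm χ β) := by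
  refine Subtype.ext ?_
  funext p k
  change ∑ i : Fin (k + 1), wedgeAlt _ (χ p • α.1 p i) (β.1 p (k - i)) =
    ∑ i : Fin (k + 1), wedgeAlt _ (α.1 p i) (χ p • β.1 p (k - i))
  simp only [wedgeAlt_smul_left, wedgeAlt_smul_right]

theorem form_sub_eq (α β : Form I M) : α - β = α + (-1 : ℝ) • β := by
  refine Subtype.ext (funext fun p => funext fun k => ?_)
  ext v
  change α.1 p k v - β.1 p k v = α.1 p k v + (-1 : ℝ) * β.1 p k v
  ring

theorem sum_form_apply {ι : Type*} (s : Finset ι) (α : ι → Form I M) (p : M) :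
    (∑ i ∈ s, α i).1 p = ∑ i ∈ s, (α i).1 p := by
  have : (∑ i ∈ s, α i).1 = ∑ i ∈ s, (α i).1 := by
    exact map_sum (Form I M).subtype α s
  rw [this, Finset.sum_apply]

theorem sum_mulForm {ι : Type*} {s : Finset ι} {ρ : ι → C^∞⟮I, M; 𝓘(ℝ), ℝ⟯}
    (hρ : ∀ p, ∑ x ∈ s, ρ x p = 1) (α : Form I M) : ∑ x ∈ s, mulForm (ρ x) α = α := by
  refine Subtype.ext (funext fun p => ?_)
  rw [sum_form_apply]
  change ∑ x ∈ s, ρ x p • α.1 p = α.1 p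
  rw [← Finset.sum_smul, hρ, one_smul]

/-- A finite smooth partition of unity subordinate to a family of neighbourhoods. -/
theorem exists_finite_partition [FiniteDimensional ℝ E] [T2Space M] [CompactSpace M] (N : M → Set M)
    (hN : ∀ p, IsOpen (N p)) (hp : ∀ p, p ∈ N p) :
    ∃ (s : Finset M) (ρ : M → C^∞⟮I, M; 𝓘(ℝ), ℝ⟯), (∀ x, tsupport (ρ x) ⊆ N x) ∧
      ∀ p, ∑ x ∈ s, ρ x p = 1 := by
  obtain ⟨f, hf⟩ := SmoothPartitionOfUnity.exists_isSubordinate I (isClosed_univ (X := M)) N hN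
    (fun p _ => mem_iUnion.2 ⟨p, hp p⟩)
  have hfin : {x : M | (Function.support (f x)).Nonempty}.Finite :=
    f.locallyFinite.finite_nonempty_of_compact
  refine ⟨hfin.toFinset, fun x => f x, hf, fun p => ?_⟩
  refine Eq.trans ?_ (f.sum_eq_one (mem_univ p))
  symm
  refine finsum_eq_sum_of_support_subset _ fun x hx => ?_
  exact hfin.mem_toFinset.2 ⟨p, hx⟩

theorem contDiff_indicator_of_isClosed {V F : Type*} [NormedAddCommGroup V]
    [NormedSpace ℝ V] [NormedAddCommGroup F] [NormedSpace ℝ F]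
    {O C : Set V} {g : V → F} (hO : IsOpen O) (hC : IsClosed C) (hCO : C ⊆ O)
    (hg : ContDiffOn ℝ ∞ g O) (h0 : ∀ z ∈ O, z ∉ C → g z = 0) :
    ContDiff ℝ ∞ (indicator O g) := by
  rw [contDiff_iff_contDiffAt]
  intro z
  by_cases hz : z ∈ O
  · refine (hg.contDiffAt (hO.mem_nhds hz)).congr_of_eventuallyEq ?_
    filter_upwards [hO.mem_nhds hz] with y hy using indicator_of_mem hy g
  · refine contDiffAt_const (c := (0 : F)) |>.congr_of_eventuallyEq ?_
    filter_upwards [hC.isOpen_compl.mem_nhds fun h => hz (hCO h)] with y hy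
    by_cases hyO : y ∈ O
    · rw [indicator_of_mem hyO, h0 y hyO hy]
    · exact indicator_of_notMem hyO g

end FormOperations

section DualForms

variable {E : Type*} [NormedAddCommGroup E] [NormedSpace ℝ E] [NormedSpace ℂ E]
  [IsScalarTower ℝ ℂ E] [FiniteDimensional ℂ E] [FiniteDimensional ℝ E]

variable (E) in
/-- The real dimension. -/
abbrev realDim : ℕ := finrank ℂ E * 2

variable (E) in
/-- Indices of the coefficients of a form: a degree and a sequence of frame vectors. -/
abbrev CoeffIndex : Type := Σ i : Fin (realDim E + 1), (Fin i → Fin (realDim E))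

/-- The vectors of the frame selected by an index. -/
def CoeffIndex.vec (q : CoeffIndex E) : Fin q.1 → E := fun l => complexFrame E (q.2 l)

/-- Evaluation of a form as a linear functional. -/
def evalLM {k : ℕ} (w : Fin k → E) : (E [⋀^Fin k]→L[ℝ] ℝ) →ₗ[ℝ] ℝ where
  toFun a := a w
  map_add' _ _ := rfl
  map_smul' _ _ := rfl

/-- A form whose exterior product from the right with a form `a` is a given value of `a`. -/
def dualRight {i j : ℕ} (h : i + j = realDim E) (w : Fin i → E) : E [⋀^Fin j]→L[ℝ] ℝ :=
  Classical.choose (exists_wedge_right_eq h (complexFrame E) (evalLM w))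

theorem wedgeAlt_dualRight {i j : ℕ} (h : i + j = realDim E) (w : Fin i → E)
    (a : E [⋀^Fin i]→L[ℝ] ℝ) : wedgeAlt h a (dualRight h w) (complexFrame E) = a w :=
  Classical.choose_spec (exists_wedge_right_eq h (complexFrame E) (evalLM w)) a

/-- A form whose exterior product from the left with a form `a` is a given value of `a`. -/
def dualLeft {i j : ℕ} (h : i + j = realDim E) (w : Fin i → E) : E [⋀^Fin j]→L[ℝ] ℝ :=
  Classical.choose (exists_wedge_left_eq ((add_comm j i).trans h) (complexFrame E) (evalLM w))

theorem wedgeAlt_dualLeft {i j : ℕ} (h : i + j = realDim E) (h' : j + i = realDim E) (w : Fin i → E)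
    (a : E [⋀^Fin i]→L[ℝ] ℝ) : wedgeAlt h' (dualLeft h w) a (complexFrame E) = a w :=
  Classical.choose_spec
    (exists_wedge_left_eq ((add_comm j i).trans h) (complexFrame E) (evalLM w)) a

/-- The form on the model space whose product from the right with a form is a given combination of
the coefficients of that form. -/
def dualRawRight (G : CoeffIndex E → E → ℝ) : RawForm E E := fun z j =>
  ∑ q : CoeffIndex E, if h : (q.1 : ℕ) + j = realDim E then G q z • dualRight h q.vec else 0

/-- The form on the model space whose product from the left with a form is a given combination of
the coefficients of that form. -/
def dualRawLeft (G : CoeffIndex E → E → ℝ) : RawForm E E := fun z j =>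
  ∑ q : CoeffIndex E, if h : (q.1 : ℕ) + j = realDim E then G q z • dualLeft h q.vec else 0

theorem wedge_dualRawRight (G : CoeffIndex E → E → ℝ) (a : ∀ k : ℕ, E [⋀^Fin k]→L[ℝ] ℝ) (z : E) :
    (∑ i : Fin (realDim E + 1), wedgeAlt (Nat.add_sub_of_le (Nat.lt_succ_iff.1 i.2)) (a i)
      (dualRawRight G z (realDim E - i))) (complexFrame E) =
      ∑ q : CoeffIndex E, G q z * a q.1 q.vec := by
  have h1 : ∀ i : Fin (realDim E + 1),
      wedgeAlt (Nat.add_sub_of_le (Nat.lt_succ_iff.1 i.2)) (a i)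
        (dualRawRight G z (realDim E - i)) (complexFrame E) =
      ∑ q : CoeffIndex E, if q.1 = i then G q z * a q.1 q.vec else 0 := by
    intro i
    rw [← wedgePairing_apply, dualRawRight, map_sum]
    refine Finset.sum_congr rfl fun q _ => ?_
    by_cases hq : q.1 = i
    · subst hq
      rw [dif_pos (Nat.add_sub_of_le (Nat.lt_succ_iff.1 q.1.2)), if_pos rfl, map_smul,
        wedgePairing_apply, wedgeAlt_dualRight, smul_eq_mul]
    · rw [dif_neg, if_neg hq, map_zero]
      intro h
      apply hq
      have := q.1.2
      have := i.2
      exact Fin.ext (by omega)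
  rw [ContinuousAlternatingMap.sum_apply]
  simp only [h1]
  rw [Finset.sum_comm]
  refine Finset.sum_congr rfl fun q _ => ?_
  simp

theorem wedge_dualRawLeft (G : CoeffIndex E → E → ℝ) (a : ∀ k : ℕ, E [⋀^Fin k]→L[ℝ] ℝ) (z : E) :
    (∑ i : Fin (realDim E + 1), wedgeAlt (Nat.add_sub_of_le (Nat.lt_succ_iff.1 i.2))
      (dualRawLeft G z i) (a (realDim E - i))) (complexFrame E) =
      ∑ q : CoeffIndex E, G q z * a q.1 q.vec := by
  have h1 : ∀ i : Fin (realDim E + 1),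
      wedgeAlt (Nat.add_sub_of_le (Nat.lt_succ_iff.1 i.2)) (dualRawLeft G z i)
        (a (realDim E - i)) (complexFrame E) =
      ∑ q : CoeffIndex E, if q.1 = i.rev then G q z * a q.1 q.vec else 0 := by
    intro i
    rw [← wedgePairing_apply, dualRawLeft, map_sum, LinearMap.sum_apply]
    refine Finset.sum_congr rfl fun q _ => ?_
    by_cases hq : q.1 = i.rev
    · have hi : (i : ℕ) = realDim E - q.1 := by
        rw [hq, Fin.val_rev]; have := i.2; omega
      obtain ⟨⟨m, hm⟩, r⟩ := q
      obtain ⟨i, hi'⟩ := i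
      simp only at hi
      have hmi : realDim E - i = m := by omega
      subst hmi
      rw [dif_pos (by simp only; omega), if_pos hq, map_smul, LinearMap.smul_apply,
        wedgePairing_apply, wedgeAlt_dualLeft, smul_eq_mul]
    · rw [dif_neg, if_neg hq, map_zero, LinearMap.zero_apply]
      intro h
      apply hq
      have := q.1.2
      have := i.2
      exact Fin.ext (by rw [Fin.val_rev]; omega)
  rw [ContinuousAlternatingMap.sum_apply]
  simp only [h1]
  rw [Finset.sum_comm]
  refine Finset.sum_congr rfl fun q _ => ?_
  rw [Finset.sum_eq_single q.1.rev]
  · simp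
  · intro i _ hi
    rw [if_neg]
    intro h; exact hi (by rw [h, Fin.rev_rev])
  · intro h; exact absurd (Finset.mem_univ _) h

theorem dualRawRight_contDiffAt {P : Type*} [NormedAddCommGroup P] [NormedSpace ℝ P]
    {G : P → CoeffIndex E → E → ℝ} {p : P × E}
    (hG : ∀ q, ContDiffAt ℝ ∞ (fun w : P × E => G w.1 q w.2) p) (k : ℕ) (v : Fin k → E) :
    ContDiffAt ℝ ∞ (fun w : P × E => dualRawRight (G w.1) w.2 k v) p := by
  simp only [dualRawRight, ContinuousAlternatingMap.sum_apply]
  refine ContDiffAt.sum fun q _ => ?_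
  by_cases h : (q.1 : ℕ) + k = realDim E
  · simp only [dif_pos h]
    exact (hG q).mul contDiffAt_const
  · simp only [dif_neg h]
    exact contDiffAt_const

theorem dualRawLeft_contDiffAt {P : Type*} [NormedAddCommGroup P] [NormedSpace ℝ P]
    {G : P → CoeffIndex E → E → ℝ} {p : P × E}
    (hG : ∀ q, ContDiffAt ℝ ∞ (fun w : P × E => G w.1 q w.2) p) (k : ℕ) (v : Fin k → E) :
    ContDiffAt ℝ ∞ (fun w : P × E => dualRawLeft (G w.1) w.2 k v) p := by
  simp only [dualRawLeft, ContinuousAlternatingMap.sum_apply]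
  refine ContDiffAt.sum fun q _ => ?_
  by_cases h : (q.1 : ℕ) + k = realDim E
  · simp only [dif_pos h]
    exact (hG q).mul contDiffAt_const
  · simp only [dif_neg h]
    exact contDiffAt_const

theorem dualRawRight_eq_zero {G : CoeffIndex E → E → ℝ} {z : E} (h : ∀ q, G q z = 0) :
    dualRawRight G z = 0 := by
  funext j
  refine Finset.sum_eq_zero fun q _ => ?_
  split_ifs
  · rw [h, zero_smul]
  · rfl

theorem dualRawLeft_eq_zero {G : CoeffIndex E → E → ℝ} {z : E} (h : ∀ q, G q z = 0) :
    dualRawLeft G z = 0 := by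
  funext j
  refine Finset.sum_eq_zero fun q _ => ?_
  split_ifs
  · rw [h, zero_smul]
  · rfl

variable {H : Type*} [TopologicalSpace H] {I : ModelWithCorners ℝ E H} [I.Boundaryless]
  {M : Type*} [TopologicalSpace M] [ChartedSpace H M] [T2Space M] [CompactSpace M]
  [IsManifold I ∞ M]

theorem isSmoothForm_extendForm {e : PartialEquiv M E} (he : IsChart I e) {A : RawForm E E}
    {K : Set E} (hKc : IsCompact K) (hKt : K ⊆ e.target)
    (hA : ∀ z ∈ e.target, ∀ k v, ContDiffAt ℝ ∞ (fun z => A z k v) z)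
    (hA0 : ∀ z ∉ K, A z = 0) : IsSmoothForm I (extendForm I e A) := by
  refine (SmoothFamily.extendForm (P := ℝ) he (A := fun _ => A) (fun p z hz k v => ?_)
    (fun p => ⟨K, hKt, hKc, Eventually.of_forall fun _ => hA0⟩)).isSmoothForm 0
  exact (hA z hz k v).comp (p, z) contDiffAt_snd

theorem isSmoothForm_dualRight {e : PartialEquiv M E} (he : IsChart I e)
    {G : CoeffIndex E → E → ℝ} {K : Set E} (hKc : IsCompact K) (hKt : K ⊆ e.target)
    (hG : ∀ q, ContDiff ℝ ∞ (G q)) (hG0 : ∀ q, ∀ z ∉ K, G q z = 0) :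
    IsSmoothForm I (extendForm I e (dualRawRight G)) := by
  refine isSmoothForm_extendForm he hKc hKt (fun z _ k v => ?_)
    fun z hz => dualRawRight_eq_zero fun q => hG0 q z hz
  have := dualRawRight_contDiffAt (P := ℝ) (G := fun _ => G) (p := (0, z))
    (fun q => (hG q).contDiffAt.comp _ contDiffAt_snd) k v
  exact this.comp z (contDiffAt_const.prodMk contDiffAt_id)

theorem isSmoothForm_dualLeft {e : PartialEquiv M E} (he : IsChart I e)
    {G : CoeffIndex E → E → ℝ} {K : Set E} (hKc : IsCompact K) (hKt : K ⊆ e.target)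
    (hG : ∀ q, ContDiff ℝ ∞ (G q)) (hG0 : ∀ q, ∀ z ∉ K, G q z = 0) :
    IsSmoothForm I (extendForm I e (dualRawLeft G)) := by
  refine isSmoothForm_extendForm he hKc hKt (fun z _ k v => ?_)
    fun z hz => dualRawLeft_eq_zero fun q => hG0 q z hz
  have := dualRawLeft_contDiffAt (P := ℝ) (G := fun _ => G) (p := (0, z))
    (fun q => (hG q).contDiffAt.comp _ contDiffAt_snd) k v
  exact this.comp z (contDiffAt_const.prodMk contDiffAt_id)

theorem extendForm_eq_zero_of_notMem_image {e : PartialEquiv M E} {A : RawForm E E} {K : Set E}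
    (hA0 : ∀ z ∉ K, A z = 0) {p : M} (hp : p ∉ e.symm '' K) : extendForm I e A p = 0 := by
  by_cases hs : p ∈ e.source
  · exact extendForm_eq_zero I e (hA0 _ fun hmem => hp ⟨_, hmem, e.left_inv hs⟩)
  · exact extendForm_of_notMem I e _ hs

theorem integrableOn_coeff [MeasurableSpace E] [BorelSpace E] {e : PartialEquiv M E}
    (he : IsChart I e) {α : RawForm E M} (hα : IsSmoothForm I α) {g : E → ℝ} (hg : ContDiff ℝ ∞ g)
    {K : Set E} (hKc : IsCompact K) (hKt : K ⊆ e.target) (hg0 : ∀ z ∉ K, g z = 0)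
    {k : ℕ} (w : Fin k → E) :
    IntegrableOn (fun z => g z * formIn I e α k z w) e.target (frameMeasure E) := by
  refine integrableOn_of_compact_support _ he.open_target.measurableSet hKc hKt ?_ ?_
  · exact hg.continuous.continuousOn.mul (isSmoothForm_formIn_continuousOn hα he _ _).continuousOn
  · intro z _ hz; rw [hg0 z hz, zero_mul]

theorem integral_wedge_dualRight [MeasurableSpace E] [BorelSpace E]
    {e : PartialEquiv M E} (he : IsChart I e) {σ : ℝ}
    (hσ : HasSign I e σ) {G : CoeffIndex E → E → ℝ} {K : Set E} (hKc : IsCompact K)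
    (hKt : K ⊆ e.target) (hG : ∀ q, ContDiff ℝ ∞ (G q)) (hG0 : ∀ q, ∀ z ∉ K, G q z = 0)
    (α : Form I M) :
    integral I (wedge I α ⟨_, isSmoothForm_dualRight he hKc hKt hG hG0⟩) =
      σ * ∑ q : CoeffIndex E, ∫ z in e.target, G q z * formIn I e α.1 q.1 z q.vec
        ∂frameMeasure E := by
  rw [integral_eq_of_chart he hσ _ hKc hKt, ← integral_finsetSum]
  · congr 1
    refine setIntegral_congr_fun he.open_target.measurableSet fun z hz => ?_
    rw [wedge]
    simp only [formIn_rawWedge, formIn_extendForm he _ _ hz]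
    exact wedge_dualRawRight G (fun k => formIn I e α.1 k z) z
  · exact fun q _ => integrableOn_coeff he α.2 (hG q) hKc hKt (hG0 q) _
  · intro p hp
    exact rawWedge_eq_zero_right _ (extendForm_eq_zero_of_notMem_image
      (fun z hz => dualRawRight_eq_zero fun q => hG0 q z hz) hp) _

theorem integral_wedge_dualLeft [MeasurableSpace E] [BorelSpace E]
    {e : PartialEquiv M E} (he : IsChart I e) {σ : ℝ}
    (hσ : HasSign I e σ) {G : CoeffIndex E → E → ℝ} {K : Set E} (hKc : IsCompact K)
    (hKt : K ⊆ e.target) (hG : ∀ q, ContDiff ℝ ∞ (G q)) (hG0 : ∀ q, ∀ z ∉ K, G q z = 0)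
    (α : Form I M) :
    integral I (wedge I ⟨_, isSmoothForm_dualLeft he hKc hKt hG hG0⟩ α) =
      σ * ∑ q : CoeffIndex E, ∫ z in e.target, G q z * formIn I e α.1 q.1 z q.vec
        ∂frameMeasure E := by
  rw [integral_eq_of_chart he hσ _ hKc hKt, ← integral_finsetSum]
  · congr 1
    refine setIntegral_congr_fun he.open_target.measurableSet fun z hz => ?_
    rw [wedge]
    simp only [formIn_rawWedge, formIn_extendForm he _ _ hz]
    exact wedge_dualRawLeft G (fun k => formIn I e α.1 k z) z
  · exact fun q _ => integrableOn_coeff he α.2 (hG q) hKc hKt (hG0 q) _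
  · intro p hp
    exact rawWedge_eq_zero_left _ (extendForm_eq_zero_of_notMem_image
      (fun z hz => dualRawLeft_eq_zero fun q => hG0 q z hz) hp) _

theorem finrank_real_eq : finrank ℝ E = realDim E := by
  rw [Module.finrank_eq_card_basis (complexFrame E), Fintype.card_fin]

theorem alternating_eq_zero_of_frame {k : ℕ} {a : E [⋀^Fin k]→L[ℝ] ℝ}
    (h : ∀ r : Fin k → Fin (realDim E), a (fun l => complexFrame E (r l)) = 0) : a = 0 := by
  ext v
  rw [continuousAlternating_apply_eq_sum (complexFrame E)]
  exact Finset.sum_eq_zero fun r _ => by rw [h, mul_zero]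

variable [PositiveAtlas I M]

/-- A form all of whose coefficients are orthogonal to the test functions vanishes. -/
theorem form_eq_zero_of_coeff [MeasurableSpace E] [BorelSpace E] {α : Form I M}
    (h : ∀ (x : M) (q : CoeffIndex E) (u : E → ℝ), ContDiff ℝ ∞ u → HasCompactSupport u →
      tsupport u ⊆ (extChartAt I x).target → ∫ z in (extChartAt I x).target,
        u z * formIn I (extChartAt I x) α.1 q.1 z q.vec ∂frameMeasure E = 0) : α = 0 := by
  refine Subtype.ext (funext fun p => funext fun k => ?_)
  by_cases hk : k < realDim E + 1
  swap
  · exact alternating_eq_zero_of_finrank_lt (by rw [finrank_real_eq]; omega) _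
  set e := extChartAt I p with he
  have hec : IsChart I e := isChart_extChartAt I p
  have hzero : formIn I e α.1 k (e p) = 0 := by
    refine alternating_eq_zero_of_frame fun r => ?_
    have hcont : ContinuousOn (fun z => formIn I e α.1 k z (fun l => complexFrame E (r l)))
        e.target := (isSmoothForm_formIn_continuousOn α.2 hec _ _).continuousOn
    have hae : ∀ᵐ z ∂frameMeasure E, z ∈ e.target →
        formIn I e α.1 k z (fun l => complexFrame E (r l)) = 0 := by
      refine hec.open_target.ae_eq_zero_of_integral_contDiff_smul_eq_zero
        (hcont.locallyIntegrableOn hec.open_target.measurableSet) fun u hu huc hut => ?_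
      have := h p ⟨⟨k, hk⟩, r⟩ u hu huc hut
      rw [setIntegral_eq_integral_of_forall_compl_eq_zero] at this
      · exact this
      · intro z hz
        have : u z = 0 := by
          by_contra hne
          exact hz (hut (subset_tsupport _ hne))
        rw [this, zero_mul]
    have hae' : ∀ᵐ z ∂(frameMeasure E).restrict e.target,
        formIn I e α.1 k z (fun l => complexFrame E (r l)) = 0 :=
      (ae_restrict_iff' hec.open_target.measurableSet).2 hae
    exact Measure.eqOn_open_of_ae_eq hae' hec.open_target hcont continuousOn_const
      (mem_extChartAt_target p)
  rw [form_eq_of_formIn hec (mem_extChartAt_source p) α.1 k, hzero]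
  rfl

theorem form_eq_zero_of_integral_wedge_right {α : Form I M}
    (h : ∀ φ : Form I M, integral I (wedge I α φ) = 0) : α = 0 := by
  classical
  letI : MeasurableSpace E := borel E
  haveI : BorelSpace E := ⟨rfl⟩
  refine form_eq_zero_of_coeff fun x q u hu huc hut => ?_
  have h1 := integral_wedge_dualRight (isChart_extChartAt I x) (hasSign_extChartAt I x)
    (G := fun q' => if q' = q then u else 0) huc.isCompact hut
    (fun q' => by split_ifs; exacts [hu, contDiff_const])
    (fun q' z hz => by split_ifs; exacts [image_eq_zero_of_notMem_tsupport hz, rfl]) α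
  rw [h, one_mul, Finset.sum_eq_single q] at h1
  · rw [h1]; simp
  · intro q' _ hq'
    simp [if_neg hq']
  · intro hq; exact absurd (Finset.mem_univ _) hq

theorem form_eq_zero_of_integral_wedge_left {α : Form I M}
    (h : ∀ φ : Form I M, integral I (wedge I φ α) = 0) : α = 0 := by
  classical
  letI : MeasurableSpace E := borel E
  haveI : BorelSpace E := ⟨rfl⟩
  refine form_eq_zero_of_coeff fun x q u hu huc hut => ?_
  have h1 := integral_wedge_dualLeft (isChart_extChartAt I x) (hasSign_extChartAt I x)
    (G := fun q' => if q' = q then u else 0) huc.isCompact hut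
    (fun q' => by split_ifs; exacts [hu, contDiff_const])
    (fun q' z hz => by split_ifs; exacts [image_eq_zero_of_notMem_tsupport hz, rfl]) α
  rw [h, one_mul, Finset.sum_eq_single q] at h1
  · rw [h1]; simp
  · intro q' _ hq'
    simp [if_neg hq']
  · intro hq; exact absurd (Finset.mem_univ _) hq

theorem form_eq_of_integral_wedge_right {α β : Form I M}
    (h : ∀ φ : Form I M, integral I (wedge I α φ) = integral I (wedge I β φ)) : α = β := by
  rw [← sub_eq_zero]
  refine form_eq_zero_of_integral_wedge_right fun φ => ?_
  have h1 : wedge I (α - β) φ = wedge I α φ + (-1 : ℝ) • wedge I β φ := by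
    rw [form_sub_eq]
    exact Subtype.ext ((rawWedge_add_left _ _ _).trans
      (congrArg _ (rawWedge_smul_left _ _ _)))
  rw [h1, integral_add, integral_smul, h φ]
  ring

theorem form_eq_of_integral_wedge_left {α β : Form I M}
    (h : ∀ φ : Form I M, integral I (wedge I φ α) = integral I (wedge I φ β)) : α = β := by
  rw [← sub_eq_zero]
  refine form_eq_zero_of_integral_wedge_left fun φ => ?_
  have h1 : wedge I φ (α - β) = wedge I φ α + (-1 : ℝ) • wedge I φ β := by
    rw [form_sub_eq]
    exact Subtype.ext ((rawWedge_add_right _ _ _).trans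
      (congrArg _ (rawWedge_smul_right _ _ _)))
  rw [h1, integral_add, integral_smul, h φ]
  ring

/-- Invariance of the integral under orientation preserving diffeomorphisms. -/
theorem integral_pullback_diffeo (s s' : C^∞⟮I, M; I, M⟯) (hss' : ∀ p, s (s' p) = p)
    (hs's : ∀ p, s' (s p) = p)
    (hpos : ∀ x x' : M, ∀ z ∈ (extChartAt I x).target,
      s' ((extChartAt I x).symm z) ∈ (extChartAt I x').source →
        0 < (fderiv ℝ (fun y => extChartAt I x' (s' ((extChartAt I x).symm y))) z).det)
    (α : Form I M) : integral I (pullback I I s α) = integral I α := by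
  letI : MeasurableSpace E := borel E
  haveI : BorelSpace E := ⟨rfl⟩
  have hα : α = ∑ x ∈ chartPoints I M, mulForm (chartPartition I M x) α :=
    (sum_mulForm (sum_chartPartition I) α).symm
  suffices h : ∀ x, integral I (pullback I I s (mulForm (chartPartition I M x) α)) =
      integral I (mulForm (chartPartition I M x) α) by
    have h2 : (integralLM I M).comp (pullbackLM s) (∑ x ∈ chartPoints I M,
        mulForm (chartPartition I M x) α) = integralLM I M (∑ x ∈ chartPoints I M,
          mulForm (chartPartition I M x) α) := by
      rw [map_sum, map_sum]
      exact Finset.sum_congr rfl fun x _ => h x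
    rw [← hα] at h2
    exact h2
  intro x
  set β := mulForm (chartPartition I M x) α with hβ
  obtain ⟨K, hKt, hKc, hK⟩ := exists_compact_chartPartition (I := I) x
  have hβ0 : ∀ p ∉ (extChartAt I x).symm '' K, β.1 p = 0 := fun p hp => by
    rw [hβ, mulForm_apply, hK p hp, zero_smul]
  let S : M ≃ M := ⟨s, s', hs's, hss'⟩
  let e : PartialEquiv M E := S.toPartialEquiv.trans (extChartAt I x)
  have hsource : e.source = s ⁻¹' (extChartAt I x).source := by
    ext p; simp [e, S]
  have htarget : e.target = (extChartAt I x).target := by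
    ext p; simp [e, S]
  have hecoe : ∀ p, e p = extChartAt I x (s p) := fun p => rfl
  have hesymm : ∀ z, e.symm z = s' ((extChartAt I x).symm z) := fun p => rfl
  have hx := isChart_extChartAt I x
  have hec : IsChart I e :=
    { open_source := by rw [hsource]; exact hx.open_source.preimage s.contMDiff.continuous
      open_target := by rw [htarget]; exact hx.open_target
      smooth := by
        rw [hsource]
        exact hx.smooth.comp s.contMDiff.contMDiffOn (fun p hp => hp)
      smooth_symm := by
        rw [htarget]
        exact s'.contMDiff.comp_contMDiffOn hx.smooth_symm }
  have hsign : HasSign I e 1 := ⟨Or.inl rfl, fun z hz x' hx' => by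
    rw [one_mul]
    exact hpos x x' z (htarget ▸ hz) hx'⟩
  rw [integral_eq_of_chart hec hsign (pullback I I s β) hKc (htarget ▸ hKt),
    integral_eq_of_chart hx (hasSign_extChartAt I x) β hKc hKt, htarget]
  · congr 1
    refine setIntegral_congr_fun hx.open_target.measurableSet fun z hz => ?_
    have h1 : s (e.symm z) = (extChartAt I x).symm z := by rw [hesymm, hss']
    have h2 := formIn_rawPullback (s := s) hec hx (z := z) (htarget ▸ hz) s.contMDiff.contMDiffAt
      (by rw [h1]; exact (extChartAt I x).map_target hz) β.1 (finrank ℂ E * 2)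
    have h3 : (fun y => extChartAt I x (s (e.symm y))) =ᶠ[𝓝 z] id := by
      filter_upwards [hx.open_target.mem_nhds hz] with y hy
      rw [hesymm, hss', (extChartAt I x).right_inv hy]; rfl
    rw [h3.fderiv_eq, h1, (extChartAt I x).right_inv hz, fderiv_id] at h2
    change formIn I e (rawPullback I I s β.1) (finrank ℂ E * 2) z (complexFrame E) = _
    rw [h2]
    rfl
  · intro p hp; rw [hβ0 p hp]; rfl
  · intro p hp
    have : β.1 (s p) = 0 := by
      refine hβ0 _ ?_
      rintro ⟨y, hy, hyp⟩
      refine hp ⟨y, hy, ?_⟩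
      rw [hesymm, hyp, hs's]
    change (β.1 (s p) (finrank ℂ E * 2)).compContinuousLinearMap _ = 0
    rw [this]; rfl

end DualForms

section ParametricIntegral

variable {W : Type*} [NormedAddCommGroup W] [NormedSpace ℝ W] [FiniteDimensional ℝ W]
  [MeasurableSpace W] [BorelSpace W]

/-- The measure is concentrated on a compact set. -/
def IsCompactMeasure (μ : Measure W) : Prop := ∃ K : Set W, IsCompact K ∧ μ Kᶜ = 0

theorem IsCompactMeasure.integrable {μ : Measure W} [IsFiniteMeasure μ] (hμ : IsCompactMeasure μ)
    {F : Type*} [NormedAddCommGroup F] {g : W → F} (hg : Continuous g) : Integrable g μ := by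
  obtain ⟨K, hK, hK0⟩ := hμ
  have h1 : IntegrableOn g K μ := hg.continuousOn.integrableOn_compact hK
  have h2 : μ.restrict K = μ := Measure.restrict_eq_self_of_ae_mem hK0
  rwa [IntegrableOn, h2] at h1

theorem contDiffOn_parametric_integral {Z : Type*} [NormedAddCommGroup Z] [NormedSpace ℝ Z]
    {F : Type*} [NormedAddCommGroup F] [NormedSpace ℝ F]
    {μ : Measure W} [IsFiniteMeasure μ] (hμ : IsCompactMeasure μ) {g : Z → W → F} {s : Set Z}
    (hs : IsOpen s) (hg : ContDiffOn ℝ ∞ (fun q : Z × W => g q.1 q.2) (s ×ˢ univ)) :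
    ContDiffOn ℝ ∞ (fun z => ∫ w, g z w ∂μ) s := by
  obtain ⟨K, hK, hK0⟩ := hμ
  obtain ⟨R, hR⟩ := hK.isBounded.subset_ball (0 : W)
  let χ : ContDiffBump (0 : W) := ⟨max R 1, max R 1 + 1, by positivity, by linarith⟩
  have hχ1 : ∀ w ∈ K, χ w = 1 := fun w hw => χ.one_of_mem_closedBall (by
    have := hR hw
    rw [Metric.mem_ball] at this
    rw [Metric.mem_closedBall]
    exact this.le.trans (le_max_left _ _))
  have key : ∀ z, ∫ w, g z w ∂μ = (convolution (fun _ : W => (1 : ℝ))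
      (fun w => χ (-w) • g z (-w)) (ContinuousLinearMap.lsmul ℝ ℝ) μ) 0 := by
    intro z
    rw [convolution_def]
    refine integral_congr_ae ?_
    have : ∀ᵐ w ∂μ, w ∈ K := hK0
    filter_upwards [this] with w hw
    simp [hχ1 w hw]
  simp only [key]
  refine contDiffOn_convolution_right_with_param_comp (n := ⊤) (ContinuousLinearMap.lsmul ℝ ℝ)
    (v := fun _ => (0 : W)) contDiffOn_const hs
    (isCompact_closedBall (0 : W) (max R 1 + 1)) (fun z w _ hw => ?_) ?_ ?_
  · have : χ (-w) = 0 := by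
      refine χ.zero_of_le_dist ?_
      rw [Metric.mem_closedBall, dist_zero_right] at hw
      rw [dist_zero_right, norm_neg]
      exact (not_le.1 hw).le
    rw [this, zero_smul]
  · exact (integrable_const (1 : ℝ)).locallyIntegrable
  · have h1 : ContDiffOn ℝ ∞ (fun q : Z × W => (q.1, -q.2)) (s ×ˢ univ) :=
      contDiffOn_fst.prodMk contDiffOn_snd.neg
    have h2 : ContDiffOn ℝ ∞ (fun q : Z × W => g q.1 (-q.2)) (s ×ˢ univ) :=
      hg.comp h1 (fun q hq => ⟨hq.1, mem_univ _⟩)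
    exact ((χ.contDiff.comp (contDiff_snd.neg)).contDiffOn).smul h2

end ParametricIntegral

section FamilyCalculus

variable {E : Type*} [NormedAddCommGroup E] [NormedSpace ℝ E] [FiniteDimensional ℝ E]
  {H : Type*} [TopologicalSpace H] {I : ModelWithCorners ℝ E H} [I.Boundaryless]
  {M : Type*} [TopologicalSpace M] [ChartedSpace H M] [IsManifold I ∞ M]
  {P : Type*} [NormedAddCommGroup P] [NormedSpace ℝ P]
  {V : Type*} [NormedAddCommGroup V] [NormedSpace ℝ V]

theorem SmoothFamily.contDiff_formIn {Φ : P → RawForm E M} (h : SmoothFamily I Φ)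
    {e : PartialEquiv M V} (he : IsChart I e) {z : V} (hz : z ∈ e.target) (k : ℕ) (v : Fin k → V) :
    ContDiff ℝ ∞ (fun p => formIn I e (Φ p) k z v) := by
  rw [contDiff_iff_contDiffAt]
  intro p
  exact ContDiffAt.comp p (g := fun q : P × V => formIn I e (Φ q.1) k q.2 v)
    (f := fun p : P => (p, z)) (h.familyAt he p hz k v) (contDiffAt_id.prodMk contDiffAt_const)

theorem SmoothFamily.contDiff_apply {Φ : P → RawForm E M} (h : SmoothFamily I Φ) (q : M) (k : ℕ)
    (v : Fin k → E) : ContDiff ℝ ∞ (fun p => Φ p q k v) := by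
  have he := isChart_extChartAt I q
  simp only [form_eq_of_formIn he (mem_extChartAt_source q)]
  exact h.contDiff_formIn he (mem_extChartAt_target q) k _

theorem SmoothFamily.contDiff_pointwise {Φ : P → RawForm E M} (h : SmoothFamily I Φ) (q : M)
    (k : ℕ) : ContDiff ℝ ∞ (fun p => Φ p q k) := by
  rw [contDiff_iff_contDiffAt]
  exact fun p => contDiffAt_alternating fun v => (h.contDiff_apply q k v).contDiffAt

section IntForm

variable {W : Type*} [NormedAddCommGroup W] [NormedSpace ℝ W] [FiniteDimensional ℝ W]
  [MeasurableSpace W] [BorelSpace W]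

/-- The pointwise integral of a family of forms. -/
def intForm (μ : Measure W) (Θ : W → RawForm E M) : RawForm E M := fun q k => ∫ w, Θ w q k ∂μ

theorem integral_alternating_apply {μ : Measure W} {k : ℕ} {g : W → E [⋀^Fin k]→L[ℝ] ℝ}
    (hg : Integrable g μ) (v : Fin k → E) : (∫ w, g w ∂μ) v = ∫ w, g w v ∂μ := by
  haveI : CompleteSpace (E [⋀^Fin k]→L[ℝ] ℝ) := FiniteDimensional.complete ℝ _
  exact ((ContinuousAlternatingMap.apply ℝ E ℝ v).integral_comp_comm hg).symm

theorem SmoothFamily.integrable {μ : Measure W} [IsFiniteMeasure μ] (hμ : IsCompactMeasure μ)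
    {Θ : W → RawForm E M} (h : SmoothFamily I Θ) (q : M) (k : ℕ) :
    Integrable (fun w => Θ w q k) μ := hμ.integrable (h.contDiff_pointwise q k).continuous

theorem SmoothFamily.intForm_apply {μ : Measure W} [IsFiniteMeasure μ] (hμ : IsCompactMeasure μ)
    {Θ : W → RawForm E M} (h : SmoothFamily I Θ) (q : M) (k : ℕ) (v : Fin k → E) :
    intForm μ Θ q k v = ∫ w, Θ w q k v ∂μ :=
  integral_alternating_apply (h.integrable hμ q k) v

theorem SmoothFamily.formIn_intForm {μ : Measure W} [IsFiniteMeasure μ] (hμ : IsCompactMeasure μ)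
    {Θ : W → RawForm E M} (h : SmoothFamily I Θ) (e : PartialEquiv M V) (k : ℕ) (z : V)
    (v : Fin k → V) : formIn I e (intForm μ Θ) k z v = ∫ w, formIn I e (Θ w) k z v ∂μ := by
  rw [formIn_apply, h.intForm_apply hμ]
  rfl

/-- Integrating a smooth family over some of its parameters gives a smooth family. -/
theorem SmoothFamily.intForm {μ : Measure W} [IsFiniteMeasure μ] (hμ : IsCompactMeasure μ)
    {Θ : P × W → RawForm E M} (h : SmoothFamily I Θ) :
    SmoothFamily I (fun p => intForm μ (fun w => Θ (p, w))) := by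
  intro x p z hz k v
  have hfix : ∀ p, SmoothFamily I (fun w => Θ (p, w)) := fun p =>
    h.comp (contDiff_const.prodMk contDiff_id)
  simp only [(hfix _).formIn_intForm hμ]
  have ho : IsOpen (univ ×ˢ (extChartAt I x).target : Set (P × E)) :=
    isOpen_univ.prod (isOpen_extChartAt_target x)
  refine (contDiffOn_parametric_integral hμ
    (g := fun (q : P × E) w => formIn I (extChartAt I x) (Θ (q.1, w)) k q.2 v) ho ?_).contDiffAt
    (ho.mem_nhds ⟨mem_univ _, hz⟩)
  intro q hq
  refine ContDiffAt.contDiffWithinAt ?_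
  have h1 := h x (q.1.1, q.2) q.1.2 hq.1.2 k v
  exact ContDiffAt.comp q
    (g := fun q : (P × W) × E => formIn I (extChartAt I x) (Θ q.1) k q.2 v)
    (f := fun q : (P × E) × W => ((q.1.1, q.2), q.1.2)) h1
    (((contDiffAt_fst.comp _ contDiffAt_fst).prodMk contDiffAt_snd).prodMk
      (contDiffAt_snd.comp _ contDiffAt_fst))

end IntForm

/-- The pointwise derivative of a family of forms with respect to the parameter. -/
def derivForm (Θ : P → RawForm E M) (z v : P) : RawForm E M := fun q k =>
  fderiv ℝ (fun z => Θ z q k) z v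

theorem SmoothFamily.derivForm_apply {Θ : P → RawForm E M} (h : SmoothFamily I Θ) (z v : P)
    (q : M) (k : ℕ) (u : Fin k → E) :
    derivForm Θ z v q k u = fderiv ℝ (fun z => Θ z q k u) z v := by
  have h1 : HasFDerivAt (fun z => Θ z q k) (fderiv ℝ (fun z => Θ z q k) z) z :=
    ((h.contDiff_pointwise q k).differentiable (by simp) z).hasFDerivAt
  have h2 := (ContinuousAlternatingMap.apply ℝ E ℝ u).hasFDerivAt.comp z h1
  have h3 : HasFDerivAt (fun z => Θ z q k u)
    ((ContinuousAlternatingMap.apply ℝ E ℝ u).comp (fderiv ℝ (fun z => Θ z q k) z)) z := h2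
  rw [h3.fderiv]
  rfl

theorem SmoothFamily.derivForm {Θ : P → RawForm E M} (h : SmoothFamily I Θ) :
    SmoothFamily I (fun q : P × P => derivForm Θ q.1 q.2) := by
  intro x p z hz k u
  set c := extChartAt I x with hc
  have key : ∀ᶠ q : (P × P) × E in 𝓝 (p, z), formIn I c (Currents.derivForm Θ q.1.1 q.1.2) k q.2 u =
      fderiv ℝ (fun w : P × E => formIn I c (Θ w.1) k w.2 u) (q.1.1, q.2) (q.1.2, 0) := by
    filter_upwards [continuousAt_snd.preimage_mem_nhds
      ((isOpen_extChartAt_target x).mem_nhds hz)] with q hq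
    rw [formIn_apply, h.derivForm_apply]
    have h1 : HasFDerivAt (fun w : P × E => formIn I c (Θ w.1) k w.2 u)
        (fderiv ℝ (fun w : P × E => formIn I c (Θ w.1) k w.2 u) (q.1.1, q.2)) (q.1.1, q.2) :=
      ((h x q.1.1 q.2 hq k u).differentiableAt (by simp)).hasFDerivAt
    have h2 := HasFDerivAt.comp (g := fun w : P × E => formIn I c (Θ w.1) k w.2 u)
      (f := fun p : P => (p, q.2)) q.1.1 h1 (hasFDerivAt_prodMk_left q.1.1 q.2)
    have h3 : fderiv ℝ (fun w : P => formIn I c (Θ w) k q.2 u) q.1.1 = _ := h2.fderiv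
    change fderiv ℝ (fun w : P => formIn I c (Θ w) k q.2 u) q.1.1 q.1.2 = _
    rw [h3]
    rfl
  refine ContDiffAt.congr_of_eventuallyEq ?_ key
  have h1 : ContDiffAt ℝ ∞ (fderiv ℝ (fun w : P × E => formIn I c (Θ w.1) k w.2 u)) (p.1, z) :=
    (h x p.1 z hz k u).fderiv_right (m := ∞) (by simp)
  have h2 : ContDiffAt ℝ ∞ (fun q : (P × P) × E => (q.1.1, q.2)) (p, z) :=
    (contDiffAt_fst.comp _ contDiffAt_fst).prodMk contDiffAt_snd
  have h3 : ContDiffAt ℝ ∞ (fun q : (P × P) × E => (q.1.2, (0 : E))) (p, z) :=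
    (contDiffAt_snd.comp _ contDiffAt_fst).prodMk contDiffAt_const
  exact (ContDiffAt.comp (p, z) (g := fderiv ℝ (fun w : P × E => formIn I c (Θ w.1) k w.2 u))
    (f := fun q : (P × P) × E => (q.1.1, q.2)) h1 h2).clm_apply h3

/-- Iterated partial derivatives of a jointly smooth function are jointly continuous. -/
theorem continuousAt_iteratedFDeriv_partial {f : P × V → ℝ} {s : Set (P × V)} (hs : IsOpen s)
    (hf : ContDiffOn ℝ ∞ f s) (j : ℕ) {q : P × V} (hq : q ∈ s) :
    ContinuousAt (fun q : P × V => iteratedFDeriv ℝ j (fun z => f (q.1, z)) q.2) q := by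
  have key : ∀ q ∈ s, iteratedFDeriv ℝ j (fun z => f (q.1, z)) q.2 =
      (iteratedFDeriv ℝ j f q).compContinuousLinearMap
        (fun _ => ContinuousLinearMap.inr ℝ P V) := by
    intro q hq
    set a : P × V := (q.1, 0) with ha
    set s' : Set (P × V) := (fun w => w + a) ⁻¹' s with hs'
    have hs'o : IsOpen s' := hs.preimage (continuous_id.add continuous_const)
    have hf' : ContDiffOn ℝ ∞ (fun w => f (w + a)) s' :=
      hf.comp (contDiff_id.add contDiff_const).contDiffOn (fun w hw => hw)
    have hmem : ContinuousLinearMap.inr ℝ P V q.2 ∈ s' := by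
      simpa [hs', ha] using hq
    have hpo : IsOpen (ContinuousLinearMap.inr ℝ P V ⁻¹' s') :=
      hs'o.preimage (ContinuousLinearMap.inr ℝ P V).continuous
    have h1 := (ContinuousLinearMap.inr ℝ P V).iteratedFDerivWithin_comp_right hf'
      hs'o.uniqueDiffOn hpo.uniqueDiffOn (x := q.2) hmem (i := j) (by exact_mod_cast le_top)
    rw [iteratedFDerivWithin_of_isOpen j hpo hmem, iteratedFDerivWithin_of_isOpen j hs'o hmem,
      iteratedFDeriv_comp_add_right] at h1
    have h2 : ((fun w => f (w + a)) ∘ (ContinuousLinearMap.inr ℝ P V)) = fun z => f (q.1, z) := by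
      funext z; simp [ha]
    have h3 : ContinuousLinearMap.inr ℝ P V q.2 + a = q := by simp [ha]
    rw [h2, h3] at h1
    exact h1
  have h1 : ContinuousAt (fun q => (iteratedFDeriv ℝ j f q).compContinuousLinearMap
      (fun _ => ContinuousLinearMap.inr ℝ P V)) q := by
    have h2 : ContDiffAt ℝ (0 + j : ℕ) f q := (hf.contDiffAt (hs.mem_nhds hq)).of_le (by
      exact_mod_cast le_top)
    have h3 : ContinuousAt (iteratedFDeriv ℝ j f) q :=
      (h2.iteratedFDeriv_right (m := 0) (i := j) (by simp)).continuousAt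
    exact (ContinuousMultilinearMap.compContinuousLinearMapL
      (fun _ => ContinuousLinearMap.inr ℝ P V)).continuous.continuousAt.comp h3
  refine h1.congr ?_
  filter_upwards [hs.mem_nhds hq] with w hw using (key w hw).symm

/-- Convergence to zero of forms, tested locally in the charts. -/
theorem tendstoZero_iff {φ : ℕ → Form I M} : TendstoZero I φ ↔
    ∀ (x : M) (k : ℕ) (v : Fin k → E) (j : ℕ), ∀ z ∈ (extChartAt I x).target,
      Tendsto (fun q : ℕ × E => iteratedFDeriv ℝ j (fun z => coordForm I x (φ q.1).1 k z v) q.2)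
        (atTop ×ˢ 𝓝 z) (𝓝 0) := by
  haveI : ProperSpace E := FiniteDimensional.proper ℝ E
  refine forall_congr' fun x => forall_congr' fun k => forall_congr' fun v =>
    forall_congr' fun j => ?_
  have ho := isOpen_extChartAt_target (I := I) x
  have h1 := tendstoLocallyUniformlyOn_iff_forall_isCompact (p := atTop)
    (F := fun n y => iteratedFDeriv ℝ j (fun z => coordForm I x (φ n).1 k z v) y)
    (f := 0) ho
  rw [tendstoLocallyUniformlyOn_iff_forall_tendsto] at h1
  have h2 : (∀ K : Set E, IsCompact K → K ⊆ (extChartAt I x).target → TendstoUniformlyOn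
      (fun n y => iteratedFDeriv ℝ j (fun z => coordForm I x (φ n).1 k z v) y) 0 atTop K) ↔
      (∀ K ⊆ (extChartAt I x).target, IsCompact K → TendstoUniformlyOn
      (fun n y => iteratedFDeriv ℝ j (fun z => coordForm I x (φ n).1 k z v) y) 0 atTop K) :=
    ⟨fun h K a b => h K b a, fun h K a b => h K b a⟩
  rw [h2, ← h1]
  refine forall_congr' fun z => forall_congr' fun hz => ?_
  rw [ho.nhdsWithin_eq hz]
  rw [Metric.tendsto_nhds, Metric.uniformity_basis_dist.tendsto_right_iff]
  refine forall_congr' fun ε => forall_congr' fun hε => ?_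
  simp only [mem_ofPred_eq, Pi.zero_apply, dist_comm]

/-- A smooth family of forms is continuous for the convergence of forms. -/
theorem SmoothFamily.tendstoZero {Φ : P → Form I M} (h : SmoothFamily I (fun p => (Φ p).1))
    {p : P} {u : ℕ → P} (hu : Tendsto u atTop (𝓝 p)) :
    TendstoZero I (fun n => Φ (u n) + (-1 : ℝ) • Φ p) := by
  rw [tendstoZero_iff]
  intro x k v j z hz
  have ho : IsOpen (univ ×ˢ (extChartAt I x).target : Set (P × E)) :=
    isOpen_univ.prod (isOpen_extChartAt_target x)
  have hcont : ∀ q ∈ (univ ×ˢ (extChartAt I x).target : Set (P × E)), ContinuousAt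
      (fun q : P × E => iteratedFDeriv ℝ j (fun z => coordForm I x (Φ q.1).1 k z v) q.2) q :=
    fun q hq => continuousAt_iteratedFDeriv_partial ho
      (f := fun q : P × E => coordForm I x (Φ q.1).1 k q.2 v)
      (fun q hq => (h x q.1 q.2 hq.2 k v).contDiffWithinAt) j hq
  have h0 := hcont (p, z) ⟨mem_univ _, hz⟩
  have h1 : Tendsto (fun q : ℕ × E => (u q.1, q.2)) (atTop ×ˢ 𝓝 z) (𝓝 (p, z)) := by
    rw [nhds_prod_eq]
    exact (hu.comp tendsto_fst).prodMk tendsto_snd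
  have h2 : Tendsto (fun q : ℕ × E => (p, q.2)) (atTop ×ˢ 𝓝 z) (𝓝 (p, z)) := by
    rw [nhds_prod_eq]
    exact tendsto_const_nhds.prodMk tendsto_snd
  have h3 := (h0.tendsto.comp h1).sub (h0.tendsto.comp h2)
  rw [sub_self] at h3
  refine h3.congr' ?_
  have h4 : ∀ᶠ q : ℕ × E in atTop ×ˢ 𝓝 z, q.2 ∈ (extChartAt I x).target :=
    tendsto_snd.eventually ((isOpen_extChartAt_target x).mem_nhds hz)
  filter_upwards [h4] with q hq
  have hsm : ∀ p', ContDiffAt ℝ j (fun z => coordForm I x (Φ p').1 k z v) q.2 := fun p' =>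
    (((Φ p').2 x k v).contDiffAt ((isOpen_extChartAt_target x).mem_nhds hq)).of_le (by
      exact_mod_cast le_top)
  have h5 : (fun z => coordForm I x (Φ (u q.1) + (-1 : ℝ) • Φ p).1 k z v) =
      (fun z => coordForm I x (Φ (u q.1)).1 k z v) - fun z => coordForm I x (Φ p).1 k z v := by
    funext z
    change coordForm I x (Φ (u q.1)).1 k z v + (-1 : ℝ) * coordForm I x (Φ p).1 k z v =
      coordForm I x (Φ (u q.1)).1 k z v - coordForm I x (Φ p).1 k z v
    ring
  rw [h5, iteratedFDeriv_sub_apply (hsm _) (hsm _)]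
  rfl

end FamilyCalculus

section Regular

variable {E : Type*} [NormedAddCommGroup E] [NormedSpace ℝ E] [FiniteDimensional ℝ E]
  {H : Type*} [TopologicalSpace H] {I : ModelWithCorners ℝ E H} [I.Boundaryless]
  {M : Type*} [TopologicalSpace M] [ChartedSpace H M] [IsManifold I ∞ M]

/-- A linear functional on forms is regular if it is continuous along smooth families. -/
def IsRegular (S : Form I M →ₗ[ℝ] ℝ) : Prop :=
  ∀ (P : Type) [NormedAddCommGroup P] [NormedSpace ℝ P] (Φ : P → Form I M),
    SmoothFamily I (fun p => (Φ p).1) → Continuous fun p => S (Φ p)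

theorem isRegular_of_tendsto {S : Form I M →ₗ[ℝ] ℝ}
    (h : ∀ φ : ℕ → Form I M, TendstoZero I φ → Tendsto (fun n => S (φ n)) atTop (𝓝 0)) :
    IsRegular S := by
  intro P _ _ Φ hΦ
  rw [continuous_iff_seqContinuous]
  intro u p hu
  have h1 := (h _ (hΦ.tendstoZero hu)).add_const (S (Φ p))
  rw [zero_add] at h1
  refine h1.congr fun n => ?_
  rw [map_add, map_smul, smul_eq_mul]
  simp

theorem Current.isRegular (T : Current I M) : IsRegular T.toLinearMap :=
  isRegular_of_tendsto T.tendsto_zero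

/-- Lebesgue measure on the unit interval. -/
def unitMeasure : Measure ℝ := volume.restrict (Ioc 0 1)

instance : IsFiniteMeasure unitMeasure := by unfold unitMeasure; infer_instance


theorem isCompactMeasure_unitMeasure : IsCompactMeasure unitMeasure :=
  ⟨Icc 0 1, isCompact_Icc, by
    rw [unitMeasure, Measure.restrict_apply measurableSet_Icc.compl]
    have : (Icc (0 : ℝ) 1)ᶜ ∩ Ioc 0 1 = ∅ := by
      rw [← disjoint_iff_inter_eq_empty, disjoint_compl_left_iff]
      exact Ioc_subset_Icc_self
    rw [this, measure_empty]⟩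

@[simp] theorem unitMeasure_real_univ : unitMeasure.real univ = 1 := by
  simp [unitMeasure, measureReal_restrict_apply MeasurableSet.univ]

theorem integral_unitMeasure {F : Type*} [NormedAddCommGroup F] [NormedSpace ℝ F] (g : ℝ → F) :
    ∫ t, g t ∂unitMeasure = ∫ t in (0 : ℝ)..1, g t := by
  rw [intervalIntegral.integral_of_le zero_le_one]; rfl

section Line

variable {Θ : ℝ → Form I M}

theorem smoothFamily_segment (hΘ : SmoothFamily I (fun t => (Θ t).1)) :
    SmoothFamily I (fun p : ℝ × ℝ => intForm unitMeasure (fun σ => (Θ (p.1 + p.2 * σ)).1)) :=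
  SmoothFamily.intForm (Θ := fun q : (ℝ × ℝ) × ℝ => (Θ (q.1.1 + q.1.2 * q.2)).1)
    isCompactMeasure_unitMeasure
    (SmoothFamily.comp (Φ := fun t => (Θ t).1) (g := fun q : (ℝ × ℝ) × ℝ => q.1.1 + q.1.2 * q.2)
      hΘ (by fun_prop))

theorem smul_intForm_segment (a h : ℝ) (q : M) (k : ℕ) :
    h • intForm unitMeasure (fun σ => (Θ (a + h * σ)).1) q k =
      ∫ t in a..a + h, (Θ t).1 q k := by
  have h1 := intervalIntegral.smul_integral_comp_add_mul (a := 0) (b := 1)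
    (fun t => (Θ t).1 q k) h a
  rw [mul_zero, add_zero, mul_one] at h1
  rw [← h1, intForm, integral_unitMeasure]

/-- A regular functional commutes with one-dimensional integrals. -/
theorem IsRegular.map_integral_line {S : Form I M →ₗ[ℝ] ℝ} (hS : IsRegular S)
    (hΘ : SmoothFamily I (fun t => (Θ t).1)) {a b : ℝ} (hab : a ≤ b) {A : Form I M}
    (hA : A.1 = intForm (volume.restrict (Ioc a b)) (fun t => (Θ t).1)) :
    S A = ∫ t in Ioc a b, S (Θ t) := by
  set B : ℝ × ℝ → Form I M := fun p =>
    ⟨intForm unitMeasure (fun σ => (Θ (p.1 + p.2 * σ)).1), (smoothFamily_segment hΘ).isSmoothForm p⟩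
    with hB
  have hBc : Continuous fun p => S (B p) := hS _ B (smoothFamily_segment hΘ)
  have hint : ∀ q k a b, IntervalIntegrable (fun t => (Θ t).1 q k) volume a b := fun q k a b =>
    (hΘ.contDiff_pointwise q k).continuous.intervalIntegrable _ _
  have hadd : ∀ t h, (t + h - a) • B (a, t + h - a) = (t - a) • B (a, t - a) + h • B (t, h) := by
    intro t h
    apply Subtype.ext
    funext q k
    change (t + h - a) • intForm unitMeasure (fun σ => (Θ (a + (t + h - a) * σ)).1) q k =
      (t - a) • intForm unitMeasure (fun σ => (Θ (a + (t - a) * σ)).1) q k +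
      h • intForm unitMeasure (fun σ => (Θ (t + h * σ)).1) q k
    rw [smul_intForm_segment, smul_intForm_segment, smul_intForm_segment,
      add_sub_cancel, add_sub_cancel]
    exact (intervalIntegral.integral_add_adjacent_intervals (hint _ _ _ _) (hint _ _ _ _)).symm
  have hB0 : ∀ t, B (t, 0) = Θ t := by
    intro t
    apply Subtype.ext
    funext q k
    change intForm unitMeasure (fun σ => (Θ (t + 0 * σ)).1) q k = _
    simp [intForm]
  have hderiv : ∀ t, HasDerivAt (fun t => S ((t - a) • B (a, t - a))) (S (Θ t)) t := by
    intro t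
    rw [hasDerivAt_iff_tendsto_slope_zero]
    have h1 : Tendsto (fun h : ℝ => S (B (t, h))) (𝓝[≠] 0) (𝓝 (S (Θ t))) := by
      rw [← hB0 t]
      exact ((hBc.comp (Continuous.prodMk_right t)).tendsto 0).mono_left nhdsWithin_le_nhds
    refine h1.congr' ?_
    filter_upwards [self_mem_nhdsWithin] with h hh
    rw [hadd, map_add, map_smul S h, smul_eq_mul, smul_eq_mul, add_sub_cancel_left,
      inv_mul_cancel_left₀ hh]
  have hc : Continuous fun t => S (Θ t) := hS _ Θ hΘ
  have h2 := intervalIntegral.integral_eq_sub_of_hasDerivAt (a := a) (b := b)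
    (fun t _ => hderiv t) (hc.intervalIntegrable _ _)
  rw [← intervalIntegral.integral_of_le hab, h2, sub_self, zero_smul, map_zero, sub_zero]
  congr 1
  apply Subtype.ext
  funext q k
  change _ = (b - a) • intForm unitMeasure (fun σ => (Θ (a + (b - a) * σ)).1) q k
  rw [smul_intForm_segment, add_sub_cancel, hA, intForm,
    intervalIntegral.integral_of_le hab]

end Line

/-- Lebesgue measure on a cube. -/
def cubeMeasure (R : ℝ) (d : ℕ) : Measure (Fin d → ℝ) :=
  Measure.pi fun _ => volume.restrict (Ioc (-R) R)

instance (R : ℝ) (d : ℕ) : IsFiniteMeasure (cubeMeasure R d) := by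
  unfold cubeMeasure; infer_instance

theorem cubeMeasure_eq (R : ℝ) (d : ℕ) :
    cubeMeasure R d = volume.restrict (Set.univ.pi fun _ => Ioc (-R) R) := by
  rw [cubeMeasure, volume_pi, Measure.restrict_pi_pi]

theorem isCompactMeasure_cubeMeasure (R : ℝ) (d : ℕ) : IsCompactMeasure (cubeMeasure R d) := by
  refine ⟨Set.univ.pi fun _ => Icc (-R) R, isCompact_univ_pi fun _ => isCompact_Icc, ?_⟩
  rw [cubeMeasure_eq, Measure.restrict_apply
    (MeasurableSet.univ_pi fun _ => measurableSet_Icc).compl]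
  have : (Set.univ.pi fun _ : Fin d => Icc (-R) R)ᶜ ∩ Set.univ.pi (fun _ => Ioc (-R) R) = ∅ := by
    rw [← disjoint_iff_inter_eq_empty, disjoint_compl_left_iff]
    exact Set.pi_mono fun _ _ => Ioc_subset_Icc_self
  rw [this, measure_empty]

theorem isCompactMeasure_Ioc (R : ℝ) : IsCompactMeasure (volume.restrict (Ioc (-R) R)) := by
  refine ⟨Icc (-R) R, isCompact_Icc, ?_⟩
  rw [Measure.restrict_apply measurableSet_Icc.compl]
  have : (Icc (-R) R)ᶜ ∩ Ioc (-R) R = ∅ := by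
    rw [← disjoint_iff_inter_eq_empty, disjoint_compl_left_iff]
    exact Ioc_subset_Icc_self
  rw [this, measure_empty]

theorem contDiff_insertNth_zero (d : ℕ) :
    ContDiff ℝ ∞ (fun q : ℝ × (Fin d → ℝ) => (Fin.insertNth 0 q.1 q.2 : Fin (d + 1) → ℝ)) := by
  rw [contDiff_pi]
  intro i
  refine Fin.cases ?_ (fun j => ?_) i
  · simpa using contDiff_fst
  · have : (fun q : ℝ × (Fin d → ℝ) => (Fin.insertNth 0 q.1 q.2 : Fin (d + 1) → ℝ) j.succ) =
        fun q => q.2 j := by funext q; simp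
    rw [this]
    fun_prop

theorem integral_cubeMeasure_succ (R : ℝ) (d : ℕ) {F : Type*} [NormedAddCommGroup F]
    [NormedSpace ℝ F] {g : (Fin (d + 1) → ℝ) → F} (hg : Continuous g) :
    ∫ w, g w ∂(cubeMeasure R (d + 1)) =
      ∫ t in Ioc (-R) R, ∫ w, g (Fin.insertNth 0 t w) ∂(cubeMeasure R d) := by
  have h1 := measurePreserving_piFinSuccAbove
    (fun _ : Fin (d + 1) => (volume : Measure ℝ).restrict (Ioc (-R) R)) 0
  have h2 : MeasurePreserving (MeasurableEquiv.piFinSuccAbove (fun _ : Fin (d + 1) => ℝ) 0)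
      (cubeMeasure R (d + 1)) ((volume.restrict (Ioc (-R) R)).prod (cubeMeasure R d)) := h1
  have h3 := h2.symm.integral_comp (MeasurableEquiv.measurableEmbedding _) g
  have hc : Continuous fun q : ℝ × (Fin d → ℝ) => g (Fin.insertNth 0 q.1 q.2) :=
    hg.comp (contDiff_insertNth_zero d).continuous
  rw [← h3]
  have h4 : Integrable (fun q : ℝ × (Fin d → ℝ) => g (Fin.insertNth 0 q.1 q.2))
      ((volume.restrict (Ioc (-R) R)).prod (cubeMeasure R d)) := by
    have : IsCompactMeasure ((volume.restrict (Ioc (-R) R)).prod (cubeMeasure R d)) := by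
      obtain ⟨K, hK, hK0⟩ := isCompactMeasure_Ioc R
      obtain ⟨K', hK', hK0'⟩ := isCompactMeasure_cubeMeasure R d
      refine ⟨K ×ˢ K', hK.prod hK', ?_⟩
      rw [Set.compl_prod_eq_union]
      refine measure_union_null ?_ ?_
      · rw [Measure.prod_prod, hK0, zero_mul]
      · rw [Measure.prod_prod, hK0', mul_zero]
    exact this.integrable hc
  exact integral_prod _ h4

theorem IsRegular.map_integral_cube {S : Form I M →ₗ[ℝ] ℝ} (hS : IsRegular S) {R : ℝ} (hR : 0 ≤ R)
    {d : ℕ} {Θ : (Fin d → ℝ) → Form I M} (hΘ : SmoothFamily I (fun t => (Θ t).1)) {A : Form I M}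
    (hA : A.1 = intForm (cubeMeasure R d) (fun t => (Θ t).1)) :
    S A = ∫ t, S (Θ t) ∂(cubeMeasure R d) := by
  induction d generalizing A with
  | zero =>
    have h1 : cubeMeasure R 0 = Measure.dirac default := by
      rw [cubeMeasure, Measure.pi_of_empty _ default]
    rw [h1, integral_dirac]
    congr 1
    apply Subtype.ext
    funext q k
    rw [hA, intForm, h1, integral_dirac]
  | succ d ih =>
    have hfam : SmoothFamily I (fun q : ℝ × (Fin d → ℝ) => (Θ (Fin.insertNth 0 q.1 q.2)).1) :=
      SmoothFamily.comp (Φ := fun w => (Θ w).1) hΘ (contDiff_insertNth_zero d)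
    have hfam2 := SmoothFamily.intForm (isCompactMeasure_cubeMeasure R d) hfam
    set Ψ : ℝ → Form I M := fun t => ⟨_, hfam2.isSmoothForm t⟩ with hΨ
    have h1 : S A = ∫ t in Ioc (-R) R, S (Ψ t) := by
      refine hS.map_integral_line hfam2 (by linarith) ?_
      rw [hA]
      funext q k
      exact integral_cubeMeasure_succ R d (hΘ.contDiff_pointwise q k).continuous
    rw [h1, integral_cubeMeasure_succ R d (hS _ Θ hΘ)]
    refine integral_congr_ae (ae_of_all _ fun t => ?_)
    exact ih (Θ := fun w => Θ (Fin.insertNth 0 t w))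
      (SmoothFamily.comp (Φ := fun q : ℝ × (Fin d → ℝ) => (Θ (Fin.insertNth 0 q.1 q.2)).1) hfam
        (g := fun w => (t, w)) (by fun_prop)) rfl

theorem integral_euclidean_eq_cube {d : ℕ} {F : Type*} [NormedAddCommGroup F] [NormedSpace ℝ F]
    {R : ℝ} {g : EuclideanSpace ℝ (Fin d) → F} (hg : ∀ x, R ≤ ‖x‖ → g x = 0) :
    ∫ x, g x = ∫ w, g (WithLp.toLp 2 w) ∂(cubeMeasure R d) := by
  have h1 := (PiLp.volume_preserving_toLp (Fin d)).integral_comp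
    (MeasurableEquiv.toLp 2 (Fin d → ℝ)).measurableEmbedding g
  rw [← h1, cubeMeasure_eq]
  symm
  refine setIntegral_eq_integral_of_forall_compl_eq_zero fun w hw => hg _ ?_
  by_contra! hlt
  refine hw fun i _ => ?_
  have h2 : ‖w i‖ < R := lt_of_le_of_lt (PiLp.norm_apply_le (WithLp.toLp 2 w) i) hlt
  rw [Real.norm_eq_abs, abs_lt] at h2
  exact ⟨h2.1, h2.2.le⟩

/-- A regular functional commutes with the integral of a smooth family of forms that is cut off
by a compactly supported function. -/
theorem IsRegular.map_integral {S : Form I M →ₗ[ℝ] ℝ} (hS : IsRegular S) {R : ℝ} (hR : 0 ≤ R)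
    {d : ℕ} {f : EuclideanSpace ℝ (Fin d) → ℝ} (hf : ContDiff ℝ ∞ f) (hfR : ∀ x, R ≤ ‖x‖ → f x = 0)
    {Θ : EuclideanSpace ℝ (Fin d) → Form I M} (hΘ : SmoothFamily I (fun t => (Θ t).1)) {A : Form I M}
    (hA : ∀ q k, A.1 q k = ∫ x, f x • (Θ x).1 q k) :
    S A = ∫ x, f x * S (Θ x) := by
  have h1 : ContDiff ℝ ∞ (fun w : Fin d → ℝ => (WithLp.toLp 2 w : EuclideanSpace ℝ (Fin d))) :=
    PiLp.contDiff_toLp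
  have h2 : SmoothFamily I (fun w : Fin d → ℝ => (f (WithLp.toLp 2 w) • Θ (WithLp.toLp 2 w)).1) :=
    SmoothFamily.comp (Φ := fun x => f x • (Θ x).1) (hΘ.smul hf) h1
  rw [hS.map_integral_cube hR h2 (A := A), integral_euclidean_eq_cube (R := R)]
  · simp only [map_smul, smul_eq_mul]
  · intro x hx; rw [hfR x hx, zero_mul]
  · funext q k
    rw [hA, integral_euclidean_eq_cube (R := R)]
    · rfl
    · intro x hx; rw [hfR x hx, zero_smul]

section Smoothness

variable {P : Type} [NormedAddCommGroup P] [NormedSpace ℝ P] [FiniteDimensional ℝ P]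

/-- The derivative of a smooth family, as a family of smooth forms. -/
def SmoothFamily.deriv {Θ : P → Form I M} (hΘ : SmoothFamily I (fun p => (Θ p).1)) (z v : P) :
    Form I M := ⟨Currents.derivForm (fun p => (Θ p).1) z v, hΘ.derivForm.isSmoothForm (z, v)⟩

theorem IsRegular.hasFDerivAt {S : Form I M →ₗ[ℝ] ℝ} (hS : IsRegular S) {Θ : P → Form I M}
    (hΘ : SmoothFamily I (fun p => (Θ p).1)) (z : P) :
    ∃ L : P →L[ℝ] ℝ, (∀ v, L v = S (hΘ.deriv z v)) ∧ HasFDerivAt (fun p => S (Θ p)) L z := by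
  have hfam : SmoothFamily I (fun q : P × P => intForm unitMeasure (fun σ =>
      derivForm (fun p => (Θ p).1) (z + σ • q.1) q.2)) :=
    SmoothFamily.intForm isCompactMeasure_unitMeasure
      (Θ := fun q : (P × P) × ℝ => derivForm (fun p => (Θ p).1) (z + q.2 • q.1.1) q.1.2)
      (SmoothFamily.comp (Φ := fun q : P × P => derivForm (fun p => (Θ p).1) q.1 q.2)
        (g := fun q : (P × P) × ℝ => (z + q.2 • q.1.1, q.1.2)) hΘ.derivForm (by fun_prop))
  set D : P × P → Form I M := fun q => ⟨_, hfam.isSmoothForm q⟩ with hD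
  have hDc : Continuous fun q => S (D q) := hS _ D hfam
  have hcd : ∀ q k, ContDiff ℝ ∞ (fun p => (Θ p).1 q k) := fun q k => hΘ.contDiff_pointwise q k
  have hfc : ∀ (h v : P) (q : M) (k : ℕ), Continuous fun σ : ℝ =>
      fderiv ℝ (fun p => (Θ p).1 q k) (z + σ • h) v := fun h v q k =>
    (((hcd q k).continuous_fderiv (by simp)).comp (by fun_prop)).clm_apply continuous_const
  have hint : ∀ (h v : P) (q : M) (k : ℕ), Integrable (fun σ : ℝ =>
      fderiv ℝ (fun p => (Θ p).1 q k) (z + σ • h) v) unitMeasure := fun h v q k =>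
    isCompactMeasure_unitMeasure.integrable (hfc h v q k)
  have hadd : ∀ h v w, D (h, v + w) = D (h, v) + D (h, w) := by
    intro h v w
    apply Subtype.ext
    funext q k
    change ∫ σ, fderiv ℝ (fun p => (Θ p).1 q k) (z + σ • h) (v + w) ∂unitMeasure =
      (∫ σ, fderiv ℝ (fun p => (Θ p).1 q k) (z + σ • h) v ∂unitMeasure) +
      ∫ σ, fderiv ℝ (fun p => (Θ p).1 q k) (z + σ • h) w ∂unitMeasure
    simp only [map_add]
    exact MeasureTheory.integral_add (hint _ _ _ _) (hint _ _ _ _)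
  have hsmul : ∀ h (c : ℝ) v, D (h, c • v) = c • D (h, v) := by
    intro h c v
    apply Subtype.ext
    funext q k
    change ∫ σ, fderiv ℝ (fun p => (Θ p).1 q k) (z + σ • h) (c • v) ∂unitMeasure =
      c • ∫ σ, fderiv ℝ (fun p => (Θ p).1 q k) (z + σ • h) v ∂unitMeasure
    simp only [map_smul]
    exact MeasureTheory.integral_smul _ _
  let ℓ : P → P →L[ℝ] ℝ := fun h => LinearMap.toContinuousLinearMap
    { toFun := fun v => S (D (h, v))
      map_add' := fun v w => by rw [hadd, map_add]
      map_smul' := fun c v => by rw [hsmul, map_smul]; rfl }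
  have hℓ : ∀ h v, ℓ h v = S (D (h, v)) := fun _ _ => rfl
  have hℓc : Continuous ℓ := by
    rw [continuous_clm_apply]
    intro v
    exact hDc.comp (by fun_prop)
  have hstep : ∀ h, Θ (z + h) = Θ z + D (h, h) := by
    intro h
    apply Subtype.ext
    funext q k
    change (Θ (z + h)).1 q k = (Θ z).1 q k +
      ∫ σ, fderiv ℝ (fun p => (Θ p).1 q k) (z + σ • h) h ∂unitMeasure
    haveI : CompleteSpace (E [⋀^Fin k]→L[ℝ] ℝ) := FiniteDimensional.complete ℝ _
    rw [integral_unitMeasure]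
    have hd : ∀ σ : ℝ, HasDerivAt (fun σ : ℝ => (Θ (z + σ • h)).1 q k)
        (fderiv ℝ (fun p => (Θ p).1 q k) (z + σ • h) h) σ := by
      intro σ
      have h1 : HasFDerivAt (fun p => (Θ p).1 q k) _ (z + σ • h) :=
        ((hcd q k).differentiable (by simp) _).hasFDerivAt
      have h2 : HasDerivAt (fun σ : ℝ => z + σ • h) h σ := by
        simpa using ((hasDerivAt_id σ).smul_const h).const_add z
      exact h1.comp_hasDerivAt σ h2
    have h3 := intervalIntegral.integral_eq_sub_of_hasDerivAt (a := 0) (b := 1)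
      (fun σ _ => hd σ) ((hfc h h q k).intervalIntegrable _ _)
    rw [h3]
    simp
  refine ⟨ℓ 0, fun v => ?_, ?_⟩
  · rw [hℓ]
    congr 1
    apply Subtype.ext
    funext q k
    change ∫ σ, fderiv ℝ (fun p => (Θ p).1 q k) (z + σ • 0) v ∂unitMeasure =
      fderiv ℝ (fun p => (Θ p).1 q k) z v
    simp
  · rw [hasFDerivAt_iff_isLittleO_nhds_zero]
    have h1 : ∀ h, S (Θ (z + h)) - S (Θ z) - ℓ 0 h = (ℓ h - ℓ 0) h := by
      intro h
      rw [hstep, map_add, sub_apply, hℓ h]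
      ring
    simp only [h1]
    have h2 : Tendsto (fun h => ℓ h - ℓ 0) (𝓝 0) (𝓝 0) := by
      have := (hℓc.tendsto 0).sub_const (ℓ 0)
      rwa [sub_self] at this
    rw [Asymptotics.isLittleO_iff]
    intro c hc
    filter_upwards [h2.norm.eventually (gt_mem_nhds (by simpa using hc))] with h hh
    exact ((ℓ h - ℓ 0).le_opNorm h).trans (by gcongr)

/-- A regular functional maps smooth families to smooth functions. -/
theorem IsRegular.contDiff {S : Form I M →ₗ[ℝ] ℝ} (hS : IsRegular S) {Θ : P → Form I M}
    (hΘ : SmoothFamily I (fun p => (Θ p).1)) : ContDiff ℝ ∞ fun p => S (Θ p) := by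
  rw [contDiff_infty]
  intro n
  induction n generalizing Θ with
  | zero => exact contDiff_zero.2 (hS _ Θ hΘ)
  | succ n ih =>
    rw [show ((n + 1 : ℕ) : WithTop ℕ∞) = (n : WithTop ℕ∞) + 1 by norm_cast,
      contDiff_succ_iff_fderiv_apply]
    choose L hL hL' using hS.hasFDerivAt hΘ
    refine ⟨fun z => (hL' z).differentiableAt, fun h => by simp at h, fun v => ?_⟩
    simp only [fun z => (hL' z).fderiv, hL]
    exact ih (SmoothFamily.comp (g := fun z : P => (z, v)) hΘ.derivForm (by fun_prop))

end Smoothness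

end Regular

section Smearing

variable {E : Type*} [NormedAddCommGroup E] [NormedSpace ℝ E]
  {H : Type*} [TopologicalSpace H] {I : ModelWithCorners ℝ E H}
  {M : Type*} [TopologicalSpace M] [ChartedSpace H M]
  {E' : Type*} [NormedAddCommGroup E'] [NormedSpace ℝ E']
  {H' : Type*} [TopologicalSpace H'] {I' : ModelWithCorners ℝ E' H'}
  {M' : Type*} [TopologicalSpace M'] [ChartedSpace H' M']

variable (I M) in
/-- A smooth family of diffeomorphisms `s_x` with `s_0 = id` and `s_x⁻¹ = s_{-x}`, together with an
even bump function on the parameter space. -/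
structure SmearingDatum where
  dim : ℕ
  map : EuclideanSpace ℝ (Fin dim) → M → M
  map_smooth : ContMDiff (𝓘(ℝ, EuclideanSpace ℝ (Fin dim)).prod I) I ∞
    fun z : EuclideanSpace ℝ (Fin dim) × M => map z.1 z.2
  map_zero : ∀ p, map 0 p = p
  map_neg : ∀ x p, map x (map (-x) p) = p
  bump : EuclideanSpace ℝ (Fin dim) → ℝ
  bump_smooth : ContDiff ℝ ∞ bump
  bump_support : ∀ x, 1 ≤ ‖x‖ → bump x = 0
  bump_even : ∀ x, bump (-x) = bump x
  bump_integral : ∫ x, bump x = 1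

/-- The average of the pull-backs of a form along a family of maps, with scaled parameters. -/
def smearRaw {d : ℕ} (I : ModelWithCorners ℝ E H) (s : EuclideanSpace ℝ (Fin d) → M → M)
    (f : EuclideanSpace ℝ (Fin d) → ℝ)
    (ε : ℝ) (α : RawForm E M) : RawForm E M := fun p k =>
  ∫ x, f x • rawPullback I I (s (ε • x)) α p k

/-- Lebesgue measure on the unit ball. -/
def ballMeasure (d : ℕ) : Measure (EuclideanSpace ℝ (Fin d)) :=
  volume.restrict (Metric.closedBall 0 1)

instance (d : ℕ) : IsFiniteMeasure (ballMeasure d) :=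
  isFiniteMeasure_restrict.2 (isCompact_closedBall _ _).measure_lt_top.ne

theorem isCompactMeasure_ballMeasure (d : ℕ) : IsCompactMeasure (ballMeasure d) :=
  ⟨Metric.closedBall 0 1, isCompact_closedBall _ _, by
    rw [ballMeasure, Measure.restrict_apply Metric.isClosed_closedBall.measurableSet.compl,
      compl_inter_self, measure_empty]⟩

theorem integral_ballMeasure {d : ℕ} {F : Type*} [NormedAddCommGroup F] [NormedSpace ℝ F]
    {g : EuclideanSpace ℝ (Fin d) → F} (hg : ∀ x, 1 ≤ ‖x‖ → g x = 0) :
    ∫ x, g x ∂(ballMeasure d) = ∫ x, g x := by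
  refine setIntegral_eq_integral_of_forall_compl_eq_zero fun x hx => hg x ?_
  rw [Metric.mem_closedBall, dist_zero_right, not_le] at hx
  exact hx.le

theorem smearRaw_eq_intForm {d : ℕ} (s : EuclideanSpace ℝ (Fin d) → M → M)
    {f : EuclideanSpace ℝ (Fin d) → ℝ} (hf : ∀ x, 1 ≤ ‖x‖ → f x = 0) (ε : ℝ) (α : RawForm E M) :
    smearRaw I s f ε α =
      intForm (ballMeasure d) (fun x => f x • rawPullback I I (s (ε • x)) α) := by
  funext p k
  exact (integral_ballMeasure fun x hx => by rw [hf x hx, zero_smul]).symm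

namespace SmearingDatum

variable (D : SmearingDatum I M)

theorem neg_map (x : EuclideanSpace ℝ (Fin D.dim)) (p : M) : D.map (-x) (D.map x p) = p := by
  simpa using D.map_neg (-x) p

theorem contMDiff_map {Q : Type*} [NormedAddCommGroup Q] [NormedSpace ℝ Q]
    {g : Q → EuclideanSpace ℝ (Fin D.dim)} (hg : ContDiff ℝ ∞ g) :
    ContMDiff (𝓘(ℝ, Q).prod I) I ∞ (fun q : Q × M => D.map (g q.1) q.2) :=
  D.map_smooth.comp ((hg.contMDiff.comp contMDiff_fst).prodMk contMDiff_snd)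

/-- The diffeomorphisms of the family. -/
def diffeo (x : EuclideanSpace ℝ (Fin D.dim)) : C^∞⟮I, M; I, M⟯ :=
  ⟨D.map x, D.map_smooth.comp (contMDiff_const.prodMk contMDiff_id)⟩

@[simp] theorem diffeo_apply (x : EuclideanSpace ℝ (Fin D.dim)) (p : M) :
    D.diffeo x p = D.map x p := rfl

variable [I.Boundaryless] [IsManifold I ∞ M] [FiniteDimensional ℝ E]

theorem smoothFamily_pullback {Q : Type*} [NormedAddCommGroup Q] [NormedSpace ℝ Q]
    {Φ : Q → RawForm E M} (hΦ : SmoothFamily I Φ)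
    {g : Q → EuclideanSpace ℝ (Fin D.dim)} (hg : ContDiff ℝ ∞ g) :
    SmoothFamily I (fun q => rawPullback I I (D.map (g q)) (Φ q)) :=
  SmoothFamily.pullback (s := fun q => D.map (g q)) (D.contMDiff_map hg) hΦ

theorem smoothFamily_smearRaw {P : Type*} [NormedAddCommGroup P] [NormedSpace ℝ P]
    {Φ : P → RawForm E M} (hΦ : SmoothFamily I Φ) :
    SmoothFamily I (fun q : ℝ × P => smearRaw I D.map D.bump q.1 (Φ q.2)) := by
  simp only [smearRaw_eq_intForm D.map D.bump_support]
  refine SmoothFamily.intForm (isCompactMeasure_ballMeasure _) (Θ := fun q : (ℝ × P) ×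
    EuclideanSpace ℝ (Fin D.dim) => D.bump q.2 • rawPullback I I (D.map (q.1.1 • q.2)) (Φ q.1.2)) ?_
  refine SmoothFamily.smul (c := fun q : (ℝ × P) × EuclideanSpace ℝ (Fin D.dim) => D.bump q.2) ?_
    (D.bump_smooth.comp contDiff_snd)
  exact D.smoothFamily_pullback (Q := (ℝ × P) × EuclideanSpace ℝ (Fin D.dim))
    (Φ := fun q => Φ q.1.2) (g := fun q => q.1.1 • q.2)
    (hΦ.comp (by fun_prop)) (by fun_prop)

theorem smoothFamily_smearRaw_of {P : Type*} [NormedAddCommGroup P] [NormedSpace ℝ P]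
    {Φ : P → RawForm E M} (hΦ : SmoothFamily I Φ) {ε : P → ℝ} (hε : ContDiff ℝ ∞ ε) :
    SmoothFamily I (fun q : P => smearRaw I D.map D.bump (ε q) (Φ q)) :=
  SmoothFamily.comp (Φ := fun q : ℝ × P => smearRaw I D.map D.bump q.1 (Φ q.2))
    (g := fun q => (ε q, q)) (D.smoothFamily_smearRaw hΦ) (hε.prodMk contDiff_id)

theorem isSmoothForm_smearRaw (ε : ℝ) {α : RawForm E M} (hα : IsSmoothForm I α) :
    IsSmoothForm I (smearRaw I D.map D.bump ε α) :=
  (D.smoothFamily_smearRaw (SmoothFamily.const (P := ℝ) hα)).isSmoothForm (ε, 0)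

theorem integrable_smear (ε : ℝ) {α : RawForm E M} (hα : IsSmoothForm I α) (p : M) (k : ℕ) :
    Integrable (fun x => D.bump x • rawPullback I I (D.map (ε • x)) α p k) := by
  have h1 : SmoothFamily I (fun x => D.bump x • rawPullback I I (D.map (ε • x)) α) :=
    (D.smoothFamily_pullback (SmoothFamily.const hα) (by fun_prop)).smul D.bump_smooth
  refine (h1.contDiff_pointwise p k).continuous.integrable_of_hasCompactSupport
    (HasCompactSupport.of_support_subset_isCompact (isCompact_closedBall 0 1) fun x hx => ?_)
  rw [Metric.mem_closedBall, dist_zero_right]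
  by_contra! h
  refine hx ?_
  change D.bump x • rawPullback I I (D.map (ε • x)) α p k = 0
  rw [D.bump_support x h.le, zero_smul]

/-- The smearing operator on smooth forms. -/
def op (ε : ℝ) : Form I M →ₗ[ℝ] Form I M where
  toFun φ := ⟨smearRaw I D.map D.bump ε φ.1, D.isSmoothForm_smearRaw ε φ.2⟩
  map_add' φ ψ := by
    refine Subtype.ext (funext fun p => funext fun k => ?_)
    change ∫ x, D.bump x • rawPullback I I (D.map (ε • x)) (φ.1 + ψ.1) p k =
      (∫ x, D.bump x • rawPullback I I (D.map (ε • x)) φ.1 p k) +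
      ∫ x, D.bump x • rawPullback I I (D.map (ε • x)) ψ.1 p k
    rw [← MeasureTheory.integral_add (D.integrable_smear ε φ.2 p k)
      (D.integrable_smear ε ψ.2 p k)]
    refine integral_congr_ae (ae_of_all _ fun x => ?_)
    exact smul_add (D.bump x) (rawPullback I I (D.map (ε • x)) φ.1 p k)
      (rawPullback I I (D.map (ε • x)) ψ.1 p k)
  map_smul' c φ := by
    refine Subtype.ext (funext fun p => funext fun k => ?_)
    change ∫ x, D.bump x • rawPullback I I (D.map (ε • x)) (c • φ.1) p k =
      c • ∫ x, D.bump x • rawPullback I I (D.map (ε • x)) φ.1 p k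
    rw [← MeasureTheory.integral_smul]
    refine integral_congr_ae (ae_of_all _ fun x => ?_)
    exact smul_comm (D.bump x) c (rawPullback I I (D.map (ε • x)) φ.1 p k)

theorem op_val (ε : ℝ) (φ : Form I M) : (D.op ε φ).1 = smearRaw I D.map D.bump ε φ.1 := rfl

theorem smear_eq_op {ε : ℝ} (hε : 0 < ε) (φ : Form I M) :
    smear D.map D.bump ε φ = D.op ε φ := by
  have key : (fun p k => ∫ x, ((ε ^ D.dim)⁻¹ * D.bump (ε⁻¹ • x)) • rawPullback I I (D.map x) φ.1 p k :
      RawForm E M) = smearRaw I D.map D.bump ε φ.1 := by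
    funext p k
    have h1 := Measure.integral_comp_smul volume
      (fun x => D.bump x • rawPullback I I (D.map (ε • x)) φ.1 p k) ε⁻¹
    rw [finrank_euclideanSpace_fin, inv_pow, inv_inv, abs_of_pos (by positivity)] at h1
    simp only [smul_inv_smul₀ hε.ne'] at h1
    simp only [mul_smul]
    rw [MeasureTheory.integral_smul, h1, inv_smul_smul₀ (by positivity)]
    rfl
  have h2 := D.isSmoothForm_smearRaw ε φ.2
  refine Subtype.ext ?_
  rw [op_val, ← key, smear, dif_pos]
  rw [key]
  exact h2

theorem smearRaw_const_id {d : ℕ} {f : EuclideanSpace ℝ (Fin d) → ℝ} (hf : ∫ x, f x = 1) (ε : ℝ)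
    (α : RawForm E M) : smearRaw I (fun _ p => p) f ε α = α := by
  funext p k
  have h1 := congrFun (congrFun (rawPullback_id (I := I) α) p) k
  simp only [smearRaw]
  rw [h1]
  haveI : CompleteSpace (E [⋀^Fin k]→L[ℝ] ℝ) := FiniteDimensional.complete ℝ _
  rw [integral_smul_const, hf, one_smul]

theorem op_zero (φ : Form I M) : D.op 0 φ = φ := by
  refine Subtype.ext ?_
  rw [op_val]
  have : smearRaw I D.map D.bump 0 φ.1 = smearRaw I (fun _ p => p) D.bump 0 φ.1 := by
    funext p k
    simp only [smearRaw, zero_smul]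
    rw [show D.map 0 = fun p => p from funext D.map_zero]
  rw [this, smearRaw_const_id D.bump_integral]

/-- A regular functional of a smeared form is an average. -/
theorem map_op {S : Form I M →ₗ[ℝ] ℝ} (hS : IsRegular S) (ε : ℝ) (φ : Form I M) :
    S (D.op ε φ) = ∫ x, D.bump x * S (pullback I I (D.diffeo (ε • x)) φ) :=
  hS.map_integral zero_le_one D.bump_smooth D.bump_support
    (Θ := fun x => pullback I I (D.diffeo (ε • x)) φ)
    (D.smoothFamily_pullback (SmoothFamily.const φ.2) (by fun_prop)) fun _ _ => rfl

end SmearingDatum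

variable [I.Boundaryless] [IsManifold I ∞ M] [FiniteDimensional ℝ E]
  [I'.Boundaryless] [IsManifold I' ∞ M'] [FiniteDimensional ℝ E']

/-- Smearing is compatible with pull-backs along maps that intertwine the families. -/
theorem rawPullback_smearRaw {d : ℕ} {s : EuclideanSpace ℝ (Fin d) → M → M}
    {s' : EuclideanSpace ℝ (Fin d) → M' → M'} {f : EuclideanSpace ℝ (Fin d) → ℝ} {ε : ℝ}
    {π : M → M'} (hπ : ContMDiff I I' ∞ π) (hs : ∀ x, ContMDiff I I ∞ (s x))
    (hs' : ∀ x, ContMDiff I' I' ∞ (s' x)) (h : ∀ x p, π (s x p) = s' x (π p)) {α : RawForm E' M'}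
    (hα : ∀ p k, Integrable (fun x => f x • rawPullback I' I' (s' (ε • x)) α p k)) :
    rawPullback I I' π (smearRaw I' s' f ε α) = smearRaw I s f ε (rawPullback I I' π α) := by
  funext p k
  let L : (E' [⋀^Fin k]→L[ℝ] ℝ) →L[ℝ] (E [⋀^Fin k]→L[ℝ] ℝ) :=
    ContinuousAlternatingMap.compContinuousLinearMapCLM (diffAt I I' π p)
  haveI : CompleteSpace (E' [⋀^Fin k]→L[ℝ] ℝ) := FiniteDimensional.complete ℝ _
  haveI : CompleteSpace (E [⋀^Fin k]→L[ℝ] ℝ) := FiniteDimensional.complete ℝ _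
  have h1 := L.integral_comp_comm (hα (π p) k)
  have h2 : rawPullback I I' π (smearRaw I' s' f ε α) p k =
    L (∫ x, f x • rawPullback I' I' (s' (ε • x)) α (π p) k) := rfl
  rw [h2, ← h1]
  refine integral_congr_ae (ae_of_all _ fun x => ?_)
  have h3 := rawPullback_comp (hs (ε • x)) hπ α
  have h4 := rawPullback_comp hπ (hs' (ε • x)) α
  simp only [h] at h3
  change _ = f x • rawPullback I I (s (ε • x)) (rawPullback I I' π α) p k
  rw [h3, ← h4]
  rfl

end Smearing

section RegularIntegral

variable {E : Type*} [NormedAddCommGroup E] [NormedSpace ℝ E] [NormedSpace ℂ E]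
  [IsScalarTower ℝ ℂ E] [FiniteDimensional ℂ E] [FiniteDimensional ℝ E]
  {H : Type*} [TopologicalSpace H] {I : ModelWithCorners ℝ E H} [I.Boundaryless]
  {M : Type*} [TopologicalSpace M] [ChartedSpace H M] [T2Space M] [CompactSpace M]
  [IsManifold I ∞ M]

theorem TendstoZero.integral_tendsto_zero {φ : ℕ → Form I M} (h : TendstoZero I φ) :
    Tendsto (fun n => integral I (φ n)) atTop (𝓝 0) := by
  refine Currents.integral_tendsto_zero fun x K hK hKt => ?_
  have h1 := h x _ (complexFrame E) 0 K hK hKt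
  rw [Metric.tendstoUniformlyOn_iff] at h1 ⊢
  intro ε hε
  filter_upwards [h1 ε hε] with n hn y hy
  have := hn y hy
  rwa [Pi.zero_apply, dist_zero_left, norm_iteratedFDeriv_zero, ← dist_zero_left] at this

variable (I M) in
theorem isRegular_integral : IsRegular (integralLM I M) :=
  isRegular_of_tendsto fun _ h => h.integral_tendsto_zero

theorem IsRegular.comp {E' : Type*} [NormedAddCommGroup E'] [NormedSpace ℝ E']
    {H' : Type*} [TopologicalSpace H'] {I' : ModelWithCorners ℝ E' H'}
    {M' : Type*} [TopologicalSpace M'] [ChartedSpace H' M']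
    {S : Form I M →ₗ[ℝ] ℝ} (hS : IsRegular S) {L : Form I' M' →ₗ[ℝ] Form I M}
    (hL : ∀ (P : Type) [NormedAddCommGroup P] [NormedSpace ℝ P] (Φ : P → Form I' M'),
      SmoothFamily I' (fun p => (Φ p).1) → SmoothFamily I (fun p => (L (Φ p)).1)) :
    IsRegular (S.comp L) := fun P _ _ Φ hΦ => hS P (fun p => L (Φ p)) (hL P Φ hΦ)

theorem isRegular_integral_wedge_right (α : Form I M) :
    IsRegular ((integralLM I M).comp (wedgeLM I α)) :=
  (isRegular_integral I M).comp fun _ _ _ _ hΦ => SmoothFamily.wedge (SmoothFamily.const α.2) hΦ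

theorem isRegular_integral_wedge_left (α : Form I M) :
    IsRegular ((integralLM I M).comp ((wedgeLM I).flip α)) :=
  (isRegular_integral I M).comp fun _ _ _ _ hΦ => SmoothFamily.wedge hΦ (SmoothFamily.const α.2)

variable [PositiveAtlas I M]

/-- The Jacobian determinants in a connected family of diffeomorphisms are positive. -/
theorem SmearingDatum.det_pos (D : SmearingDatum I M) (y : EuclideanSpace ℝ (Fin D.dim)) (x x' : M)
    {z : E} (hz : z ∈ (extChartAt I x).target)
    (hz' : D.map y ((extChartAt I x).symm z) ∈ (extChartAt I x').source) :
    0 < (fderiv ℝ (fun w => extChartAt I x' (D.map y ((extChartAt I x).symm w))) z).det := by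
  set e := extChartAt I x with he
  have hec := isChart_extChartAt I x
  set J : ℝ → M → ℝ := fun t x' =>
    (fderiv ℝ (fun w => extChartAt I x' (D.map (t • y) (e.symm w))) z).det with hJ
  set N : ℝ → M := fun t => D.map (t • y) (e.symm z) with hN
  have hNc : Continuous N := D.map_smooth.continuous.comp
    ((continuous_id.smul continuous_const).prodMk continuous_const)
  have hsm : ∀ t x', N t ∈ (extChartAt I x').source → ContDiffAt ℝ ∞
      (fun q : ℝ × E => extChartAt I x' (D.map (q.1 • y) (e.symm q.2))) (t, z) := by
    intro t x' ht
    rw [← contMDiffAt_iff_contDiffAt]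
    have h1 : ContMDiffAt 𝓘(ℝ, ℝ × E) I ∞
        (fun q : ℝ × E => D.map (q.1 • y) (e.symm q.2)) (t, z) := by
      have h2 := (D.contMDiff_map (g := fun t : ℝ => t • y) (by fun_prop)).contMDiffAt
        (x := (t, e.symm z))
      have h4 : ContMDiffAt 𝓘(ℝ, ℝ × E) 𝓘(ℝ, ℝ) ∞ (Prod.fst : ℝ × E → ℝ) (t, z) :=
        contDiff_fst.contMDiff.contMDiffAt
      have h5 : ContMDiffAt 𝓘(ℝ, ℝ × E) 𝓘(ℝ, E) ∞ (Prod.snd : ℝ × E → E) (t, z) :=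
        contDiff_snd.contMDiff.contMDiffAt
      have h3 : ContMDiffAt 𝓘(ℝ, ℝ × E) I ∞ (fun q : ℝ × E => e.symm q.2) (t, z) :=
        (hec.contMDiffAt_symm hz).comp (t, z) h5
      exact ContMDiffAt.comp (t, z) (g := fun q : ℝ × M => D.map (q.1 • y) q.2)
        (f := fun q : ℝ × E => (q.1, e.symm q.2)) h2 (h4.prodMk h3)
    exact ContMDiffAt.comp (t, z) (g := extChartAt I x')
      ((isChart_extChartAt I x').contMDiffAt ht) h1
  -- continuity of the determinant in a fixed chart
  have hcont : ∀ t x', N t ∈ (extChartAt I x').source → ContinuousAt (fun t => J t x') t := by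
    intro t x' ht
    have h0 := hsm t x' ht
    have h1 : ContinuousAt (fun q : ℝ × E => (fderiv ℝ (fun q : ℝ × E =>
        extChartAt I x' (D.map (q.1 • y) (e.symm q.2))) q).comp
          (ContinuousLinearMap.inr ℝ ℝ E)) (t, z) := by
      have := (h0.fderiv_right (m := 0) (by simp)).continuousAt
      exact this.clm_comp continuousAt_const
    have h2 : ContinuousAt (fun t : ℝ => (t, z)) t := by fun_prop
    have h3 := ContinuousAt.comp (f := fun t : ℝ => (t, z)) h1 h2
    have h4 : ∀ᶠ t' in 𝓝 t, N t' ∈ (extChartAt I x').source :=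
      hNc.continuousAt.preimage_mem_nhds ((isOpen_extChartAt_source x').mem_nhds ht)
    refine (ContinuousLinearMap.continuous_det.continuousAt.comp h3).congr ?_
    filter_upwards [h4] with t' ht'
    have h5 := HasFDerivAt.comp (f := fun w : E => (t', w)) z
      ((hsm t' x' ht').differentiableAt (by simp)).hasFDerivAt (hasFDerivAt_prodMk_right t' z)
    have h6 : fderiv ℝ (fun w => extChartAt I x' (D.map (t' • y) (e.symm w))) z = _ := h5.fderiv
    change ContinuousLinearMap.det _ = (fderiv ℝ (fun w => extChartAt I x' (D.map (t' • y) (e.symm w))) z).det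
    rw [h6]
    rfl
  -- the determinant does not vanish
  have hne : ∀ t x', N t ∈ (extChartAt I x').source → J t x' ≠ 0 := by
    intro t x' ht
    have hcc := isChart_extChartAt I x'
    have hf : DifferentiableAt ℝ (fun w => extChartAt I x' (D.map (t • y) (e.symm w))) z := by
      have := ContDiffAt.comp (f := fun w : E => (t, w)) z (hsm t x' ht)
        (contDiffAt_const.prodMk contDiffAt_id)
      exact this.differentiableAt (by simp)
    have hg : DifferentiableAt ℝ (fun w => e (D.map (-(t • y)) ((extChartAt I x').symm w)))
        (extChartAt I x' (N t)) := by
      have h1 : ContMDiffAt 𝓘(ℝ, E) I ∞ (fun w => D.map (-(t • y)) ((extChartAt I x').symm w))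
          (extChartAt I x' (N t)) :=
        (D.diffeo (-(t • y))).contMDiff.contMDiffAt.comp _
          (hcc.contMDiffAt_symm ((extChartAt I x').map_source ht))
      have h2 : D.map (-(t • y)) ((extChartAt I x').symm (extChartAt I x' (N t))) = e.symm z := by
        rw [(extChartAt I x').left_inv ht]
        exact D.neg_map _ _
      have h3 : ContMDiffAt 𝓘(ℝ, E) 𝓘(ℝ, E) ∞
          (fun w => e (D.map (-(t • y)) ((extChartAt I x').symm w))) (extChartAt I x' (N t)) := by
        refine ContMDiffAt.comp _ (g := e) ?_ h1
        rw [h2]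
        exact hec.contMDiffAt (e.map_target hz)
      exact (contMDiffAt_iff_contDiffAt.1 h3).differentiableAt (by simp)
    have hcomp := HasFDerivAt.comp z hg.hasFDerivAt hf.hasFDerivAt
    have hid : ((fun w => e (D.map (-(t • y)) ((extChartAt I x').symm w))) ∘
        fun w => extChartAt I x' (D.map (t • y) (e.symm w))) =ᶠ[𝓝 z] id := by
      have h4 : ContinuousAt (fun w => D.map (t • y) (e.symm w)) z :=
        ((D.diffeo (t • y)).contMDiff.continuous.continuousAt).comp
          (hec.contMDiffAt_symm hz).continuousAt
      filter_upwards [h4.preimage_mem_nhds ((isOpen_extChartAt_source x').mem_nhds ht),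
        hec.open_target.mem_nhds hz] with w hw hw'
      have h5 : (extChartAt I x').symm (extChartAt I x' (D.map (t • y) (e.symm w))) = _ :=
        (extChartAt I x').left_inv hw
      simp only [Function.comp, id]
      rw [h5, D.neg_map, e.right_inv hw']
    have h6 := (hcomp.congr_of_eventuallyEq hid.symm).unique (hasFDerivAt_id z)
    intro h0
    have h7 : (fderiv ℝ (fun w => e (D.map (-(t • y)) ((extChartAt I x').symm w)))
        (extChartAt I x' (N t))).det * J t x' = 1 := by
      have := congrArg ContinuousLinearMap.det h6
      rw [ContinuousLinearMap.det, ContinuousLinearMap.toLinearMap_comp, LinearMap.det_comp] at this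
      rw [ContinuousLinearMap.det, hJ]
      refine this.trans ?_
      simp [ContinuousLinearMap.det]
    rw [h0, mul_zero] at h7
    exact zero_ne_one h7
  -- independence of the chart
  have hind : ∀ t x₁ x₂, N t ∈ (extChartAt I x₁).source → N t ∈ (extChartAt I x₂).source →
      0 < J t x₁ → 0 < J t x₂ := by
    intro t x₁ x₂ h1 h2 hpos
    have hf : DifferentiableAt ℝ (fun w => extChartAt I x₁ (D.map (t • y) (e.symm w))) z := by
      have := ContDiffAt.comp (f := fun w : E => (t, w)) z (hsm t x₁ h1)
        (contDiffAt_const.prodMk contDiffAt_id)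
      exact this.differentiableAt (by simp)
    have hz1 := (extChartAt I x₁).map_source h1
    have hz2 : (extChartAt I x₁).symm (extChartAt I x₁ (N t)) ∈ (extChartAt I x₂).source := by
      rw [(extChartAt I x₁).left_inv h1]; exact h2
    have hg := (contDiffAt_chart_change (isChart_extChartAt I x₁) (isChart_extChartAt I x₂) hz1
      hz2).differentiableAt (by simp)
    have hcomp := HasFDerivAt.comp z hg.hasFDerivAt hf.hasFDerivAt
    have h4 : ContinuousAt (fun w => D.map (t • y) (e.symm w)) z :=
      ((D.diffeo (t • y)).contMDiff.continuous.continuousAt).comp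
        (hec.contMDiffAt_symm hz).continuousAt
    have hid : (fun w => extChartAt I x₂ (D.map (t • y) (e.symm w))) =ᶠ[𝓝 z]
        ((fun w => extChartAt I x₂ ((extChartAt I x₁).symm w)) ∘
          fun w => extChartAt I x₁ (D.map (t • y) (e.symm w))) := by
      filter_upwards [h4.preimage_mem_nhds ((isOpen_extChartAt_source x₁).mem_nhds h1)] with w hw
      have h5 : (extChartAt I x₁).symm (extChartAt I x₁ (D.map (t • y) (e.symm w))) = _ :=
        (extChartAt I x₁).left_inv hw
      simp only [Function.comp]
      rw [h5]
    have h6 : J t x₂ = (fderiv ℝ (fun w => extChartAt I x₂ ((extChartAt I x₁).symm w))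
        (extChartAt I x₁ (N t))).det * J t x₁ := by
      rw [hJ]
      simp only
      rw [(hcomp.congr_of_eventuallyEq hid).fderiv, ContinuousLinearMap.det,
        ContinuousLinearMap.toLinearMap_comp, LinearMap.det_comp]
    rw [h6]
    exact mul_pos (PositiveAtlas.det_pos x₁ x₂ _ hz1 hz2) hpos
  set A : Set ℝ := {t | 0 < J t (N t)} with hA
  have hmem : ∀ t, N t ∈ (extChartAt I (N t)).source := fun t => mem_extChartAt_source _
  have hnear : ∀ t, ∀ᶠ t' in 𝓝 t, N t' ∈ (extChartAt I (N t)).source := fun t =>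
    hNc.continuousAt.preimage_mem_nhds ((isOpen_extChartAt_source _).mem_nhds (hmem t))
  have hclopen : IsClopen A := by
    refine ⟨⟨?_⟩, ?_⟩
    · rw [isOpen_iff_mem_nhds]
      intro t ht
      have h1 : J t (N t) < 0 := lt_of_le_of_ne (not_lt.1 ht) (hne _ _ (hmem t))
      filter_upwards [(hcont t _ (hmem t)).eventually (gt_mem_nhds h1), hnear t] with t' h2 h3 h4
      exact lt_asymm h2 (hind t' _ _ (hmem t') h3 h4)
    · rw [isOpen_iff_mem_nhds]
      intro t ht
      filter_upwards [(hcont t _ (hmem t)).eventually (lt_mem_nhds ht), hnear t] with t' h2 h3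
      exact hind t' _ _ h3 (hmem t') h2
  have h0 : (0 : ℝ) ∈ A := by
    have hN0 : N 0 = e.symm z := by simp only [hN, zero_smul]; exact D.map_zero _
    refine hind 0 x (N 0) (hN0 ▸ e.map_target hz) (hmem 0) ?_
    have h1 : (fun w => extChartAt I x (D.map ((0 : ℝ) • y) (e.symm w))) =ᶠ[𝓝 z] id := by
      filter_upwards [hec.open_target.mem_nhds hz] with w hw
      rw [zero_smul, D.map_zero]
      exact e.right_inv hw
    rw [hJ]
    simp only
    rw [h1.fderiv_eq, fderiv_id]
    simp [ContinuousLinearMap.det]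
  have h1 : (1 : ℝ) ∈ A := by
    rw [hclopen.eq_univ ⟨0, h0⟩]; trivial
  have h2 := hind 1 (N 1) x' (hmem 1) (by simpa [hN] using hz') h1
  simpa [hJ] using h2

namespace SmearingDatum

variable (D : SmearingDatum I M)

theorem integral_pullback (y : EuclideanSpace ℝ (Fin D.dim)) (α : Form I M) :
    integral I (pullback I I (D.diffeo y) α) = integral I α :=
  integral_pullback_diffeo (D.diffeo y) (D.diffeo (-y)) (D.map_neg y) (D.neg_map y)
    (fun x x' _ hz hz' => D.det_pos (-y) x x' hz hz') α

theorem pullback_neg_pullback (y : EuclideanSpace ℝ (Fin D.dim)) (α : Form I M) :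
    pullback I I (D.diffeo (-y)) (pullback I I (D.diffeo y) α) = α := by
  refine Subtype.ext ?_
  have h1 := rawPullback_comp (D.diffeo (-y)).contMDiff (D.diffeo y).contMDiff α.1
  refine h1.trans ?_
  simp only [diffeo_apply, D.map_neg]
  exact rawPullback_id I α.1

/-- The smearing operators are self-adjoint for the pairing of forms. -/
theorem integral_wedge_op (ε : ℝ) (α φ : Form I M) :
    integral I (wedge I α (D.op ε φ)) = integral I (wedge I (D.op ε α) φ) := by
  have h1 : integral I (wedge I α (D.op ε φ)) = _ :=
    D.map_op (isRegular_integral_wedge_right α) ε φ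
  have h2 : integral I (wedge I (D.op ε α) φ) = _ :=
    D.map_op (isRegular_integral_wedge_left φ) ε α
  rw [h1, h2, ← integral_neg_eq_self]
  refine integral_congr_ae (ae_of_all _ fun x => ?_)
  simp only [D.bump_even]
  congr 1
  change integral I (wedge I α (pullback I I (D.diffeo (ε • -x)) φ)) =
    integral I (wedge I (pullback I I (D.diffeo (ε • x)) α) φ)
  rw [← D.integral_pullback (ε • x), pullback_wedge]
  congr 2
  have := D.pullback_neg_pullback (-(ε • x)) φ
  rwa [neg_neg, ← smul_neg] at this

end SmearingDatum

end RegularIntegral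

section Chains

variable {E : Type*} [NormedAddCommGroup E] [NormedSpace ℝ E]
  {H : Type*} [TopologicalSpace H] {I : ModelWithCorners ℝ E H}
  {M : Type*} [TopologicalSpace M] [ChartedSpace H M]
  {E' : Type*} [NormedAddCommGroup E'] [NormedSpace ℝ E']
  {H' : Type*} [TopologicalSpace H'] {I' : ModelWithCorners ℝ E' H'}
  {M' : Type*} [TopologicalSpace M'] [ChartedSpace H' M']

theorem translate_of_notMem {d : ℕ} (h : OpenPartialHomeomorph M (EuclideanSpace ℝ (Fin d)))
    (x : EuclideanSpace ℝ (Fin d)) {p : M} (hp : p ∉ h.source) : translate h x p = p := by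
  rw [translate, if_neg hp]

theorem translate_of_mem {d : ℕ} (h : OpenPartialHomeomorph M (EuclideanSpace ℝ (Fin d)))
    (x : EuclideanSpace ℝ (Fin d)) {p : M} (hp : p ∈ h.source) :
    translate h x p = h.symm (h p + x) := by
  rw [translate, if_pos hp]

/-- The translations in a ball, with the bump function. -/
def SmoothingChart.datum (c : SmoothingChart I M) : SmearingDatum I M where
  dim := finrank ℝ E
  map := translate c.ball
  map_smooth := c.translate_smooth
  map_zero p := by
    by_cases hp : p ∈ c.ball.source
    · rw [translate_of_mem _ _ hp, add_zero, c.ball.left_inv hp]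
    · rw [translate_of_notMem _ _ hp]
  map_neg x p := by
    by_cases hp : p ∈ c.ball.source
    · have h1 : c.ball p + -x ∈ c.ball.target := by rw [c.ball_target]; trivial
      rw [translate_of_mem _ _ hp, translate_of_mem _ _ (c.ball.map_target h1),
        c.ball.right_inv h1, neg_add_cancel_right, c.ball.left_inv hp]
    · rw [translate_of_notMem _ _ hp, translate_of_notMem _ _ hp]
  bump := c.bump
  bump_smooth := c.bump_smooth
  bump_support := c.bump_support
  bump_even := c.bump_even
  bump_integral := c.bump_integral

variable (M' I') in
/-- A smearing datum acting on the first factor of a product. -/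
def SmearingDatum.onLeft (D : SmearingDatum I M) : SmearingDatum (I.prod I') (M × M') where
  dim := D.dim
  map x z := (D.map x z.1, z.2)
  map_smooth := (D.map_smooth.comp (contMDiff_fst.prodMk
    (contMDiff_fst.comp contMDiff_snd))).prodMk (contMDiff_snd.comp contMDiff_snd)
  map_zero p := by rw [D.map_zero]
  map_neg x p := by rw [D.map_neg]
  bump := D.bump
  bump_smooth := D.bump_smooth
  bump_support := D.bump_support
  bump_even := D.bump_even
  bump_integral := D.bump_integral

variable (M I) in
/-- A smearing datum acting on the second factor of a product. -/
def SmearingDatum.onRight (D : SmearingDatum I' M') : SmearingDatum (I.prod I') (M × M') where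
  dim := D.dim
  map x z := (z.1, D.map x z.2)
  map_smooth := (contMDiff_fst.comp contMDiff_snd).prodMk (D.map_smooth.comp (contMDiff_fst.prodMk
    (contMDiff_snd.comp contMDiff_snd)))
  map_zero p := by rw [D.map_zero]
  map_neg x p := by rw [D.map_neg]
  bump := D.bump
  bump_smooth := D.bump_smooth
  bump_support := D.bump_support
  bump_even := D.bump_even
  bump_integral := D.bump_integral

variable [I.Boundaryless] [IsManifold I ∞ M] [FiniteDimensional ℝ E]
  [I'.Boundaryless] [IsManifold I' ∞ M'] [FiniteDimensional ℝ E']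

/-- Successive application of smearing operators. -/
def smearChain (l : List (SmearingDatum I M)) (ε : ℝ) (φ : Form I M) : Form I M :=
  l.foldl (fun φ D => D.op ε φ) φ

theorem smearChain_add (l : List (SmearingDatum I M)) (ε : ℝ) (φ ψ : Form I M) :
    smearChain l ε (φ + ψ) = smearChain l ε φ + smearChain l ε ψ := by
  induction l generalizing φ ψ with
  | nil => rfl
  | cons D l ih =>
    change smearChain l ε (D.op ε (φ + ψ)) = smearChain l ε (D.op ε φ) + smearChain l ε (D.op ε ψ)
    rw [map_add, ih]

theorem smearChain_smul (l : List (SmearingDatum I M)) (ε c : ℝ) (φ : Form I M) :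
    smearChain l ε (c • φ) = c • smearChain l ε φ := by
  induction l generalizing φ with
  | nil => rfl
  | cons D l ih =>
    change smearChain l ε (D.op ε (c • φ)) = c • smearChain l ε (D.op ε φ)
    rw [map_smul, ih]

theorem smearChain_smoothFamily (l : List (SmearingDatum I M)) {P : Type*} [NormedAddCommGroup P]
    [NormedSpace ℝ P] {Φ : P → Form I M} (hΦ : SmoothFamily I (fun p => (Φ p).1)) {ε : P → ℝ}
    (hε : ContDiff ℝ ∞ ε) : SmoothFamily I (fun p => (smearChain l (ε p) (Φ p)).1) := by
  induction l generalizing Φ with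
  | nil => exact hΦ
  | cons D l ih => exact ih (Φ := fun p => D.op (ε p) (Φ p)) (D.smoothFamily_smearRaw_of hΦ hε)

theorem smearChain_zero (l : List (SmearingDatum I M)) (φ : Form I M) : smearChain l 0 φ = φ := by
  induction l generalizing φ with
  | nil => rfl
  | cons D l ih =>
    change smearChain l 0 (D.op 0 φ) = φ
    rw [D.op_zero, ih]

/-- Regular functionals of smeared forms converge. -/
theorem IsRegular.tendsto_smearChain {S : Form I M →ₗ[ℝ] ℝ} (hS : IsRegular S)
    (l : List (SmearingDatum I M)) (φ : Form I M) :
    Tendsto (fun ε => S (smearChain l ε φ)) (𝓝[>] 0) (𝓝 (S φ)) := by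
  have h1 : Continuous fun ε : ℝ => S (smearChain l ε φ) :=
    hS ℝ (fun ε => smearChain l ε φ)
      (smearChain_smoothFamily l (SmoothFamily.const φ.2) contDiff_id)
  have h2 := h1.tendsto 0
  rw [smearChain_zero] at h2
  exact h2.mono_left nhdsWithin_le_nhds

theorem foldl_smear_eq {ι : Type*} (D : ι → SmearingDatum I M) (l : List ι) {ε : ℝ} (hε : 0 < ε)
    (φ : Form I M) : l.foldl (fun φ c => smear (D c).map (D c).bump ε φ) φ =
      smearChain (l.map D) ε φ := by
  rw [smearChain, List.foldl_map]
  congr 1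
  funext φ c
  exact (D c).smear_eq_op hε φ

theorem DeRhamData.smooth_eq (𝒰 : DeRhamData I M) {ε : ℝ} (hε : 0 < ε) (φ : Form I M) :
    𝒰.smooth ε φ = smearChain (𝒰.charts.map SmoothingChart.datum) ε φ :=
  foldl_smear_eq SmoothingChart.datum 𝒰.charts hε φ

theorem smearChain_append (l l' : List (SmearingDatum I M)) (ε : ℝ) (φ : Form I M) :
    smearChain (l ++ l') ε φ = smearChain l' ε (smearChain l ε φ) := List.foldl_append

theorem DeRhamData.prodSmooth_eq (𝒰 : DeRhamData I M) (𝒱 : DeRhamData I' M') {ε : ℝ}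
    (hε : 0 < ε) (φ : Form (I.prod I') (M × M')) :
    𝒰.prodSmooth 𝒱 ε φ = smearChain (𝒰.charts.map (fun c => c.datum.onLeft I' M') ++
      𝒱.charts.map (fun c => c.datum.onRight I M)) ε φ := by
  rw [smearChain_append, ← foldl_smear_eq _ _ hε, ← foldl_smear_eq _ _ hε]
  rfl

variable (D : SmearingDatum I M) (D' : SmearingDatum I' M')

theorem pullback_fst_op (ε : ℝ) (η : Form I M) :
    pullback (I.prod I') I (ContMDiffMap.fst : C^∞⟮I.prod I', M × M'; I, M⟯) (D.op ε η) =
      (D.onLeft I' M').op ε (pullback (I.prod I') I ContMDiffMap.fst η) :=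
  Subtype.ext (rawPullback_smearRaw contMDiff_fst (fun x => ((D.onLeft I' M').diffeo x).contMDiff)
    (fun x => (D.diffeo x).contMDiff) (fun _ _ => rfl) (D.integrable_smear ε η.2))

theorem pullback_snd_op (ε : ℝ) (η : Form I' M') :
    pullback (I.prod I') I' (ContMDiffMap.snd : C^∞⟮I.prod I', M × M'; I', M'⟯) (D'.op ε η) =
      (D'.onRight I M).op ε (pullback (I.prod I') I' ContMDiffMap.snd η) :=
  Subtype.ext (rawPullback_smearRaw contMDiff_snd (fun x => ((D'.onRight I M).diffeo x).contMDiff)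
    (fun x => (D'.diffeo x).contMDiff) (fun _ _ => rfl) (D'.integrable_smear ε η.2))

/-- Smearing does not change the pull-back of a form along a map that is constant on the orbits. -/
theorem SmearingDatum.op_pullback (π : C^∞⟮I, M; I', M'⟯) (h : ∀ x p, π (D.map x p) = π p) (ε : ℝ)
    (η : Form I' M') : D.op ε (pullback I I' π η) = pullback I I' π η := by
  refine Subtype.ext ?_
  have h1 := rawPullback_smearRaw (s := D.map) (s' := fun _ p => p) (f := D.bump) (ε := ε)
    (α := η.1) π.contMDiff (fun x => (D.diffeo x).contMDiff) (fun x => contMDiff_id)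
    h (fun p k => by
      have h2 := congrFun (congrFun (rawPullback_id (I := I') η.1) p) k
      rw [h2]
      refine Integrable.smul_const ?_ _
      exact D.bump_smooth.continuous.integrable_of_hasCompactSupport
        (HasCompactSupport.of_support_subset_isCompact (isCompact_closedBall 0 1) fun x hx => by
          rw [Metric.mem_closedBall, dist_zero_right]
          by_contra! hlt
          exact hx (D.bump_support x hlt.le)))
  rw [SmearingDatum.smearRaw_const_id D.bump_integral] at h1
  exact h1.symm

end Chains

section Monomials

variable {E : Type*} [NormedAddCommGroup E] [NormedSpace ℝ E] [NormedSpace ℂ E]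
  [IsScalarTower ℝ ℂ E] [FiniteDimensional ℂ E] [FiniteDimensional ℝ E]

/-- An alternating form, as a form of mixed degree. -/
def constForm {k : ℕ} (c : E [⋀^Fin k]→L[ℝ] ℝ) (j : ℕ) : E [⋀^Fin j]→L[ℝ] ℝ :=
  if h : k = j then h ▸ c else 0

@[simp] theorem constForm_self {k : ℕ} (c : E [⋀^Fin k]→L[ℝ] ℝ) : constForm c k = c := by
  rw [constForm, dif_pos rfl]

theorem constForm_of_ne {k j : ℕ} (h : k ≠ j) (c : E [⋀^Fin k]→L[ℝ] ℝ) : constForm c j = 0 := by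
  rw [constForm, dif_neg h]

/-- The forms of the expansion of a form with respect to the complex frame. -/
def CoeffIndex.covec (q : CoeffIndex E) : E [⋀^Fin q.1]→L[ℝ] ℝ :=
  Classical.choose (exists_alternating_expansion (complexFrame E) q.1) q.2

theorem eq_sum_constForm (a : ∀ k : ℕ, E [⋀^Fin k]→L[ℝ] ℝ) (j : ℕ) :
    a j = ∑ q : CoeffIndex E, a q.1 q.vec • constForm q.covec j := by
  by_cases hj : j < realDim E + 1
  · rw [Fintype.sum_sigma, Finset.sum_eq_single ⟨j, hj⟩]
    · rw [Classical.choose_spec (exists_alternating_expansion (complexFrame E) j) (a j)]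
      refine Finset.sum_congr rfl fun r _ => ?_
      change _ = a j (fun l => complexFrame E (r l)) • constForm (k := j) _ j
      rw [constForm_self]
      congr 1
    · intro i _ hi
      refine Finset.sum_eq_zero fun r _ => ?_
      rw [constForm_of_ne, smul_zero]
      exact fun h => hi (Fin.ext h)
    · intro h; exact absurd (Finset.mem_univ _) h
  · rw [alternating_eq_zero_of_finrank_lt (by rw [finrank_real_eq]; omega) (a j)]
    symm
    refine Finset.sum_eq_zero fun q _ => ?_
    rw [constForm_of_ne, smul_zero]
    have := q.1.2
    omega

variable {H : Type*} [TopologicalSpace H] {I : ModelWithCorners ℝ E H} [I.Boundaryless]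
  {M : Type*} [TopologicalSpace M] [ChartedSpace H M] [T2Space M] [CompactSpace M]
  [IsManifold I ∞ M]

theorem isSmoothForm_monomial {e : PartialEquiv M E} (he : IsChart I e) {u : E → ℝ} {K : Set E}
    (hKc : IsCompact K) (hKt : K ⊆ e.target) (hu : ContDiff ℝ ∞ u) (hu0 : ∀ z ∉ K, u z = 0)
    (C : ∀ j : ℕ, E [⋀^Fin j]→L[ℝ] ℝ) :
    IsSmoothForm I (extendForm I e (fun z => u z • C)) :=
  isSmoothForm_extendForm he hKc hKt (fun _ _ _ _ => (hu.contDiffAt.mul contDiffAt_const :))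
    fun z hz => by rw [hu0 z hz, zero_smul]

/-- A form with support in the domain of a coordinate system is a sum of monomials. -/
theorem eq_sum_monomial {e : PartialEquiv M E} (he : IsChart I e) {φ : RawForm E M}
    (hφ0 : ∀ p ∉ e.source, φ p = 0) :
    φ = ∑ q : CoeffIndex E, extendForm I e
      (fun z => formIn I e φ q.1 z q.vec • constForm q.covec) := by
  funext p k
  rw [Finset.sum_apply, Finset.sum_apply]
  by_cases hp : p ∈ e.source
  · rw [form_eq_of_formIn he hp φ k, eq_sum_constForm (fun k => formIn I e φ k (e p)) k]
    ext v
    rw [ContinuousAlternatingMap.compContinuousLinearMap_apply, ContinuousAlternatingMap.sum_apply,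
      ContinuousAlternatingMap.sum_apply]
    refine Finset.sum_congr rfl fun q _ => ?_
    rw [extendForm, if_pos hp]
    rfl
  · rw [hφ0 p hp]
    symm
    refine Finset.sum_eq_zero fun q _ => ?_
    rw [extendForm_of_notMem I e _ hp]; rfl

end Monomials

section Regularization

variable {E : Type*} [NormedAddCommGroup E] [NormedSpace ℝ E] [NormedSpace ℂ E]
  [IsScalarTower ℝ ℂ E] [FiniteDimensional ℂ E] [FiniteDimensional ℝ E]
  {H : Type*} [TopologicalSpace H] {I : ModelWithCorners ℝ E H} [I.Boundaryless]
  {M : Type*} [TopologicalSpace M] [ChartedSpace H M] [T2Space M] [CompactSpace M]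
  [IsManifold I ∞ M]

/-- Near `p` the functional `S` is given by a smooth form. -/
def IsLocallySmoothAt (S : Form I M →ₗ[ℝ] ℝ) (p : M) : Prop :=
  ∃ N : Set M, IsOpen N ∧ p ∈ N ∧ ∃ τ : Form I M, ∀ φ : Form I M, (∀ q ∉ N, φ.1 q = 0) →
    S φ = integral I (wedge I τ φ)

theorem exists_form_of_isLocallySmoothAt {S : Form I M →ₗ[ℝ] ℝ}
    (h : ∀ p, IsLocallySmoothAt S p) : ∃ τ : Form I M, ∀ φ, S φ = integral I (wedge I τ φ) := by
  choose N hN hp τ hτ using h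
  obtain ⟨s, ρ, hρ, hsum⟩ := exists_finite_partition (I := I) N hN hp
  refine ⟨∑ x ∈ s, mulForm (ρ x) (τ x), fun φ => ?_⟩
  have h1 : ∀ x, S (mulForm (ρ x) φ) = integral I (wedge I (mulForm (ρ x) (τ x)) φ) := by
    intro x
    rw [hτ x, wedge_mulForm]
    intro q hq
    rw [mulForm_apply, image_eq_zero_of_notMem_tsupport (fun hm => hq (hρ x hm)), zero_smul]
  have h2 : integral I (wedge I (∑ x ∈ s, mulForm (ρ x) (τ x)) φ) =
      ∑ x ∈ s, integral I (wedge I (mulForm (ρ x) (τ x)) φ) :=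
    map_sum ((integralLM I M).comp ((wedgeLM I).flip φ)) _ _
  rw [h2, ← Finset.sum_congr rfl fun x _ => h1 x, ← map_sum, sum_mulForm hsum]

theorem IsLocallySmoothAt.comp_op [PositiveAtlas I M] {S : Form I M →ₗ[ℝ] ℝ} {p : M}
    (h : IsLocallySmoothAt S p) (D : SmearingDatum I M) (hD : ∀ x, D.map x p = p) (ε : ℝ) :
    IsLocallySmoothAt (S.comp (D.op ε)) p := by
  obtain ⟨N, hN, hp, τ, hτ⟩ := h
  have hopen : IsOpen ((fun z : EuclideanSpace ℝ (Fin D.dim) × M => D.map z.1 z.2) ⁻¹' N) :=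
    hN.preimage D.map_smooth.continuous
  obtain ⟨U, V, hU, hV, hsU, hpV, hUV⟩ := generalized_tube_lemma
    (isCompact_closedBall (0 : EuclideanSpace ℝ (Fin D.dim)) |ε|) (isCompact_singleton (x := p))
    hopen (by
      rintro ⟨x, q⟩ ⟨_, hq⟩
      have hq' : q = p := hq
      subst hq'
      change D.map x q ∈ N
      rw [hD]
      exact hp)
  refine ⟨V, hV, hpV rfl, D.op ε τ, fun φ hφ => ?_⟩
  rw [← D.integral_wedge_op]
  refine hτ _ fun q hq => ?_
  funext k
  change ∫ x, D.bump x • rawPullback I I (D.map (ε • x)) φ.1 q k = 0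
  rw [← integral_zero (EuclideanSpace ℝ (Fin D.dim)) (E [⋀^Fin k]→L[ℝ] ℝ)]
  refine integral_congr_ae (ae_of_all _ fun x => ?_)
  by_cases hx : 1 ≤ ‖x‖
  · simp only [D.bump_support x hx, zero_smul]
  · have h1 : φ.1 (D.map (ε • x) q) = 0 := by
      refine hφ _ fun hmem => hq ?_
      have h2 : (-(ε • x), D.map (ε • x) q) ∈ U ×ˢ V := by
        refine ⟨hsU ?_, hmem⟩
        rw [Metric.mem_closedBall, dist_zero_right, norm_neg, norm_smul, Real.norm_eq_abs]
        exact mul_le_of_le_one_right (abs_nonneg _) (not_le.1 hx).le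
      have h3 := hUV h2
      change D.map (-(ε • x)) (D.map (ε • x) q) ∈ N at h3
      rwa [D.neg_map] at h3
    have h4 : rawPullback I I (D.map (ε • x)) φ.1 q k = 0 := by
      rw [rawPullback, h1]; rfl
    simp only [h4, smul_zero]

/-- Restriction of a coordinate system to a part of its target. -/
def restrictTarget (e : PartialEquiv M E) (U : Set E) : PartialEquiv M E := (e.symm.restr U).symm

theorem IsChart.restrictTarget {e : PartialEquiv M E} (he : IsChart I e) {U : Set E}
    (hU : IsOpen U) : IsChart I (restrictTarget e U) where
  open_source := by
    have : (Currents.restrictTarget e U).source = e.source ∩ e ⁻¹' U := by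
      ext p
      simp [Currents.restrictTarget]
    rw [this]
    exact he.smooth.continuousOn.isOpen_inter_preimage he.open_source hU
  open_target := by
    have : (Currents.restrictTarget e U).target = e.target ∩ U := by
      simp [Currents.restrictTarget]
    rw [this]
    exact he.open_target.inter hU
  smooth := he.smooth.mono (by
    intro p hp
    simp only [Currents.restrictTarget, PartialEquiv.symm_source, PartialEquiv.restr_target] at hp
    exact hp.1)
  smooth_symm := he.smooth_symm.mono (by
    intro z hz
    simp only [Currents.restrictTarget, PartialEquiv.symm_target, PartialEquiv.restr_source] at hz
    exact hz.1)

theorem restrictTarget_target (e : PartialEquiv M E) (U : Set E) :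
    (restrictTarget e U).target = e.target ∩ U := by
  simp [restrictTarget]

theorem restrictTarget_source (e : PartialEquiv M E) (U : Set E) :
    (restrictTarget e U).source = e.source ∩ e ⁻¹' U := by
  simp [restrictTarget]

theorem chart_change_det {e e₁ e₂ : PartialEquiv M E} (he : IsChart I e) (h₁ : IsChart I e₁)
    (h₂ : IsChart I e₂) {z : E} (hz : z ∈ e.target) (hz₁ : e.symm z ∈ e₁.source)
    (hz₂ : e.symm z ∈ e₂.source) : (fderiv ℝ (fun y => e₂ (e.symm y)) z).det =
      (fderiv ℝ (fun y => e₂ (e₁.symm y)) (e₁ (e.symm z))).det *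
        (fderiv ℝ (fun y => e₁ (e.symm y)) z).det := by
  have hf := (contDiffAt_chart_change he h₁ hz hz₁).differentiableAt (by simp)
  have hz1 : e₁.symm (e₁ (e.symm z)) ∈ e₂.source := by rwa [e₁.left_inv hz₁]
  have hg := (contDiffAt_chart_change h₁ h₂ (e₁.map_source hz₁) hz1).differentiableAt (by simp)
  have hcomp := HasFDerivAt.comp z hg.hasFDerivAt hf.hasFDerivAt
  have hid : (fun y => e₂ (e.symm y)) =ᶠ[𝓝 z]
      ((fun y => e₂ (e₁.symm y)) ∘ fun y => e₁ (e.symm y)) := by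
    filter_upwards [(he.contMDiffAt_symm hz).continuousAt.preimage_mem_nhds
      (h₁.open_source.mem_nhds hz₁)] with w hw
    simp only [Function.comp]
    rw [e₁.left_inv hw]
  rw [(hcomp.congr_of_eventuallyEq hid).fderiv, ContinuousLinearMap.det,
    ContinuousLinearMap.toLinearMap_comp, LinearMap.det_comp]

theorem chart_change_det_ne_zero {e e₁ : PartialEquiv M E} (he : IsChart I e) (h₁ : IsChart I e₁)
    {z : E} (hz : z ∈ e.target) (hz₁ : e.symm z ∈ e₁.source) :
    (fderiv ℝ (fun y => e₁ (e.symm y)) z).det ≠ 0 := by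
  intro h0
  have h1 := chart_change_det he h₁ he hz hz₁ (e.map_target hz)
  rw [h0, mul_zero] at h1
  have hid : (fun y => e (e.symm y)) =ᶠ[𝓝 z] id := by
    filter_upwards [he.open_target.mem_nhds hz] with w hw using e.right_inv hw
  rw [hid.fderiv_eq, fderiv_id] at h1
  simp [ContinuousLinearMap.det] at h1

/-- Locally, every coordinate system has an orientation sign. -/
theorem exists_hasSign [PositiveAtlas I M] {e : PartialEquiv M E} (he : IsChart I e) {z : E}
    (hz : z ∈ e.target) : ∃ U : Set E, IsOpen U ∧ z ∈ U ∧ U ⊆ e.target ∧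
      ∃ σ : ℝ, HasSign I (restrictTarget e U) σ := by
  set c := extChartAt I (e.symm z) with hc
  have hcc : IsChart I c := isChart_extChartAt I _
  have hzc : e.symm z ∈ c.source := mem_extChartAt_source _
  set J : E → ℝ := fun w => (fderiv ℝ (fun y => c (e.symm y)) w).det with hJ
  have hJc : ContinuousAt J z := by
    have := ((contDiffAt_chart_change he hcc hz hzc).fderiv_right (m := 0) (by simp)).continuousAt
    exact ContinuousLinearMap.continuous_det.continuousAt.comp this
  obtain ⟨σ, hσ, hpos⟩ : ∃ σ : ℝ, (σ = 1 ∨ σ = -1) ∧ 0 < σ * J z := by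
    rcases lt_or_gt_of_ne (chart_change_det_ne_zero he hcc hz hzc) with h | h
    · exact ⟨-1, Or.inr rfl, by rw [neg_one_mul]; exact neg_pos.2 h⟩
    · exact ⟨1, Or.inl rfl, by rw [one_mul]; exact h⟩
  have h1 : ∀ᶠ w in 𝓝 z, 0 < σ * J w ∧ w ∈ e.target ∧ e.symm w ∈ c.source :=
    ((continuousAt_const.mul hJc).eventually (lt_mem_nhds hpos)).and
      ((he.open_target.eventually_mem hz).and
        ((he.contMDiffAt_symm hz).continuousAt.preimage_mem_nhds (hcc.open_source.mem_nhds hzc)))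
  obtain ⟨U, hU, hUo, hzU⟩ := eventually_nhds_iff.1 h1
  refine ⟨U, hUo, hzU, fun w hw => (hU w hw).2.1, σ, hσ, fun w hw x hx => ?_⟩
  rw [restrictTarget_target] at hw
  obtain ⟨hw1, hw2, hw3⟩ := hU w hw.2
  change 0 < σ * (fderiv ℝ (fun y => extChartAt I x (e.symm y)) w).det
  rw [chart_change_det he hcc (isChart_extChartAt I x) hw2 hw3 hx]
  have := PositiveAtlas.det_pos (I := I) (M := M) (e.symm z) x (c (e.symm w)) (c.map_source hw3)
    (by rw [c.left_inv hw3]; exact hx)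
  calc (0 : ℝ) < _ := mul_pos this hw1
    _ = _ := by ring

/-- The maps of the family are translations in the coordinate system `e` and are the identity
outside of its domain. -/
structure SmearingDatum.IsTranslation (D : SmearingDatum I M) (e : PartialEquiv M E)
    (L : EuclideanSpace ℝ (Fin D.dim) ≃L[ℝ] E) : Prop where
  isChart : IsChart I e
  target : e.target = univ
  map_source : ∀ x, ∀ p ∈ e.source, D.map x p ∈ e.source
  apply_map : ∀ x, ∀ p ∈ e.source, e (D.map x p) = e p + L x
  map_notMem : ∀ x, ∀ p ∉ e.source, D.map x p = p

namespace SmearingDatum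

variable {D : SmearingDatum I M} {e : PartialEquiv M E}
  {L : EuclideanSpace ℝ (Fin D.dim) ≃L[ℝ] E}

theorem IsTranslation.rawPullback_extendForm (h : D.IsTranslation e L) (A : RawForm E E)
    (y : EuclideanSpace ℝ (Fin D.dim)) :
    rawPullback I I (D.map y) (extendForm I e A) = extendForm I e (fun z => A (z + L y)) := by
  funext p k
  by_cases hp : p ∈ e.source
  · ext v
    have h1 : mfderiv I 𝓘(ℝ, E) (fun q => e (D.map y q)) p =
        (mfderiv I 𝓘(ℝ, E) e (D.map y p)).comp (mfderiv I I (D.map y) p) :=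
      mfderiv_comp p ((h.isChart.contMDiffAt (h.map_source y p hp)).mdifferentiableAt (by simp))
        ((D.diffeo y).contMDiff.mdifferentiableAt (by simp))
    have h2 : mfderiv I 𝓘(ℝ, E) (fun q => e q + L y) p =
        (mfderiv 𝓘(ℝ, E) 𝓘(ℝ, E) (fun w => w + L y) (e p)).comp (mfderiv I 𝓘(ℝ, E) e p) :=
      mfderiv_comp p (g := fun w => w + L y)
        ((differentiableAt_id.add_const _).mdifferentiableAt)
        ((h.isChart.contMDiffAt hp).mdifferentiableAt (by simp))
    have h3 : (fun q => e (D.map y q)) =ᶠ[𝓝 p] fun q => e q + L y := by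
      filter_upwards [h.isChart.open_source.mem_nhds hp] with q hq using h.apply_map y q hq
    have h4 : diffAt I 𝓘(ℝ, E) (fun q => e (D.map y q)) p =
      (diffAt I 𝓘(ℝ, E) e (D.map y p)).comp (diffAt I I (D.map y) p) := h1
    have h5 : diffAt I 𝓘(ℝ, E) (fun q => e (D.map y q)) p =
      diffAt I 𝓘(ℝ, E) (fun q => e q + L y) p := h3.mfderiv_eq
    have h6 : diffAt I 𝓘(ℝ, E) (fun q => e q + L y) p =
        (fderiv ℝ (fun w => w + L y) (e p)).comp (diffAt I 𝓘(ℝ, E) e p) := by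
      rw [← mfderiv_eq_fderiv]; exact h2
    rw [fderiv_add_const, fderiv_fun_id, ContinuousLinearMap.id_comp] at h6
    rw [extendForm, if_pos hp, ← h.apply_map y p hp, ← h6, ← h5, h4]
    change extendForm I e A (D.map y p) k (fun i => diffAt I I (D.map y) p (v i)) = _
    rw [extendForm, if_pos (h.map_source y p hp)]
    rfl
  · rw [extendForm_of_notMem I e _ hp, rawPullback, h.map_notMem y p hp,
      extendForm_of_notMem I e _ hp]
    rfl

/-- The kernel of the smearing operator in the coordinates in which it acts by translations. -/
def kernel (D : SmearingDatum I M) (L : EuclideanSpace ℝ (Fin D.dim) ≃L[ℝ] E) (ε : ℝ)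
    (w : EuclideanSpace ℝ (Fin D.dim)) (z : E) : ℝ :=
  (ε ^ D.dim)⁻¹ * D.bump (ε⁻¹ • (w - L.symm z))

theorem smoothFamily_kernel (h : D.IsTranslation e L) {ε : ℝ} (hε : 0 < ε)
    (C : ∀ j : ℕ, E [⋀^Fin j]→L[ℝ] ℝ) :
    SmoothFamily I (fun w => extendForm I e (fun z => D.kernel L ε w z • C)) := by
  refine SmoothFamily.extendForm h.isChart (fun p z _ k v => ?_) fun p => ?_
  · have h1 : ContDiff ℝ ∞ (fun q : EuclideanSpace ℝ (Fin D.dim) × E => D.kernel L ε q.1 q.2) :=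
      contDiff_const.mul (D.bump_smooth.comp (by fun_prop))
    exact (h1.contDiffAt.mul contDiffAt_const :)
  · refine ⟨L '' Metric.closedBall p (1 + ε), by rw [h.target]; exact subset_univ _,
      (isCompact_closedBall _ _).image L.continuous, ?_⟩
    filter_upwards [Metric.ball_mem_nhds p one_pos] with w hw z hz
    have h1 : D.bump (ε⁻¹ • (w - L.symm z)) = 0 := by
      refine D.bump_support _ ?_
      by_contra! hlt
      refine hz ⟨L.symm z, ?_, L.apply_symm_apply z⟩
      rw [norm_smul, norm_inv, Real.norm_of_nonneg hε.le, inv_mul_lt_iff₀ hε, mul_one,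
        ← dist_eq_norm] at hlt
      rw [Metric.mem_ball] at hw
      rw [Metric.mem_closedBall]
      linarith [dist_triangle_left (L.symm z) p w]
    rw [kernel, h1, mul_zero, zero_smul]

theorem IsTranslation.op_monomial (h : D.IsTranslation e L) {ε : ℝ} (hε : 0 < ε) (u : E → ℝ)
    (C : ∀ j : ℕ, E [⋀^Fin j]→L[ℝ] ℝ) (p : M) (j : ℕ) :
    smearRaw I D.map D.bump ε (extendForm I e (fun z => u z • C)) p j =
      ∫ w, u (L w) • extendForm I e (fun z => D.kernel L ε w z • C) p j := by
  by_cases hp : p ∈ e.source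
  · simp only [smearRaw, h.rawPullback_extendForm]
    set X := (C j).compContinuousLinearMap (diffAt I 𝓘(ℝ, E) e p) with hX
    have h1 : ∀ g : E → ℝ, extendForm I e (fun z => g z • C) p j = g (e p) • X := by
      intro g; rw [extendForm, if_pos hp]; rfl
    simp only [h1 (fun z => u (z + L _)), h1 (fun z => D.kernel L ε _ z), smul_smul]
    haveI : CompleteSpace (E [⋀^Fin j]→L[ℝ] ℝ) := FiniteDimensional.complete ℝ _
    rw [integral_smul_const, integral_smul_const]
    congr 1
    set a := L.symm (e p) with ha
    have h2 := Measure.integral_comp_smul volume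
      (fun x => D.bump x * u (e p + L (ε • x))) ε⁻¹
    rw [finrank_euclideanSpace_fin, inv_pow, inv_inv, abs_of_pos (by positivity)] at h2
    simp only [smul_inv_smul₀ hε.ne'] at h2
    have h3 := integral_add_left_eq_self (μ := volume)
      (fun w => u (L w) * D.kernel L ε w (e p)) a
    rw [← h3]
    simp only [kernel, ← ha, add_sub_cancel_left, map_add]
    have h4 : L a = e p := L.apply_symm_apply _
    rw [h4]
    have h5 : ∀ x, u (e p + L x) * ((ε ^ D.dim)⁻¹ * D.bump (ε⁻¹ • x)) =
      (ε ^ D.dim)⁻¹ * (D.bump (ε⁻¹ • x) * u (e p + L x)) := fun x => by ring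
    simp only [h5]
    rw [MeasureTheory.integral_const_mul, h2, smul_eq_mul, inv_mul_cancel_left₀ (by positivity)]
  · rw [smearRaw]
    simp only [h.rawPullback_extendForm]
    simp only [extendForm_of_notMem I e _ hp]
    simp

theorem exists_integral_comp_equiv [MeasurableSpace E] [BorelSpace E] {d : ℕ}
    (L : EuclideanSpace ℝ (Fin d) ≃L[ℝ] E) :
    ∃ c : ℝ, ∀ g : E → ℝ, ∫ w, g (L w) = c * ∫ z, g z ∂frameMeasure E := by
  haveI : (Measure.map L (volume : Measure (EuclideanSpace ℝ (Fin d)))).IsAddHaarMeasure :=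
    L.isAddHaarMeasure_map volume
  obtain ⟨c, h1⟩ : ∃ c : NNReal, Measure.map L (volume : Measure (EuclideanSpace ℝ (Fin d))) =
      c • frameMeasure E := ⟨_, Measure.isAddLeftInvariant_eq_smul _ _⟩
  refine ⟨c, fun g => ?_⟩
  have h2 := L.toHomeomorph.measurableEmbedding.integral_map (μ := volume) g
  change _ = ∫ w, g (L w) at h2
  rw [← h2]
  change ∫ z, g z ∂(Measure.map L volume) = _
  rw [h1, integral_smul_nnreal_measure]
  rfl

/-- In the coordinates in which a family acts by translations, smearing makes functionals
smooth. -/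
theorem IsTranslation.isLocallySmoothAt [PositiveAtlas I M] (h : D.IsTranslation e L)
    {S : Form I M →ₗ[ℝ] ℝ} (hS : IsRegular S) {ε : ℝ} (hε : 0 < ε) {p : M} (hp : p ∈ e.source) :
    IsLocallySmoothAt (S.comp (D.op ε)) p := by
  letI : MeasurableSpace E := borel E
  haveI : BorelSpace E := ⟨rfl⟩
  have he := h.isChart
  obtain ⟨U, hU, hpU, -, σ, hσ⟩ := exists_hasSign he (e.map_source hp)
  obtain ⟨r, hr, hrU⟩ := Metric.nhds_basis_closedBall.mem_iff.1 (hU.mem_nhds hpU)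
  have hσ2 : σ * σ = 1 := by rcases hσ.1 with rfl | rfl <;> norm_num
  set e' := restrictTarget e U with he'
  have hec' : IsChart I e' := he.restrictTarget hU
  have ht' : e'.target = U := by rw [he', restrictTarget_target, h.target, univ_inter]
  let χ : ContDiffBump (e p) := ⟨r / 2, r, by positivity, by linarith⟩
  obtain ⟨c, hc⟩ := exists_integral_comp_equiv L
  set h' : CoeffIndex E → EuclideanSpace ℝ (Fin D.dim) → Form I M := fun q w =>
    ⟨_, (smoothFamily_kernel h hε (constForm q.covec)).isSmoothForm w⟩ with hh'
  have hh'S : ∀ q, ContDiff ℝ ∞ fun w => S (h' q w) := fun q =>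
    hS.contDiff (smoothFamily_kernel h hε (constForm q.covec))
  set G : CoeffIndex E → E → ℝ := fun q z => χ z * (σ * c * S (h' q (L.symm z))) with hG
  have hGs : ∀ q, ContDiff ℝ ∞ (G q) := fun q =>
    χ.contDiff.mul (contDiff_const.mul ((hh'S q).comp L.symm.contDiff))
  have hG0 : ∀ q, ∀ z ∉ Metric.closedBall (e p) r, G q z = 0 := by
    intro q z hz
    rw [Metric.mem_closedBall, not_le] at hz
    simp only [hG]
    rw [χ.zero_of_le_dist hz.le, zero_mul]
  have hKt : Metric.closedBall (e p) r ⊆ e'.target := ht' ▸ hrU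
  refine ⟨e.source ∩ e ⁻¹' Metric.ball (e p) (r / 2),
    he.smooth.continuousOn.isOpen_inter_preimage he.open_source Metric.isOpen_ball,
    ⟨hp, Metric.mem_ball_self (by positivity)⟩,
    ⟨_, isSmoothForm_dualLeft hec' (isCompact_closedBall _ _) hKt hGs hG0⟩, fun φ hφ => ?_⟩
  set u : CoeffIndex E → E → ℝ := fun q z => formIn I e φ.1 q.1 z q.vec with hu
  have hu0 : ∀ q, ∀ z ∉ Metric.closedBall (e p) (r / 2), u q z = 0 := by
    intro q z hz
    have hz' : z ∈ e.target := by rw [h.target]; trivial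
    have h1 : φ.1 (e.symm z) = 0 := by
      refine hφ _ fun hm => hz (Metric.ball_subset_closedBall ?_)
      have := hm.2
      rwa [mem_preimage, e.right_inv hz'] at this
    simp only [hu]
    rw [formIn_eq_zero I e (congrFun h1 _)]
    rfl
  have hus : ∀ q, ContDiff ℝ ∞ (u q) := by
    intro q
    have := isSmoothForm_formIn_continuousOn φ.2 he q.1 q.vec
    rw [h.target] at this
    exact contDiffOn_univ.1 this
  have hsum : φ = ∑ q, (⟨_, isSmoothForm_monomial he (isCompact_closedBall (e p) (r / 2))
      (by rw [h.target]; exact subset_univ _) (hus q) (hu0 q) (constForm q.covec)⟩ : Form I M) := by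
    refine Subtype.ext ?_
    have h1 := eq_sum_monomial he (φ := φ.1) (fun q hq => hφ q fun hm => hq hm.1)
    refine h1.trans ?_
    symm
    exact map_sum (Form I M).subtype _ _
  obtain ⟨R, hR⟩ := ((isCompact_closedBall (e p) (r / 2)).image L.symm.continuous).isBounded.subset_ball 0
  have hop : ∀ q, S (D.op ε (⟨_, isSmoothForm_monomial he (isCompact_closedBall (e p) (r / 2))
      (by rw [h.target]; exact subset_univ _) (hus q) (hu0 q) (constForm q.covec)⟩ : Form I M)) =
      ∫ w, u q (L w) * S (h' q w) := by
    intro q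
    refine hS.map_integral (R := max R 0) (le_max_right _ _)
      ((hus q).comp L.contDiff) (fun x hx => hu0 q _ fun hm => ?_)
      (smoothFamily_kernel h hε (constForm q.covec)) fun p' k => ?_
    · have := hR ⟨_, hm, L.symm_apply_apply x⟩
      rw [Metric.mem_ball, dist_zero_right] at this
      exact absurd (lt_of_lt_of_le this (le_max_left R 0)) (not_lt.2 hx)
    · exact h.op_monomial hε (u q) (constForm q.covec) p' k
  rw [integral_wedge_dualLeft hec' hσ (isCompact_closedBall _ _) hKt hGs hG0 φ]
  rw [LinearMap.comp_apply]
  conv_lhs => rw [hsum]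
  rw [map_sum, map_sum, Finset.mul_sum]
  refine Finset.sum_congr rfl fun q _ => ?_
  rw [hop q]
  have h2 := hc (fun z => u q z * S (h' q (L.symm z)))
  simp only [L.symm_apply_apply] at h2
  rw [h2, ht']
  have h3 : ∫ z in U, G q z * formIn I e' φ.1 q.1 z q.vec ∂frameMeasure E =
      ∫ z, σ * c * (u q z * S (h' q (L.symm z))) ∂frameMeasure E := by
    rw [← setIntegral_eq_integral_of_forall_compl_eq_zero (s := U)
      (f := fun z => σ * c * (u q z * S (h' q (L.symm z))))]
    · refine setIntegral_congr_fun hU.measurableSet fun z _ => ?_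
      change χ z * (σ * c * S (h' q (L.symm z))) * u q z = _
      by_cases hz : z ∈ Metric.closedBall (e p) (r / 2)
      · rw [χ.one_of_mem_closedBall hz]; ring
      · rw [hu0 q z hz]; ring
    · intro z hz
      rw [hu0 q z, zero_mul, mul_zero]
      intro hm
      exact hz (hrU (Metric.closedBall_subset_closedBall (by linarith) hm))
  rw [h3, MeasureTheory.integral_const_mul]
  calc _ = (σ * σ) * (c * ∫ z, u q z * S (h' q (L.symm z)) ∂frameMeasure E) := by rw [hσ2, one_mul]
    _ = _ := by ring

end SmearingDatum

theorem SmoothingChart.exists_isTranslation (c : SmoothingChart I M) :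
    ∃ (e : PartialEquiv M E) (L : EuclideanSpace ℝ (Fin c.datum.dim) ≃L[ℝ] E),
      e.source = c.ball.source ∧ c.datum.IsTranslation e L := by
  let L : EuclideanSpace ℝ (Fin (finrank ℝ E)) ≃L[ℝ] E :=
    ContinuousLinearEquiv.ofFinrankEq (by rw [finrank_euclideanSpace_fin])
  let e : PartialEquiv M E := c.ball.toPartialEquiv.trans L.toLinearEquiv.toEquiv.toPartialEquiv
  have hs : e.source = c.ball.source := by simp [e]
  have ht : e.target = univ := by simp [e, c.ball_target]
  have hball : ∀ z : EuclideanSpace ℝ (Fin (finrank ℝ E)), z ∈ c.ball.target := fun z => by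
    rw [c.ball_target]; trivial
  refine ⟨e, L, hs, ⟨⟨?_, ?_, ?_, ?_⟩, ht, fun x p hp => ?_, fun x p hp => ?_, fun x p hp => ?_⟩⟩
  · rw [hs]; exact c.ball.open_source
  · rw [ht]; exact isOpen_univ
  · rw [hs]
    exact L.contDiff.contMDiff.comp_contMDiffOn c.ball_smooth
  · exact (c.ball_symm_smooth.comp L.symm.contDiff.contMDiff).contMDiffOn
  · rw [hs] at hp ⊢
    have h1 : ∀ x : EuclideanSpace ℝ (Fin (finrank ℝ E)),
        translate c.ball x p ∈ c.ball.source := fun x => by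
      rw [translate_of_mem _ _ hp]
      exact c.ball.map_target (hball _)
    exact h1 x
  · rw [hs] at hp
    have h1 : ∀ x : EuclideanSpace ℝ (Fin (finrank ℝ E)),
        L (c.ball (translate c.ball x p)) = L (c.ball p) + L x := fun x => by
      rw [translate_of_mem _ _ hp, c.ball.right_inv (hball _), map_add]
    exact h1 x
  · rw [hs] at hp
    exact translate_of_notMem _ _ hp

/-- Successive smearing as a linear map. -/
def smearChainLM (l : List (SmearingDatum I M)) (ε : ℝ) : Form I M →ₗ[ℝ] Form I M where
  toFun := smearChain l ε
  map_add' := smearChain_add l ε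
  map_smul' := smearChain_smul l ε

theorem IsRegular.comp_smearChain {S : Form I M →ₗ[ℝ] ℝ} (hS : IsRegular S)
    (l : List (SmearingDatum I M)) (ε : ℝ) : IsRegular (S.comp (smearChainLM l ε)) :=
  hS.comp fun _ _ _ _ hΦ => smearChain_smoothFamily l hΦ contDiff_const

theorem isLocallySmoothAt_smearChain [PositiveAtlas I M] (l : List (SmoothingChart I M))
    {S : Form I M →ₗ[ℝ] ℝ} (hS : IsRegular S) {ε : ℝ} (hε : 0 < ε) {p : M}
    (hp : ∃ c ∈ l, p ∈ c.ball.source) :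
    IsLocallySmoothAt (S.comp (smearChainLM (l.map SmoothingChart.datum) ε)) p := by
  induction l with
  | nil => simp at hp
  | cons c l ih =>
    have h1 : S.comp (smearChainLM ((c :: l).map SmoothingChart.datum) ε) =
        (S.comp (smearChainLM (l.map SmoothingChart.datum) ε)).comp (c.datum.op ε) := rfl
    rw [h1]
    by_cases hc : p ∈ c.ball.source
    · obtain ⟨e, L, hs, h⟩ := c.exists_isTranslation
      exact h.isLocallySmoothAt (hS.comp_smearChain _ ε) hε (hs ▸ hc)
    · refine (ih ?_).comp_op c.datum (fun x => translate_of_notMem _ _ hc) ε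
      obtain ⟨c', hc', hp'⟩ := hp
      rcases List.mem_cons.1 hc' with rfl | h
      · exact absurd hp' hc
      · exact ⟨c', h, hp'⟩

/-- De Rham's regularisation of a current is a smooth form. -/
theorem DeRhamData.exists_represents [PositiveAtlas I M] (𝒰 : DeRhamData I M)
    {S : Form I M →ₗ[ℝ] ℝ} (hS : IsRegular S) {ε : ℝ} (hε : 0 < ε) :
    ∃ τ : Form I M, ∀ φ, integral I (wedge I τ φ) = S (𝒰.smooth ε φ) := by
  obtain ⟨τ, hτ⟩ := exists_form_of_isLocallySmoothAt fun p =>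
    isLocallySmoothAt_smearChain 𝒰.charts hS hε (𝒰.cover p)
  refine ⟨τ, fun φ => ?_⟩
  rw [← hτ φ, 𝒰.smooth_eq hε]
  rfl

end Regularization

section SpecialCurve

theorem eventually_iteratedFDeriv_mul_le {V : Type*} [NormedAddCommGroup V] [NormedSpace ℝ V]
    {O K : Set V} (hO : IsOpen O) (hK : IsCompact K) (hKO : K ⊆ O) {b : ℝ → ℝ}
    (hb : ContDiff ℝ ∞ b) (hbc : HasCompactSupport b) {χ : V → ℝ} (hχ : ContDiff ℝ ∞ χ)
    (hχ0 : ∀ z ∉ K, χ z = 0) {g : ℕ → V → ℝ} (hg : ∀ n, ContDiffOn ℝ ∞ (g n) O)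
    (hg0 : ∀ j, TendstoUniformlyOn (fun n => iteratedFDeriv ℝ j (g n)) 0 atTop K) (j : ℕ) {δ : ℝ}
    (hδ : 0 < δ) : ∀ᶠ n in atTop, ∀ w : ℝ × V,
      ‖iteratedFDeriv ℝ j (fun q : ℝ × V => b q.1 * (χ q.2 * g n q.2)) w‖ ≤ δ := by
  set h : ℝ × V → ℝ := fun q => b q.1 * χ q.2 with hh
  have hhs : ContDiff ℝ ∞ h := (hb.comp contDiff_fst).mul (hχ.comp contDiff_snd)
  have hhc : HasCompactSupport h := by
    refine HasCompactSupport.of_support_subset_isCompact (hbc.prod hK) fun q hq => ⟨?_, ?_⟩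
    · exact subset_tsupport _ fun h0 => hq (by simp only [hh]; rw [h0, zero_mul])
    · by_contra h0
      exact hq (by simp only [hh]; rw [hχ0 _ h0, mul_zero])
  have hbd : ∀ i, ∃ C, ∀ w, ‖iteratedFDeriv ℝ i h w‖ ≤ C := fun i =>
    (hhc.iteratedFDeriv i).exists_bound_of_continuous
      (hhs.continuous_iteratedFDeriv (by exact_mod_cast le_top))
  choose C hC using hbd
  have hC0 : ∀ i, 0 ≤ C i := fun i => (norm_nonneg _).trans (hC i (0, 0))
  set B : ℝ := ∑ i ∈ Finset.range (j + 1), (j.choose i) * C i with hB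
  have hB0 : 0 ≤ B := Finset.sum_nonneg fun i _ => mul_nonneg (Nat.cast_nonneg _) (hC0 i)
  have hη : 0 < δ / (B + 1) := by positivity
  have hev : ∀ᶠ n in atTop, ∀ i ∈ Finset.range (j + 1), ∀ z ∈ K,
      ‖iteratedFDeriv ℝ i (g n) z‖ ≤ δ / (B + 1) := by
    rw [Filter.eventually_all_finset]
    intro i _
    filter_upwards [Metric.tendstoUniformlyOn_iff.1 (hg0 i) _ hη] with n hn z hz
    have := hn z hz
    rw [Pi.zero_apply, dist_zero_left] at this
    exact this.le
  filter_upwards [hev] with n hn w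
  by_cases hw : w.2 ∈ K
  · have hs : IsOpen (Prod.snd ⁻¹' O : Set (ℝ × V)) := hO.preimage continuous_snd
    have hws : w ∈ (Prod.snd ⁻¹' O : Set (ℝ × V)) := hKO hw
    have hgs : ContDiffOn ℝ ∞ (g n ∘ ContinuousLinearMap.snd ℝ ℝ V) (Prod.snd ⁻¹' O) :=
      (hg n).comp contDiff_snd.contDiffOn fun q hq => hq
    have h1 := norm_iteratedFDerivWithin_mul_le hhs.contDiffOn hgs hs.uniqueDiffOn hws (n := j)
      (by exact_mod_cast le_top)
    have heq : (fun q : ℝ × V => b q.1 * (χ q.2 * g n q.2)) =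
        fun q => h q * (g n ∘ ContinuousLinearMap.snd ℝ ℝ V) q := by
      funext q; exact (mul_assoc _ _ _).symm
    rw [heq, ← iteratedFDerivWithin_of_isOpen j hs hws]
    refine h1.trans ?_
    have h2 : ∀ i ∈ Finset.range (j + 1), (j.choose i : ℝ) *
        ‖iteratedFDerivWithin ℝ i h (Prod.snd ⁻¹' O) w‖ * ‖iteratedFDerivWithin ℝ (j - i)
          (g n ∘ ContinuousLinearMap.snd ℝ ℝ V) (Prod.snd ⁻¹' O) w‖ ≤
        (j.choose i : ℝ) * C i * (δ / (B + 1)) := by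
      intro i hi
      have hle : ∀ m : ℕ, (m : WithTop ℕ∞) ≤ ∞ := fun m => by exact_mod_cast le_top
      have h3 : ‖iteratedFDerivWithin ℝ i h (Prod.snd ⁻¹' O) w‖ ≤ C i := by
        rw [iteratedFDerivWithin_of_isOpen i hs hws]; exact hC i w
      have h4 : ‖iteratedFDerivWithin ℝ (j - i)
          (g n ∘ ContinuousLinearMap.snd ℝ ℝ V) (Prod.snd ⁻¹' O) w‖ ≤ δ / (B + 1) := by
        have h5 := (ContinuousLinearMap.snd ℝ ℝ V).iteratedFDerivWithin_comp_right (hg n)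
          hO.uniqueDiffOn (by exact hs.uniqueDiffOn) (x := w) (hKO hw) (i := j - i)
          (hle _)
        have h7 : iteratedFDerivWithin ℝ (j - i) (g n) O (ContinuousLinearMap.snd ℝ ℝ V w) =
          iteratedFDeriv ℝ (j - i) (g n) w.2 :=
            iteratedFDerivWithin_of_isOpen (j - i) hO (hKO hw)
        rw [h7] at h5
        change ‖iteratedFDerivWithin ℝ (j - i) (g n ∘ ContinuousLinearMap.snd ℝ ℝ V)
          (ContinuousLinearMap.snd ℝ ℝ V ⁻¹' O) w‖ ≤ _
        rw [h5]
        refine (ContinuousMultilinearMap.norm_compContinuousLinearMap_le _ _).trans ?_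
        have h6 : ∏ _i : Fin (j - i), ‖ContinuousLinearMap.snd ℝ ℝ V‖ ≤ 1 :=
          Finset.prod_le_one (fun _ _ => norm_nonneg _)
            fun _ _ => ContinuousLinearMap.norm_snd_le ℝ ℝ V
        refine (mul_le_of_le_one_right (norm_nonneg _) h6).trans ?_
        exact hn (j - i) (Finset.mem_range.2 (by omega)) w.2 hw
      exact mul_le_mul (mul_le_mul_of_nonneg_left h3 (Nat.cast_nonneg _)) h4 (norm_nonneg _)
        (mul_nonneg (Nat.cast_nonneg _) (hC0 i))
    refine (Finset.sum_le_sum h2).trans ?_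
    rw [← Finset.sum_mul, ← hB, mul_div_assoc']
    rw [div_le_iff₀ (by linarith)]
    nlinarith
  · have h1 : (fun q : ℝ × V => b q.1 * (χ q.2 * g n q.2)) =ᶠ[𝓝 w] fun _ => 0 := by
      filter_upwards [(hK.isClosed.isOpen_compl.preimage continuous_snd).mem_nhds
        (show w ∈ Prod.snd ⁻¹' Kᶜ from hw)] with q hq
      rw [hχ0 _ hq, zero_mul, mul_zero]
    rw [(h1.iteratedFDeriv ℝ j).self_of_nhds, iteratedFDeriv_fun_zero]
    simpa using hδ.le

/-- Bump functions with disjoint supports, centred at the powers of `1/2`. -/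
def dyadicBump (k : ℕ) : ContDiffBump ((1 / 2 : ℝ) ^ k) where
  rIn := (1 / 2) ^ k / 8
  rOut := (1 / 2) ^ k / 4
  rIn_pos := by positivity
  rIn_lt_rOut := by linarith [show (0 : ℝ) < (1 / 2) ^ k by positivity]

theorem dyadicBump_self (k : ℕ) : dyadicBump k ((1 / 2 : ℝ) ^ k) = 1 :=
  (dyadicBump k).one_of_mem_closedBall (Metric.mem_closedBall_self (dyadicBump k).rIn_pos.le)

theorem dyadicBump_of_ne {k l : ℕ} (h : l ≠ k) : dyadicBump l ((1 / 2 : ℝ) ^ k) = 0 := by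
  refine (dyadicBump l).zero_of_le_dist ?_
  change (1 / 2 : ℝ) ^ l / 4 ≤ _
  rw [Real.dist_eq]
  have h0 : ∀ n : ℕ, (0 : ℝ) < (1 / 2) ^ n := fun n => by positivity
  have h1 : ∀ {a b : ℕ}, a < b → (1 / 2 : ℝ) ^ b ≤ (1 / 2) ^ a / 2 := by
    intro a b hab
    calc (1 / 2 : ℝ) ^ b ≤ (1 / 2) ^ (a + 1) :=
          pow_le_pow_of_le_one (by norm_num) (by norm_num) hab
      _ = _ := by ring
  rcases lt_or_gt_of_ne h with h | h
  · rw [abs_sub_comm, abs_of_nonneg (by linarith [h1 h, h0 l])]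
    linarith [h1 h, h0 l]
  · rw [abs_of_nonneg (by linarith [h1 h, h0 k])]
    linarith [h1 h, h0 k, h0 l]

theorem dyadicBump_zero (k : ℕ) : dyadicBump k (0 : ℝ) = 0 := by
  refine (dyadicBump k).zero_of_le_dist ?_
  change (1 / 2 : ℝ) ^ k / 4 ≤ _
  have h0 : (0 : ℝ) < (1 / 2) ^ k := by positivity
  rw [Real.dist_eq, zero_sub, abs_neg, abs_of_pos h0]
  linarith

theorem finite_dyadicBump_support (t : ℝ) : {k : ℕ | dyadicBump k t ≠ 0}.Finite := by
  have h0 : ∀ n : ℕ, (0 : ℝ) < (1 / 2) ^ n := fun n => by positivity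
  by_cases ht : t ≤ 0
  · have : {k : ℕ | dyadicBump k t ≠ 0} = ∅ := by
      refine eq_empty_of_forall_notMem fun k hk => hk ?_
      refine (dyadicBump k).zero_of_le_dist ?_
      change (1 / 2 : ℝ) ^ k / 4 ≤ _
      rw [Real.dist_eq, abs_sub_comm, abs_of_nonneg (by linarith [h0 k])]
      linarith [h0 k]
    rw [this]; exact finite_empty
  · push Not at ht
    have h1 := (tendsto_pow_atTop_nhds_zero_of_lt_one (r := (1 / 2 : ℝ)) (by norm_num)
      (by norm_num)).eventually (gt_mem_nhds (half_pos ht))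
    obtain ⟨N, hN⟩ := eventually_atTop.1 h1
    refine (finite_lt_nat N).subset fun k hk => ?_
    by_contra hlt
    refine hk ((dyadicBump k).zero_of_le_dist ?_)
    change (1 / 2 : ℝ) ^ k / 4 ≤ _
    have h2 := hN k (not_lt.1 hlt)
    rw [Real.dist_eq, abs_of_nonneg (by linarith)]
    linarith [h0 k]

variable {E : Type*} [NormedAddCommGroup E] [NormedSpace ℝ E] [NormedSpace ℂ E]
  [IsScalarTower ℝ ℂ E] [FiniteDimensional ℂ E] [FiniteDimensional ℝ E]
  {H : Type*} [TopologicalSpace H] {I : ModelWithCorners ℝ E H} [I.Boundaryless]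
  {M : Type*} [TopologicalSpace M] [ChartedSpace H M] [T2Space M] [CompactSpace M]
  [IsManifold I ∞ M]

variable (I) in
/-- A coefficient of a form as a linear functional. -/
def coeffLM {V : Type*} [NormedAddCommGroup V] [NormedSpace ℝ V] (e : PartialEquiv M V) {k : ℕ}
    (z : V) (v : Fin k → V) : Form I M →ₗ[ℝ] ℝ where
  toFun α := formIn I e α.1 k z v
  map_add' _ _ := rfl
  map_smul' _ _ := rfl

/-- A functional that is continuous along smooth families is sequentially continuous. -/
theorem IsRegular.tendsto_zero {S : Form I M →ₗ[ℝ] ℝ} (hS : IsRegular S) {φ : ℕ → Form I M}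
    (h : TendstoZero I φ) : Tendsto (fun n => S (φ n)) atTop (𝓝 0) := by
  by_contra hnt
  rw [Metric.tendsto_nhds] at hnt
  push Not at hnt
  obtain ⟨ε, hε, hfreq⟩ := hnt
  choose K hKt hKc hK using fun x : M => exists_compact_chartPartition (I := I) x
  set χ : M → E → ℝ := fun x => indicator (extChartAt I x).target
    (fun z => chartPartition I M x ((extChartAt I x).symm z)) with hχ
  have hχeq : ∀ x, ∀ z ∈ (extChartAt I x).target, χ x z =
      chartPartition I M x ((extChartAt I x).symm z) := fun x z hz => indicator_of_mem hz _
  have hχ0' : ∀ x, ∀ z ∈ (extChartAt I x).target, z ∉ K x →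
      chartPartition I M x ((extChartAt I x).symm z) = 0 := by
    intro x z hz hzK
    refine hK x _ ?_
    rintro ⟨y, hy, hyz⟩
    exact hzK ((extChartAt I x).symm.injOn (hKt x hy) hz hyz ▸ hy)
  have hχ0 : ∀ x, ∀ z ∉ K x, χ x z = 0 := by
    intro x z hzK
    by_cases hz : z ∈ (extChartAt I x).target
    · rw [hχeq x z hz, hχ0' x z hz hzK]
    · exact indicator_of_notMem hz _
  have hχs : ∀ x, ContDiff ℝ ∞ (χ x) := by
    intro x
    refine contDiff_indicator_of_isClosed (isOpen_extChartAt_target x) (hKc x).isClosed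
      (hKt x) ?_ (hχ0' x)
    exact contMDiffOn_iff_contDiffOn.1 ((chartPartition_contMDiff x).comp_contMDiffOn
      (isChart_extChartAt I x).smooth_symm)
  have hev : ∀ k : ℕ, ∀ᶠ n in atTop, ∀ x ∈ chartPoints I M, ∀ q ∈ (Finset.univ : Finset (CoeffIndex E)),
      ∀ j ∈ Finset.range (k + 1), ∀ w : ℝ × E, ‖iteratedFDeriv ℝ j (fun w : ℝ × E =>
        dyadicBump k w.1 * (χ x w.2 * coordForm I x (φ n).1 q.1 w.2 q.vec)) w‖ ≤ (1 / 2) ^ k := by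
    intro k
    rw [Filter.eventually_all_finset]
    intro x _
    rw [Filter.eventually_all_finset]
    intro q _
    rw [Filter.eventually_all_finset]
    intro j _
    exact eventually_iteratedFDeriv_mul_le (isOpen_extChartAt_target x) (hKc x) (hKt x)
      (dyadicBump k).contDiff (dyadicBump k).hasCompactSupport (hχs x) (hχ0 x)
      (g := fun n z => coordForm I x (φ n).1 q.1 z q.vec) (fun n => (φ n).2 x q.1 q.vec)
      (fun j => h x q.1 q.vec j (K x) (hKc x) (hKt x)) j (by positivity)
  choose n hn using fun k => (hfreq.and_eventually (hev k)).exists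
  set Φ : ℝ → Form I M := fun t => ∑ᶠ k, dyadicBump k t • φ (n k) with hΦ
  have hfin : ∀ t, (Function.support fun k => dyadicBump k t • φ (n k)).Finite := fun t =>
    (finite_dyadicBump_support t).subset fun k hk h0 => hk (by
      change dyadicBump k t • φ (n k) = 0
      rw [h0, zero_smul])
  have hΦk : ∀ k, Φ ((1 / 2) ^ k) = φ (n k) := by
    intro k
    simp only [hΦ]
    rw [finsum_eq_single _ k fun l hl => by rw [dyadicBump_of_ne hl, zero_smul],
      dyadicBump_self, one_smul]
  have hΦ0 : Φ 0 = 0 := by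
    simp only [hΦ, dyadicBump_zero, zero_smul, finsum_zero]
  have hfam : SmoothFamily I (fun t => (Φ t).1) := by
    intro y p z hz
    set m := (extChartAt I y).symm z with hm
    obtain ⟨x, hx, hxm⟩ : ∃ x ∈ chartPoints I M, chartPartition I M x m ≠ 0 := by
      by_contra! h0
      have := sum_chartPartition (I := I) m
      rw [Finset.sum_eq_zero h0] at this
      exact zero_ne_one this
    have hms : m ∈ (extChartAt I x).source := by
      by_contra hmem
      refine hxm (hK x m ?_)
      rintro ⟨y, hy, hyz⟩
      exact hmem (hyz ▸ (extChartAt I x).map_target (hKt x hy))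
    refine FamilyAt.change (isChart_extChartAt I y) (isChart_extChartAt I x) hz hms ?_
    set z' := extChartAt I x m with hz'
    have hz't : z' ∈ (extChartAt I x).target := (extChartAt I x).map_source hms
    have hχz' : χ x z' ≠ 0 := by
      rw [hχeq x z' hz't, (extChartAt I x).left_inv hms]; exact hxm
    have hq : ∀ q : CoeffIndex E, ContDiffAt ℝ ∞ (fun w : ℝ × E =>
        formIn I (extChartAt I x) (Φ w.1).1 q.1 w.2 q.vec) (p, z') := by
      intro q
      set f : ℕ → ℝ × E → ℝ := fun k w =>
        dyadicBump k w.1 * (χ x w.2 * coordForm I x (φ (n k)).1 q.1 w.2 q.vec) with hf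
      have hfs : ∀ k, ContDiff ℝ ∞ (f k) := by
        intro k
        refine ((dyadicBump k).contDiff.comp contDiff_fst).mul ?_
        have h1 : (fun w : E => χ x w * coordForm I x (φ (n k)).1 q.1 w q.vec) =
            indicator (extChartAt I x).target
              (fun w : E => χ x w * coordForm I x (φ (n k)).1 q.1 w q.vec) := by
          funext w
          by_cases hw : w ∈ (extChartAt I x).target
          · rw [indicator_of_mem hw]
          · rw [indicator_of_notMem hw, hχ0 x w fun hwK => hw (hKt x hwK), zero_mul]
        have h2 : ContDiff ℝ ∞ (fun w : E => χ x w * coordForm I x (φ (n k)).1 q.1 w q.vec) := by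
          rw [h1]
          exact contDiff_indicator_of_isClosed (isOpen_extChartAt_target x) (hKc x).isClosed (hKt x)
            ((hχs x).contDiffOn.mul ((φ (n k)).2 x q.1 q.vec))
            fun w _ hw => by rw [hχ0 x w hw, zero_mul]
        exact h2.comp contDiff_snd
      have hsum : ContDiff ℝ ∞ fun w => ∑' k, f k w := by
        refine contDiff_tsum_of_eventually (v := fun _ k => (1 / 2 : ℝ) ^ k) hfs
          (fun _ _ => summable_geometric_of_lt_one (by norm_num) (by norm_num)) fun j _ => ?_
        rw [Nat.cofinite_eq_atTop]
        filter_upwards [eventually_ge_atTop j] with k hk w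
        exact (hn k).2 x hx q (Finset.mem_univ _) j (Finset.mem_range.2 (by omega)) w
      have hrel : ∀ w : ℝ × E, ∑' k, f k w =
          χ x w.2 * formIn I (extChartAt I x) (Φ w.1).1 q.1 w.2 q.vec := by
        intro w
        have h1 : (Function.support fun k => f k w).Finite :=
          (finite_dyadicBump_support w.1).subset fun k hk h0 => hk (by
            change dyadicBump k w.1 * _ = 0
            rw [h0, zero_mul])
        rw [tsum_eq_finsum h1]
        have h2 := (coeffLM I (extChartAt I x) w.2 q.vec).toAddMonoidHom.map_finsum (hfin w.1)
        have h3 : formIn I (extChartAt I x) (Φ w.1).1 q.1 w.2 q.vec =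
          ∑ᶠ k, dyadicBump k w.1 * coordForm I x (φ (n k)).1 q.1 w.2 q.vec := h2
        rw [h3, mul_finsum]
        refine finsum_congr fun k => ?_
        simp only [hf]
        ring
      have h1 : ContDiffAt ℝ ∞ (fun w : ℝ × E => (χ x w.2)⁻¹ * ∑' k, f k w) (p, z') :=
        (((hχs x).contDiffAt.comp (p, z') contDiffAt_snd).inv hχz').mul hsum.contDiffAt
      refine h1.congr_of_eventuallyEq ?_
      have h2 : ∀ᶠ w : ℝ × E in 𝓝 (p, z'), χ x w.2 ≠ 0 :=
        (((hχs x).continuous.comp continuous_snd).continuousAt (x := (p, z'))).eventually_ne hχz'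
      filter_upwards [h2] with w hw
      rw [hrel, inv_mul_cancel_left₀ hw]
    intro k v
    have h1 : ∀ w : ℝ × E, formIn I (extChartAt I x) (Φ w.1).1 k w.2 v =
        ∑ q : CoeffIndex E, formIn I (extChartAt I x) (Φ w.1).1 q.1 w.2 q.vec *
          constForm q.covec k v := by
      intro w
      conv_lhs => rw [eq_sum_constForm (fun k => formIn I (extChartAt I x) (Φ w.1).1 k w.2) k]
      rw [ContinuousAlternatingMap.sum_apply]
      rfl
    simp only [h1]
    exact ContDiffAt.sum fun q _ => (hq q).mul contDiffAt_const
  have hcont : Continuous fun t => S (Φ t) := hS ℝ Φ hfam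
  have hlim := (hcont.tendsto 0).comp (tendsto_pow_atTop_nhds_zero_of_lt_one (r := (1 / 2 : ℝ))
    (by norm_num) (by norm_num))
  rw [hΦ0, map_zero, Metric.tendsto_nhds] at hlim
  obtain ⟨k, hk⟩ := (hlim ε hε).exists
  simp only [Function.comp, hΦk] at hk
  exact absurd hk (not_lt.2 (hn k).1)

/-- A functional that is continuous along smooth families, as a current. -/
def IsRegular.toCurrent {S : Form I M →ₗ[ℝ] ℝ} (hS : IsRegular S) : Current I M :=
  ⟨S, fun _ h => hS.tendsto_zero h⟩

end SpecialCurve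

section SubmersionChart

variable {E : Type*} [NormedAddCommGroup E] [NormedSpace ℝ E]
  {H : Type*} [TopologicalSpace H] {I : ModelWithCorners ℝ E H}
  {M : Type*} [TopologicalSpace M] [ChartedSpace H M]
  {E' : Type*} [NormedAddCommGroup E'] [NormedSpace ℝ E']
  {H' : Type*} [TopologicalSpace H'] {I' : ModelWithCorners ℝ E' H'}
  {M' : Type*} [TopologicalSpace M'] [ChartedSpace H' M']
  {V : Type*} [NormedAddCommGroup V] [NormedSpace ℝ V]
  {V' : Type*} [NormedAddCommGroup V'] [NormedSpace ℝ V']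

theorem IsChart.trans {e : PartialEquiv M V} (he : IsChart I e) (φ : OpenPartialHomeomorph V V')
    (hφ : ContDiffOn ℝ ∞ φ φ.source) (hφ' : ContDiffOn ℝ ∞ φ.symm φ.target) :
    IsChart I (e.trans φ.toPartialEquiv) where
  open_source := by
    rw [PartialEquiv.trans_source]
    exact he.smooth.continuousOn.isOpen_inter_preimage he.open_source φ.open_source
  open_target := by
    rw [PartialEquiv.trans_target]
    exact φ.symm.continuousOn.isOpen_inter_preimage φ.open_target he.open_target
  smooth := by
    rw [PartialEquiv.trans_source]
    exact hφ.contMDiffOn.comp (he.smooth.mono inter_subset_left) fun p hp => hp.2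
  smooth_symm := by
    rw [PartialEquiv.trans_target]
    exact he.smooth_symm.comp (hφ'.contMDiffOn.mono inter_subset_left) fun p hp => hp.2

/-- The inverse function theorem, on an open set on which the differential is invertible. -/
theorem exists_local_diffeo [FiniteDimensional ℝ V] {G : V → V} {O : Set V} (hO : IsOpen O)
    (hG : ContDiffOn ℝ ∞ G O) {y : V} (hy : y ∈ O) (hd : (fderiv ℝ G y).det ≠ 0) :
    ∃ φ : OpenPartialHomeomorph V V, ⇑φ = G ∧ y ∈ φ.source ∧ φ.source ⊆ O ∧
      ContDiffOn ℝ ∞ φ φ.source ∧ ContDiffOn ℝ ∞ φ.symm φ.target := by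
  haveI : CompleteSpace V := FiniteDimensional.complete ℝ V
  have hGy : ∀ z ∈ O, ContDiffAt ℝ ∞ G z := fun z hz => hG.contDiffAt (hO.mem_nhds hz)
  have hdiff : ∀ z ∈ O, (hz : (fderiv ℝ G z).det ≠ 0) → HasFDerivAt G
      (((fderiv ℝ G z).toContinuousLinearEquivOfDetNeZero hz : V ≃L[ℝ] V) : V →L[ℝ] V) z :=
    fun z hz hz' => by
      have h := ((hGy z hz).differentiableAt (by simp)).hasFDerivAt
      convert h using 1
      ext v
      rfl
  have h1 := hdiff y hy hd
  set φ := (hGy y hy).toOpenPartialHomeomorph G h1 (by simp) with hφ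
  have hdet : ContinuousOn (fun z => (fderiv ℝ G z).det) O := fun z hz =>
    (ContinuousLinearMap.continuous_det.continuousAt.comp
      (((hGy z hz).fderiv_right (m := 0) (by simp)).continuousAt)).continuousWithinAt
  set U : Set V := O ∩ (fun z => (fderiv ℝ G z).det) ⁻¹' {0}ᶜ with hU
  have hUo : IsOpen U := hdet.isOpen_inter_preimage hO isClosed_singleton.isOpen_compl
  refine ⟨φ.restrOpen U hUo, rfl, ?_, ?_, ?_, ?_⟩
  · rw [OpenPartialHomeomorph.restrOpen_source]
    exact ⟨(hGy y hy).mem_toOpenPartialHomeomorph_source h1 (by simp), hy, hd⟩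
  · rw [OpenPartialHomeomorph.restrOpen_source]
    exact fun z hz => hz.2.1
  · rw [OpenPartialHomeomorph.restrOpen_source]
    exact hG.mono fun z hz => hz.2.1
  · intro a ha
    have h2 : (φ.restrOpen U hUo).symm a ∈ (φ.restrOpen U hUo).source :=
      (φ.restrOpen U hUo).map_target ha
    rw [OpenPartialHomeomorph.restrOpen_source] at h2
    exact (OpenPartialHomeomorph.contDiffAt_symm (φ.restrOpen U hUo) ha
      (hdiff _ h2.2.1 h2.2.2) (hGy _ h2.2.1)).contDiffWithinAt

variable [I.Boundaryless] [IsManifold I ∞ M]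

/-- In suitable coordinates a submersion is a surjective linear map. -/
theorem exists_submersion_chart [FiniteDimensional ℝ E] [FiniteDimensional ℝ E'] {s : M → M'}
    (hs : ContMDiff I I' ∞ s) {p : M} (hp : Function.Surjective (diffAt I I' s p))
    {e' : PartialEquiv M' E'} (he' : IsChart I' e') (hpe' : s p ∈ e'.source) :
    ∃ e : PartialEquiv M E, IsChart I e ∧ p ∈ e.source ∧ ∃ A : E →L[ℝ] E',
      Function.Surjective A ∧ ∀ q ∈ e.source, s q ∈ e'.source ∧ e' (s q) = A (e q) := by
  set e0 := extChartAt I p with he0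
  have hc0 : IsChart I e0 := isChart_extChartAt I p
  set O : Set E := e0.target ∩ (fun y => s (e0.symm y)) ⁻¹' e'.source with hO
  have hcont : ContMDiffOn 𝓘(ℝ, E) I' ∞ (fun y => s (e0.symm y)) e0.target :=
    hs.comp_contMDiffOn hc0.smooth_symm
  have hOo : IsOpen O := hcont.continuousOn.isOpen_inter_preimage hc0.open_target he'.open_source
  set F : E → E' := fun y => e' (s (e0.symm y)) with hF
  have hFs : ContDiffOn ℝ ∞ F O := by
    rw [← contMDiffOn_iff_contDiffOn]
    exact he'.smooth.comp (t := e'.source) (hcont.mono inter_subset_left) fun y hy => hy.2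
  have hp0 : p ∈ e0.source := mem_extChartAt_source p
  have hy0 : e0 p ∈ O := ⟨e0.map_source hp0, by
    change s (e0.symm (e0 p)) ∈ e'.source; rwa [e0.left_inv hp0]⟩
  set A := fderiv ℝ F (e0 p) with hA
  have hAs : Function.Surjective A := by
    have h1 : A = (diffAt I' 𝓘(ℝ, E') e' (s p)).comp
        ((diffAt I I' s p).comp (diffAt 𝓘(ℝ, E) I e0.symm (e0 p))) := by
      have h2 : ContMDiffAt 𝓘(ℝ, E) I ∞ e0.symm (e0 p) := hc0.contMDiffAt_symm hy0.1
      have h3 : MDifferentiableAt I I' s (e0.symm (e0 p)) := hs.mdifferentiableAt (by simp)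
      have h4 : diffAt 𝓘(ℝ, E) I' (fun y => s (e0.symm y)) (e0 p) =
          (diffAt I I' s (e0.symm (e0 p))).comp (diffAt 𝓘(ℝ, E) I e0.symm (e0 p)) :=
        mfderiv_comp (e0 p) h3 (h2.mdifferentiableAt (by simp))
      have h5 : MDifferentiableAt I' 𝓘(ℝ, E') e' (s (e0.symm (e0 p))) := by
        rw [e0.left_inv hp0]
        exact (he'.contMDiffAt hpe').mdifferentiableAt (by simp)
      have h6 : diffAt 𝓘(ℝ, E) 𝓘(ℝ, E') F (e0 p) =
          (diffAt I' 𝓘(ℝ, E') e' (s (e0.symm (e0 p)))).comp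
            (diffAt 𝓘(ℝ, E) I' (fun y => s (e0.symm y)) (e0 p)) :=
        mfderiv_comp (e0 p) h5 (f := fun y => s (e0.symm y))
          ((hcont.contMDiffAt (hc0.open_target.mem_nhds hy0.1)).mdifferentiableAt (by simp))
      rw [h4, e0.left_inv hp0] at h6
      rw [← h6, hA, ← mfderiv_eq_fderiv]
      rfl
    have h7 : Function.Surjective (diffAt I' 𝓘(ℝ, E') e' (s p)) := fun v =>
      ⟨diffAt 𝓘(ℝ, E') I' e'.symm (e' (s p)) v, by
        have := DFunLike.congr_fun (he'.diffAt_comp_symm (e'.map_source hpe')) v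
        rwa [e'.left_inv hpe'] at this⟩
    have h8 : Function.Surjective (diffAt 𝓘(ℝ, E) I e0.symm (e0 p)) := fun v =>
      ⟨diffAt I 𝓘(ℝ, E) e0 p v, DFunLike.congr_fun (hc0.diffAt_symm_comp hp0) v⟩
    rw [h1]
    exact h7.comp (hp.comp h8)
  obtain ⟨B, hB⟩ := A.exists_rightInverse_of_surjective
    (LinearMap.range_eq_top.2 hAs)
  have hAB : ∀ v, A (B v) = v := fun v => DFunLike.congr_fun hB v
  set G : E → E := fun y => y + B (F y - A y) with hG
  have hGs : ContDiffOn ℝ ∞ G O :=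
    contDiffOn_id.add (B.contDiff.comp_contDiffOn (hFs.sub A.contDiff.contDiffOn))
  have hGd : fderiv ℝ G (e0 p) = ContinuousLinearMap.id ℝ E := by
    have h1 : HasFDerivAt F A (e0 p) :=
      ((hFs.contDiffAt (hOo.mem_nhds hy0)).differentiableAt (by simp)).hasFDerivAt
    have h2 : HasFDerivAt G (ContinuousLinearMap.id ℝ E + B.comp (A - A)) (e0 p) :=
      (hasFDerivAt_id _).add (B.hasFDerivAt.comp (e0 p) (h1.sub A.hasFDerivAt))
    rw [h2.fderiv, sub_self, ContinuousLinearMap.comp_zero, add_zero]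
  obtain ⟨φ, hφ, hyφ, hφO, hφs, hφs'⟩ := exists_local_diffeo hOo hGs hy0
    (by rw [hGd]; simp [ContinuousLinearMap.det])
  refine ⟨e0.trans φ.toPartialEquiv, hc0.trans φ hφs hφs', ⟨hp0, hyφ⟩, A, hAs, ?_⟩
  rintro q ⟨hq, hq'⟩
  have h1 : s (e0.symm (e0 q)) ∈ e'.source := (hφO hq').2
  rw [e0.left_inv hq] at h1
  refine ⟨h1, ?_⟩
  change _ = A (φ (e0 q))
  rw [hφ]
  simp only [hG, hF, map_add, hAB, e0.left_inv hq]
  abel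

end SubmersionChart

section FibreAverage

variable {E : Type*} [NormedAddCommGroup E] [NormedSpace ℝ E] [NormedSpace ℂ E]
  [IsScalarTower ℝ ℂ E] [FiniteDimensional ℂ E] [FiniteDimensional ℝ E]
  {E' : Type*} [NormedAddCommGroup E'] [NormedSpace ℝ E'] [NormedSpace ℂ E']
  [IsScalarTower ℝ ℂ E'] [FiniteDimensional ℂ E'] [FiniteDimensional ℝ E']

/-- Integration of functions supported in a compact set over the fibres of a linear map. -/
theorem exists_fibre_average [MeasurableSpace E] [BorelSpace E] [MeasurableSpace E']
    [BorelSpace E'] (A : E →L[ℝ] E') (hA : Function.Surjective A) {K : Set E} (hK : IsCompact K) :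
    ∃ G : (E → ℝ) → E' → ℝ,
      (∀ (P : Type) [NormedAddCommGroup P] [NormedSpace ℝ P] (w : P → E → ℝ),
        ContDiff ℝ ∞ (fun q : P × E => w q.1 q.2) →
          ContDiff ℝ ∞ (fun q : P × E' => G (w q.1) q.2)) ∧
      (∀ w : E → ℝ, (∀ z ∉ K, w z = 0) → ∀ z ∉ A '' K, G w z = 0) ∧
      ∀ (w : E → ℝ) (O : Set E') (u : E' → ℝ), Continuous w → (∀ z ∉ K, w z = 0) → IsOpen O →
        A '' K ⊆ O → ContinuousOn u O →
          ∫ z, u (A z) * w z ∂frameMeasure E = ∫ z in O, G w z * u z ∂frameMeasure E' := by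
  obtain ⟨k, Λ, hΛ1⟩ : ∃ (k : Submodule ℝ E) (Λ : E ≃L[ℝ] E' × k), ∀ y, A (Λ.symm y) = y.1 := by
    obtain ⟨B, hB⟩ := A.exists_rightInverse_of_surjective (LinearMap.range_eq_top.2 hA)
    have hAB : Function.RightInverse B A := fun v => DFunLike.congr_fun hB v
    exact ⟨_, ContinuousLinearEquiv.equivOfRightInverse A B hAB, fun y =>
      congrArg Prod.fst ((ContinuousLinearEquiv.equivOfRightInverse A B hAB).apply_symm_apply y)⟩
  letI : MeasurableSpace k := borel k
  haveI : BorelSpace k := ⟨rfl⟩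
  haveI : ProperSpace k := FiniteDimensional.proper ℝ k
  haveI : ProperSpace E' := FiniteDimensional.proper ℝ E'
  set ν : Measure k := Measure.addHaar with hν
  haveI : (Measure.map Λ.symm ((frameMeasure E').prod ν)).IsAddHaarMeasure :=
    Λ.symm.isAddHaarMeasure_map _
  obtain ⟨c, hc⟩ : ∃ c : NNReal, frameMeasure E =
      c • Measure.map Λ.symm ((frameMeasure E').prod ν) :=
    ⟨_, Measure.isAddLeftInvariant_eq_smul _ _⟩
  obtain ⟨R, hR⟩ := (hK.image (continuous_snd.comp Λ.continuous)).isBounded.subset_closedBall 0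
  have hKR : ∀ z' (v : k), v ∉ Metric.closedBall (0 : k) R → Λ.symm (z', v) ∉ K := fun z' v hv hm =>
    hv (hR ⟨_, hm, by simp⟩)
  have hint : ∀ g : E → ℝ, ∫ z, g z ∂frameMeasure E =
      c * ∫ y, g (Λ.symm y) ∂((frameMeasure E').prod ν) := fun g => by
    rw [hc, integral_smul_nnreal_measure]
    exact congrArg (c • ·) (Λ.symm.toHomeomorph.measurableEmbedding.integral_map g)
  set ν' : Measure k := ν.restrict (Metric.closedBall 0 R) with hν'
  haveI : IsFiniteMeasure ν' := ⟨by
    rw [hν', Measure.restrict_apply_univ]; exact (isCompact_closedBall _ _).measure_lt_top⟩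
  have hν'c : IsCompactMeasure ν' := ⟨_, isCompact_closedBall 0 R, by
    rw [hν', Measure.restrict_apply' Metric.isClosed_closedBall.measurableSet]; simp⟩
  refine ⟨fun w z' => c * ∫ v, w (Λ.symm (z', v)) ∂ν', fun P _ _ w hw => ?_, fun w hw z' hz' => ?_,
    fun w O u hw hw0 hO hKO hu => ?_⟩
  · rw [← contDiffOn_univ]
    refine contDiffOn_const.mul (contDiffOn_parametric_integral hν'c isOpen_univ
      (g := fun (q : P × E') (v : k) => w q.1 (Λ.symm (q.2, v))) ?_)
    refine ContDiff.contDiffOn ?_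
    exact hw.comp ((contDiff_fst.comp contDiff_fst).prodMk (Λ.symm.contDiff.comp
      ((contDiff_snd.comp contDiff_fst).prodMk contDiff_snd)))
  · have : ∀ v : k, w (Λ.symm (z', v)) = 0 := fun v => hw _ fun hm =>
      hz' ⟨_, hm, hΛ1 _⟩
    simp only [this, MeasureTheory.integral_zero, mul_zero]
  · have hG : ∀ z', ∫ v, w (Λ.symm (z', v)) ∂ν' = ∫ v, w (Λ.symm (z', v)) ∂ν := fun z' =>
      setIntegral_eq_integral_of_forall_compl_eq_zero fun v hv => hw0 _ (hKR z' v hv)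
    rw [hint]
    have hz : ∀ y : E' × k, y ∉ O ×ˢ (univ : Set k) →
        u (A (Λ.symm y)) * w (Λ.symm y) = 0 := fun y hy => by
      rw [hw0 _ fun hm => hy ⟨hKO ⟨_, hm, hΛ1 y⟩, trivial⟩, mul_zero]
    have hi : Integrable (fun y : E' × k => u (A (Λ.symm y)) * w (Λ.symm y))
        ((frameMeasure E').prod ν) := by
      rw [← integrableOn_univ]
      refine IntegrableOn.of_forall_sdiff_eq_zero (s := O ×ˢ (univ : Set k)) ?_
        MeasurableSet.univ fun y hy => hz y hy.2
      refine integrableOn_of_compact_support _ (hO.prod isOpen_univ).measurableSet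
        (hK.image Λ.continuous) ?_ ?_ ?_
      · rintro _ ⟨z, hz, rfl⟩
        exact ⟨hKO ⟨z, hz, by rw [← hΛ1, Λ.symm_apply_apply]⟩, trivial⟩
      · refine ContinuousOn.mul ?_ (hw.comp Λ.symm.continuous).continuousOn
        simp only [hΛ1]
        exact hu.comp continuous_fst.continuousOn fun y hy => hy.1
      · intro y _ hy
        rw [hw0 _ fun hm => hy ⟨_, hm, Λ.apply_symm_apply y⟩, mul_zero]
    rw [integral_prod _ hi, ← MeasureTheory.integral_const_mul,
      ← setIntegral_eq_integral_of_forall_compl_eq_zero (s := O)]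
    · refine integral_congr_ae (Eventually.of_forall fun z' => ?_)
      simp only [hΛ1, hG]
      rw [MeasureTheory.integral_const_mul]
      ring
    · intro z' hz'
      have : ∀ v : k, u (A (Λ.symm (z', v))) * w (Λ.symm (z', v)) = 0 := fun v =>
        hz _ fun h => hz' h.1
      simp only [this, MeasureTheory.integral_zero, mul_zero]

end FibreAverage

section FibreIntegral

variable {E : Type*} [NormedAddCommGroup E] [NormedSpace ℝ E] [NormedSpace ℂ E]
  [IsScalarTower ℝ ℂ E] [FiniteDimensional ℂ E] [FiniteDimensional ℝ E]
  {H : Type*} [TopologicalSpace H] {I : ModelWithCorners ℝ E H} [I.Boundaryless]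
  {M : Type*} [TopologicalSpace M] [ChartedSpace H M] [T2Space M] [CompactSpace M]
  [IsManifold I ∞ M]
  {E' : Type*} [NormedAddCommGroup E'] [NormedSpace ℝ E'] [NormedSpace ℂ E']
  [IsScalarTower ℝ ℂ E'] [FiniteDimensional ℂ E'] [FiniteDimensional ℝ E']
  {H' : Type*} [TopologicalSpace H'] {I' : ModelWithCorners ℝ E' H'} [I'.Boundaryless]
  {M' : Type*} [TopologicalSpace M'] [ChartedSpace H' M'] [T2Space M'] [CompactSpace M']
  [IsManifold I' ∞ M']

/-- The coefficient of `A^* c ∧ φ` with respect to the frame, in a coordinate system. -/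
def fibreCoeff (A : E →L[ℝ] E') (c : ∀ k : ℕ, E' [⋀^Fin k]→L[ℝ] ℝ)
    (φ : ∀ k : ℕ, E [⋀^Fin k]→L[ℝ] ℝ) : ℝ :=
  ∑ i : Fin (realDim E + 1), wedgePairing (Nat.add_sub_of_le (Nat.lt_succ_iff.1 i.2))
    (complexFrame E) ((c i).compContinuousLinearMap A) (φ (realDim E - i))

theorem fibreCoeff_sum (A : E →L[ℝ] E') (c : ∀ k : ℕ, E' [⋀^Fin k]→L[ℝ] ℝ)
    (φ : ∀ k : ℕ, E [⋀^Fin k]→L[ℝ] ℝ) :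
    fibreCoeff A c φ =
      ∑ q : CoeffIndex E', c q.1 q.vec * fibreCoeff A (constForm q.covec) φ := by
  simp only [fibreCoeff, Finset.mul_sum]
  rw [Finset.sum_comm]
  refine Finset.sum_congr rfl fun i _ => ?_
  have h1 : (c i).compContinuousLinearMap A = ∑ q : CoeffIndex E', c q.1 q.vec •
      ((constForm q.covec i).compContinuousLinearMap A) := by
    conv_lhs => rw [eq_sum_constForm c i]
    ext v
    simp [ContinuousAlternatingMap.sum_apply]
  rw [h1, map_sum, LinearMap.sum_apply]
  exact Finset.sum_congr rfl fun q _ => by rw [map_smul, LinearMap.smul_apply, smul_eq_mul]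

theorem fibreCoeff_smul (A : E →L[ℝ] E') (c : ∀ k : ℕ, E' [⋀^Fin k]→L[ℝ] ℝ) (t : ℝ)
    (φ : ∀ k : ℕ, E [⋀^Fin k]→L[ℝ] ℝ) :
    fibreCoeff A c (fun k => t • φ k) = t * fibreCoeff A c φ := by
  simp only [fibreCoeff, Finset.mul_sum, map_smul, smul_eq_mul]

theorem contDiffAt_fibreCoeff {Z : Type*} [NormedAddCommGroup Z] [NormedSpace ℝ Z]
    (A : E →L[ℝ] E') (c : ∀ k : ℕ, E' [⋀^Fin k]→L[ℝ] ℝ) {φ : Z → ∀ k : ℕ, E [⋀^Fin k]→L[ℝ] ℝ}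
    {z : Z} (h : ∀ k v, ContDiffAt ℝ ∞ (fun z => φ z k v) z) :
    ContDiffAt ℝ ∞ (fun z => fibreCoeff A c (φ z)) z := by
  refine ContDiffAt.sum fun i _ => ?_
  exact (LinearMap.toContinuousLinearMap (wedgePairing
    (Nat.add_sub_of_le (Nat.lt_succ_iff.1 i.2)) (complexFrame E)
      ((c i).compContinuousLinearMap A))).contDiff.contDiffAt.comp z
    (contDiffAt_alternating fun v => h _ v)

/-- The coefficients, extended by zero, of `A^* c ∧ ρ φ` for the basic covectors `c`. -/
def fibreWeight (e : PartialEquiv M E) (A : E →L[ℝ] E') (ρ : M → ℝ) (q : CoeffIndex E')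
    (φ : RawForm E M) : E → ℝ :=
  indicator e.target fun z =>
    ρ (e.symm z) * fibreCoeff A (constForm q.covec) (fun k => formIn I e φ k z)

theorem fibreWeight_eq_zero {e : PartialEquiv M E} (A : E →L[ℝ] E') {ρ : M → ℝ}
    (q : CoeffIndex E') (φ : RawForm E M) {z : E} (hz : z ∉ e '' tsupport ρ) :
    fibreWeight (I := I) e A ρ q φ z = 0 := by
  by_cases h : z ∈ e.target
  · refine (indicator_of_mem h _).trans ?_
    rw [image_eq_zero_of_notMem_tsupport fun h' => hz ⟨_, h', e.right_inv h⟩, zero_mul]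
  · exact indicator_of_notMem h _

theorem contDiff_fibreWeight {e : PartialEquiv M E} (hc : IsChart I e) (A : E →L[ℝ] E')
    {ρ : C^∞⟮I, M; 𝓘(ℝ), ℝ⟯} (hρ : tsupport ρ ⊆ e.source) (q : CoeffIndex E')
    {P : Type*} [NormedAddCommGroup P] [NormedSpace ℝ P] {Φ : P → RawForm E M}
    (hΦ : SmoothFamily I Φ) :
    ContDiff ℝ ∞ fun x : P × E => fibreWeight (I := I) e A ρ q (Φ x.1) x.2 := by
  have hKc : IsCompact (e '' tsupport ρ) :=
    (isClosed_tsupport _).isCompact.image_of_continuousOn (hc.smooth.continuousOn.mono hρ)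
  have hρs : ContDiffOn ℝ ∞ (fun z => ρ (e.symm z)) e.target := by
    rw [← contMDiffOn_iff_contDiffOn]
    exact ρ.contMDiff.comp_contMDiffOn hc.smooth_symm
  have h1 : (fun x : P × E => fibreWeight (I := I) e A ρ q (Φ x.1) x.2) =
      indicator (univ ×ˢ e.target) fun x =>
        ρ (e.symm x.2) * fibreCoeff A (constForm q.covec)
          (fun k => formIn I e (Φ x.1) k x.2) := by
    funext x
    by_cases h : x.2 ∈ e.target
    · rw [indicator_of_mem (show x ∈ univ ×ˢ e.target from ⟨trivial, h⟩)]
      exact indicator_of_mem h _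
    · rw [indicator_of_notMem fun h' : x ∈ univ ×ˢ e.target => h h'.2]
      exact indicator_of_notMem h _
  rw [h1]
  refine contDiff_indicator_of_isClosed (C := univ ×ˢ (e '' tsupport ρ))
    (isOpen_univ.prod hc.open_target) (isClosed_univ.prod hKc.isClosed) (prod_mono_right ?_)
    (fun x hx => ?_) fun x hx hxK => ?_
  · rintro _ ⟨p, hp, rfl⟩
    exact e.map_source (hρ hp)
  · refine ContDiffAt.contDiffWithinAt (ContDiffAt.mul ?_ (contDiffAt_fibreCoeff _ _ fun k v =>
      hΦ.familyAt hc x.1 hx.2 k v))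
    exact (hρs.contDiffAt (hc.open_target.mem_nhds hx.2)).comp x contDiffAt_snd
  · rw [image_eq_zero_of_notMem_tsupport fun h => hxK ⟨trivial, _, h, e.right_inv hx.2⟩, zero_mul]

theorem formIn_wedge_pullback {s : C^∞⟮I, M; I', M'⟯} {e : PartialEquiv M E} (hc : IsChart I e)
    {e' : PartialEquiv M' E'} (hc' : IsChart I' e') {A : E →L[ℝ] E'}
    (hsA : ∀ z ∈ e.target, s (e.symm z) ∈ e'.source ∧ e' (s (e.symm z)) = A z)
    (η : Form I' M') (ρ : C^∞⟮I, M; 𝓘(ℝ), ℝ⟯) (φ : Form I M) {z : E} (hz : z ∈ e.target) :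
    formIn I e (wedge I (pullback I I' s η) (mulForm ρ φ)).1 (realDim E) z (complexFrame E) =
      ∑ q : CoeffIndex E', formIn I' e' η.1 q.1 (A z) q.vec *
        fibreWeight (I := I) e A ρ q φ.1 z := by
  have hd : fderiv ℝ (fun y => e' (s (e.symm y))) z = A := by
    rw [Filter.EventuallyEq.fderiv_eq (f := A), A.fderiv]
    filter_upwards [hc.open_target.mem_nhds hz] with y hy using (hsA y hy).2
  have h2 : formIn I e (wedge I (pullback I I' s η) (mulForm ρ φ)).1 (realDim E) z
      (complexFrame E) = fibreCoeff A (fun k => formIn I' e' η.1 k (A z))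
        (fun k => ρ (e.symm z) • formIn I e φ.1 k z) := by
    change formIn I e (rawWedge (rawPullback I I' s η.1) (mulForm ρ φ).1) _ z _ = _
    rw [formIn_rawWedge, ContinuousAlternatingMap.sum_apply]
    refine Finset.sum_congr rfl fun i _ => ?_
    rw [formIn_rawPullback hc hc' hz s.contMDiff.contMDiffAt (hsA z hz).1, (hsA z hz).2, hd]
    rfl
  rw [h2, fibreCoeff_sum]
  refine Finset.sum_congr rfl fun q _ => ?_
  rw [fibreCoeff_smul, fibreWeight, indicator_of_mem hz]

theorem integral_wedge_pullback_eq [MeasurableSpace E] [BorelSpace E] {s : C^∞⟮I, M; I', M'⟯}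
    {e : PartialEquiv M E} (hc : IsChart I e) {σ : ℝ} (hσ : HasSign I e σ)
    {e' : PartialEquiv M' E'} (hc' : IsChart I' e') {A : E →L[ℝ] E'}
    (hsA : ∀ z ∈ e.target, s (e.symm z) ∈ e'.source ∧ e' (s (e.symm z)) = A z)
    (η : Form I' M') {ρ : C^∞⟮I, M; 𝓘(ℝ), ℝ⟯} (hρ : tsupport ρ ⊆ e.source) (φ : Form I M) :
    integral I (wedge I (pullback I I' s η) (mulForm ρ φ)) =
      σ * ∑ q : CoeffIndex E', ∫ z, formIn I' e' η.1 q.1 (A z) q.vec *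
        fibreWeight (I := I) e A ρ q φ.1 z ∂frameMeasure E := by
  have hKc : IsCompact (e '' tsupport ρ) :=
    (isClosed_tsupport _).isCompact.image_of_continuousOn (hc.smooth.continuousOn.mono hρ)
  have hKt : e '' tsupport ρ ⊆ e.target := by rintro _ ⟨q, hq, rfl⟩; exact e.map_source (hρ hq)
  have hwc : ∀ q, Continuous (fibreWeight (I := I) e A ρ q φ.1) := fun q =>
    ((contDiff_fibreWeight hc A hρ q (SmoothFamily.const (P := ℝ) φ.2)).comp
      ((contDiff_const (c := (0 : ℝ))).prodMk contDiff_id)).continuous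
  rw [integral_eq_of_chart hc hσ _ hKc hKt]
  · rw [setIntegral_congr_fun hc.open_target.measurableSet fun z hz =>
      formIn_wedge_pullback hc hc' hsA η ρ φ hz, integral_finsetSum]
    · congr 1
      refine Finset.sum_congr rfl fun q _ => ?_
      exact setIntegral_eq_integral_of_forall_compl_eq_zero fun z hz => by
        rw [fibreWeight_eq_zero A q φ.1 fun h => hz (hKt h), mul_zero]
    · intro q _
      refine integrableOn_of_compact_support _ hc.open_target.measurableSet hKc hKt
        (ContinuousOn.mul ((isSmoothForm_formIn_continuousOn η.2 hc' _ _).continuousOn.comp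
          A.continuous.continuousOn fun z hz => ?_) (hwc q).continuousOn) fun z _ hz => by
            rw [fibreWeight_eq_zero A q φ.1 hz, mul_zero]
      rw [← (hsA z hz).2]
      exact e'.map_source (hsA z hz).1
  · intro q hq
    have h1 : (mulForm ρ φ).1 q = 0 := by
      by_cases hqt : q ∈ tsupport ρ
      · exact absurd ⟨_, mem_image_of_mem e hqt, e.left_inv (hρ hqt)⟩ hq
      · change ρ q • φ.1 q = 0
        rw [image_eq_zero_of_notMem_tsupport hqt, zero_smul]
    exact rawWedge_eq_zero_right _ h1 _

variable [PositiveAtlas I M] [PositiveAtlas I' M']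

theorem exists_fibreIntegral_of_chart {s : C^∞⟮I, M; I', M'⟯}
    {e : PartialEquiv M E} (hc : IsChart I e) {σ : ℝ} (hσ : HasSign I e σ)
    {e' : PartialEquiv M' E'} (hc' : IsChart I' e') (hσ' : HasSign I' e' 1) {A : E →L[ℝ] E'}
    (hA : Function.Surjective A)
    (hsA : ∀ q ∈ e.source, s q ∈ e'.source ∧ e' (s q) = A (e q))
    {ρ : C^∞⟮I, M; 𝓘(ℝ), ℝ⟯} (hρ : tsupport ρ ⊆ e.source) {P : Type} [NormedAddCommGroup P]
    [NormedSpace ℝ P] {Φ : P → Form I M} (hΦ : SmoothFamily I fun p => (Φ p).1) :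
    ∃ Ψ : P → Form I' M', SmoothFamily I' (fun p => (Ψ p).1) ∧
      ∀ p, IsFibreIntegral s (mulForm ρ (Φ p)) (Ψ p) := by
  letI : MeasurableSpace E := borel E
  haveI : BorelSpace E := ⟨rfl⟩
  letI : MeasurableSpace E' := borel E'
  haveI : BorelSpace E' := ⟨rfl⟩
  have hKc : IsCompact (e '' tsupport ρ) :=
    (isClosed_tsupport _).isCompact.image_of_continuousOn (hc.smooth.continuousOn.mono hρ)
  have hAK : A '' (e '' tsupport ρ) ⊆ e'.target := by
    rintro _ ⟨_, ⟨q, hq, rfl⟩, rfl⟩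
    rw [← (hsA q (hρ hq)).2]
    exact e'.map_source (hsA q (hρ hq)).1
  have hAKc : IsCompact (A '' (e '' tsupport ρ)) := hKc.image A.continuous
  have hsymm : ∀ z ∈ e.target, s (e.symm z) ∈ e'.source ∧ e' (s (e.symm z)) = A z := fun z hz => by
    have := hsA _ (e.map_target hz)
    rwa [e.right_inv hz] at this
  obtain ⟨G, hG1, hG2, hG3⟩ := exists_fibre_average A hA hKc
  obtain ⟨w, hw⟩ : ∃ w : CoeffIndex E' → P → E → ℝ,
    w = fun q p => fibreWeight (I := I) e A ρ q (Φ p).1 := ⟨_, rfl⟩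
  have hws : ∀ q, ContDiff ℝ ∞ fun x : P × E => w q x.1 x.2 := fun q => by
    simp only [hw]; exact contDiff_fibreWeight (Φ := fun p => (Φ p).1) hc A hρ q hΦ
  have hw0 : ∀ q p, ∀ z ∉ e '' tsupport ρ, w q p z = 0 := fun q p z hz => by
    rw [hw]; exact fibreWeight_eq_zero A q _ hz
  obtain ⟨g, hg⟩ : ∃ g : P → CoeffIndex E' → E' → ℝ,
    g = fun p q z => σ * G (w q p) z := ⟨_, rfl⟩
  have hgs : ∀ q, ContDiff ℝ ∞ fun x : P × E' => g x.1 q x.2 := fun q => by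
    rw [hg]; exact contDiff_const.mul (hG1 P _ (hws q))
  have hgs' : ∀ p q, ContDiff ℝ ∞ (g p q) := fun p q =>
    (hgs q).comp (contDiff_const.prodMk contDiff_id)
  have hg0 : ∀ p q, ∀ z ∉ A '' (e '' tsupport ρ), g p q z = 0 := fun p q z hz => by
    simp only [hg]
    rw [hG2 (w q p) (hw0 q p) z hz, mul_zero]
  obtain ⟨Ψ, hΨ⟩ : ∃ Ψ : P → Form I' M', Ψ = fun p => ⟨extendForm I' e' (dualRawRight (g p)),
    isSmoothForm_dualRight hc' hAKc hAK (hgs' p) (hg0 p)⟩ := ⟨_, rfl⟩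
  refine ⟨Ψ, ?_, fun p η => ?_⟩
  · rw [hΨ]
    exact SmoothFamily.extendForm (A := fun p => dualRawRight (g p)) hc'
      (fun p z _ k v => dualRawRight_contDiffAt (fun q => (hgs q).contDiffAt) k v) fun p =>
      ⟨_, hAK, hAKc, Eventually.of_forall fun p' z hz => dualRawRight_eq_zero fun q => hg0 p' q z hz⟩
  · have hwc : ∀ q, Continuous (w q p) := fun q =>
      ((hws q).comp (contDiff_const.prodMk contDiff_id)).continuous
    rw [hΨ, integral_wedge_dualRight hc' hσ' hAKc hAK (hgs' p) (hg0 p) η,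
      one_mul, integral_wedge_pullback_eq hc hσ hc' hsymm η hρ (Φ p), Finset.mul_sum]
    refine Finset.sum_congr rfl fun q _ => ?_
    have h3 := hG3 (w q p) e'.target (fun z => formIn I' e' η.1 q.1 z q.vec) (hwc q) (hw0 q p)
      hc'.open_target hAK (isSmoothForm_formIn_continuousOn η.2 hc' _ _).continuousOn
    rw [hw] at h3
    rw [h3, ← MeasureTheory.integral_const_mul, hg, hw]
    simp only [mul_assoc]

theorem exists_local_fibreIntegral (s : C^∞⟮I, M; I', M'⟯) (p : M)
    (hp : Function.Surjective (diffAt I I' s p)) :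
    ∃ N : Set M, IsOpen N ∧ p ∈ N ∧ ∀ ρ : C^∞⟮I, M; 𝓘(ℝ), ℝ⟯, tsupport ρ ⊆ N →
      ∀ (P : Type) [NormedAddCommGroup P] [NormedSpace ℝ P] (Φ : P → Form I M),
        SmoothFamily I (fun p => (Φ p).1) → ∃ Ψ : P → Form I' M',
          SmoothFamily I' (fun p => (Ψ p).1) ∧
            ∀ p, IsFibreIntegral s (mulForm ρ (Φ p)) (Ψ p) := by
  have hc' : IsChart I' (extChartAt I' (s p)) := isChart_extChartAt I' (s p)
  obtain ⟨e, hc, hpe, A, hA, hsA⟩ := exists_submersion_chart s.contMDiff hp hc'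
    (mem_extChartAt_source (s p))
  obtain ⟨U, hU, hpU, -, σ, hσ⟩ := exists_hasSign hc (e.map_source hpe)
  have hsrc : (restrictTarget e U).source = e.source ∩ e ⁻¹' U := restrictTarget_source e U
  refine ⟨(restrictTarget e U).source, (hc.restrictTarget hU).open_source, hsrc ▸ ⟨hpe, hpU⟩,
    fun ρ hρ P _ _ Φ hΦ => ?_⟩
  exact exists_fibreIntegral_of_chart (hc.restrictTarget hU) hσ hc' (hasSign_extChartAt I' (s p)) hA
    (fun q hq => hsA q (hsrc ▸ hq).1) hρ hΦ

theorem IsFibreIntegral.sum {s : C^∞⟮I, M; I', M'⟯} {ι : Type*} {t : Finset ι}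
    {φ : ι → Form I M} {ψ : ι → Form I' M'} (h : ∀ i ∈ t, IsFibreIntegral s (φ i) (ψ i)) :
    IsFibreIntegral s (∑ i ∈ t, φ i) (∑ i ∈ t, ψ i) := fun η => by
  change integralLM I' M' (wedgeLM I' η (∑ i ∈ t, ψ i)) =
    integralLM I M (wedgeLM I (pullback I I' s η) (∑ i ∈ t, φ i))
  rw [map_sum, map_sum, map_sum, map_sum]
  exact Finset.sum_congr rfl fun i hi => h i hi η

theorem IsFibreIntegral.unique {s : C^∞⟮I, M; I', M'⟯} {φ : Form I M} {ψ ψ' : Form I' M'}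
    (h : IsFibreIntegral s φ ψ) (h' : IsFibreIntegral s φ ψ') : ψ = ψ' :=
  form_eq_of_integral_wedge_left fun η => (h η).trans (h' η).symm

theorem SmoothFamily.sum {P : Type*} [NormedAddCommGroup P] [NormedSpace ℝ P] {ι : Type*}
    {t : Finset ι} {Φ : ι → P → Form I M} (h : ∀ i ∈ t, SmoothFamily I fun p => (Φ i p).1) :
    SmoothFamily I fun p => (∑ i ∈ t, Φ i p).1 := by
  classical
  induction t using Finset.induction_on with
  | empty => exact SmoothFamily.const (0 : Form I M).2
  | insert a t ha ih =>
    simp only [Finset.sum_insert ha]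
    exact (h a (Finset.mem_insert_self a t)).add (ih fun i hi => h i (Finset.mem_insert_of_mem hi))

theorem exists_fibreIntegral_family {s : C^∞⟮I, M; I', M'⟯}
    (hs : ∀ p, Function.Surjective (diffAt I I' s p)) {P : Type} [NormedAddCommGroup P]
    [NormedSpace ℝ P] {Φ : P → Form I M} (hΦ : SmoothFamily I fun p => (Φ p).1) :
    ∃ Ψ : P → Form I' M', SmoothFamily I' (fun p => (Ψ p).1) ∧
      ∀ p, IsFibreIntegral s (Φ p) (Ψ p) := by
  choose N hN hpN h using fun p => exists_local_fibreIntegral s p (hs p)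
  obtain ⟨t, ρ, hρ, hsum⟩ := exists_finite_partition (I := I) N hN hpN
  choose Ψ hΨ hΨ' using fun x => h x (ρ x) (hρ x) P Φ hΦ
  refine ⟨fun p => ∑ x ∈ t, Ψ x p, SmoothFamily.sum fun x _ => hΨ x, fun p => ?_⟩
  rw [← sum_mulForm hsum (Φ p)]
  exact IsFibreIntegral.sum fun x _ => hΨ' x p

theorem exists_fibreIntegral {s : C^∞⟮I, M; I', M'⟯}
    (hs : ∀ p, Function.Surjective (diffAt I I' s p)) (φ : Form I M) :
    ∃ ψ : Form I' M', IsFibreIntegral s φ ψ := by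
  obtain ⟨Ψ, -, h⟩ := exists_fibreIntegral_family hs
    (SmoothFamily.const (P := ℝ) φ.2 : SmoothFamily I fun _ : ℝ => (φ : Form I M).1)
  exact ⟨Ψ 0, h 0⟩

/-- Integration over the fibres of a submersion. -/
def fibreIntegral (s : C^∞⟮I, M; I', M'⟯) (hs : ∀ p, Function.Surjective (diffAt I I' s p)) :
    Form I M →ₗ[ℝ] Form I' M' where
  toFun φ := Classical.choose (exists_fibreIntegral hs φ)
  map_add' φ φ' := by
    refine (Classical.choose_spec (exists_fibreIntegral hs (φ + φ'))).unique fun η => ?_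
    have h1 := Classical.choose_spec (exists_fibreIntegral hs φ) η
    have h2 := Classical.choose_spec (exists_fibreIntegral hs φ') η
    change integralLM I' M' (wedgeLM I' η _) = integralLM I M (wedgeLM I (pullback I I' s η) _)
    rw [map_add, map_add, map_add, map_add]
    exact congrArg₂ (· + ·) h1 h2
  map_smul' c φ := by
    refine (Classical.choose_spec (exists_fibreIntegral hs (c • φ))).unique fun η => ?_
    have h1 := Classical.choose_spec (exists_fibreIntegral hs φ) η
    change integralLM I' M' (wedgeLM I' η _) = integralLM I M (wedgeLM I (pullback I I' s η) _)
    rw [map_smul, map_smul, map_smul, map_smul]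
    exact congrArg (c • ·) h1

variable {s : C^∞⟮I, M; I', M'⟯} (hs : ∀ p, Function.Surjective (diffAt I I' s p))

theorem isFibreIntegral_fibreIntegral (φ : Form I M) :
    IsFibreIntegral s φ (fibreIntegral s hs φ) :=
  Classical.choose_spec (exists_fibreIntegral hs φ)

theorem SmoothFamily.fibreIntegral {P : Type} [NormedAddCommGroup P] [NormedSpace ℝ P]
    {Φ : P → Form I M} (hΦ : SmoothFamily I fun p => (Φ p).1) :
    SmoothFamily I' fun p => (fibreIntegral s hs (Φ p)).1 := by
  obtain ⟨Ψ, hΨ, h⟩ := exists_fibreIntegral_family hs hΦ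
  have : Ψ = fun p => Currents.fibreIntegral s hs (Φ p) := funext fun p =>
    (h p).unique (isFibreIntegral_fibreIntegral hs _)
  rw [this] at hΨ
  exact hΨ

/-- The pull-back of a current along a submersion. -/
def smoothPullback (T : Current I' M') : Current I M :=
  IsRegular.toCurrent (T.isRegular.comp (L := fibreIntegral s hs)
    fun _ _ _ _ hΦ => hΦ.fibreIntegral hs)

theorem smoothPullback_apply (T : Current I' M') (φ : Form I M) :
    smoothPullback hs T φ = T (fibreIntegral s hs φ) := rfl

theorem isSmoothPullback_iff (T : Current I' M') (S : Current I M) :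
    IsSmoothPullback s T S ↔ ∀ φ, S φ = T (fibreIntegral s hs φ) := by
  refine ⟨fun h φ => ?_, fun h φ => ⟨_, isFibreIntegral_fibreIntegral hs φ, h φ⟩⟩
  obtain ⟨ψ, hψ, hS⟩ := h φ
  rw [hS, hψ.unique (isFibreIntegral_fibreIntegral hs φ)]

end FibreIntegral
section ComplexAtlas

theorem det_prodMap_pos {E E' : Type*} [NormedAddCommGroup E] [NormedSpace ℝ E]
    [FiniteDimensional ℝ E] [NormedAddCommGroup E'] [NormedSpace ℝ E'] [FiniteDimensional ℝ E']
    {f : E → E} {g : E' → E'} {z : E × E'} (hf : 0 < (fderiv ℝ f z.1).det)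
    (hg : 0 < (fderiv ℝ g z.2).det) (hfd : DifferentiableAt ℝ f z.1)
    (hgd : DifferentiableAt ℝ g z.2) :
    0 < (fderiv ℝ (fun w : E × E' => (f w.1, g w.2)) z).det := by
  have h : HasFDerivAt (fun w : E × E' => (f w.1, g w.2))
      ((fderiv ℝ f z.1).prodMap (fderiv ℝ g z.2)) z :=
    HasFDerivAt.prodMap z hfd.hasFDerivAt hgd.hasFDerivAt
  rw [h.fderiv, ContinuousLinearMap.det]
  have h2 : (((fderiv ℝ f z.1).prodMap (fderiv ℝ g z.2) : E × E' →L[ℝ] E × E') :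
      E × E' →ₗ[ℝ] E × E') = LinearMap.prodMap (fderiv ℝ f z.1 : E →ₗ[ℝ] E)
        (fderiv ℝ g z.2 : E' →ₗ[ℝ] E') := rfl
  rw [h2, LinearMap.det_prodMap]
  exact mul_pos hf hg

instance positiveAtlas_prod {E : Type*} [NormedAddCommGroup E] [NormedSpace ℝ E] [NormedSpace ℂ E]
    [IsScalarTower ℝ ℂ E] [FiniteDimensional ℂ E] [FiniteDimensional ℝ E]
    {H : Type*} [TopologicalSpace H] {I : ModelWithCorners ℝ E H} [I.Boundaryless]
    {M : Type*} [TopologicalSpace M] [ChartedSpace H M] [T2Space M] [CompactSpace M]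
    [IsManifold I ∞ M] {E' : Type*} [NormedAddCommGroup E'] [NormedSpace ℝ E'] [NormedSpace ℂ E']
    [IsScalarTower ℝ ℂ E'] [FiniteDimensional ℂ E'] [FiniteDimensional ℝ E']
    {H' : Type*} [TopologicalSpace H'] {I' : ModelWithCorners ℝ E' H'} [I'.Boundaryless]
    {M' : Type*} [TopologicalSpace M'] [ChartedSpace H' M'] [T2Space M'] [CompactSpace M']
    [IsManifold I' ∞ M'] [PositiveAtlas I M] [PositiveAtlas I' M'] : PositiveAtlas (I.prod I') (M × M') where
  det_pos := by
    rintro ⟨x, y⟩ ⟨x', y'⟩ ⟨z, w⟩ hz hz'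
    rw [extChartAt_prod] at hz hz' ⊢
    rw [extChartAt_prod] at hz' ⊢
    have hc := isChart_extChartAt I (M := M)
    have hc' := isChart_extChartAt I' (M := M')
    exact det_prodMap_pos (z := (z, w)) (PositiveAtlas.det_pos x x' z hz.1 hz'.1)
      (PositiveAtlas.det_pos y y' w hz.2 hz'.2)
      ((contDiffAt_chart_change (hc x) (hc x') hz.1 hz'.1).differentiableAt (by simp))
      ((contDiffAt_chart_change (hc' y) (hc' y') hz.2 hz'.2).differentiableAt (by simp))

variable {E : Type*} [NormedAddCommGroup E] [NormedSpace ℂ E] [FiniteDimensional ℂ E]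
  {X : Type*} [TopologicalSpace X] [ChartedSpace E X] [IsManifold 𝓘(ℂ, E) ω X]
  [T2Space X] [CompactSpace X]
  {E' : Type*} [NormedAddCommGroup E'] [NormedSpace ℂ E'] [FiniteDimensional ℂ E']
  {Y : Type*} [TopologicalSpace Y] [ChartedSpace E' Y] [IsManifold 𝓘(ℂ, E') ω Y]

theorem det_restrictScalars_nonneg (A : E →L[ℂ] E) : 0 ≤ (A.restrictScalars ℝ).det := by
  have h := LinearMap.det_restrictScalars (R := ℝ) (f := (A : E →ₗ[ℂ] E))
  rw [Algebra.norm_complex_apply] at h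
  have h2 : (A.restrictScalars ℝ).det = LinearMap.det ((A : E →ₗ[ℂ] E).restrictScalars ℝ) := rfl
  rw [h2, h]
  exact Complex.normSq_nonneg _

instance positiveAtlas_complex : PositiveAtlas 𝓘(ℝ, E) X where
  det_pos x x' z hz hz' := by
    refine lt_of_le_of_ne ?_ (chart_change_det_ne_zero (isChart_extChartAt 𝓘(ℝ, E) x)
      (isChart_extChartAt 𝓘(ℝ, E) x') hz hz').symm
    have h1 : ContMDiffAt 𝓘(ℂ, E) 𝓘(ℂ, E) ω (fun y => extChartAt 𝓘(ℂ, E) x'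
        ((extChartAt 𝓘(ℂ, E) x).symm y)) z := by
      have h2 : ContMDiffAt 𝓘(ℂ, E) 𝓘(ℂ, E) ω (extChartAt 𝓘(ℂ, E) x).symm z :=
        (contMDiffOn_extChartAt_symm x).contMDiffAt ((isOpen_extChartAt_target x).mem_nhds hz)
      have h3 : ContMDiffAt 𝓘(ℂ, E) 𝓘(ℂ, E) ω (extChartAt 𝓘(ℂ, E) x')
          ((extChartAt 𝓘(ℂ, E) x).symm z) :=
        contMDiffAt_extChartAt' (by rwa [extChartAt_source] at hz')
      exact h3.comp z h2
    have h2 := (h1.contDiffAt.differentiableAt (by simp)).hasFDerivAt.restrictScalars ℝ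
    have h3 : fderiv ℝ (fun y => extChartAt 𝓘(ℝ, E) x' ((extChartAt 𝓘(ℝ, E) x).symm y)) z = _ :=
      h2.fderiv
    rw [h3]
    exact det_restrictScalars_nonneg _

theorem diffAt_realMap (f : X → Y) (hf : ContMDiff 𝓘(ℂ, E) 𝓘(ℂ, E') ω f) (x : X) :
    diffAt 𝓘(ℝ, E) 𝓘(ℝ, E') (realMap f hf) x =
      (mfderiv 𝓘(ℂ, E) 𝓘(ℂ, E') f x : E →L[ℂ] E').restrictScalars ℝ := by
  have h1 := (hf.mdifferentiableAt (x := x) (by simp)).hasMFDerivAt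
  have h2 : HasMFDerivAt 𝓘(ℝ, E) 𝓘(ℝ, E') f x
      ((mfderiv 𝓘(ℂ, E) 𝓘(ℂ, E') f x : E →L[ℂ] E').restrictScalars ℝ) :=
    ⟨h1.1, HasFDerivWithinAt.restrictScalars ℝ h1.2⟩
  exact h2.mfderiv

end ComplexAtlas

section Operations

variable {E : Type*} [NormedAddCommGroup E] [NormedSpace ℝ E] [NormedSpace ℂ E]
  [IsScalarTower ℝ ℂ E] [FiniteDimensional ℂ E] [FiniteDimensional ℝ E]
  {H : Type*} [TopologicalSpace H] {I : ModelWithCorners ℝ E H} [I.Boundaryless]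
  {M : Type*} [TopologicalSpace M] [ChartedSpace H M] [T2Space M] [CompactSpace M]
  [IsManifold I ∞ M]
  {E' : Type*} [NormedAddCommGroup E'] [NormedSpace ℝ E'] [NormedSpace ℂ E']
  [IsScalarTower ℝ ℂ E'] [FiniteDimensional ℂ E'] [FiniteDimensional ℝ E']
  {H' : Type*} [TopologicalSpace H'] {I' : ModelWithCorners ℝ E' H'} [I'.Boundaryless]
  {M' : Type*} [TopologicalSpace M'] [ChartedSpace H' M'] [T2Space M'] [CompactSpace M']
  [IsManifold I' ∞ M']

theorem Current.ext {S S' : Current I M} (h : ∀ φ, S φ = S' φ) : S = S' := by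
  cases S
  cases S'
  congr 1
  exact LinearMap.ext h

theorem pullback_comp {E'' : Type*} [NormedAddCommGroup E''] [NormedSpace ℝ E'']
    [FiniteDimensional ℝ E'']
    {H'' : Type*} [TopologicalSpace H''] {I'' : ModelWithCorners ℝ E'' H''} [I''.Boundaryless]
    {M'' : Type*} [TopologicalSpace M''] [ChartedSpace H'' M''] [IsManifold I'' ∞ M'']
    (s : C^∞⟮I, M; I', M'⟯) (t : C^∞⟮I', M'; I'', M''⟯) (α : Form I'' M'') :
    pullback I I' s (pullback I' I'' t α) = pullback I I'' (t.comp s) α :=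
  Subtype.ext (rawPullback_comp s.contMDiff t.contMDiff α.1)

theorem SmoothFamily.pullbackLM {P : Type*} [NormedAddCommGroup P] [NormedSpace ℝ P]
    (s : C^∞⟮I, M; I', M'⟯) {Φ : P → Form I' M'} (hΦ : SmoothFamily I' fun p => (Φ p).1) :
    SmoothFamily I fun p => (Currents.pullbackLM s (Φ p)).1 :=
  hΦ.pullback (s := fun _ => s) (s.contMDiff.comp contMDiff_snd)

/-- The push-forward of a current. -/
def pushforward (s : C^∞⟮I, M; I', M'⟯) (T : Current I M) : Current I' M' :=
  IsRegular.toCurrent (T.isRegular.comp (L := pullbackLM s) fun _ _ _ _ hΦ => hΦ.pullbackLM s)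

theorem pushforward_apply (s : C^∞⟮I, M; I', M'⟯) (T : Current I M) (φ : Form I' M') :
    pushforward s T φ = T (pullback I I' s φ) := rfl

theorem isPushforward_iff {s : C^∞⟮I, M; I', M'⟯} {T : Current I M} {S : Current I' M'} :
    IsPushforward s T S ↔ S = pushforward s T :=
  ⟨fun h => Current.ext h, fun h => h ▸ fun _ => rfl⟩

/-- Integration over the graph of a map. -/
def graphCurrent (s : C^∞⟮I, M; I', M'⟯) : Current (I.prod I') (M × M') :=
  pushforward (ContMDiffMap.id.prodMk s) (isRegular_integral I M).toCurrent

theorem graphCurrent_apply (s : C^∞⟮I, M; I', M'⟯) (Φ : Form (I.prod I') (M × M')) :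
    graphCurrent s Φ = integral I (pullback I (I.prod I') (ContMDiffMap.id.prodMk s) Φ) := rfl

theorem pullback_graph_fst (s : C^∞⟮I, M; I', M'⟯) (α : Form I M) :
    pullback I (I.prod I') (ContMDiffMap.id.prodMk s)
      (pullback (I.prod I') I ContMDiffMap.fst α) = α := by
  rw [pullback_comp]
  exact Subtype.ext (rawPullback_id I α.1)

theorem pullback_graph_snd (s : C^∞⟮I, M; I', M'⟯) (α : Form I' M') :
    pullback I (I.prod I') (ContMDiffMap.id.prodMk s)
      (pullback (I.prod I') I' ContMDiffMap.snd α) = pullback I I' s α := by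
  rw [pullback_comp]
  rfl

theorem graphCurrent_wedge_fst (s : C^∞⟮I, M; I', M'⟯) (α : Form I M)
    (Φ : Form (I.prod I') (M × M')) :
    graphCurrent s (wedge _ (pullback (I.prod I') I ContMDiffMap.fst α) Φ) =
      integral I (wedge I α (pullback I (I.prod I') (ContMDiffMap.id.prodMk s) Φ)) := by
  rw [graphCurrent_apply, pullback_wedge, pullback_graph_fst]

theorem graphCurrent_wedge_snd (s : C^∞⟮I, M; I', M'⟯) (α : Form I' M')
    (Φ : Form (I.prod I') (M × M')) :
    graphCurrent s (wedge _ (pullback (I.prod I') I' ContMDiffMap.snd α) Φ) =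
      integral I (wedge I (pullback I I' s α)
        (pullback I (I.prod I') (ContMDiffMap.id.prodMk s) Φ)) := by
  rw [graphCurrent_apply, pullback_wedge, pullback_graph_snd]

theorem surjective_diffAt_fst (p : M × M') : Function.Surjective
    (diffAt (I.prod I') I (ContMDiffMap.fst : C^∞⟮I.prod I', M × M'; I, M⟯) p) := by
  have h : diffAt (I.prod I') I (ContMDiffMap.fst : C^∞⟮I.prod I', M × M'; I, M⟯) p =
    ContinuousLinearMap.fst ℝ E E' := mfderiv_fst
  rw [h]
  exact fun v => ⟨(v, 0), rfl⟩

theorem surjective_diffAt_snd (p : M × M') : Function.Surjective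
    (diffAt (I.prod I') I' (ContMDiffMap.snd : C^∞⟮I.prod I', M × M'; I', M'⟯) p) := by
  have h : diffAt (I.prod I') I' (ContMDiffMap.snd : C^∞⟮I.prod I', M × M'; I', M'⟯) p =
    ContinuousLinearMap.snd ℝ E E' := mfderiv_snd
  rw [h]
  exact fun v => ⟨(0, v), rfl⟩

variable [PositiveAtlas I M] [PositiveAtlas I' M']

theorem fibreIntegral_op {s : C^∞⟮I, M; I', M'⟯} (hs : ∀ p, Function.Surjective (diffAt I I' s p))
    (D : SmearingDatum I M) (D' : SmearingDatum I' M') (ε : ℝ)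
    (h : ∀ η, pullback I I' s (D'.op ε η) = D.op ε (pullback I I' s η)) (φ : Form I M) :
    fibreIntegral s hs (D.op ε φ) = D'.op ε (fibreIntegral s hs φ) := by
  refine (isFibreIntegral_fibreIntegral hs _).unique fun η => ?_
  rw [D'.integral_wedge_op, isFibreIntegral_fibreIntegral hs φ, h, D.integral_wedge_op]

theorem fibreIntegral_op_of_invariant {s : C^∞⟮I, M; I', M'⟯}
    (hs : ∀ p, Function.Surjective (diffAt I I' s p)) (D : SmearingDatum I M)
    (h : ∀ x p, s (D.map x p) = s p) (ε : ℝ) (φ : Form I M) :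
    fibreIntegral s hs (D.op ε φ) = fibreIntegral s hs φ := by
  refine (isFibreIntegral_fibreIntegral hs _).unique fun η => ?_
  rw [isFibreIntegral_fibreIntegral hs φ, D.integral_wedge_op, D.op_pullback s h]

theorem fibreIntegral_smearChain_map {s : C^∞⟮I, M; I', M'⟯}
    (hs : ∀ p, Function.Surjective (diffAt I I' s p)) {ι : Type*} (l : List ι)
    (D : ι → SmearingDatum I M) (D' : ι → SmearingDatum I' M') (ε : ℝ)
    (h : ∀ c η, pullback I I' s ((D' c).op ε η) = (D c).op ε (pullback I I' s η)) (φ : Form I M) :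
    fibreIntegral s hs (smearChain (l.map D) ε φ) =
      smearChain (l.map D') ε (fibreIntegral s hs φ) := by
  induction l generalizing φ with
  | nil => rfl
  | cons c l ih =>
    change fibreIntegral s hs (smearChain (l.map D) ε ((D c).op ε φ)) =
      smearChain (l.map D') ε ((D' c).op ε (fibreIntegral s hs φ))
    rw [ih, fibreIntegral_op hs _ _ _ (h c)]

theorem fibreIntegral_smearChain_of_invariant {s : C^∞⟮I, M; I', M'⟯}
    (hs : ∀ p, Function.Surjective (diffAt I I' s p)) {ι : Type*} (l : List ι)
    (D : ι → SmearingDatum I M) (ε : ℝ) (h : ∀ c x p, s ((D c).map x p) = s p) (φ : Form I M) :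
    fibreIntegral s hs (smearChain (l.map D) ε φ) = fibreIntegral s hs φ := by
  induction l generalizing φ with
  | nil => rfl
  | cons c l ih =>
    change fibreIntegral s hs (smearChain (l.map D) ε ((D c).op ε φ)) = _
    rw [ih, fibreIntegral_op_of_invariant hs _ (h c)]

variable (𝒰 : DeRhamData I M) (𝒱 : DeRhamData I' M')

theorem fibreIntegral_fst_prodSmooth {ε : ℝ} (hε : 0 < ε) (Φ : Form (I.prod I') (M × M')) :
    fibreIntegral (ContMDiffMap.fst : C^∞⟮I.prod I', M × M'; I, M⟯) surjective_diffAt_fst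
      (𝒰.prodSmooth 𝒱 ε Φ) =
      𝒰.smooth ε (fibreIntegral ContMDiffMap.fst surjective_diffAt_fst Φ) := by
  rw [𝒰.prodSmooth_eq 𝒱 hε, 𝒰.smooth_eq hε, smearChain_append]
  exact (fibreIntegral_smearChain_of_invariant surjective_diffAt_fst 𝒱.charts
    (fun c => c.datum.onRight I M) ε (fun _ _ _ => rfl) _).trans
    (fibreIntegral_smearChain_map surjective_diffAt_fst 𝒰.charts (fun c => c.datum.onLeft I' M')
      SmoothingChart.datum ε (fun c η => pullback_fst_op c.datum ε η) Φ)

theorem fibreIntegral_snd_prodSmooth {ε : ℝ} (hε : 0 < ε) (Φ : Form (I.prod I') (M × M')) :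
    fibreIntegral (ContMDiffMap.snd : C^∞⟮I.prod I', M × M'; I', M'⟯) surjective_diffAt_snd
      (𝒰.prodSmooth 𝒱 ε Φ) =
      𝒱.smooth ε (fibreIntegral ContMDiffMap.snd surjective_diffAt_snd Φ) := by
  rw [𝒰.prodSmooth_eq 𝒱 hε, 𝒱.smooth_eq hε, smearChain_append]
  refine (fibreIntegral_smearChain_map surjective_diffAt_snd 𝒱.charts
    (fun c => c.datum.onRight I M) SmoothingChart.datum ε
    (fun c η => pullback_snd_op c.datum ε η) _).trans ?_
  exact congrArg _ (fibreIntegral_smearChain_of_invariant surjective_diffAt_snd 𝒰.charts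
    (fun c => c.datum.onLeft I' M') ε (fun _ _ _ => rfl) Φ)

theorem Current.tendsto_smooth (T : Current I M) (φ : Form I M) :
    Tendsto (fun ε => T (𝒰.smooth ε φ)) (𝓝[>] 0) (𝓝 (T φ)) := by
  refine (T.isRegular.tendsto_smearChain (𝒰.charts.map SmoothingChart.datum) φ).congr' ?_
  filter_upwards [self_mem_nhdsWithin] with ε hε
  rw [𝒰.smooth_eq hε]

theorem isIntersection_iff {R : ℝ → Form I M → Form I M} {T₁ T₂ W : Current I M}
    {α : ℝ → Form I M} (hα : ∀ᶠ ε in 𝓝[>] (0 : ℝ), Represents (α ε) T₂ (R ε))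
    (hW : ∀ φ, Tendsto (fun ε => T₁ (wedge I (α ε) φ)) (𝓝[>] (0 : ℝ)) (𝓝 (W φ)))
    {W' : Current I M} : IsIntersection R T₁ T₂ W' ↔ W' = W := by
  refine ⟨?_, fun h => h ▸ ⟨α, hα, hW⟩⟩
  rintro ⟨β, hβ, hW'⟩
  refine Current.ext fun φ => tendsto_nhds_unique (hW' φ) ((hW φ).congr' ?_)
  filter_upwards [hα, hβ] with ε h1 h2
  rw [form_eq_of_integral_wedge_right fun φ => (h1 φ).trans (h2 φ).symm]

/-- The smoothing of `s^* T` is the pull-back of the smoothing of `T`, if the smoothing operators are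
compatible. -/
theorem represents_smoothPullback {s : C^∞⟮I, M; I', M'⟯}
    (hs : ∀ p, Function.Surjective (diffAt I I' s p)) {R : Form I M → Form I M}
    {R' : Form I' M' → Form I' M'}
    (hR : ∀ φ, fibreIntegral s hs (R φ) = R' (fibreIntegral s hs φ)) {T : Current I' M'}
    {τ : Form I' M'} (hτ : Represents τ T R') :
    Represents (pullback I I' s τ) (smoothPullback hs T) R := fun φ => by
  rw [← isFibreIntegral_fibreIntegral hs φ, hτ, smoothPullback_apply, hR]

theorem isIntersection_graph_fst_iff (s : C^∞⟮I, M; I', M'⟯) (T : Current I M)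
    {W : Current (I.prod I') (M × M')} :
    IsIntersection (𝒰.prodSmooth 𝒱) (graphCurrent s) (smoothPullback surjective_diffAt_fst T) W ↔
      W = pushforward (ContMDiffMap.id.prodMk s) T := by
  have h : ∀ ε : ℝ, ∃ τ : Form I M, 0 < ε → Represents τ T (𝒰.smooth ε) := fun ε => by
    by_cases hε : 0 < ε
    · obtain ⟨τ, hτ⟩ := 𝒰.exists_represents T.isRegular hε
      exact ⟨τ, fun _ => hτ⟩
    · exact ⟨0, fun h => absurd h hε⟩
  choose τ hτ using h
  refine isIntersection_iff (α := fun ε => pullback (I.prod I') I ContMDiffMap.fst (τ ε))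
    (by
      filter_upwards [self_mem_nhdsWithin] with ε hε
      exact represents_smoothPullback _ (fibreIntegral_fst_prodSmooth 𝒰 𝒱 hε) (hτ ε hε))
    fun Φ => (T.tendsto_smooth 𝒰 _).congr' ?_
  filter_upwards [self_mem_nhdsWithin] with ε hε
  rw [graphCurrent_wedge_fst, hτ ε hε]
  rfl

theorem isIntersection_graph_snd_iff {s : C^∞⟮I, M; I', M'⟯}
    (hs : ∀ p, Function.Surjective (diffAt I I' s p)) (T : Current I' M')
    {W : Current (I.prod I') (M × M')} :
    IsIntersection (𝒰.prodSmooth 𝒱) (graphCurrent s) (smoothPullback surjective_diffAt_snd T) W ↔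
      W = pushforward (ContMDiffMap.id.prodMk s) (smoothPullback hs T) := by
  have h : ∀ ε : ℝ, ∃ τ : Form I' M', 0 < ε → Represents τ T (𝒱.smooth ε) := fun ε => by
    by_cases hε : 0 < ε
    · obtain ⟨τ, hτ⟩ := 𝒱.exists_represents T.isRegular hε
      exact ⟨τ, fun _ => hτ⟩
    · exact ⟨0, fun h => absurd h hε⟩
  choose τ hτ using h
  refine isIntersection_iff (α := fun ε => pullback (I.prod I') I' ContMDiffMap.snd (τ ε))
    (by
      filter_upwards [self_mem_nhdsWithin] with ε hε
      exact represents_smoothPullback _ (fibreIntegral_snd_prodSmooth 𝒰 𝒱 hε) (hτ ε hε))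
    fun Φ => (T.tendsto_smooth 𝒱 _).congr' ?_
  filter_upwards [self_mem_nhdsWithin] with ε hε
  rw [graphCurrent_wedge_snd, ← isFibreIntegral_fibreIntegral hs, hτ ε hε]
  rfl

theorem isSmoothPullback_iff_eq {s : C^∞⟮I, M; I', M'⟯}
    (hs : ∀ p, Function.Surjective (diffAt I I' s p)) {T : Current I' M'} {S : Current I M} :
    IsSmoothPullback s T S ↔ S = smoothPullback hs T :=
  (isSmoothPullback_iff hs T S).trans ⟨fun h => Current.ext h, fun h => h ▸ fun _ => rfl⟩

theorem isPushforwardThrough_graph_iff (s : C^∞⟮I, M; I', M'⟯) (T : Current I M)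
    {S : Current I' M'} :
    IsPushforwardThrough 𝒰 𝒱 (graphCurrent s) T S ↔ S = pushforward s T := by
  have h : pushforward (ContMDiffMap.snd : C^∞⟮I.prod I', M × M'; I', M'⟯)
      (pushforward (ContMDiffMap.id.prodMk s) T) = pushforward s T := Current.ext fun φ => by
    rw [pushforward_apply, pushforward_apply, pullback_graph_snd, pushforward_apply]
  simp only [IsPushforwardThrough, IsTimesRight, isSmoothPullback_iff_eq surjective_diffAt_fst,
    isPushforward_iff]
  constructor
  · rintro ⟨U, W, rfl, hW, rfl⟩
    rw [(isIntersection_graph_fst_iff 𝒰 𝒱 s T).1 hW, h]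
  · rintro rfl
    exact ⟨_, _, rfl, (isIntersection_graph_fst_iff 𝒰 𝒱 s T).2 rfl, h.symm⟩

theorem isPullbackThrough_graph_iff {s : C^∞⟮I, M; I', M'⟯}
    (hs : ∀ p, Function.Surjective (diffAt I I' s p)) (T : Current I' M') {S : Current I M} :
    IsPullbackThrough 𝒰 𝒱 (graphCurrent s) T S ↔ S = smoothPullback hs T := by
  have h : pushforward (ContMDiffMap.fst : C^∞⟮I.prod I', M × M'; I, M⟯)
      (pushforward (ContMDiffMap.id.prodMk s) (smoothPullback hs T)) = smoothPullback hs T :=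
    Current.ext fun φ => by
      rw [pushforward_apply, pushforward_apply, pullback_graph_fst]
  simp only [IsPullbackThrough, IsTimesLeft, isSmoothPullback_iff_eq surjective_diffAt_snd,
    isPushforward_iff]
  constructor
  · rintro ⟨U, W, rfl, hW, rfl⟩
    rw [(isIntersection_graph_snd_iff 𝒰 𝒱 hs T).1 hW, h]
  · rintro rfl
    exact ⟨_, _, rfl, (isIntersection_graph_snd_iff 𝒰 𝒱 hs T).2 rfl, h.symm⟩

end Operations
section Stokes

variable {E : Type*} [NormedAddCommGroup E] [NormedSpace ℝ E] [FiniteDimensional ℝ E]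

theorem integral_fderiv_apply_eq_zero [MeasurableSpace E] [BorelSpace E] {μ : Measure E}
    [μ.IsAddHaarMeasure] {g : E → ℝ} (hg : ContDiff ℝ ∞ g) (hc : HasCompactSupport g) (v : E) :
    ∫ z, fderiv ℝ g z v ∂μ = 0 := by
  have hd : Continuous fun z => fderiv ℝ g z v := hg.continuous_fderiv_apply (by simp) |>.comp
    (continuous_id.prodMk continuous_const)
  have h := integral_mul_fderiv_eq_neg_fderiv_mul_of_integrable (μ := μ) (f := fun _ : E => (1 : ℝ))
    (g := g) (v := v) (by simp)
    (by simpa using hd.integrable_of_hasCompactSupport (hc.fderiv_apply (𝕜 := ℝ) v))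
    (by simpa using hg.continuous.integrable_of_hasCompactSupport hc)
    (fun _ _ => differentiableAt_const _) (fun z _ => hg.contDiffAt.differentiableAt (by simp))
  simpa using h

theorem setIntegral_extDeriv_eq_zero [MeasurableSpace E] [BorelSpace E] {μ : Measure E}
    [μ.IsAddHaarMeasure] {k : ℕ} {O K : Set E} {θ : E → E [⋀^Fin k]→L[ℝ] ℝ} (hO : IsOpen O)
    (hK : IsCompact K) (hKO : K ⊆ O) (hθ : ContDiffOn ℝ ∞ θ O) (h0 : ∀ z ∈ O, z ∉ K → θ z = 0)
    (v : Fin (k + 1) → E) : ∫ z in O, extDeriv θ z v ∂μ = 0 := by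
  set g : E → E [⋀^Fin k]→L[ℝ] ℝ := indicator O θ with hg
  have hgs : ContDiff ℝ ∞ g := contDiff_indicator_of_isClosed hO hK.isClosed hKO hθ h0
  have hg0 : ∀ z ∉ K, g z = 0 := fun z hz => by
    by_cases h : z ∈ O
    · exact (indicator_of_mem h θ).trans (h0 z h hz)
    · exact indicator_of_notMem h θ
  have hgw : ∀ w : Fin k → E, ContDiff ℝ ∞ fun z => g z w := fun w =>
    contDiff_iff_contDiffAt.2 fun z => ContDiffAt.alternating_eval hgs.contDiffAt w
  have hgc : ∀ w : Fin k → E, HasCompactSupport fun z => g z w := fun w =>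
    HasCompactSupport.intro hK fun z hz => by rw [hg0 z hz]; rfl
  have h1 : ∀ z, extDeriv g z v =
      ∑ i : Fin (k + 1), (-1 : ℝ) ^ i.val * fderiv ℝ (g · (i.removeNth v)) z (v i) := fun z => by
    rw [extDeriv_apply (hgs.contDiffAt.differentiableAt (by simp)) v]
    simp [zsmul_eq_mul]
  have h2 : ∫ z in O, extDeriv θ z v ∂μ = ∫ z in O, extDeriv g z v ∂μ := by
    refine setIntegral_congr_fun hO.measurableSet fun z hz => ?_
    have : θ =ᶠ[𝓝 z] g := by
      filter_upwards [hO.mem_nhds hz] with y hy using (indicator_of_mem hy θ).symm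
    exact congrArg (fun c : E [⋀^Fin (k + 1)]→L[ℝ] ℝ => c v) this.extDeriv_eq
  rw [h2, setIntegral_eq_integral_of_forall_compl_eq_zero fun z hz => ?_]
  · simp only [h1]
    rw [MeasureTheory.integral_finsetSum]
    · refine Finset.sum_eq_zero fun i _ => ?_
      rw [MeasureTheory.integral_const_mul, integral_fderiv_apply_eq_zero (hgw _) (hgc _), mul_zero]
    · intro i _
      refine Integrable.const_mul (Continuous.integrable_of_hasCompactSupport ?_
        ((hgc _).fderiv_apply (𝕜 := ℝ) _)) _
      exact ((hgw _).continuous_fderiv_apply (by simp)).comp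
        (continuous_id.prodMk continuous_const)
  · have h3 : g =ᶠ[𝓝 z] fun _ => 0 := by
      filter_upwards [hK.isClosed.isOpen_compl.mem_nhds fun h => hz (hKO h)] with y hy using hg0 y hy
    rw [h3.extDeriv_eq, extDeriv_apply (differentiableAt_const _)]
    simp

variable {H : Type*} [TopologicalSpace H] {I : ModelWithCorners ℝ E H} [I.Boundaryless]
  {M : Type*} [TopologicalSpace M] [ChartedSpace H M] [IsManifold I ∞ M]

variable (I) in
/-- The form `dχ ∧ α`. -/
def gradWedge (χ : M → ℝ) (α : RawForm E M) : RawForm E M := fun p k =>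
  match k with
  | 0 => 0
  | k + 1 => .alternatizeUncurryFin ((diffAt I 𝓘(ℝ) χ p).smulRight (α p k))

theorem formIn_gradWedge {V : Type*} [NormedAddCommGroup V] [NormedSpace ℝ V]
    {e : PartialEquiv M V} (he : IsChart I e) (χ : C^∞⟮I, M; 𝓘(ℝ), ℝ⟯) (α : RawForm E M) (k : ℕ)
    {z : V} (hz : z ∈ e.target) : formIn I e (gradWedge I χ α) (k + 1) z =
      .alternatizeUncurryFin ((fderiv ℝ (fun y => χ (e.symm y)) z).smulRight (formIn I e α k z)) := by
  have h : diffAt 𝓘(ℝ, V) 𝓘(ℝ) (fun y => χ (e.symm y)) z =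
      (diffAt I 𝓘(ℝ) χ (e.symm z)).comp (diffAt 𝓘(ℝ, V) I e.symm z) :=
    mfderiv_comp z (χ.contMDiff.mdifferentiableAt (by simp))
      ((he.contMDiffAt_symm hz).mdifferentiableAt (by simp))
  have h' : fderiv ℝ (fun y => χ (e.symm y)) z = _ := (mfderiv_eq_fderiv).symm.trans h
  ext v
  rw [formIn_apply, h']
  change ContinuousAlternatingMap.alternatizeUncurryFin _ _ = _
  rw [ContinuousAlternatingMap.alternatizeUncurryFin_apply,
    ContinuousAlternatingMap.alternatizeUncurryFin_apply]
  rfl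

theorem isSmoothForm_gradWedge (χ : C^∞⟮I, M; 𝓘(ℝ), ℝ⟯) {α : RawForm E M}
    (hα : IsSmoothForm I α) : IsSmoothForm I (gradWedge I χ α) := by
  intro x k v
  have hc := isChart_extChartAt I x
  cases k with
  | zero => exact contDiffOn_const (c := (0 : ℝ))
  | succ k =>
    have h : ContDiffOn ℝ ∞ (fun y => ∑ i : Fin (k + 1), (-1 : ℤ) ^ (i : ℕ) •
        (fderiv ℝ (fun y => χ ((extChartAt I x).symm y)) y (v i) *
          coordForm I x α k y (i.removeNth v))) (extChartAt I x).target := by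
      refine ContDiffOn.sum fun i _ => ContDiffOn.const_smul _ (ContDiffOn.mul ?_ (hα x k _))
      have h1 : ContDiffOn ℝ ∞ (fun y => χ ((extChartAt I x).symm y)) (extChartAt I x).target := by
        rw [← contMDiffOn_iff_contDiffOn]
        exact χ.contMDiff.comp_contMDiffOn hc.smooth_symm
      exact (h1.fderiv_of_isOpen hc.open_target (by simp)).clm_apply contDiffOn_const
    refine h.congr fun y hy => ?_
    rw [coordForm_eq_formIn, formIn_gradWedge hc χ α k hy,
      ContinuousAlternatingMap.alternatizeUncurryFin_apply]
    rfl

theorem extDeriv_mul_formIn [NormedSpace ℂ E] [IsScalarTower ℝ ℂ E] [FiniteDimensional ℂ E]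
    [T2Space M] [CompactSpace M] {e : PartialEquiv M E} (he : IsChart I e) (χ : C^∞⟮I, M; 𝓘(ℝ), ℝ⟯)
    {α : RawForm E M} (hα : IsSmoothForm I α) (k : ℕ) {z : E} (hz : z ∈ e.target) :
    extDeriv (fun y => χ (e.symm y) • formIn I e α k y) z =
      χ (e.symm z) • extDeriv (formIn I e α k) z + formIn I e (gradWedge I χ α) (k + 1) z := by
  have h1 : DifferentiableAt ℝ (fun y => χ (e.symm y)) z := by
    have : ContDiffAt ℝ ∞ (fun y => χ (e.symm y)) z := by
      rw [← contMDiffAt_iff_contDiffAt]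
      exact χ.contMDiff.contMDiffAt.comp z (he.contMDiffAt_symm hz)
    exact this.differentiableAt (by simp)
  have h2 : DifferentiableAt ℝ (formIn I e α k) z :=
    (contDiffAt_alternating fun v => (isSmoothForm_formIn_continuousOn hα he k v).contDiffAt
      (he.open_target.mem_nhds hz)).differentiableAt (n := ∞) (by simp)
  rw [formIn_gradWedge he χ α k hz, extDeriv, extDeriv, fderiv_fun_smul h1 h2,
    ContinuousAlternatingMap.alternatizeUncurryFin_add]
  congr 1
  exact map_smul (ContinuousAlternatingMap.alternatizeUncurryFinCLM ℝ E ℝ) _ _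

theorem sum_gradWedge {ι : Type*} {t : Finset ι} {ρ : ι → C^∞⟮I, M; 𝓘(ℝ), ℝ⟯}
    (hρ : ∀ p, ∑ x ∈ t, ρ x p = 1) (α : RawForm E M) (p : M) (k : ℕ) :
    ∑ x ∈ t, gradWedge I (ρ x) α p k = 0 := by
  cases k with
  | zero => exact Finset.sum_const_zero
  | succ k =>
    have h1 : ∑ x ∈ t, diffAt I 𝓘(ℝ) (ρ x) p = 0 := by
      obtain ⟨L, hL, h2⟩ : ∃ L : E →L[ℝ] ℝ, L = ∑ x ∈ t, diffAt I 𝓘(ℝ) (ρ x) p ∧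
          HasMFDerivAt I 𝓘(ℝ) (∑ x ∈ t, (ρ x : M → ℝ)) p L := by
        clear hρ
        classical
        induction t using Finset.induction_on with
        | empty => exact ⟨0, rfl, hasMFDerivAt_const (0 : ℝ) p⟩
        | insert a t ha ih =>
          obtain ⟨L, hL, h⟩ := ih
          refine ⟨diffAt I 𝓘(ℝ) (ρ a) p + L, by rw [Finset.sum_insert ha, hL], ?_⟩
          rw [Finset.sum_insert ha]
          exact (((ρ a).contMDiff.mdifferentiableAt (by simp)).hasMFDerivAt).add h
      have h3 : (∑ x ∈ t, (ρ x : M → ℝ)) = fun _ => 1 := funext fun q => by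
        rw [Finset.sum_apply, hρ]
      rw [h3] at h2
      rw [← hL]
      exact hasMFDerivAt_unique h2 (hasMFDerivAt_const 1 p)
    change ∑ x ∈ t, ContinuousAlternatingMap.alternatizeUncurryFinCLM ℝ E ℝ
      ((diffAt I 𝓘(ℝ) (ρ x) p).smulRight (α p k)) = 0
    rw [← map_sum]
    have h4 : ∑ x ∈ t, (diffAt I 𝓘(ℝ) (ρ x) p).smulRight (α p k) =
        (∑ x ∈ t, diffAt I 𝓘(ℝ) (ρ x) p).smulRight (α p k) := by
      ext v
      simp [Finset.sum_mul, ContinuousAlternatingMap.sum_apply]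
    rw [h4, h1]
    have h5 : (0 : E →L[ℝ] ℝ).smulRight (α p k) = 0 := by ext; simp
    rw [h5, map_zero]

end Stokes

section ExteriorDerivative

variable {E : Type*} [NormedAddCommGroup E] [NormedSpace ℝ E]
  {H : Type*} [TopologicalSpace H] {I : ModelWithCorners ℝ E H} [I.Boundaryless]
  {M : Type*} [TopologicalSpace M] [ChartedSpace H M] [IsManifold I ∞ M]
  {E' : Type*} [NormedAddCommGroup E'] [NormedSpace ℝ E'] [FiniteDimensional ℝ E']
  {H' : Type*} [TopologicalSpace H'] {I' : ModelWithCorners ℝ E' H'} [I'.Boundaryless]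
  {M' : Type*} [TopologicalSpace M'] [ChartedSpace H' M'] [IsManifold I' ∞ M']

theorem IsExteriorDerivative.pullback (s : C^∞⟮I, M; I', M'⟯) {α β : Form I' M'}
    (h : IsExteriorDerivative I' α β) :
    IsExteriorDerivative I (Currents.pullback I I' s α) (Currents.pullback I I' s β) := by
  intro x y hy
  have hc := isChart_extChartAt I x
  set e := extChartAt I x with he
  set x' := s (e.symm y) with hx'
  have hc' := isChart_extChartAt I' x'
  set e' := extChartAt I' x' with he'
  have hy' : s (e.symm y) ∈ e'.source := mem_extChartAt_source x'
  have hev : ∀ᶠ z in 𝓝 y, z ∈ e.target ∧ s (e.symm z) ∈ e'.source :=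
    (hc.open_target.eventually_mem hy).and
      ((s.contMDiff.continuous.continuousAt.comp
        (hc.contMDiffAt_symm hy).continuousAt).preimage_mem_nhds (hc'.open_source.mem_nhds hy'))
  have hform : ∀ (γ : Form I' M') (k : ℕ), ∀ z, z ∈ e.target ∧ s (e.symm z) ∈ e'.source →
      coordForm I x (Currents.pullback I I' s γ).1 k z =
        (coordForm I' x' γ.1 k (e' (s (e.symm z)))).compContinuousLinearMap
          (fderiv ℝ (fun y => e' (s (e.symm y))) z) := fun γ k z hz =>
    formIn_rawPullback hc hc' hz.1 s.contMDiff.contMDiffAt hz.2 γ.1 k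
  have hg : ContDiffAt ℝ ∞ (fun y => e' (s (e.symm y))) y := by
    rw [← contMDiffAt_iff_contDiffAt]
    exact (hc'.contMDiffAt hy').comp y
      (s.contMDiff.contMDiffAt.comp y (hc.contMDiffAt_symm hy))
  obtain ⟨h0, h1⟩ := h x' (e' (s (e.symm y))) (e'.map_source hy')
  refine ⟨?_, fun k => ?_⟩
  · rw [hform β 0 y hev.self_of_nhds, h0]
    rfl
  · rw [hform β (k + 1) y hev.self_of_nhds, h1 k]
    have h2 : coordForm I x (Currents.pullback I I' s α).1 k =ᶠ[𝓝 y] fun z =>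
        (coordForm I' x' α.1 k (e' (s (e.symm z)))).compContinuousLinearMap
          (fderiv ℝ (fun y => e' (s (e.symm y))) z) := by
      filter_upwards [hev] with z hz using hform α k z hz
    rw [h2.extDeriv_eq]
    refine (extDeriv_pullback (r := ∞) ?_ hg
      (by rw [minSmoothness_of_isRCLikeNormedField]; exact ENat.LEInfty.out)).symm
    exact (contDiffAt_alternating fun v => (α.2 x' k v).contDiffAt
      (hc'.open_target.mem_nhds (e'.map_source hy'))).differentiableAt (n := ∞) (by simp)

end ExteriorDerivative

section StokesManifold

variable {E : Type*} [NormedAddCommGroup E] [NormedSpace ℝ E] [NormedSpace ℂ E]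
  [IsScalarTower ℝ ℂ E] [FiniteDimensional ℂ E] [FiniteDimensional ℝ E]
  {H : Type*} [TopologicalSpace H] {I : ModelWithCorners ℝ E H} [I.Boundaryless]
  {M : Type*} [TopologicalSpace M] [ChartedSpace H M] [T2Space M] [CompactSpace M]
  [IsManifold I ∞ M]

theorem integral_eq_zero {α : Form I M} (h : ∀ p, α.1 p (realDim E) = 0) : integral I α = 0 := by
  have h1 : ∀ x y, coordForm I x α.1 (realDim E) y (complexFrame E) = 0 := fun x y => by
    rw [coordForm_eq_formIn, formIn_eq_zero I _ (h _)]
    rfl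
  unfold integral
  simp only [h1, mul_zero, MeasureTheory.integral_zero, finsum_zero]

/-- Stokes' theorem on a compact manifold. -/
theorem integral_eq_zero_of_isExteriorDerivative [PositiveAtlas I M] {α β : Form I M}
    (h : IsExteriorDerivative I α β) : integral I β = 0 := by
  letI : MeasurableSpace E := borel E
  haveI : BorelSpace E := ⟨rfl⟩
  obtain ⟨t, ρ, hρ, hsum⟩ := exists_finite_partition (I := I) (fun x : M => (extChartAt I x).source)
    (fun x => isOpen_extChartAt_source (I := I) x) (fun x => mem_extChartAt_source (I := I) x)
  set w : M → Form I M := fun x =>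
    mulForm (ρ x) β + (⟨gradWedge I (ρ x) α.1, isSmoothForm_gradWedge (ρ x) α.2⟩ : Form I M)
      with hw
  have hβ : β = ∑ x ∈ t, w x := by
    rw [hw, Finset.sum_add_distrib, sum_mulForm hsum]
    refine Subtype.ext (funext fun p => funext fun k => ?_)
    change _ = β.1 p k + (∑ x ∈ t, _ : Form I M).1 p k
    rw [sum_form_apply, Finset.sum_apply]
    exact (add_eq_left.2 (sum_gradWedge hsum α.1 p k)).symm
  have hzero : ∀ x, integral I (w x) = 0 := fun x => by
    have hc := isChart_extChartAt I x
    set e := extChartAt I x with he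
    have hKc : IsCompact (e '' tsupport (ρ x)) :=
      (isClosed_tsupport _).isCompact.image_of_continuousOn (hc.smooth.continuousOn.mono (hρ x))
    have hKt : e '' tsupport (ρ x) ⊆ e.target := by
      rintro _ ⟨q, hq, rfl⟩
      exact e.map_source (hρ x hq)
    have hform : ∀ (m : ℕ) (v : Fin m → E),
        ∫ z in e.target, formIn I e (w x).1 m z v ∂frameMeasure E = 0 := by
      intro m v
      cases m with
      | zero =>
        refine setIntegral_eq_zero_of_forall_eq_zero fun z hz => ?_
        have h1 : formIn I e (w x).1 0 z = ρ x (e.symm z) • formIn I e β.1 0 z + 0 := rfl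
        have h2 : formIn I e β.1 0 z = 0 := (h x z hz).1
        rw [h1, h2, smul_zero, add_zero]
        rfl
      | succ k =>
        have h1 : ∀ z ∈ e.target, formIn I e (w x).1 (k + 1) z v =
            extDeriv (fun y => ρ x (e.symm y) • formIn I e α.1 k y) z v := fun z hz => by
          have h2 : formIn I e β.1 (k + 1) z = extDeriv (formIn I e α.1 k) z := (h x z hz).2 k
          rw [extDeriv_mul_formIn hc (ρ x) α.2 k hz, ← h2]
          rfl
        rw [setIntegral_congr_fun hc.open_target.measurableSet h1]
        have h2 : ContDiffOn ℝ ∞ (fun y => ρ x (e.symm y)) e.target := by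
          rw [← contMDiffOn_iff_contDiffOn]
          exact (ρ x).contMDiff.comp_contMDiffOn hc.smooth_symm
        have h3 : ContDiffOn ℝ ∞ (formIn I e α.1 k) e.target := fun z hz =>
          (contDiffAt_alternating fun v => (α.2 x k v).contDiffAt
            (hc.open_target.mem_nhds hz)).contDiffWithinAt
        refine setIntegral_extDeriv_eq_zero hc.open_target hKc hKt (h2.smul h3)
          (fun z hz hzK => ?_) v
        · change ρ x (e.symm z) • formIn I e α.1 k z = 0
          rw [image_eq_zero_of_notMem_tsupport fun h' => hzK ⟨_, h', e.right_inv hz⟩, zero_smul]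
    rw [integral_eq_of_chart hc (hasSign_extChartAt I x) _ hKc hKt, hform, mul_zero]
    intro p hp
    have hpt : p ∉ tsupport (ρ x) := fun h' => hp ⟨_, mem_image_of_mem e h', e.left_inv (hρ x h')⟩
    have h1 : diffAt I 𝓘(ℝ) (ρ x) p = 0 := by
      have h2 := (notMem_tsupport_iff_eventuallyEq.1 hpt).mfderiv_eq (I := I) (I' := 𝓘(ℝ))
      exact h2.trans mfderiv_const
    change ρ x p • β.1 p _ + gradWedge I (ρ x) α.1 p _ = 0
    rw [image_eq_zero_of_notMem_tsupport hpt, zero_smul, zero_add]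
    generalize finrank ℂ E * 2 = m
    cases m with
    | zero => rfl
    | succ k =>
      change ContinuousAlternatingMap.alternatizeUncurryFinCLM ℝ E ℝ _ = 0
      have h5 : (diffAt I 𝓘(ℝ) (ρ x) p).smulRight (α.1 p k) = 0 := by rw [h1]; ext; simp
      rw [h5, map_zero]
  rw [hβ]
  change integralLM I M _ = 0
  rw [map_sum]
  exact Finset.sum_eq_zero fun x _ => hzero x

variable {E' : Type*} [NormedAddCommGroup E'] [NormedSpace ℝ E'] [NormedSpace ℂ E']
  [IsScalarTower ℝ ℂ E'] [FiniteDimensional ℂ E'] [FiniteDimensional ℝ E']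
  {H' : Type*} [TopologicalSpace H'] {I' : ModelWithCorners ℝ E' H'} [I'.Boundaryless]
  {M' : Type*} [TopologicalSpace M'] [ChartedSpace H' M'] [T2Space M'] [CompactSpace M']
  [IsManifold I' ∞ M']

theorem graphCurrent_isClosed [PositiveAtlas I M] (s : C^∞⟮I, M; I', M'⟯) :
    (graphCurrent s).IsClosed := fun _ _ h =>
  integral_eq_zero_of_isExteriorDerivative (h.pullback _)

end StokesManifold
section LebesgueCurrents

variable {E : Type*} [NormedAddCommGroup E] [NormedSpace ℝ E]
  {H : Type*} [TopologicalSpace H] {I : ModelWithCorners ℝ E H}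
  {M : Type*} [TopologicalSpace M] [ChartedSpace H M]

/-- A coordinate system as an open partial homeomorphism. -/
def IsChart.toOpenPartialHomeomorph {V : Type*} [NormedAddCommGroup V] [NormedSpace ℝ V]
    {e : PartialEquiv M V} (he : IsChart I e) : OpenPartialHomeomorph M V where
  toPartialEquiv := e
  open_source := he.open_source
  open_target := he.open_target
  continuousOn_toFun := he.smooth.continuousOn
  continuousOn_invFun := he.smooth_symm.continuousOn

theorem locallyRiemannIntegrable_of_continuous {ι : Type*} [Fintype ι] {g : (ι → ℝ) → ℝ}
    (hg : Continuous g) : LocallyRiemannIntegrable g := fun _ =>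
  BoxIntegral.integrable_of_continuousOn _ hg.continuousOn volume

/-- Points at which the projections of a current have continuous densities are of Lebesgue type. -/
theorem Current.isLebesgueTypeAt_of_continuous {T : Current I M} {k : ℕ} {q : M}
    {e : PartialEquiv M (Fin (finrank ℝ E) → ℝ)} (he : IsChart I e) {B : Set M} (hB : IsOpen B)
    (hq : q ∈ B) (hBe : B ⊆ e.source)
    (h : ∀ ξ : M → ℝ, ContMDiff I 𝓘(ℝ) ∞ ξ → tsupport ξ ⊆ B → ∀ s : Fin k ↪o Fin (finrank ℝ E),
      ∃ L : (Fin k → ℝ) → ℝ, Continuous L ∧ HasCompactSupport L ∧ ∀ (g : (Fin k → ℝ) → ℝ)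
        (η : Form I M), IsCutoffPlaneForm he.toOpenPartialHomeomorph s ξ g η →
          T η = ∫ a, g a * L a) : T.IsLebesgueTypeAt k q := by
  refine ⟨he.toOpenPartialHomeomorph, hBe hq, he.smooth, he.smooth_symm, B, hB, hq, hBe,
    fun ξ hξ _ hξB s => ?_⟩
  obtain ⟨L, hL, hLc, hT⟩ := h ξ hξ hξB s
  obtain ⟨C, hC⟩ := hL.bounded_above_of_compact_support hLc
  refine ⟨L, hLc, ⟨C, hC⟩, locallyRiemannIntegrable_of_continuous hL, fun g _ _ η hη => hT g η hη,
    fun a _ => L a, fun a => Eventually.of_forall fun x => ?_, ⟨C, fun a _ => hC a⟩, ?_⟩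
  · have h1 : Continuous fun t : ℝ => L (t • x + a) := by fun_prop
    have h2 := h1.tendsto 0
    rw [zero_smul, zero_add] at h2
    exact h2.mono_left nhdsWithin_le_nhds
  · refine locallyRiemannIntegrable_of_continuous (hL.comp ?_)
    fun_prop

theorem formIn_cutoffPlaneForm {m k : ℕ} {e : PartialEquiv M (Fin m → ℝ)} (he : IsChart I e)
    {s : Fin k ↪o Fin m} {ξ : M → ℝ} {g : (Fin k → ℝ) → ℝ} {η : Form I M}
    (hη : IsCutoffPlaneForm he.toOpenPartialHomeomorph s ξ g η) {w : Fin m → ℝ}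
    (hw : w ∈ e.target) (v : Fin k → Fin m → ℝ) :
    formIn I e η.1 k w v =
      ξ (e.symm w) * g (fun i => w (s i)) * (Matrix.of fun i j => v j (s i)).det := by
  have h1 := hη.2.2 (e.symm w) (e.map_target hw)
    (fun j => diffAt 𝓘(ℝ, Fin m → ℝ) I e.symm w (v j))
  have h2 : ∀ j, diffAt I 𝓘(ℝ, Fin m → ℝ) e (e.symm w)
      (diffAt 𝓘(ℝ, Fin m → ℝ) I e.symm w (v j)) = v j := fun j =>
    DFunLike.congr_fun (he.diffAt_comp_symm hw) (v j)
  change formIn I e η.1 k w v = ξ (e.symm w) * g (fun i => e (e.symm w) (s i)) *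
    (Matrix.of fun i j => diffAt I 𝓘(ℝ, Fin m → ℝ) e (e.symm w)
      (diffAt 𝓘(ℝ, Fin m → ℝ) I e.symm w (v j)) (s i)).det at h1
  simp only [h2, e.right_inv hw] at h1
  exact h1

theorem cutoffPlaneForm_eq_zero {m k : ℕ} {e : PartialEquiv M (Fin m → ℝ)} {he : IsChart I e}
    {s : Fin k ↪o Fin m} {ξ : M → ℝ} {g : (Fin k → ℝ) → ℝ} {η : Form I M}
    (hη : IsCutoffPlaneForm he.toOpenPartialHomeomorph s ξ g η) {p : M} (hp : ξ p = 0) (j : ℕ) :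
    η.1 p j = 0 := by
  by_cases hj : j = k
  · subst hj
    by_cases hpe : p ∈ e.source
    · ext v
      rw [hη.2.2 p hpe v, hp, zero_mul, zero_mul]
      rfl
    · exact hη.2.1 p hpe
  · exact hη.1 p j hj

theorem orderEmbedding_val_eq {n m : ℕ} (s : Fin n ↪o Fin m) (h : ∀ i, (s i : ℕ) < n) (i : Fin n) :
    (s i : ℕ) = i := by
  have hf : StrictMono fun i : Fin n => (⟨s i, h i⟩ : Fin n) := fun i j hij =>
    s.strictMono hij
  exact congrArg Fin.val (le_antisymm (hf.apply_le (x := i)) (hf.le_apply (x := i)))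

end LebesgueCurrents

section GraphCoordinates

variable {E : Type*} [NormedAddCommGroup E] [NormedSpace ℝ E] [NormedSpace ℂ E]
  [IsScalarTower ℝ ℂ E] [FiniteDimensional ℂ E] [FiniteDimensional ℝ E]
  {H : Type*} [TopologicalSpace H] {I : ModelWithCorners ℝ E H} [I.Boundaryless]
  {M : Type*} [TopologicalSpace M] [ChartedSpace H M] [T2Space M] [CompactSpace M]
  [IsManifold I ∞ M]
  {E' : Type*} [NormedAddCommGroup E'] [NormedSpace ℝ E'] [NormedSpace ℂ E']
  [IsScalarTower ℝ ℂ E'] [FiniteDimensional ℂ E'] [FiniteDimensional ℝ E']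
  {H' : Type*} [TopologicalSpace H'] {I' : ModelWithCorners ℝ E' H'} [I'.Boundaryless]
  {M' : Type*} [TopologicalSpace M'] [ChartedSpace H' M'] [T2Space M'] [CompactSpace M']
  [IsManifold I' ∞ M']

variable (E E') in
theorem realDim_add : realDim E + realDim E' = finrank ℝ (E × E') := by
  rw [Module.finrank_prod, finrank_real_eq, finrank_real_eq]

variable (E E') in
/-- The numbering of the real coordinates of a product. -/
def prodIndex : Fin (realDim E) ⊕ Fin (realDim E') ≃ Fin (finrank ℝ (E × E')) :=
  finSumFinEquiv.trans (finCongr (realDim_add E E'))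

variable (E E') in
/-- Linear coordinates on a product: those of the first factor and then those of the second. -/
def prodCoord : (E × E') ≃L[ℝ] (Fin (finrank ℝ (E × E')) → ℝ) :=
  (((complexFrame E).prod (complexFrame E')).reindex (prodIndex E E')).equivFunL

theorem prodCoord_inl (z : E) (w : E') (i : Fin (realDim E)) :
    prodCoord E E' (z, w) (prodIndex E E' (Sum.inl i)) = (complexFrame E).equivFun z i := by
  simp [prodCoord]

theorem prodCoord_inr (z : E) (w : E') (i : Fin (realDim E')) :
    prodCoord E E' (z, w) (prodIndex E E' (Sum.inr i)) = (complexFrame E').equivFun w i := by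
  simp [prodCoord]

/-- The homeomorphism that straightens the graph of a map. -/
def shear {D : Set E} (hD : IsOpen D) {G : E → E'} (hG : ContinuousOn G D) :
    OpenPartialHomeomorph (E × E') (Fin (finrank ℝ (E × E')) → ℝ) where
  toFun p := prodCoord E E' (p.1, p.2 - G p.1)
  invFun t := (((prodCoord E E').symm t).1,
    ((prodCoord E E').symm t).2 + G ((prodCoord E E').symm t).1)
  source := D ×ˢ univ
  target := (prodCoord E E').symm ⁻¹' (D ×ˢ univ)
  map_source' p hp := by simpa using hp
  map_target' t ht := ⟨ht.1, trivial⟩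
  left_inv' p _ := by simp
  right_inv' t _ := by simp
  open_source := hD.prod isOpen_univ
  open_target := (hD.prod isOpen_univ).preimage (prodCoord E E').symm.continuous
  continuousOn_toFun := (prodCoord E E').continuous.comp_continuousOn
    (continuousOn_fst.prodMk (continuousOn_snd.sub (hG.comp continuousOn_fst fun p hp => hp.1)))
  continuousOn_invFun := by
    have h := (prodCoord E E').symm.continuous
    exact (continuous_fst.comp h).continuousOn.prodMk ((continuous_snd.comp h).continuousOn.add
      (hG.comp (continuous_fst.comp h).continuousOn fun p hp => hp.1))

theorem exists_graph_chart (f : C^∞⟮I, M; I', M'⟯) (x : M) :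
    ∃ e : PartialEquiv (M × M') (Fin (finrank ℝ (E × E')) → ℝ), IsChart (I.prod I') e ∧
      (x, f x) ∈ e.source ∧
      (∀ p, (p, f p) ∈ e.source ↔
        p ∈ (extChartAt I x).source ∧ f p ∈ (extChartAt I' (f x)).source) ∧
      ∀ p, p ∈ (extChartAt I x).source →
        e (p, f p) = prodCoord E E' (extChartAt I x p, 0) := by
  set h := extChartAt I x with hh
  set g := extChartAt I' (f x) with hg
  have hc : IsChart I h := isChart_extChartAt I x
  have hc' : IsChart I' g := isChart_extChartAt I' (f x)
  have hprod : IsChart (I.prod I') (h.prod g) := by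
    have := isChart_extChartAt (I.prod I') (x, f x)
    rw [extChartAt_prod] at this
    exact this
  have hs : ContMDiffOn 𝓘(ℝ, E) I' ∞ (fun z => f (h.symm z)) h.target :=
    f.contMDiff.comp_contMDiffOn hc.smooth_symm
  set D : Set E := h.target ∩ (fun z => f (h.symm z)) ⁻¹' g.source with hD
  have hDo : IsOpen D := hs.continuousOn.isOpen_inter_preimage hc.open_target hc'.open_source
  have hG : ContDiffOn ℝ ∞ (fun z => g (f (h.symm z))) D := by
    rw [← contMDiffOn_iff_contDiffOn]
    exact hc'.smooth.comp (t := g.source) (hs.mono inter_subset_left) fun z hz => hz.2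
  have hsrc : ∀ p, (p, f p) ∈ ((h.prod g).trans (shear hDo hG.continuousOn).toPartialEquiv).source ↔
      p ∈ h.source ∧ f p ∈ g.source := fun p => by
    refine ⟨fun hp => hp.1, fun hp => ⟨hp, ⟨h.map_source hp.1, ?_⟩, trivial⟩⟩
    change f (h.symm (h p)) ∈ g.source
    rw [h.left_inv hp.1]
    exact hp.2
  refine ⟨(h.prod g).trans (shear hDo hG.continuousOn).toPartialEquiv, hprod.trans _ ?_ ?_,
    (hsrc x).2 ⟨mem_extChartAt_source x, mem_extChartAt_source (f x)⟩, hsrc, fun p hp => ?_⟩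
  · exact (prodCoord E E').contDiff.comp_contDiffOn (contDiffOn_fst.prodMk
      (contDiffOn_snd.sub (hG.comp contDiffOn_fst fun p hp => hp.1)))
  · have h := (prodCoord E E').symm.contDiff (n := ∞)
    exact (contDiff_fst.comp h).contDiffOn.prodMk ((contDiff_snd.comp h).contDiffOn.add
      (hG.comp (contDiff_fst.comp h).contDiffOn fun p hp => hp.1))
  · change prodCoord E E' (h p, g (f p) - g (f (h.symm (h p)))) = _
    rw [h.left_inv hp, sub_self]

variable [PositiveAtlas I M]

/-- In coordinates that straighten the graph, a form cut off in a coordinate plane is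
integrated over the graph. -/
theorem graphCurrent_cutoffPlaneForm [MeasurableSpace E] [BorelSpace E] (f : C^∞⟮I, M; I', M'⟯)
    {x : M} {e : PartialEquiv (M × M') (Fin (finrank ℝ (E × E')) → ℝ)}
    (he : IsChart (I.prod I') e)
    (hsrc : ∀ p, (p, f p) ∈ e.source → p ∈ (extChartAt I x).source)
    (hval : ∀ p, p ∈ (extChartAt I x).source → e (p, f p) = prodCoord E E' (extChartAt I x p, 0))
    {s : Fin (realDim E) ↪o Fin (finrank ℝ (E × E'))} {ξ : M × M' → ℝ}
    (hξ : tsupport ξ ⊆ e.source) {g : (Fin (realDim E) → ℝ) → ℝ}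
    {η : Form (I.prod I') (M × M')}
    (hη : IsCutoffPlaneForm he.toOpenPartialHomeomorph s ξ g η) :
    graphCurrent f η = ∫ z in (extChartAt I x).target,
      ξ ((extChartAt I x).symm z, f ((extChartAt I x).symm z)) *
        g (fun i => prodCoord E E' (z, 0) (s i)) *
        (Matrix.of fun i j => prodCoord E E' (complexFrame E j, 0) (s i)).det ∂frameMeasure E := by
  have hc : IsChart I (extChartAt I x) := isChart_extChartAt I x
  have hsign : HasSign I (extChartAt I x) 1 := hasSign_extChartAt I x
  set h := extChartAt I x with hh
  have hγc : Continuous fun p => (p, f p) := continuous_id.prodMk f.contMDiff.continuous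
  set C : Set M := (fun p => (p, f p)) ⁻¹' tsupport ξ with hC
  have hCc : IsCompact C := ((isClosed_tsupport ξ).preimage hγc).isCompact
  have hCs : C ⊆ h.source := fun p hp => hsrc p (hξ hp)
  have hKc : IsCompact (h '' C) := hCc.image_of_continuousOn (hc.smooth.continuousOn.mono hCs)
  have hKt : h '' C ⊆ h.target := by
    rintro _ ⟨p, hp, rfl⟩
    exact h.map_source (hCs hp)
  have h0 : ∀ p ∉ C, ∀ j, η.1 (p, f p) j = 0 := fun p hp j =>
    cutoffPlaneForm_eq_zero hη (image_eq_zero_of_notMem_tsupport hp) j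
  have hpb : ∀ p ∉ C, (pullback I (I.prod I') (ContMDiffMap.id.prodMk f) η).1 p (realDim E) = 0 :=
    fun p hp => by
      change (η.1 (p, f p) (realDim E)).compContinuousLinearMap _ = 0
      rw [h0 p hp]
      rfl
  rw [graphCurrent_apply, integral_eq_of_chart hc hsign _ hKc hKt, one_mul]
  · refine setIntegral_congr_fun hc.open_target.measurableSet fun z hz => ?_
    by_cases hzC : h.symm z ∈ C
    · have hze : (h.symm z, f (h.symm z)) ∈ e.source := hξ hzC
      have hγ : ContMDiff I (I.prod I') ∞ fun p => (p, f p) := contMDiff_id.prodMk f.contMDiff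
      have h1 := formIn_rawPullback hc he hz hγ.contMDiffAt hze η.1 (realDim E)
      have h2 : e (h.symm z, f (h.symm z)) = prodCoord E E' (z, 0) := by
        rw [hval _ (h.map_target hz), h.right_inv hz]
      have h3 : fderiv ℝ (fun y => e (h.symm y, f (h.symm y))) z =
          ((prodCoord E E' : (E × E') →L[ℝ] _).comp (ContinuousLinearMap.inl ℝ E E')) := by
        refine (Filter.EventuallyEq.fderiv_eq (f := ((prodCoord E E' :
          (E × E') →L[ℝ] (Fin (finrank ℝ (E × E')) → ℝ)).comp
            (ContinuousLinearMap.inl ℝ E E'))) ?_).trans (ContinuousLinearMap.fderiv _)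
        filter_upwards [hc.open_target.mem_nhds hz] with y hy
        rw [hval _ (h.map_target hy), h.right_inv hy]
        rfl
      rw [h3] at h1
      have h4 := formIn_cutoffPlaneForm he hη (e.map_source hze) (fun j =>
        ((prodCoord E E' : (E × E') →L[ℝ] _).comp (ContinuousLinearMap.inl ℝ E E'))
          (complexFrame E j))
      rw [e.left_inv hze, h2] at h4
      rw [h2] at h1
      exact (DFunLike.congr_fun h1 (⇑(complexFrame E))).trans h4
    · have h1 : ξ (h.symm z, f (h.symm z)) = 0 := image_eq_zero_of_notMem_tsupport hzC
      rw [h1, zero_mul, zero_mul, formIn_eq_zero I h (hpb _ hzC)]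
      rfl
  · intro p hp
    refine hpb p fun hpC => hp ⟨_, mem_image_of_mem h hpC, h.left_inv (hCs hpC)⟩

theorem graphCurrent_isLebesgueTypeAt (f : C^∞⟮I, M; I', M'⟯) (k : ℕ) (x : M) :
    (graphCurrent f).IsLebesgueTypeAt k (x, f x) := by
  letI : MeasurableSpace E := borel E
  haveI : BorelSpace E := ⟨rfl⟩
  obtain ⟨e, he, hxe, hsrc, hval⟩ := exists_graph_chart f x
  refine Current.isLebesgueTypeAt_of_continuous he he.open_source hxe subset_rfl
    fun ξ hξ hξe s => ?_
  by_cases hk : k = realDim E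
  swap
  · refine ⟨0, continuous_zero, HasCompactSupport.zero, fun g η hη => ?_⟩
    rw [graphCurrent_apply, integral_eq_zero fun p => ?_]
    · simp
    · change (η.1 (p, f p) (realDim E)).compContinuousLinearMap _ = 0
      rw [hη.1 _ _ (Ne.symm hk)]
      rfl
  subst hk
  have hform := fun g η => graphCurrent_cutoffPlaneForm (g := g) (η := η) (s := s) f he
    (fun p hp => ((hsrc p).1 hp).1) hval hξe
  by_cases hs : ∀ i, (s i : ℕ) < realDim E
  swap
  · push Not at hs
    obtain ⟨i, hi⟩ := hs
    refine ⟨0, continuous_zero, HasCompactSupport.zero, fun g η hη => ?_⟩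
    rw [hform g η hη]
    obtain ⟨j, hj⟩ : ∃ j, s i = prodIndex E E' (Sum.inr j) := by
      obtain ⟨j | j, hj⟩ := (prodIndex E E').surjective (s i)
      · have h1 : (s i : ℕ) = j := by rw [← hj]; rfl
        omega
      · exact ⟨j, hj.symm⟩
    have hdet : (Matrix.of fun i j => prodCoord E E' (complexFrame E j, 0) (s i)).det = 0 :=
      Matrix.det_eq_zero_of_row_eq_zero i fun l => by
        rw [Matrix.of_apply, hj, prodCoord_inr, map_zero, Pi.zero_apply]
    simp [hdet]
  have hs' : ∀ i, s i = prodIndex E E' (Sum.inl i) := fun i =>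
    Fin.ext (orderEmbedding_val_eq s hs i)
  have hdet : (Matrix.of fun i j => prodCoord E E' (complexFrame E j, 0) (s i)).det = 1 := by
    rw [← Matrix.det_one (n := Fin (realDim E)) (R := ℝ)]
    congr 1
    ext i j
    rw [Matrix.of_apply, hs', prodCoord_inl, Basis.equivFun_apply, Basis.repr_self,
      Matrix.one_apply, Finsupp.single_apply]
    simp only [eq_comm]
  have hcoord : ∀ z, (fun i => prodCoord E E' (z, 0) (s i)) = (complexFrame E).equivFun z :=
    fun z => funext fun i => by rw [hs', prodCoord_inl]
  have hc : IsChart I (extChartAt I x) := isChart_extChartAt I x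
  set h := extChartAt I x with hh
  have hγ : ContMDiff I (I.prod I') ∞ fun p => (p, f p) := contMDiff_id.prodMk f.contMDiff
  set u : E → ℝ := indicator h.target fun z => ξ (h.symm z, f (h.symm z)) with hu
  set C : Set M := (fun p => (p, f p)) ⁻¹' tsupport ξ with hC
  have hCs : C ⊆ h.source := fun p hp => ((hsrc p).1 (hξe hp)).1
  have hKc : IsCompact (h '' C) := ((isClosed_tsupport ξ).preimage
    hγ.continuous).isCompact.image_of_continuousOn (hc.smooth.continuousOn.mono hCs)
  have hKt : h '' C ⊆ h.target := by
    rintro _ ⟨p, hp, rfl⟩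
    exact h.map_source (hCs hp)
  have hu0 : ∀ z ∈ h.target, z ∉ h '' C → ξ (h.symm z, f (h.symm z)) = 0 := fun z hz hzC =>
    image_eq_zero_of_notMem_tsupport fun hm => hzC ⟨h.symm z, hm, h.right_inv hz⟩
  have huc : Continuous u := by
    refine (contDiff_indicator_of_isClosed hc.open_target hKc.isClosed hKt ?_ hu0).continuous
    rw [← contMDiffOn_iff_contDiffOn]
    exact (hξ.comp hγ).comp_contMDiffOn hc.smooth_symm
  refine ⟨fun a => u ((complexFrame E).equivFun.symm a),
    huc.comp (complexFrame E).equivFunL.symm.continuous,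
    HasCompactSupport.intro (hKc.image (complexFrame E).equivFunL.continuous) fun a ha => ?_,
    fun g η hη => ?_⟩
  · have h1 : (complexFrame E).equivFun.symm a ∉ h '' C := fun hm =>
      ha ⟨_, hm, (complexFrame E).equivFun.apply_symm_apply a⟩
    by_cases hz : (complexFrame E).equivFun.symm a ∈ h.target
    · exact (indicator_of_mem hz _).trans (hu0 _ hz h1)
    · exact indicator_of_notMem hz _
  · rw [hform g η hη, setIntegral_frameMeasure]
    simp only [hdet, mul_one, hcoord, LinearEquiv.apply_symm_apply]
    have hm : MeasurableSet ((complexFrame E).equivFun.symm ⁻¹' h.target) :=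
      (hc.open_target.preimage (show Continuous (complexFrame E).equivFun.symm from
        (complexFrame E).equivFunL.symm.continuous)).measurableSet
    have hR : ∫ a in (complexFrame E).equivFun.symm ⁻¹' h.target,
        g a * u ((complexFrame E).equivFun.symm a) =
          ∫ a, g a * u ((complexFrame E).equivFun.symm a) :=
      setIntegral_eq_integral_of_forall_compl_eq_zero fun a ha => by
        rw [show u ((complexFrame E).equivFun.symm a) = 0 from
          indicator_of_notMem (show (complexFrame E).equivFun.symm a ∉ h.target from ha) _,
          mul_zero]
    refine Eq.trans (setIntegral_congr_fun hm fun a ha => ?_) hR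
    have h1 : u ((complexFrame E).equivFun.symm a) = _ :=
      indicator_of_mem (show (complexFrame E).equivFun.symm a ∈ h.target from ha) _
    change _ = g a * u _
    rw [h1, mul_comm]

theorem graphCurrent_isLebesgue (f : C^∞⟮I, M; I', M'⟯) : (graphCurrent f).IsLebesgue := by
  rintro k ⟨x, y⟩
  by_cases hxy : y = f x
  · rw [hxy]
    exact graphCurrent_isLebesgueTypeAt f k x
  have he : IsChart (I.prod I') ((extChartAt (I.prod I') (x, y)).trans
      (prodCoord E E').toHomeomorph.toOpenPartialHomeomorph.toPartialEquiv) :=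
    (isChart_extChartAt (I.prod I') (x, y)).trans _ (prodCoord E E').contDiff.contDiffOn
      (prodCoord E E').symm.contDiff.contDiffOn
  have hcl : IsClosed {p : M × M' | p.2 = f p.1} :=
    isClosed_eq continuous_snd (f.contMDiff.continuous.comp continuous_fst)
  refine Current.isLebesgueTypeAt_of_continuous he (he.open_source.inter hcl.isOpen_compl)
    ⟨⟨mem_extChartAt_source _, trivial⟩, hxy⟩ inter_subset_left fun ξ _ hξ s =>
    ⟨0, continuous_zero, HasCompactSupport.zero, fun g η hη => ?_⟩
  rw [graphCurrent_apply, integral_eq_zero fun p => ?_]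
  · simp
  · change (η.1 (p, f p) (realDim E)).compContinuousLinearMap _ = 0
    rw [cutoffPlaneForm_eq_zero hη (image_eq_zero_of_notMem_tsupport fun h => (hξ h).2 rfl)]
    rfl

end GraphCoordinates
end

end Currents

theorem proposition4p3
    {E : Type*} [NormedAddCommGroup E] [NormedSpace ℂ E] [FiniteDimensional ℂ E]
    {X : Type*} [TopologicalSpace X] [ChartedSpace E X] [IsManifold 𝓘(ℂ, E) ω X]
    [CompactSpace X] [T2Space X]
    {E' : Type*} [NormedAddCommGroup E'] [NormedSpace ℂ E'] [FiniteDimensional ℂ E']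
    {Y : Type*} [TopologicalSpace Y] [ChartedSpace E' Y] [IsManifold 𝓘(ℂ, E') ω Y]
    [CompactSpace Y] [T2Space Y]
    (𝒰 : Currents.DeRhamData 𝓘(ℝ, E) X) (𝒱 : Currents.DeRhamData 𝓘(ℝ, E') Y)
    (f : X → Y) (hf : ContMDiff 𝓘(ℂ, E) 𝓘(ℂ, E') ω f) :
    ∃ F : Currents.Current (𝓘(ℝ, E).prod 𝓘(ℝ, E')) (X × Y),
      Currents.IsGraphCurrent (Currents.realMap f hf) F ∧ F.IsClosed ∧ F.IsLebesgue ∧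
      (∀ T : Currents.Current 𝓘(ℝ, E) X, T.IsLebesgue →
        ∃ S : Currents.Current 𝓘(ℝ, E') Y, Currents.IsPushforward (Currents.realMap f hf) T S ∧
          ∀ S', Currents.IsPushforwardThrough 𝒰 𝒱 F T S' ↔ S' = S) ∧
      ((∀ x, Function.Surjective (mfderiv 𝓘(ℂ, E) 𝓘(ℂ, E') f x)) →
        ∀ T : Currents.Current 𝓘(ℝ, E') Y, T.IsLebesgue →
          ∃ S : Currents.Current 𝓘(ℝ, E) X,
            Currents.IsSmoothPullback (Currents.realMap f hf) T S ∧
            ∀ S', Currents.IsPullbackThrough 𝒰 𝒱 F T S' ↔ S' = S) := by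
  refine ⟨Currents.graphCurrent (Currents.realMap f hf), fun _ => rfl,
    Currents.graphCurrent_isClosed _, Currents.graphCurrent_isLebesgue _,
    fun T _ => ⟨Currents.pushforward _ T, Currents.isPushforward_iff.2 rfl,
      fun S' => Currents.isPushforwardThrough_graph_iff 𝒰 𝒱 _ T⟩, fun hs T _ => ?_⟩
  have hs' : ∀ p, Function.Surjective
      (Currents.diffAt 𝓘(ℝ, E) 𝓘(ℝ, E') (Currents.realMap f hf) p) := fun p => by
    rw [Currents.diffAt_realMap]
    exact hs p
  exact ⟨Currents.smoothPullback hs' T, (Currents.isSmoothPullback_iff_eq hs').2 rfl,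
    fun S' => Currents.isPullbackThrough_graph_iff 𝒰 𝒱 hs' T⟩
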